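/- **Setting.** Fix constants $q>2$, $A>0$, $\nu,L,D>0$ and a kernel $K:\mathbb R\to[0,\infty)$ that is even, vanishes outside $[-1,1]$, is Lipschitz on $[-1,1]$ and satisfies $\int_{-1}^1K=1$. For each sample size $n$ let $p=p_n\ge 2$, let $(\varepsilon_i)_{i\in\mathbb Z}$ be i.i.d. random vectors in $\mathbb R^p$, $\mathcal F_i=(\dots,\varepsilon_{i-1},\varepsilon_i)$, let $H=(H_1,\dots,H_p)$ be jointly measurable, $X_i^\circ(t)=H(\mathcal F_i;t)$ for $t\in[0,1]$, and let $X_i=X_i^\circ(i/n)$, $1\le i\le n$, be the observations ($H$ and the law of $\varepsilon_0$ may depend on $n$). Put $\Sigma(t)=(\sigma_{jk}(t))=\big(\mathbb E[H_j(\mathcal F_0;t)H_k(\mathcal F_0;t)]\big)_{j,k\le p}$ and $\Omega(t)=\Sigma(t)^{-1}$. For a matrix $W=(w_{jk})$ write $|W|_\infty=\max_{j,k}|w_{jk}|$, $|W|_1=\sum_{j,k}|w_{jk}|$, $|W|_{L^1}=\max_k\sum_j|w_{jk}|$, and write $\|\cdot\|_a=(\mathbb E|\cdot|^a)^{1/a}$.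 Let $X^\circ_{ij,\{m\}}(t)$ be $X^\circ_{ij}(t)$ with $\varepsilon_{i-m}$ replaced by an independent copy, and put $\theta_{m,a,j}=\sup_{0\le t\le1}\|X^\circ_{ij}(t)-X^\circ_{ij,\{m\}}(t)\|_a$ and $\|X_{\cdot,j}\|_{a,A}=\sup_{m\ge0}(m+1)^A\sum_{i\ge m}\theta_{i,a,j}$. Put $N_X=\max_j\|X_{\cdot,j}\|_{4,A}$, $M_{X,q}=\big(\sum_j\|X_{\cdot,j}\|_{2q,A}^q\big)^{1/q}$ and $J_{q,A}(x,p)=M_{X,q}(p\,\varpi_{q,A}(x))^{1/q}$, where $\varpi_{q,A}(x)=x$, $x(\log x)^{1+2q}$, $x^{q/2-Aq}$ according as $A>\frac12-\frac1q$, $A=\frac12-\frac1q$, $A<\frac12-\frac1q$. Assume for every $n$: (a) $\sup_{t\in[0,1]}\max_j\mathbb E|X^\circ_{0j}(t)|^{2q}\le\nu$, and $\|X_{\cdot,j}\|_{2q,A}<\infty$ for every $j\le p$; (b) (no change points) $\mathbb E X^\circ_{0j}(t)=0$ for $t\in[0,1]$; $\|H_j(\mathcal F_0;t)-H_j(\mathcal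 F_0;t')\|_2\le L|t-t'|$ for $t,t'\in[0,1)$; each $\sigma_{jk}$ is $C^2$ on $[0,1)$ with $|\sigma_{jk}''|\le D$; (c) $\Sigma(t)$ is invertible and $|\Omega(t)|_{L^1}\le\kappa_p$ for all $t\in[0,1]$, where $\kappa_p$ may grow with $p$. Let the bandwidth $b=b_n$ satisfy $b\to0$ and $B_n:=nb\to\infty$. With $t_i=i/n$, let $\hat\Sigma(t)=\sum_{i=1}^n w(t,t_i)X_iX_i^\top$, where $w(t,t_i)=K(|t_i-t|/b)\big/\sum_{l=1}^nK(|t_l-t|/b)$, and let the kernelized tv-CLIME estimator $\hat\Omega_\lambda(t)$ be any minimizer of $|W|_1$ over the matrices $W\in\mathbb R^{p\times p}$ with $|\hat\Sigma(t)W-I_p|_\infty\le\lambda$ (and an arbitrary matrix if there is no such $W$). For random $Y_n\ge0$ and $a_n>0$, $Y_n=O_{\mathbb P}(a_n)$ means: for every $\epsilon>0$ there is $C'>0$ with $\mathbb P(Y_n>C'a_n)<\epsilon$ for all sufficiently large $n$ (outer probability, if needed). **Proposition.** There is a constant $C>0$, depending only on $q,A,\nu,L,D,K$ (in particular not on $n$,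 $p$), such that: (i) *Pointwise.* If $\lambda^\circ\ge C\kappa_p\big(b^2+B_n^{-1}J_{q,A}(B_n,p)+N_X(\log p/B_n)^{1/2}\big)$ for all large $n$, then for every choice of $t=t_n\in[b,1-b]$ (in particular for every fixed $t\in(0,1)$) $$|\hat\Omega_{\lambda^\circ}(t)-\Omega(t)|_\infty=O_{\mathbb P}(\kappa_p\lambda^\circ).$$ (ii) *Uniform.* If $\lambda^\diamond\ge C\kappa_p\big(b^2+B_n^{-1}J_{q,A}(n,p)+N_XB_n^{-1}(n\log p)^{1/2}\big)$ for all large $n$, then $$\sup_{t\in[b,1-b]}|\hat\Omega_{\lambda^\diamond}(t)-\Omega(t)|_\infty=O_{\mathbb P}(\kappa_p\lambda^\diamond).$$ -/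

import Mathlib

open MeasureTheory ProbabilityTheory Filter Topology
open scoped ENNReal NNReal

noncomputable section

namespace TVClime

/-! ### Matrix norms -/

/-- `|A|_∞ = max_{j,k} |a_{jk}|`. -/
def maxNorm {p : ℕ} (A : Matrix (Fin p) (Fin p) ℝ) : ℝ := ⨆ j, ⨆ k, |A j k|

/-- `|A|_{L¹} = max_k ∑_j |a_{jk}|`. -/
def colNorm {p : ℕ} (A : Matrix (Fin p) (Fin p) ℝ) : ℝ := ⨆ k, ∑ j, |A j k|

/-- `|A|_1 = ∑_{j,k} |a_{jk}|`. -/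
def entryNorm {p : ℕ} (A : Matrix (Fin p) (Fin p) ℝ) : ℝ := ∑ j, ∑ k, |A j k|

/-! ### The time series model -/

/-- The data generating mechanism on a probability space `(S, μ)`: i.i.d. innovations
`ε_i ∈ ℝ^p`, `i ∈ ℤ`, and a jointly measurable function `H(F; t) ∈ ℝ^p` of an infinite past `F` and
of a rescaled time `t ∈ [0,1]`. A past is a sequence indexed by the lag: `F k` is the innovation
`k` steps back. Values of `H` at `t ∉ [0,1]` play no role. -/
structure Model (p : ℕ) (S : Type*) [MeasurableSpace S] where
  μ : Measure S
  isProb : IsProbabilityMeasure μ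
  ε : ℤ → S → Fin p → ℝ
  ε_meas : ∀ i, Measurable (ε i)
  ε_indep : iIndepFun ε μ
  ε_ident : ∀ i, IdentDistrib (ε i) (ε 0) μ μ
  H : (ℕ → Fin p → ℝ) → ℝ → Fin p → ℝ
  H_meas : Measurable fun z : (ℕ → Fin p → ℝ) × Set.Icc (0 : ℝ) 1 => H z.1 (z.2 : ℝ)

namespace Model

variable {p : ℕ} {S : Type*} [MeasurableSpace S] (X : Model p S)

/-- The shift process `F_i = (…, ε_{i-1}, ε_i)`. -/
def past (i : ℤ) (ω : S) : ℕ → Fin p → ℝ := fun k => X.ε (i - k) ω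

/-- `X°_i(t) = H(F_i; t)`. -/
def proc (i : ℤ) (t : ℝ) (ω : S) : Fin p → ℝ := X.H (X.past i ω) t

/-- The coupled version `X°_{i,{m}}(t) = H(F_{i,{m}}; t)`, in which `ε_{i-m}` is replaced by an
independent copy `ε'_{i-m}`. It lives on the product space `S × S` with measure `μ ⊗ μ`: the
original innovations are `ε_i(z.1)`, the independent copies are `ε'_i = ε_i(z.2)`. -/
def coupled (m : ℕ) (i : ℤ) (t : ℝ) (z : S × S) : Fin p → ℝ :=
  X.H (Function.update (X.past i z.1) m (X.ε (i - m) z.2)) t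

/-- The observation `X_{i,n} = H(F_i; i/n)`. -/
def obs (n i : ℕ) (ω : S) : Fin p → ℝ := X.proc i ((i : ℝ) / n) ω

/-- The covariance matrix function `Σ(t)`, `σ_{jk}(t) = E[H_j(F_0;t) H_k(F_0;t)]`. -/
def cov (t : ℝ) : Matrix (Fin p) (Fin p) ℝ :=
  Matrix.of fun j k => ∫ ω, X.proc 0 t ω j * X.proc 0 t ω k ∂X.μ

/-- The precision matrix function `Ω(t) = Σ(t)⁻¹`. -/
def prec (t : ℝ) : Matrix (Fin p) (Fin p) ℝ := (X.cov t)⁻¹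

/-- The uniform functional dependence measure
`θ_{m,a,j} = sup_{0 ≤ t ≤ 1} ‖X°_{ij}(t) - X°_{ij,{m}}(t)‖_a`. It does not depend on `i`, and
is taken at `i = 0`. -/
def theta (a : ℝ) (m : ℕ) (j : Fin p) : ℝ≥0∞ :=
  ⨆ t ∈ Set.Icc (0 : ℝ) 1,
    eLpNorm (fun z : S × S => X.proc 0 t z.1 j - X.coupled m 0 t z j) (ENNReal.ofReal a)
      (X.μ.prod X.μ)

/-- The dependence adjusted norm
`‖X_{·,j}‖_{a,A} = sup_{m ≥ 0} (m+1)^A ∑_{i ≥ m} θ_{i,a,j}`, in `[0,∞]`. -/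
def dan (a A : ℝ) (j : Fin p) : ℝ≥0∞ :=
  ⨆ m : ℕ, ENNReal.ofReal (((m : ℝ) + 1) ^ A) * ∑' i : ℕ, X.theta a (m + i) j

/-- `ν_{2q} = sup_{t ∈ [0,1]} max_j E|X°_j(t)|^{2q}`, in `[0,∞]`. -/
def moment (q : ℝ) : ℝ≥0∞ :=
  ⨆ t ∈ Set.Icc (0 : ℝ) 1, ⨆ j, ∫⁻ ω, ‖X.proc 0 t ω j‖ₑ ^ (2 * q) ∂X.μ

/-- `N_{X,2q} = max_j ‖X_{·,j}‖_{2q,A}`. -/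
def N (q A : ℝ) : ℝ := ⨆ j, (X.dan (2 * q) A j).toReal

/-- `M_{X,q} = (∑_j ‖X_{·,j}‖_{2q,A}^q)^{1/q}`. -/
def M (q A : ℝ) : ℝ := (∑ j, (X.dan (2 * q) A j).toReal ^ q) ^ (1 / q)

end Model

/-- `ϖ_{q,A}(x)`: equal to `x`, `x (log x)^{1+2q}` or `x^{q/2-Aq}` according as `A` is larger than,
equal to or smaller than `1/2 - 1/q`. -/
def varpi (q A x : ℝ) : ℝ :=
  if 1 / 2 - 1 / q < A then x
  else if A = 1 / 2 - 1 / q then x * Real.log x ^ (1 + 2 * q)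
  else x ^ (q / 2 - A * q)

/-- `J_{q,A}(x,p) = M_{X,q} (p ϖ_{q,A}(x))^{1/q}`. -/
def Model.J {p : ℕ} {S : Type*} [MeasurableSpace S] (X : Model p S) (q A x : ℝ) : ℝ :=
  X.M q A * ((p : ℝ) * varpi q A x) ^ (1 / q)

/-! ### Assumptions -/

namespace Model

variable {p : ℕ} {S : Type*} [MeasurableSpace S] (X : Model p S)

/-- Dependence and moment conditions: `ν_{2q}` is at most the constant `ν`, and
`N_{X,2q} < ∞` (no bound on its size). -/
structure Dependence (q A ν : ℝ) : Prop where
  moment_le : X.moment q ≤ ENNReal.ofReal ν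
  dan_lt_top : ∀ j, X.dan (2 * q) A j < ∞

/-- Smoothness without change points: the process has mean zero, it is stochastically Lipschitz on
`[0,1)` with constant `L`, and every `σ_{jk}` is twice continuously differentiable on
`[0,1)` with second derivative at most `D` in absolute value. -/
structure Smooth (L D : ℝ) : Prop where
  mean_zero : ∀ t ∈ Set.Icc (0 : ℝ) 1, ∀ j, ∫ ω, X.proc 0 t ω j ∂X.μ = 0
  lipschitz : ∀ t ∈ Set.Ico (0 : ℝ) 1, ∀ t' ∈ Set.Ico (0 : ℝ) 1, ∀ j,
    eLpNorm (fun ω => X.proc 0 t ω j - X.proc 0 t' ω j) 2 X.μ ≤ ENNReal.ofReal (L * |t - t'|)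
  contDiff : ∀ j k, ContDiffOn ℝ 2 (fun t => X.cov t j k) (Set.Ico 0 1)
  deriv_le : ∀ j k, ∀ t ∈ Set.Ico (0 : ℝ) 1,
    |iteratedDerivWithin 2 (fun t => X.cov t j k) (Set.Ico 0 1) t| ≤ D

/-- `Σ(t)` is invertible and `|Ω(t)|_{L¹} ≤ κ` for each `t ∈ [0,1]`. -/
structure Sparse (κ : ℝ) : Prop where
  isUnit : ∀ t ∈ Set.Icc (0 : ℝ) 1, IsUnit (X.cov t)
  colNorm_le : ∀ t ∈ Set.Icc (0 : ℝ) 1, colNorm (X.prec t) ≤ κ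

end Model

/-- Regular kernels. The Lipschitz condition is on the interval `[-1,1]` which carries the kernel,
so that the uniform kernel is included. -/
structure IsRegularKernel (K : ℝ → ℝ) : Prop where
  nonneg : ∀ u, 0 ≤ K u
  symm : ∀ u, K (-u) = K u
  support : ∀ u, u ∉ Set.Icc (-1 : ℝ) 1 → K u = 0
  lipschitz : ∃ c : ℝ≥0, LipschitzOnWith c K (Set.Icc (-1) 1)
  integral_eq_one : ∫ u in (-1 : ℝ)..1, K u = 1

/-! ### The estimator -/

/-- `K_b(u,v) = K(|u-v|/b)/b`. -/
def scaledKernel (K : ℝ → ℝ) (b u v : ℝ) : ℝ := K (|u - v| / b) / b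

/-- The weight `w(t,t_i) = K_b(t_i,t) / ∑_{l=1}^n K_b(t_l,t)`, with `t_i = i/n`. -/
def weight (K : ℝ → ℝ) (b : ℝ) (n : ℕ) (t : ℝ) (i : ℕ) : ℝ :=
  scaledKernel K b ((i : ℝ) / n) t / ∑ l ∈ Finset.Icc 1 n, scaledKernel K b ((l : ℝ) / n) t

/-- The kernel smoothed covariance matrix `Σ̂(t) = ∑_{i=1}^n w(t,t_i) X_i X_iᵀ`. -/
def Model.covHat {p : ℕ} {S : Type*} [MeasurableSpace S] (X : Model p S) (K : ℝ → ℝ) (b : ℝ)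
    (n : ℕ) (ω : S) (t : ℝ) : Matrix (Fin p) (Fin p) ℝ :=
  ∑ i ∈ Finset.Icc 1 n, weight K b n t i • Matrix.vecMulVec (X.obs n i ω) (X.obs n i ω)

/-- The constraint set `{W : |Σ̂ W - I|_∞ ≤ lam}`. -/
def feasible {p : ℕ} (Shat : Matrix (Fin p) (Fin p) ℝ) (lam : ℝ) :
    Set (Matrix (Fin p) (Fin p) ℝ) :=
  {W | maxNorm (Shat * W - 1) ≤ lam}

/-- `What` is a CLIME solution: it minimizes `|W|_1` over the constraint set. Nothing is
required when the constraint set is empty, as there is then no minimizer. -/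
def IsClime {p : ℕ} (Shat : Matrix (Fin p) (Fin p) ℝ) (lam : ℝ)
    (What : Matrix (Fin p) (Fin p) ℝ) : Prop :=
  (feasible Shat lam).Nonempty →
    What ∈ feasible Shat lam ∧ ∀ W ∈ feasible Shat lam, entryNorm What ≤ entryNorm W

/-! ### Asymptotics -/

/-- `Y_n = O_P(a_n)` for `[0,∞]`-valued `Y_n`, where `Y_n` lives on `(S n, μ n)`. For events that are
not measurable, the probability is the outer one. -/
def IsBigOP {S : ℕ → Type*} [∀ n, MeasurableSpace (S n)] (μ : ∀ n, Measure (S n))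
    (Y : ∀ n, S n → ℝ≥0∞) (a : ℕ → ℝ) : Prop :=
  ∀ ε : ℝ, 0 < ε → ∃ C : ℝ, 0 < C ∧
    ∀ᶠ n in atTop, μ n {ω | ENNReal.ofReal (C * a n) < Y n ω} < ENNReal.ofReal ε

/-- The standing assumptions on an array of models: for the sample size `n`, the dimension
is `p n ≥ 2`, the bandwidth is `b n` with `n⁻¹ = o(b)` and `b = o(1)`, and the model `X n` satisfies
the dependence, smoothness and sparsity conditions, with constants `q, A, ν, L, D` that do not
depend on `n` and `p`, and with `κ_p`. -/
structure ArrayAssumptions (q A ν L D : ℝ) (κ : ℕ → ℝ) (p : ℕ → ℕ) (b : ℕ → ℝ)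
    {S : ℕ → Type*} [∀ n, MeasurableSpace (S n)] (X : ∀ n, Model (p n) (S n)) : Prop where
  two_le : ∀ n, 2 ≤ p n
  bandwidth_zero : Tendsto b atTop (𝓝 0)
  bandwidth_top : Tendsto (fun n : ℕ => (n : ℝ) * b n) atTop atTop
  dependence : ∀ n, (X n).Dependence q A ν
  smooth : ∀ n, (X n).Smooth L D
  sparse : ∀ n, (X n).Sparse (κ (p n))

/-- `b² + B⁻¹ J_{q,A}(B,p) + N_X (log p / B)^{1/2}` with `B = n b` and `N_X = N_{X,4}`. -/
def Model.pointwiseRate {p : ℕ} {S : Type*} [MeasurableSpace S] (X : Model p S) (q A : ℝ)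
    (n : ℕ) (b : ℝ) : ℝ :=
  b ^ 2 + (n * b)⁻¹ * X.J q A (n * b) + X.N 2 A * √(Real.log p / (n * b))

/-- `b² + B⁻¹ J_{q,A}(n,p) + N_X B⁻¹ (n log p)^{1/2}` with `B = n b` and `N_X = N_{X,4}`. -/
def Model.uniformRate {p : ℕ} {S : Type*} [MeasurableSpace S] (X : Model p S) (q A : ℝ)
    (n : ℕ) (b : ℝ) : ℝ :=
  b ^ 2 + (n * b)⁻¹ * X.J q A n + X.N 2 A * (n * b)⁻¹ * √(n * Real.log p)

end TVClime

end

/-! The CLIME error is deterministic once `Σ̂(t)` is entrywise close to `Σ(t)`. If `δ` bounds the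
entries of `Σ̂ - Σ` and `δ κ ≤ λ`, then `Ω` is feasible, minimality bounds the columns of the
solution `W` by `κ` in `ℓ¹`, and `W - Ω = Ω((Σ̂W - I) - (Σ̂ - Σ)W)` has entries at most `2κλ`
(`maxNorm_clime_sub_inv_le`). It remains to bound `|Σ̂ - Σ|_∞` by the rate.

The bias is of order `b² + N/(nb)`, by Taylor's formula and the symmetry of the kernel
(`Model.exists_bias_le`). Summation by parts reduces the stochastic part to the largest partial sum
of the centred products of the observations.

These products are expanded over lags. The increment at lag `m` depends on the innovations `i - m,
…, i` and is a martingale difference when `i` runs backwards. Polarisation splits the matrix of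
increments into rows, row `j` being governed by the dependence of coordinate `j` alone. A row is a
vector in an `ℓ_s` space whose even exponent `s ≥ 2q` depends on `q` only, so that its smoothness
constant is free of `p`; this gives moment bounds for sums, and dyadic chaining gives maximal
inequalities. For lags near `2^l`, blocks of length `2^(l+1)` are alternately independent, and
truncation with Bernstein's inequality applies (`LagArray.level_deviation`). Sharing the deviation
among the levels produces `varpi`. Passing to the norm of a row costs `p^(1/(2q))`, while `J`
contains `p^(1/q)`: the surplus power of `p` absorbs the powers of `log p` that come from the
exponent `Λ = 3 log p` of the union bound.

In bounded dimension this union bound does not give small failure probabilities, and the constant in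
front of the rate is fixed before `ε`, so `Ω` need not be feasible with probability near one. There,
`λ ≥ 1` makes the zero matrix feasible and the claim trivial. If `λ < 1`, then `Σ̂` is consistent,
hence invertible, and `Σ̂⁻¹` is feasible with columns bounded by `2κ`; the error is then at most
`κ(λ + 2κδ)`, where `δ` may be a multiple of the rate that depends on `ε`
(`maxNorm_clime_sub_inv_le_of_small`, `Model.exists_covHat_consistency`). -/

noncomputable section

set_option linter.unusedSectionVars false

namespace TVClime

/-! ### Averaging over coordinates of an infinite product -/

section InfiniteProduct

variable {ι E : Type*}

/-- The point with the coordinates of `x` on `s` and those of `y` off `s`. -/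
def mix (s : Set ι) (x y : ι → E) : ι → E := by
  classical exact s.piecewise x y

theorem mix_of_mem {s : Set ι} (x y : ι → E) {i : ι} (h : i ∈ s) : mix s x y i = x i := by
  simp [mix, h]

theorem mix_of_notMem {s : Set ι} (x y : ι → E) {i : ι} (h : i ∉ s) : mix s x y i = y i := by
  simp [mix, h]

variable [MeasurableSpace E]

@[fun_prop]
theorem measurable_mix (s : Set ι) :
    Measurable fun z : (ι → E) × (ι → E) => mix s z.1 z.2 := by
  refine measurable_pi_lambda _ fun i => ?_
  by_cases hs : i ∈ s
  · simp only [mix_of_mem _ _ hs]; fun_prop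
  · simp only [mix_of_notMem _ _ hs]; fun_prop

variable (ρ : Measure E) [IsProbabilityMeasure ρ]

/-- The law of an i.i.d. family with marginal `ρ`. -/
abbrev iid (ι : Type*) {E : Type*} [MeasurableSpace E] (ρ : Measure E) : Measure (ι → E) :=
  Measure.infinitePi fun _ : ι => ρ

/-- Exchanging the coordinates off `s` between two independent copies preserves the law. -/
theorem measurePreserving_mix_swap (s : Set ι) :
    MeasurePreserving (fun z : (ι → E) × (ι → E) => (mix s z.1 z.2, mix s z.2 z.1))
      ((iid ι ρ).prod (iid ι ρ)) ((iid ι ρ).prod (iid ι ρ)) := by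
  classical
  let P := iid ι ρ
  -- The exchange is a permutation of the doubled index set, and the law of an i.i.d. family is
  -- invariant under injective reindexing.
  let g : Fin 2 × ι → Fin 2 × ι := fun a => if a.2 ∈ s then a else (a.1.rev, a.2)
  have hg : Function.Injective g := by
    rintro ⟨a, i⟩ ⟨b, j⟩ h
    by_cases hi : i ∈ s <;> by_cases hj : j ∈ s <;> simp [g, hi, hj] at h ⊢
    · exact h
    · obtain ⟨_, rfl⟩ := h; exact absurd hi hj
    · obtain ⟨_, rfl⟩ := h; exact absurd hj hi
    · exact h
  have h1 : MeasurePreserving (MeasurableEquiv.finTwoArrow (α := ι → E))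
      (Measure.pi fun _ : Fin 2 => P) (P.prod P) := measurePreserving_finTwoArrow P
  have h2 : MeasurePreserving (MeasurableEquiv.curry (Fin 2) ι E)
      (Measure.infinitePi fun _ : Fin 2 × ι => ρ) (Measure.pi fun _ : Fin 2 => P) := by
    refine ⟨(MeasurableEquiv.curry (Fin 2) ι E).measurable, ?_⟩
    rw [Measure.infinitePi_map_curry (fun _ _ => ρ), Measure.infinitePi_eq_pi]
  have h3 : MeasurePreserving (fun (ω : Fin 2 × ι → E) a => ω (g a))
      (Measure.infinitePi fun _ : Fin 2 × ι => ρ) (Measure.infinitePi fun _ : Fin 2 × ι => ρ) :=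
    ⟨by fun_prop, Measure.map_infinitePi_infinitePi_of_inj (P := fun _ => ρ) hg⟩
  have h4 := (h1.comp h2).comp (h3.comp (((h1.comp h2).symm
    ((MeasurableEquiv.curry (Fin 2) ι E).trans MeasurableEquiv.finTwoArrow))))
  convert h4 using 1
  ext z i
  · by_cases hi : i ∈ s <;> simp [mix, hi, g, MeasurableEquiv.curry, MeasurableEquiv.finTwoArrow,
      MeasurableEquiv.trans, MeasurableEquiv.piFinTwo, MeasurableEquiv.symm, Function.uncurry]
  · by_cases hi : i ∈ s <;> simp [mix, hi, g, MeasurableEquiv.curry, MeasurableEquiv.finTwoArrow,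
      MeasurableEquiv.trans, MeasurableEquiv.piFinTwo, MeasurableEquiv.symm, Function.uncurry]

theorem measurePreserving_mix (s : Set ι) :
    MeasurePreserving (fun z : (ι → E) × (ι → E) => mix s z.1 z.2)
      ((iid ι ρ).prod (iid ι ρ)) (iid ι ρ) :=
  measurePreserving_fst.comp (measurePreserving_mix_swap ρ s)

variable {V : Type*} [NormedAddCommGroup V] [NormedSpace ℝ V]

/-- The average of `f` over the coordinates off `s`. -/
def avg (s : Set ι) (f : (ι → E) → V) (x : ι → E) : V := ∫ y, f (mix s x y) ∂(iid ι ρ)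

theorem dependsOn_avg {s t : Set ι} {f : (ι → E) → V} (hf : DependsOn f t) :
    DependsOn (avg ρ s f) (s ∩ t) := by
  intro x y hxy
  unfold avg
  congr 1 with z
  refine hf fun i hi => ?_
  by_cases hs : i ∈ s
  · rw [mix_of_mem _ _ hs, mix_of_mem _ _ hs, hxy i ⟨hs, hi⟩]
  · rw [mix_of_notMem _ _ hs, mix_of_notMem _ _ hs]

theorem stronglyMeasurable_avg {s : Set ι} {f : (ι → E) → V} (hf : StronglyMeasurable f) :
    StronglyMeasurable (avg ρ s f) :=
  (hf.comp_measurable (measurable_mix s)).integral_prod_right'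

/-- Integrating out one factor of a product probability space is an `L^r` contraction. -/
theorem eLpNorm_integral_right_le {X Y : Type*} [MeasurableSpace X] [MeasurableSpace Y]
    {μ : Measure X} {ν : Measure Y} [SFinite μ] [IsProbabilityMeasure ν]
    {Γ : X × Y → V} (hΓ : StronglyMeasurable Γ) {r : ℝ} (hr : 1 ≤ r) :
    eLpNorm (fun x => ∫ y, Γ (x, y) ∂ν) (ENNReal.ofReal r) μ ≤
      eLpNorm Γ (ENNReal.ofReal r) (μ.prod ν) := by
  have hr0 : 0 < r := by linarith
  have hne : ENNReal.ofReal r ≠ 0 := by simpa using hr0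
  rw [eLpNorm_eq_lintegral_rpow_enorm_toReal hne ENNReal.ofReal_ne_top,
    eLpNorm_eq_lintegral_rpow_enorm_toReal hne ENNReal.ofReal_ne_top, ENNReal.toReal_ofReal hr0.le]
  refine ENNReal.rpow_le_rpow ?_ (by positivity)
  rw [lintegral_prod _ (by fun_prop)]
  refine lintegral_mono fun x => ?_
  have h1 : ‖∫ y, Γ (x, y) ∂ν‖ₑ ≤ eLpNorm (fun y => Γ (x, y)) (ENNReal.ofReal r) ν := by
    refine (enorm_integral_le_lintegral_enorm _).trans ?_
    rw [← eLpNorm_one_eq_lintegral_enorm]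
    refine eLpNorm_le_eLpNorm_of_exponent_le (by simpa using hr) ?_
    exact (hΓ.comp_measurable measurable_prodMk_left).aestronglyMeasurable
  refine (ENNReal.rpow_le_rpow h1 hr0.le).trans ?_
  rw [eLpNorm_eq_lintegral_rpow_enorm_toReal hne ENNReal.ofReal_ne_top, ENNReal.toReal_ofReal hr0.le,
    ← ENNReal.rpow_mul, one_div, inv_mul_cancel₀ hr0.ne', ENNReal.rpow_one]

theorem eLpNorm_avg_le {s : Set ι} {f : (ι → E) → V} (hf : StronglyMeasurable f) {r : ℝ}
    (hr : 1 ≤ r) :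
    eLpNorm (avg ρ s f) (ENNReal.ofReal r) (iid ι ρ) ≤ eLpNorm f (ENNReal.ofReal r) (iid ι ρ) := by
  refine (eLpNorm_integral_right_le (hf.comp_measurable (measurable_mix s)) hr).trans_eq ?_
  exact eLpNorm_comp_measurePreserving hf.aestronglyMeasurable (measurePreserving_mix ρ s)

theorem integrable_mix {s : Set ι} {f : (ι → E) → V} (hf : Integrable f (iid ι ρ)) :
    Integrable (fun z : (ι → E) × (ι → E) => f (mix s z.1 z.2)) ((iid ι ρ).prod (iid ι ρ)) :=
  (measurePreserving_mix ρ s).integrable_comp_of_integrable hf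

theorem integral_avg {s : Set ι} {f : (ι → E) → V} (hf : Integrable f (iid ι ρ)) :
    ∫ x, avg ρ s f x ∂(iid ι ρ) = ∫ x, f x ∂(iid ι ρ) := by
  unfold avg
  rw [integral_integral (integrable_mix ρ hf)]
  have h := (measurePreserving_mix ρ s).map_eq
  conv_rhs => rw [← h]
  rw [integral_map (by fun_prop)]
  rw [h]
  exact hf.aestronglyMeasurable

/-- The `σ`-algebra of the coordinates in `s`. -/
@[reducible]
def coordSigma (E : Type*) [MeasurableSpace E] (s : Set ι) : MeasurableSpace (ι → E) :=
  ⨆ i ∈ s, MeasurableSpace.comap (fun x : ι → E => x i) inferInstance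

theorem coordSigma_le (s : Set ι) : coordSigma E s ≤ MeasurableSpace.pi :=
  iSup₂_le fun i _ => (measurable_pi_apply i).comap_le

theorem coordSigma_mono {s t : Set ι} (h : s ⊆ t) : coordSigma E s ≤ coordSigma E t :=
  biSup_mono h

theorem measurable_coordSigma_apply {s : Set ι} {i : ι} (hi : i ∈ s) :
    Measurable[coordSigma E s] fun x : ι → E => x i := by
  refine Measurable.mono (comap_measurable (fun x : ι → E => x i)) ?_ le_rfl
  exact le_iSup₂_of_le i hi le_rfl

theorem measurable_coordSigma_mix (s : Set ι) (y : ι → E) :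
    Measurable[coordSigma E s] fun x : ι → E => mix s x y := by
  refine @measurable_pi_lambda _ _ _ (coordSigma E s) _ _ fun i => ?_
  by_cases hs : i ∈ s
  · simp only [mix_of_mem _ _ hs]; exact measurable_coordSigma_apply hs
  · simp only [mix_of_notMem _ _ hs]; exact measurable_const

theorem mix_eq_self {W : Type*} {s : Set ι} {f : (ι → E) → W} (hs : DependsOn f s) (x y : ι → E) :
    f (mix s x y) = f x :=
  hs fun _ hi => mix_of_mem _ _ hi

/-- The `σ`-algebra is generated by the restriction map to `s`, so each of its events is a preimage
under that map. -/
theorem dependsOn_of_measurable_coordSigma {s : Set ι} {A : Set (ι → E)}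
    (hA : MeasurableSet[coordSigma E s] A) : DependsOn (fun x => x ∈ A) s := by
  have h : MeasurableSpace.comap (fun x : ι → E => s.domRestrict x) inferInstance =
      coordSigma E s := by
    refine le_antisymm ?_ ?_
    · rw [← measurable_iff_comap_le]
      refine @measurable_pi_lambda _ _ _ (coordSigma E s) _ _ fun i => ?_
      exact measurable_coordSigma_apply i.2
    · refine iSup₂_le fun i hi => ?_
      rw [← measurable_iff_comap_le]
      exact (measurable_pi_apply (X := fun _ : s => E) ⟨i, hi⟩).comp (comap_measurable _)
  rw [← h] at hA
  obtain ⟨B, -, rfl⟩ := hA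
  intro x y hxy
  have : s.domRestrict x = s.domRestrict y := by
    ext i; exact hxy i i.2
  simp [this]

theorem measurable_coordSigma_of_dependsOn {W : Type*} [MeasurableSpace W] {s : Set ι}
    {f : (ι → E) → W} (hs : DependsOn f s) (hf : Measurable f) : Measurable[coordSigma E s] f := by
  rcases isEmpty_or_nonempty (ι → E) with h | ⟨⟨y⟩⟩
  · exact @measurable_of_empty _ _ (coordSigma E s) _ _ _
  -- Freezing the coordinates off `s` at an arbitrary point exhibits `f` as a function of those in
  -- `s`.
  have : f = f ∘ fun x => mix s x y := by
    ext x; exact (mix_eq_self hs x y).symm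
  rw [this]
  exact hf.comp (measurable_coordSigma_mix s y)

theorem stronglyMeasurable_coordSigma_of_dependsOn {s : Set ι}
    {f : (ι → E) → V} (hs : DependsOn f s) (hf : StronglyMeasurable f) :
    StronglyMeasurable[coordSigma E s] f := by
  rcases isEmpty_or_nonempty (ι → E) with h | ⟨⟨y⟩⟩
  · have : f = fun _ => 0 := by ext x; exact (h.false x).elim
    rw [this]; exact stronglyMeasurable_const
  have : f = f ∘ fun x => mix s x y := by
    ext x; exact (mix_eq_self hs x y).symm
  rw [this]
  exact hf.comp_measurable (measurable_coordSigma_mix s y)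

theorem indep_coordSigma {s t : Set ι} (h : Disjoint s t) :
    Indep (coordSigma E s) (coordSigma E t) (iid ι ρ) := by
  refine indep_iSup_of_disjoint (fun i => (measurable_pi_apply i).comap_le) ?_ h
  exact iIndepFun_infinitePi (X := fun _ x => x) (P := fun _ : ι => ρ) (by fun_prop)

/-- Averaging over the coordinates off `s` is conditioning on the coordinates in `s`. -/
theorem condExp_coordSigma_ae_eq [CompleteSpace V] {s : Set ι} {f : (ι → E) → V}
    (hf : StronglyMeasurable f) (hfi : Integrable f (iid ι ρ)) :
    (iid ι ρ)[f | coordSigma E s] =ᵐ[iid ι ρ] avg ρ s f := by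
  have hint : Integrable (avg ρ s f) (iid ι ρ) := (integrable_mix ρ hfi).integral_prod_left
  refine (ae_eq_condExp_of_forall_setIntegral_eq (coordSigma_le s) hfi
    (fun _ _ _ => hint.integrableOn) (fun A hA _ => ?_) ?_).symm
  · have hA' : MeasurableSet A := coordSigma_le s _ hA
    have hmem := dependsOn_of_measurable_coordSigma hA
    -- Membership in `A` is not affected by `mix`, so the indicator passes through the average and
    -- `integral_avg` compares the two integrals.
    rw [← integral_indicator hA', ← integral_indicator hA',
      ← integral_avg ρ (s := s) (hfi.indicator hA')]
    congr 1 with x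
    unfold avg
    by_cases hx : x ∈ A
    · rw [Set.indicator_of_mem hx]
      congr 1 with y
      rw [Set.indicator_of_mem]
      have := mix_eq_self hmem x y
      simpa [this] using hx
    · rw [Set.indicator_of_notMem hx, ← integral_zero (ι → E) V (μ := iid ι ρ)]
      congr 1 with y
      rw [Set.indicator_of_notMem]
      have := mix_eq_self hmem x y
      simpa [this] using hx
  · refine StronglyMeasurable.aestronglyMeasurable ?_
    refine stronglyMeasurable_coordSigma_of_dependsOn ?_ (stronglyMeasurable_avg ρ hf)
    simpa using dependsOn_avg ρ (s := s) (dependsOn_univ f)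

/-- Averages over ever fewer coordinates of the past converge almost surely. -/
theorem tendsto_avg_Ici {f : (ℤ → E) → ℝ} (hf : StronglyMeasurable f)
    (hfi : Integrable f (iid ℤ ρ)) (c : ℤ) :
    ∀ᵐ x ∂(iid ℤ ρ), Tendsto (fun m : ℕ => avg ρ (Set.Ici (c - m)) f x) atTop (𝓝 (f x)) := by
  let ℱ : Filtration ℕ (MeasurableSpace.pi : MeasurableSpace (ℤ → E)) :=
    { seq := fun m => coordSigma E (Set.Ici (c - m))
      mono' := fun m n hmn => coordSigma_mono (Set.Ici_subset_Ici.2 (by gcongr))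
      le' := fun m => coordSigma_le _ }
  have hsup : (⨆ m, ℱ m) = (MeasurableSpace.pi : MeasurableSpace (ℤ → E)) := by
    refine le_antisymm (iSup_le fun m => coordSigma_le _) ?_
    refine iSup_le fun i => ?_
    have hi : i ∈ Set.Ici (c - ((c - i).toNat : ℤ)) := by
      simp only [Set.mem_Ici]; omega
    rw [← measurable_iff_comap_le]
    exact (measurable_coordSigma_apply hi).mono (le_iSup (fun m => ℱ m) ((c - i).toNat)) le_rfl
  -- Lévy's upward theorem.
  have h1 := hfi.tendsto_ae_condExp (ℱ := ℱ) (by rw [hsup]; exact hf)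
  have h2 : ∀ᵐ x ∂(iid ℤ ρ), ∀ m : ℕ, ((iid ℤ ρ)[f | ℱ m]) x = avg ρ (Set.Ici (c - m)) f x :=
    ae_all_iff.2 fun m => condExp_coordSigma_ae_eq ρ hf hfi
  filter_upwards [h1, h2] with x hx1 hx2
  simpa only [hx2] using hx1

/-- Shifting the time index preserves the law. -/
theorem measurePreserving_shift (c : ℤ) :
    MeasurePreserving (fun (x : ℤ → E) i => x (i + c)) (iid ℤ ρ) (iid ℤ ρ) :=
  ⟨by fun_prop, Measure.map_infinitePi_infinitePi_of_inj (P := fun _ => ρ) (add_left_injective c)⟩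

end InfiniteProduct

/-! ### Smooth norms and moments of martingale sums -/

/-- A two-point form of `2`-uniform smoothness for the `r`-th power of a norm. -/
def IsTwoSmooth (V : Type*) [NormedAddCommGroup V] (r c : ℝ) : Prop :=
  ∀ x h : V, ‖x + h‖ ^ r + ‖x - h‖ ^ r ≤ 2 * (‖x‖ ^ 2 + c * ‖h‖ ^ 2) ^ (r / 2)

/-- Induction on `k`. With `u = (x+h)²` and `v = (x-h)²`, the next power sum is `s(u^k + v^k) +
2xh(u^k - v^k)`, and the cross term is of second order in `h` because `u^k - v^k` contains the
factor `u - v = 4xh`. The condition on `c` is what the inductive step consumes. -/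
theorem add_pow_add_sub_pow_le (x h c : ℝ) (k : ℕ) (hc : 1 + k * 2 ^ (k + 1) ≤ c) :
    (x + h) ^ (2 * k) + (x - h) ^ (2 * k) ≤ 2 * (x ^ 2 + c * h ^ 2) ^ k := by
  induction k with
  | zero => norm_num
  | succ k ih =>
    have hc1 : (1 : ℝ) + k * 2 ^ (k + 1) ≤ c := by
      refine le_trans ?_ hc
      push_cast
      have : (2 : ℝ) ^ (k + 1) ≤ 2 ^ (k + 1 + 1) := by gcongr <;> norm_num
      nlinarith [show (0 : ℝ) < 2 ^ (k + 1) by positivity, show (0 : ℝ) ≤ k by positivity]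
    have ih' := ih hc1
    have hc0 : 1 ≤ c := by
      have : (0 : ℝ) ≤ k * 2 ^ (k + 1) := by positivity
      linarith
    set u := (x + h) ^ 2 with hu
    set v := (x - h) ^ 2 with hv
    set s := x ^ 2 + h ^ 2 with hs
    have hu0 : 0 ≤ u := sq_nonneg _
    have hv0 : 0 ≤ v := sq_nonneg _
    have hus : u ≤ 2 * s := by rw [hu, hs]; nlinarith [sq_nonneg (x - h)]
    have hvs : v ≤ 2 * s := by rw [hv, hs]; nlinarith [sq_nonneg (x + h)]
    have hs0 : 0 ≤ s := by positivity
    have hT : s ≤ x ^ 2 + c * h ^ 2 := by rw [hs]; nlinarith [sq_nonneg h]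
    rw [pow_mul, pow_mul, ← hu, ← hv] at ih' ⊢
    have h1 : u ^ (k + 1) + v ^ (k + 1) = s * (u ^ k + v ^ k) + 2 * x * h * (u ^ k - v ^ k) := by
      rw [pow_succ, pow_succ, hu, hv, hs]; ring
    have h2 : 2 * x * h * (u ^ k - v ^ k) ≤ 8 * x ^ 2 * h ^ 2 * (k * (2 * s) ^ (k - 1)) := by
      have h3 : |u ^ k - v ^ k| ≤ |u - v| * k * max |u| |v| ^ (k - 1) := abs_pow_sub_pow_le u v k
      have h4 : max |u| |v| ≤ 2 * s := by
        rw [abs_of_nonneg hu0, abs_of_nonneg hv0]; exact max_le hus hvs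
      have h5 : u - v = 4 * x * h := by rw [hu, hv]; ring
      calc 2 * x * h * (u ^ k - v ^ k) ≤ |2 * x * h| * |u ^ k - v ^ k| := by
            rw [← abs_mul]; exact le_abs_self _
        _ ≤ |2 * x * h| * (|u - v| * k * (2 * s) ^ (k - 1)) := by
            refine mul_le_mul_of_nonneg_left (h3.trans ?_) (abs_nonneg _)
            gcongr
        _ = (|2 * x * h| * |4 * x * h|) * (k * (2 * s) ^ (k - 1)) := by rw [h5]; ring
        _ = _ := by
            rw [← abs_mul, abs_of_nonneg (by nlinarith [sq_nonneg (x * h)])]; ring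
    have h6 : x ^ 2 * (k * (2 * s) ^ (k - 1)) ≤ k * 2 ^ k * (x ^ 2 + c * h ^ 2) ^ k := by
      rcases Nat.eq_zero_or_pos k with rfl | hk
      · simp
      · obtain ⟨m, rfl⟩ : ∃ m, k = m + 1 := ⟨k - 1, by omega⟩
        have hxs : x ^ 2 ≤ s := by rw [hs]; nlinarith [sq_nonneg h]
        calc x ^ 2 * (((m + 1 : ℕ) : ℝ) * (2 * s) ^ (m + 1 - 1))
            ≤ s * (((m + 1 : ℕ) : ℝ) * (2 * s) ^ m) := by
              simp only [Nat.add_sub_cancel]; gcongr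
          _ = ((m + 1 : ℕ) : ℝ) * 2 ^ m * s ^ (m + 1) := by rw [mul_pow]; ring
          _ ≤ ((m + 1 : ℕ) : ℝ) * 2 ^ (m + 1) * (x ^ 2 + c * h ^ 2) ^ (m + 1) := by
              gcongr <;> norm_num
    have hTk : 0 ≤ (x ^ 2 + c * h ^ 2) ^ k := by positivity
    calc u ^ (k + 1) + v ^ (k + 1)
        ≤ s * (2 * (x ^ 2 + c * h ^ 2) ^ k) + 8 * h ^ 2 * (k * 2 ^ k * (x ^ 2 + c * h ^ 2) ^ k) := by
          rw [h1]; nlinarith [sq_nonneg h]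
      _ = 2 * (x ^ 2 + c * h ^ 2) ^ k * (x ^ 2 + (1 + k * 2 ^ (k + 1 + 1)) * h ^ 2) := by
          rw [hs]; ring
      _ ≤ 2 * (x ^ 2 + c * h ^ 2) ^ k * (x ^ 2 + c * h ^ 2) := by
          gcongr
          refine le_trans ?_ hc
          push_cast
          have : (0 : ℝ) < 2 ^ (k + 1 + 1) := by positivity
          linarith
      _ = _ := by ring

theorem rpow_midpoint_le {x y p : ℝ} (hx : 0 ≤ x) (hy : 0 ≤ y) (hp : 1 ≤ p) :
    (1 / 2 * x + 1 / 2 * y) ^ p ≤ 1 / 2 * x ^ p + 1 / 2 * y ^ p := by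
  simpa using (convexOn_rpow hp).2 hx hy (show (0 : ℝ) ≤ 1 / 2 by norm_num)
    (show (0 : ℝ) ≤ 1 / 2 by norm_num) (by norm_num)

/-- The power mean of order `R` of the two norms dominates the one of order `r`. -/
theorem IsTwoSmooth.mono {V : Type*} [NormedAddCommGroup V] {R r c : ℝ} (h : IsTwoSmooth V R c)
    (hc : 0 ≤ c) (hr : 0 < r) (hrR : r ≤ R) : IsTwoSmooth V r c := by
  intro x y
  have hR : 0 < R := hr.trans_le hrR
  have h1 := rpow_midpoint_le (x := ‖x + y‖ ^ r) (y := ‖x - y‖ ^ r) (by positivity)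
    (by positivity) (p := R / r) (by rw [le_div_iff₀ hr]; linarith)
  rw [← Real.rpow_mul (norm_nonneg _), ← Real.rpow_mul (norm_nonneg _),
    mul_div_cancel₀ _ hr.ne'] at h1
  have h2 : (1 / 2 * ‖x + y‖ ^ r + 1 / 2 * ‖x - y‖ ^ r) ^ (R / r) ≤
      (‖x‖ ^ 2 + c * ‖y‖ ^ 2) ^ (R / 2) := by
    have := h x y; linarith
  have h3 := Real.rpow_le_rpow (by positivity) h2 (show 0 ≤ r / R by positivity)
  rw [← Real.rpow_mul (by positivity), ← Real.rpow_mul (by positivity),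
    show R / r * (r / R) = 1 by field_simp, show R / 2 * (r / R) = r / 2 by field_simp,
    Real.rpow_one] at h3
  linarith

/-- The constant of smoothness of `ℓ_{2k}`. -/
def smoothConst (k : ℕ) : ℝ := 1 + k * 2 ^ (k + 1)

theorem one_le_smoothConst (k : ℕ) : 1 ≤ smoothConst k := by
  unfold smoothConst
  have : (0 : ℝ) ≤ k * 2 ^ (k + 1) := by positivity
  linarith

/-- The scalar inequality is summed over the coordinates, and Minkowski's inequality in `ℓ_k`
separates `x i ^ 2` from `c * h i ^ 2`. The constant does not depend on the number of coordinates.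
-/
theorem isTwoSmooth_piLp {ι : Type*} [Fintype ι] (k : ℕ) [hk : Fact (1 ≤ ((2 * k : ℕ) : ℝ≥0∞))] :
    IsTwoSmooth (PiLp ((2 * k : ℕ) : ℝ≥0∞) fun _ : ι => ℝ) ((2 * k : ℕ) : ℝ) (smoothConst k) := by
  have hk1 : 1 ≤ k := by
    have : 1 ≤ 2 * k := by exact_mod_cast hk.out
    omega
  have hk0 : (0 : ℝ) < k := by exact_mod_cast hk1
  have hk2 : (0 : ℝ) < ((2 * k : ℕ) : ℝ) := by push_cast; positivity
  have hnorm : ∀ z : PiLp ((2 * k : ℕ) : ℝ≥0∞) (fun _ : ι => ℝ),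
      ‖z‖ = (∑ i, z i ^ (2 * k)) ^ (1 / ((2 * k : ℕ) : ℝ)) := fun z => by
    rw [PiLp.norm_eq_sum (by simpa using hk2)]
    simp only [ENNReal.toReal_natCast, Real.rpow_natCast, Real.norm_eq_abs]
    congr 1
    refine Finset.sum_congr rfl fun i _ => ?_
    rw [pow_mul, sq_abs, ← pow_mul]
  have hsum0 : ∀ z : PiLp ((2 * k : ℕ) : ℝ≥0∞) (fun _ : ι => ℝ), 0 ≤ ∑ i, z i ^ (2 * k) :=
    fun z => Finset.sum_nonneg fun i _ => by rw [pow_mul]; positivity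
  have hnormk : ∀ z : PiLp ((2 * k : ℕ) : ℝ≥0∞) (fun _ : ι => ℝ),
      ‖z‖ ^ ((2 * k : ℕ) : ℝ) = ∑ i, z i ^ (2 * k) := fun z => by
    rw [hnorm, ← Real.rpow_mul (hsum0 z), one_div, inv_mul_cancel₀ hk2.ne', Real.rpow_one]
  have hnorm2 : ∀ z : PiLp ((2 * k : ℕ) : ℝ≥0∞) (fun _ : ι => ℝ),
      ‖z‖ ^ 2 = (∑ i, z i ^ (2 * k)) ^ (1 / (k : ℝ)) := fun z => by
    rw [hnorm, ← Real.rpow_natCast, ← Real.rpow_mul (hsum0 z)]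
    congr 1
    push_cast
    field_simp
  intro x h
  rw [hnormk, hnormk, ← Finset.sum_add_distrib]
  have hc : (0 : ℝ) ≤ smoothConst k := by linarith [one_le_smoothConst k]
  calc ∑ i, ((x + h) i ^ (2 * k) + (x - h) i ^ (2 * k))
      ≤ ∑ i, 2 * (x i ^ 2 + smoothConst k * h i ^ 2) ^ k :=
        Finset.sum_le_sum fun i _ => add_pow_add_sub_pow_le _ _ _ _ le_rfl
    _ = 2 * ∑ i, |x i ^ 2 + smoothConst k * h i ^ 2| ^ (k : ℝ) := by
        rw [Finset.mul_sum]
        refine Finset.sum_congr rfl fun i _ => ?_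
        rw [abs_of_nonneg (by positivity), Real.rpow_natCast]
    _ ≤ 2 * (‖x‖ ^ 2 + smoothConst k * ‖h‖ ^ 2) ^ (k : ℝ) := by
        have h1 := Real.Lp_add_le Finset.univ (fun i => x i ^ 2)
          (fun i => smoothConst k * h i ^ 2) (p := (k : ℝ)) (by exact_mod_cast hk1)
        have h2 : (∑ i, |x i ^ 2| ^ (k : ℝ)) ^ (1 / (k : ℝ)) = ‖x‖ ^ 2 := by
          rw [hnorm2]; congr 1
          refine Finset.sum_congr rfl fun i _ => ?_
          rw [abs_of_nonneg (by positivity), Real.rpow_natCast, pow_mul]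
        have h3 : (∑ i, |smoothConst k * h i ^ 2| ^ (k : ℝ)) ^ (1 / (k : ℝ)) =
            smoothConst k * ‖h‖ ^ 2 := by
          rw [hnorm2]
          have : ∀ i, |smoothConst k * h i ^ 2| ^ (k : ℝ) = smoothConst k ^ k * h i ^ (2 * k) :=
            fun i => by
              rw [abs_of_nonneg (by positivity), Real.rpow_natCast, mul_pow, pow_mul]
          simp only [this]
          rw [← Finset.mul_sum, Real.mul_rpow (by positivity) (hsum0 h), ← Real.rpow_natCast,
            ← Real.rpow_mul hc, mul_one_div_cancel hk0.ne', Real.rpow_one]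
        rw [h2, h3] at h1
        have h4 := Real.rpow_le_rpow (by positivity) h1 hk0.le
        rw [← Real.rpow_mul (Finset.sum_nonneg fun i _ => by positivity), one_div,
          inv_mul_cancel₀ hk0.ne', Real.rpow_one] at h4
        linarith
    _ = _ := by
        congr 2
        push_cast
        field_simp

theorem isTwoSmooth_real_two : IsTwoSmooth ℝ 2 1 := by
  intro x h
  norm_num [Real.norm_eq_abs]
  nlinarith

section Martingale

variable {Ω : Type*} [MeasurableSpace Ω] {μ : Measure Ω}
variable {V : Type*} [NormedAddCommGroup V]

theorem eLpNorm_ofReal_rpow {r : ℝ} (hr : 0 < r) (f : Ω → V) :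
    eLpNorm f (ENNReal.ofReal r) μ ^ r = ∫⁻ ω, ‖f ω‖ₑ ^ r ∂μ := by
  rw [eLpNorm_eq_lintegral_rpow_enorm_toReal (by simpa using hr) ENNReal.ofReal_ne_top,
    ENNReal.toReal_ofReal hr.le, ← ENNReal.rpow_mul, one_div, inv_mul_cancel₀ hr.ne',
    ENNReal.rpow_one]

theorem two_mul_add_rpow_le {A e β : ℝ} (hA : 0 ≤ A) (he : 0 ≤ e) (hβ : 1 ≤ β) :
    2 * (A + e) ^ β ≤ A ^ β + (A + 2 * e) ^ β := by
  have h1 := rpow_midpoint_le hA (show 0 ≤ A + 2 * e by positivity) hβ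
  rw [show 1 / 2 * A + 1 / 2 * (A + 2 * e) = A + e by ring] at h1
  linarith

/-- One step of the moment inequality for martingales in a smooth space. -/
theorem eLpNorm_add_sq_le {r c : ℝ} (hV : IsTwoSmooth V r c) (hr : 2 ≤ r) (hc : 0 ≤ c)
    {S D : Ω → V} (hS : MemLp S (ENNReal.ofReal r) μ) (hD : MemLp D (ENNReal.ofReal r) μ)
    (hSD : eLpNorm S (ENNReal.ofReal r) μ ≤ eLpNorm (S - D) (ENNReal.ofReal r) μ) :
    (eLpNorm (S + D) (ENNReal.ofReal r) μ).toReal ^ 2 ≤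
      (eLpNorm S (ENNReal.ofReal r) μ).toReal ^ 2 +
        2 * c * (eLpNorm D (ENNReal.ofReal r) μ).toReal ^ 2 := by
  have hr0 : 0 < r := by linarith
  have hpow : ∀ f : Ω → V, eLpNorm f (ENNReal.ofReal r) μ ^ r = ∫⁻ ω, ‖f ω‖ₑ ^ r ∂μ :=
    eLpNorm_ofReal_rpow hr0
  have hpt : ∀ ω, ‖(S + D) ω‖ₑ ^ r + ‖(S - D) ω‖ₑ ^ r ≤
      2 * (‖S ω‖ₑ ^ 2 + ENNReal.ofReal c * ‖D ω‖ₑ ^ 2) ^ (r / 2) := fun ω => by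
    have h1 := ENNReal.ofReal_le_ofReal (hV (S ω) (D ω))
    rw [ENNReal.ofReal_add (by positivity) (by positivity), ENNReal.ofReal_mul (by norm_num),
      ← ENNReal.ofReal_rpow_of_nonneg (by positivity) hr0.le,
      ← ENNReal.ofReal_rpow_of_nonneg (by positivity) hr0.le,
      ← ENNReal.ofReal_rpow_of_nonneg (by positivity) (by positivity),
      ENNReal.ofReal_add (by positivity) (by positivity), ENNReal.ofReal_mul hc,
      ENNReal.ofReal_pow (norm_nonneg _), ENNReal.ofReal_pow (norm_nonneg _)] at h1
    simpa only [ofReal_norm, Pi.add_apply, Pi.sub_apply, ENNReal.ofReal_ofNat] using h1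
  have hSm := hS.1.enorm
  have hDm := hD.1.enorm
  set A := eLpNorm S (ENNReal.ofReal r) μ with hA
  set B := eLpNorm D (ENNReal.ofReal r) μ with hB
  have hAt : A ≠ ⊤ := hS.2.ne
  have hBt : B ≠ ⊤ := hD.2.ne
  have hXt : eLpNorm (S + D) (ENNReal.ofReal r) μ ≠ ⊤ := (hS.add hD).2.ne
  set X := eLpNorm (S + D) (ENNReal.ofReal r) μ with hX
  have hroot : ∀ a : ℝ≥0∞, (a ^ r) ^ (1 / (r / 2)) = a ^ 2 := fun a => by
    rw [← ENNReal.rpow_mul, ← ENNReal.rpow_natCast]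
    congr 1
    push_cast
    field_simp
  -- Minkowski's inequality in `L^(r/2)`, which needs `r ≥ 2`.
  have hmink : (∫⁻ ω, (‖S ω‖ₑ ^ 2 + ENNReal.ofReal c * ‖D ω‖ₑ ^ 2) ^ (r / 2) ∂μ) ≤
      (A ^ 2 + ENNReal.ofReal c * B ^ 2) ^ (r / 2) := by
    have h1 := ENNReal.lintegral_Lp_add_le (μ := μ) (f := fun ω => ‖S ω‖ₑ ^ 2)
      (g := fun ω => ENNReal.ofReal c * ‖D ω‖ₑ ^ 2) (by fun_prop) (by fun_prop)
      (p := r / 2) (by linarith)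
    have h2 : (∫⁻ ω, (‖S ω‖ₑ ^ 2) ^ (r / 2) ∂μ) ^ (1 / (r / 2)) = A ^ 2 := by
      rw [hA, ← hroot, hpow]
      congr 2 with ω
      rw [← ENNReal.rpow_natCast, ← ENNReal.rpow_mul]
      congr 1; push_cast; ring
    have h3 : (∫⁻ ω, (ENNReal.ofReal c * ‖D ω‖ₑ ^ 2) ^ (r / 2) ∂μ) ^ (1 / (r / 2)) =
        ENNReal.ofReal c * B ^ 2 := by
      have : ∀ ω, (ENNReal.ofReal c * ‖D ω‖ₑ ^ 2) ^ (r / 2) =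
          ENNReal.ofReal c ^ (r / 2) * ‖D ω‖ₑ ^ r := fun ω => by
        rw [ENNReal.mul_rpow_of_nonneg _ _ (by positivity), ← ENNReal.rpow_natCast,
          ← ENNReal.rpow_mul]
        congr 2; push_cast; ring
      simp only [this]
      rw [lintegral_const_mul'' _ (by fun_prop), ENNReal.mul_rpow_of_nonneg _ _ (by positivity),
        ← ENNReal.rpow_mul, ← hpow, hroot, mul_one_div_cancel (by positivity), ENNReal.rpow_one]
    have h4 := ENNReal.rpow_le_rpow (h1.trans_eq (congrArg₂ _ h2 h3))
      (show 0 ≤ r / 2 by positivity)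
    rwa [← ENNReal.rpow_mul, one_div, inv_mul_cancel₀ (by positivity), ENNReal.rpow_one] at h4
  have hmain : X ^ r + A ^ r ≤ 2 * (A ^ 2 + ENNReal.ofReal c * B ^ 2) ^ (r / 2) := by
    calc X ^ r + A ^ r ≤ X ^ r + eLpNorm (S - D) (ENNReal.ofReal r) μ ^ r := by gcongr
      _ = ∫⁻ ω, (‖(S + D) ω‖ₑ ^ r + ‖(S - D) ω‖ₑ ^ r) ∂μ := by
          rw [hX, hpow, hpow, lintegral_add_left']
          exact ((hS.1.add hD.1).enorm.pow_const _)
      _ ≤ ∫⁻ ω, 2 * (‖S ω‖ₑ ^ 2 + ENNReal.ofReal c * ‖D ω‖ₑ ^ 2) ^ (r / 2) ∂μ := lintegral_mono hpt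
      _ = 2 * ∫⁻ ω, (‖S ω‖ₑ ^ 2 + ENNReal.ofReal c * ‖D ω‖ₑ ^ 2) ^ (r / 2) ∂μ := by
          rw [lintegral_const_mul'' _ (by fun_prop)]
      _ ≤ _ := by gcongr
  have hreal : X.toReal ^ r + A.toReal ^ r ≤ 2 * (A.toReal ^ 2 + c * B.toReal ^ 2) ^ (r / 2) := by
    have h1 := ENNReal.toReal_mono (by
      refine ENNReal.mul_ne_top (by norm_num) (ENNReal.rpow_ne_top_of_nonneg (by positivity) ?_)
      finiteness) hmain
    rw [ENNReal.toReal_add (ENNReal.rpow_ne_top_of_nonneg hr0.le hXt)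
      (ENNReal.rpow_ne_top_of_nonneg hr0.le hAt), ENNReal.toReal_mul, ← ENNReal.toReal_rpow,
      ← ENNReal.toReal_rpow, ← ENNReal.toReal_rpow, ENNReal.toReal_add (by finiteness)
      (by finiteness), ENNReal.toReal_mul, ENNReal.toReal_ofReal hc, ENNReal.toReal_pow,
      ENNReal.toReal_pow] at h1
    simpa using h1
  -- Convexity of the power `r/2` lets `A^r` be subtracted from both sides; this doubles the
  -- coefficient `c`.
  have hconv := two_mul_add_rpow_le (A := A.toReal ^ 2) (e := c * B.toReal ^ 2) (β := r / 2)
    (by positivity) (by positivity) (by linarith)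
  have hsq : ∀ a : ℝ, 0 ≤ a → (a ^ 2) ^ (r / 2) = a ^ r := fun a ha => by
    rw [← Real.rpow_natCast, ← Real.rpow_mul ha]
    congr 1; push_cast; ring
  rw [hsq _ ENNReal.toReal_nonneg] at hconv
  have hfin : (X.toReal ^ 2) ^ (r / 2) ≤ (A.toReal ^ 2 + 2 * (c * B.toReal ^ 2)) ^ (r / 2) := by
    rw [hsq _ ENNReal.toReal_nonneg]; linarith
  have := (Real.rpow_le_rpow_iff (by positivity) (by positivity) (by positivity)).1 hfin
  linarith

/-- Moments of a sum whose increments are, in the `L^r` sense, orthogonal to the past. -/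
theorem eLpNorm_sum_range_le {r c : ℝ} (hV : IsTwoSmooth V r c) (hr : 2 ≤ r) (hc : 0 ≤ c)
    {D : ℕ → Ω → V} {α : ℝ} (hα : 0 ≤ α) {n : ℕ}
    (hDm : ∀ i < n, AEStronglyMeasurable (D i) μ)
    (hD : ∀ i < n, eLpNorm (D i) (ENNReal.ofReal r) μ ≤ ENNReal.ofReal α)
    (horth : ∀ m < n, eLpNorm (∑ i ∈ Finset.range m, D i) (ENNReal.ofReal r) μ ≤
      eLpNorm (∑ i ∈ Finset.range m, D i - D m) (ENNReal.ofReal r) μ) :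
    eLpNorm (∑ i ∈ Finset.range n, D i) (ENNReal.ofReal r) μ ≤
      ENNReal.ofReal (√(2 * c * n) * α) := by
  have hmem : ∀ i < n, MemLp (D i) (ENNReal.ofReal r) μ := fun i hi =>
    ⟨hDm i hi, (hD i hi).trans_lt ENNReal.ofReal_lt_top⟩
  have hsum : ∀ m ≤ n, MemLp (∑ i ∈ Finset.range m, D i) (ENNReal.ofReal r) μ := fun m hm =>
    memLp_finsetSum' _ fun i hi => hmem i ((Finset.mem_range.1 hi).trans_le hm)
  have key : ∀ m ≤ n, (eLpNorm (∑ i ∈ Finset.range m, D i) (ENNReal.ofReal r) μ).toReal ^ 2 ≤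
      2 * c * m * α ^ 2 := by
    intro m hm
    induction m with
    | zero => simp
    | succ m ih =>
      have h1 := eLpNorm_add_sq_le hV hr hc (hsum m (by omega)) (hmem m (by omega))
        (horth m (by omega))
      rw [Finset.sum_range_succ]
      have h2 : (eLpNorm (D m) (ENNReal.ofReal r) μ).toReal ≤ α :=
        ENNReal.toReal_le_of_le_ofReal hα (hD m (by omega))
      have h3 : (eLpNorm (D m) (ENNReal.ofReal r) μ).toReal ^ 2 ≤ α ^ 2 := by gcongr
      have h4 := ih (by omega)
      push_cast
      nlinarith
  rw [← ENNReal.ofReal_toReal (hsum n le_rfl).2.ne]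
  refine ENNReal.ofReal_le_ofReal (abs_le_of_sq_le_sq' ?_ (by positivity)).2
  rw [mul_pow, Real.sq_sqrt (by positivity)]
  exact key n le_rfl

end Martingale

/-! ### A maximal inequality by dyadic chaining -/

section Chaining

variable {V : Type*} [NormedAddCommGroup V]

/-- Binary expansion: an initial piece of a dyadic block is an initial piece of its left half, or
the whole left half followed by an initial piece of the right half. Each level is thus used at most
once. -/
theorem norm_sum_Ico_le_of_dyadic (f : ℕ → V) (R₀ : ℕ) (M : ℕ → ℝ)
    (hM : ∀ r ≤ R₀, ∀ j < 2 ^ (R₀ - r),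
      ‖∑ i ∈ Finset.range (2 ^ r), f (j * 2 ^ r + i)‖ ≤ M r) :
    ∀ R ≤ R₀, ∀ j < 2 ^ (R₀ - R), ∀ k < 2 ^ R,
      ‖∑ i ∈ Finset.range k, f (j * 2 ^ R + i)‖ ≤ ∑ r ∈ Finset.range R, M r := by
  intro R
  induction R with
  | zero =>
    intro _ j _ k hk
    have : k = 0 := by simpa using hk
    simp [this]
  | succ R ih =>
    intro hR j hj k hk
    have hpow : 2 ^ (R₀ - R) = 2 * 2 ^ (R₀ - (R + 1)) := by
      rw [← pow_succ']; congr 1; omega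
    have hM0 : 0 ≤ M R := (norm_nonneg _).trans (hM R (by omega) 0 (by positivity))
    rw [Finset.sum_range_succ]
    rcases lt_or_ge k (2 ^ R) with h | h
    · have h1 := ih (by omega) (2 * j) (by omega) k h
      rw [show 2 * j * 2 ^ R = j * 2 ^ (R + 1) by ring] at h1
      linarith
    · obtain ⟨l, rfl⟩ := Nat.exists_eq_add_of_le h
      have h1 := ih (by omega) (2 * j + 1) (by omega) l (by rw [pow_succ] at hk; omega)
      have h2 := hM R (by omega) (2 * j) (by omega)
      rw [Finset.sum_range_add]
      refine (norm_add_le _ _).trans ?_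
      rw [add_comm]
      refine add_le_add ?_ ?_
      · simp only [show ∀ i, j * 2 ^ (R + 1) + (2 ^ R + i) = (2 * j + 1) * 2 ^ R + i from
          fun i => by ring]
        exact h1
      · simp only [show ∀ i, j * 2 ^ (R + 1) + i = 2 * j * 2 ^ R + i from fun i => by ring]
        exact h2

theorem norm_sum_range_le_of_dyadic (f : ℕ → V) (R : ℕ) (M : ℕ → ℝ)
    (hM : ∀ r ≤ R, ∀ j < 2 ^ (R - r),
      ‖∑ i ∈ Finset.range (2 ^ r), f (j * 2 ^ r + i)‖ ≤ M r) {k : ℕ} (hk : k ≤ 2 ^ R) :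
    ‖∑ i ∈ Finset.range k, f i‖ ≤ ∑ r ∈ Finset.range (R + 1), M r := by
  have hM0 : ∀ r ≤ R, 0 ≤ M r := fun r hr =>
    (norm_nonneg _).trans (hM r hr 0 (by positivity))
  rw [Finset.sum_range_succ]
  rcases hk.lt_or_eq with h | rfl
  · have h1 := norm_sum_Ico_le_of_dyadic f R M hM R le_rfl 0 (by positivity) k h
    simp only [zero_mul, zero_add] at h1
    linarith [hM0 R le_rfl]
  · have h1 := hM R le_rfl 0 (by simp)
    simp only [zero_mul, zero_add] at h1
    have : 0 ≤ ∑ r ∈ Finset.range R, M r :=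
      Finset.sum_nonneg fun r hr => hM0 r (Finset.mem_range.1 hr).le
    linarith

variable {Ω : Type*} [MeasurableSpace Ω] {μ : Measure Ω}

/-- The maximum over the blocks of one level is replaced by the `ℓ^q` sum of their norms, at the
cost of the number of blocks to the power `1/q`. The levels are added by the triangle inequality in
`L^q`, and Markov's inequality concludes. -/
theorem measure_max_partial_sum_le {q : ℝ} (hq : 1 ≤ q) (f : ℕ → Ω → V)
    (hf : ∀ i, AEStronglyMeasurable (f i) μ) (R : ℕ) (B : ℕ → ℝ) (hB0 : ∀ r, 0 ≤ B r)
    (hB : ∀ r ≤ R, ∀ j < 2 ^ (R - r),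
      eLpNorm (fun ω => ∑ i ∈ Finset.range (2 ^ r), f (j * 2 ^ r + i) ω) (ENNReal.ofReal q) μ ≤
        ENNReal.ofReal (B r)) {y : ℝ} (hy : 0 < y) :
    μ {ω | ∃ k ≤ 2 ^ R, y < ‖∑ i ∈ Finset.range k, f i ω‖} ≤
      ENNReal.ofReal (((∑ r ∈ Finset.range (R + 1), ((2 : ℝ) ^ (R - r)) ^ (1 / q) * B r) / y) ^ q)
    := by
  have hq0 : 0 < q := by linarith
  have hne : ENNReal.ofReal q ≠ 0 := by simpa using hq0
  let T : ℕ → ℕ → Ω → V := fun r j ω => ∑ i ∈ Finset.range (2 ^ r), f (j * 2 ^ r + i) ω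
  have hT : ∀ r j, AEStronglyMeasurable (T r j) μ := fun r j =>
    Finset.aestronglyMeasurable_fun_sum _ fun i _ => hf _
  let M : ℕ → Ω → ℝ := fun r ω => (∑ j ∈ Finset.range (2 ^ (R - r)), ‖T r j ω‖ ^ q) ^ (1 / q)
  have hMm : ∀ r, AEStronglyMeasurable (M r) μ := fun r => by
    refine AEMeasurable.aestronglyMeasurable ?_
    refine AEMeasurable.pow_const ?_ _
    exact Finset.aemeasurable_fun_sum _ fun j _ => (hT r j).norm.aemeasurable.pow_const _
  have hMnorm : ∀ r ≤ R, eLpNorm (M r) (ENNReal.ofReal q) μ ≤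
      ENNReal.ofReal (((2 : ℝ) ^ (R - r)) ^ (1 / q) * B r) := fun r hr => by
    rw [← ENNReal.rpow_le_rpow_iff hq0, eLpNorm_ofReal_rpow hq0]
    have hpt : ∀ ω, ‖M r ω‖ₑ ^ q = ∑ j ∈ Finset.range (2 ^ (R - r)), ‖T r j ω‖ₑ ^ q := fun ω => by
      rw [Real.enorm_eq_ofReal (by positivity), ENNReal.ofReal_rpow_of_nonneg (by positivity) hq0.le,
        ← Real.rpow_mul (by positivity), one_div, inv_mul_cancel₀ hq0.ne', Real.rpow_one,
        ENNReal.ofReal_sum_of_nonneg fun _ _ => by positivity]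
      refine Finset.sum_congr rfl fun j _ => ?_
      rw [← ENNReal.ofReal_rpow_of_nonneg (by positivity) hq0.le, ofReal_norm]
    simp only [hpt]
    rw [lintegral_finsetSum' _ fun j _ => (hT r j).enorm.pow_const _]
    calc ∑ j ∈ Finset.range (2 ^ (R - r)), ∫⁻ ω, ‖T r j ω‖ₑ ^ q ∂μ
        ≤ ∑ j ∈ Finset.range (2 ^ (R - r)), ENNReal.ofReal (B r) ^ q := by
          refine Finset.sum_le_sum fun j hj => ?_
          rw [← eLpNorm_ofReal_rpow hq0]
          exact ENNReal.rpow_le_rpow (hB r hr j (Finset.mem_range.1 hj)) hq0.le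
      _ = ENNReal.ofReal (((2 : ℝ) ^ (R - r)) ^ (1 / q) * B r) ^ q := by
          rw [Finset.sum_const, Finset.card_range, nsmul_eq_mul, ENNReal.ofReal_mul (by positivity),
            ENNReal.mul_rpow_of_nonneg _ _ hq0.le,
            ENNReal.ofReal_rpow_of_nonneg (p := q) (x := ((2 : ℝ) ^ (R - r)) ^ (1 / q))
              (by positivity) hq0.le, ← Real.rpow_mul (by positivity), one_div,
            inv_mul_cancel₀ hq0.ne', Real.rpow_one, ENNReal.ofReal_pow (by norm_num)]
          simp
  let W : Ω → ℝ := ∑ r ∈ Finset.range (R + 1), M r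
  have hWm : AEStronglyMeasurable W μ := Finset.aestronglyMeasurable_sum _ fun r _ => hMm r
  have hWnorm : eLpNorm W (ENNReal.ofReal q) μ ≤
      ENNReal.ofReal (∑ r ∈ Finset.range (R + 1), ((2 : ℝ) ^ (R - r)) ^ (1 / q) * B r) := by
    refine (eLpNorm_sum_le (fun r _ => hMm r) (by simpa using hq)).trans ?_
    rw [ENNReal.ofReal_sum_of_nonneg fun r _ => mul_nonneg (by positivity) (hB0 r)]
    exact Finset.sum_le_sum fun r hr => hMnorm r (by simpa [Nat.lt_succ_iff] using hr)
  have hsub : {ω | ∃ k ≤ 2 ^ R, y < ‖∑ i ∈ Finset.range k, f i ω‖} ⊆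
      {ω | ENNReal.ofReal y ≤ ‖W ω‖ₑ} := by
    rintro ω ⟨k, hk, hky⟩
    have h1 := norm_sum_range_le_of_dyadic (fun i => f i ω) R (fun r => M r ω) (fun r hr j hj => by
      have h2 : ‖T r j ω‖ ^ q ≤ ∑ j ∈ Finset.range (2 ^ (R - r)), ‖T r j ω‖ ^ q :=
        Finset.single_le_sum (f := fun j => ‖T r j ω‖ ^ q) (fun _ _ => by positivity)
          (Finset.mem_range.2 hj)
      have h3 := Real.rpow_le_rpow (by positivity) h2 (show 0 ≤ 1 / q by positivity)
      rwa [← Real.rpow_mul (by positivity), mul_one_div_cancel hq0.ne', Real.rpow_one] at h3) hk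
    have h2 : y ≤ W ω := by
      simp only [W, Finset.sum_apply]; linarith
    change ENNReal.ofReal y ≤ ‖W ω‖ₑ
    rw [Real.enorm_eq_ofReal (hy.le.trans h2)]
    exact ENNReal.ofReal_le_ofReal h2
  have hG : 0 ≤ ∑ r ∈ Finset.range (R + 1), ((2 : ℝ) ^ (R - r)) ^ (1 / q) * B r :=
    Finset.sum_nonneg fun r _ => mul_nonneg (by positivity) (hB0 r)
  refine (measure_mono hsub).trans ?_
  have h3 := meas_ge_le_mul_pow_eLpNorm_enorm μ hne ENNReal.ofReal_ne_top hWm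
    (ε := ENNReal.ofReal y) (by simpa using hy) (by simp)
  refine h3.trans ?_
  rw [ENNReal.toReal_ofReal hq0.le, ← ENNReal.mul_rpow_of_nonneg _ _ hq0.le,
    ← ENNReal.ofReal_rpow_of_nonneg (by positivity) hq0.le, div_eq_inv_mul,
    ENNReal.ofReal_mul (by positivity), ENNReal.ofReal_inv_of_pos hy]
  gcongr

/-- The constant of the dyadic maximal inequality for `q > 2`. -/
def chainConst (q c : ℝ) : ℝ := √(2 * c) / (1 - (1 / 2 : ℝ) ^ (1 / 2 - 1 / q))

theorem rpow_half_lt_one {q : ℝ} (hq : 2 < q) : (1 / 2 : ℝ) ^ (1 / 2 - 1 / q) < 1 := by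
  refine Real.rpow_lt_one (by norm_num) (by norm_num) ?_
  have : 1 / q < 1 / 2 := one_div_lt_one_div_of_lt (by norm_num) hq
  linarith

theorem chainConst_nonneg {q c : ℝ} (hq : 2 < q) : 0 ≤ chainConst q c := by
  have := rpow_half_lt_one hq
  exact div_nonneg (Real.sqrt_nonneg _) (by linarith)

/-- The terms are proportional to `ρ^(R-r)` with `ρ < 1` because `q > 2`. The sum is therefore of
the order of its top term, and the maximal inequality loses no logarithm. -/
theorem sum_dyadic_sqrt_le {q c A : ℝ} (hq : 2 < q) (hA : 0 ≤ A) (R : ℕ) :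
    ∑ r ∈ Finset.range (R + 1), ((2 : ℝ) ^ (R - r)) ^ (1 / q) * (√(2 * c * (2 : ℝ) ^ r) * A) ≤
      chainConst q c * √((2 : ℝ) ^ R) * A := by
  set ρ : ℝ := (1 / 2 : ℝ) ^ (1 / 2 - 1 / q) with hρ
  have hρ1 : ρ < 1 := rpow_half_lt_one hq
  have hρ0 : 0 ≤ ρ := by positivity
  have hterm : ∀ r ∈ Finset.range (R + 1),
      ((2 : ℝ) ^ (R - r)) ^ (1 / q) * (√(2 * c * (2 : ℝ) ^ r) * A) =
        (√(2 * c) * √((2 : ℝ) ^ R) * A) * ρ ^ (R - r) := by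
    intro r hr
    have hr' : r ≤ R := by simpa [Nat.lt_succ_iff] using hr
    have h1 : (2 : ℝ) ^ R = 2 ^ (R - r) * 2 ^ r := by rw [← pow_add]; congr 1; omega
    have h2 : √((2 : ℝ) ^ (R - r)) * ρ ^ (R - r) = ((2 : ℝ) ^ (R - r)) ^ (1 / q) := by
      rw [hρ, Real.sqrt_eq_rpow, ← Real.rpow_natCast (_ ^ _) (R - r),
        ← Real.rpow_natCast 2 (R - r), ← Real.rpow_mul (by norm_num), ← Real.rpow_mul (by norm_num),
        ← Real.rpow_mul (by norm_num), one_div (2 : ℝ), Real.inv_rpow (by norm_num),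
        ← Real.rpow_neg (by norm_num), ← Real.rpow_add (by norm_num)]
      congr 1; ring
    rw [h1, Real.sqrt_mul' _ (by positivity), Real.sqrt_mul' ((2 : ℝ) ^ (R - r)) (by positivity),
      ← h2]
    ring
  rw [Finset.sum_congr rfl hterm, ← Finset.mul_sum]
  have hgeo : ∑ r ∈ Finset.range (R + 1), ρ ^ (R - r) ≤ 1 / (1 - ρ) := by
    rw [← Finset.sum_range_reflect]
    have : ∀ j ∈ Finset.range (R + 1), ρ ^ (R - (R + 1 - 1 - j)) = ρ ^ j := fun j hj => by
      congr 1; have := Finset.mem_range.1 hj; omega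
    rw [Finset.sum_congr rfl this, one_div, ← tsum_geometric_of_lt_one hρ0 hρ1]
    exact (summable_geometric_of_lt_one hρ0 hρ1).sum_le_tsum _ fun _ _ => by positivity
  calc _ ≤ (√(2 * c) * √((2 : ℝ) ^ R) * A) * (1 / (1 - ρ)) := by gcongr
    _ = _ := by unfold chainConst; ring

end Chaining

/-! ### Arrays of projections on lagged innovations -/

section LagArray

variable {E V : Type*} [MeasurableSpace E] [NormedAddCommGroup V] [NormedSpace ℝ V]
variable (ρ : Measure E) [IsProbabilityMeasure ρ]

/-- Random vectors `D i m` which are functions of the innovations `i - m, …, i` and whose average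
over the innovation `i - m` is zero. -/
structure LagArray (D : ℤ → ℕ → (ℤ → E) → V) : Prop where
  meas : ∀ i m, StronglyMeasurable (D i m)
  dep : ∀ (i : ℤ) (m : ℕ), DependsOn (D i m) (Set.Icc (i - m) i)
  avg_zero : ∀ (i : ℤ) (m : ℕ), avg ρ (Set.Ioi (i - m)) (D i m) =ᵐ[iid ℤ ρ] 0

theorem dependsOn_finset_sum {ι κ : Type*} {s : Set ι} (I : Finset κ) {f : κ → (ι → E) → V}
    (h : ∀ i ∈ I, DependsOn (f i) s) : DependsOn (fun x => ∑ i ∈ I, f i x) s := by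
  intro x y hxy
  exact Finset.sum_congr rfl fun i hi => h i hi hxy

variable {ρ}

/-- Averaging `S - D` over the coordinates off `s` returns `S`, and averaging is a contraction of
`L^r`. -/
theorem eLpNorm_le_eLpNorm_sub {s : Set ℤ} {S D : (ℤ → E) → V} {r : ℝ} (hr : 1 ≤ r)
    (hS : StronglyMeasurable S) (hD : StronglyMeasurable D) (hSs : DependsOn S s)
    (hDi : Integrable D (iid ℤ ρ)) (hD0 : avg ρ s D =ᵐ[iid ℤ ρ] 0) [CompleteSpace V] :
    eLpNorm S (ENNReal.ofReal r) (iid ℤ ρ) ≤ eLpNorm (S - D) (ENNReal.ofReal r) (iid ℤ ρ) := by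
  refine le_trans (le_of_eq ?_) (eLpNorm_avg_le ρ (s := s) (hS.sub hD) hr)
  refine eLpNorm_congr_ae ?_
  filter_upwards [hD0, (integrable_mix ρ (s := s) hDi).prod_right_ae] with x hx hx'
  have h1 : avg ρ s (S - D) x = ∫ y, (S x - D (mix s x y)) ∂(iid ℤ ρ) := by
    unfold avg
    congr 1 with y
    rw [Pi.sub_apply, mix_eq_self hSs]
  rw [h1, integral_sub (integrable_const _) hx']
  unfold avg at hx
  simp [hx]

variable {D : ℤ → ℕ → (ℤ → E) → V}

/-- For a fixed lag the sum is built up from the largest index downwards: the terms with index above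
`i` depend only on innovations after `i - m`, and `D i m` averages to zero given those. This is the
orthogonality required by `eLpNorm_sum_range_le`. -/
theorem LagArray.eLpNorm_sum_le [CompleteSpace V] (hD : LagArray ρ D) {r c : ℝ}
    (hV : IsTwoSmooth V r c) (hr : 2 ≤ r) (hc : 0 ≤ c) {m : ℕ} {α : ℝ} (hα : 0 ≤ α)
    (hb : ∀ i, eLpNorm (D i m) (ENNReal.ofReal r) (iid ℤ ρ) ≤ ENNReal.ofReal α) (a : ℤ) (n : ℕ) :
    eLpNorm (fun x => ∑ i ∈ Finset.range n, D (a + i) m x) (ENNReal.ofReal r) (iid ℤ ρ) ≤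
      ENNReal.ofReal (√(2 * c * n) * α) := by
  have hr1 : 1 ≤ ENNReal.ofReal r := by
    rw [← ENNReal.ofReal_one]; exact ENNReal.ofReal_le_ofReal (by linarith)
  have hint : ∀ i, Integrable (D i m) (iid ℤ ρ) := fun i =>
    MemLp.integrable hr1 ⟨(hD.meas i m).aestronglyMeasurable, (hb i).trans_lt ENNReal.ofReal_lt_top⟩
  have h1 := eLpNorm_sum_range_le (μ := iid ℤ ρ) hV hr hc (D := fun k : ℕ => D (a + n - 1 - k) m) hα
    (n := n) (fun i _ => (hD.meas _ m).aestronglyMeasurable) (fun i _ => hb _) (fun k hk => by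
      refine eLpNorm_le_eLpNorm_sub (s := Set.Ioi (a + n - 1 - k - m)) (by linarith)
        (Finset.stronglyMeasurable_sum _ fun i _ => hD.meas _ m) (hD.meas _ m) ?_ (hint _)
        (hD.avg_zero _ m)
      have := dependsOn_finset_sum (E := E) (V := V) (s := Set.Ioi (a + n - 1 - k - m))
        (Finset.range k) (f := fun i : ℕ => D (a + n - 1 - i) m) fun i hi =>
        (hD.dep _ m).mono fun u hu => by
          have := Finset.mem_range.1 hi
          simp only [Set.mem_Icc, Set.mem_Ioi] at hu ⊢
          omega
      convert this using 1
      ext x; simp)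
  convert h1 using 2
  ext x
  rw [Finset.sum_apply, ← Finset.sum_range_reflect]
  refine Finset.sum_congr rfl fun i hi => ?_
  have := Finset.mem_range.1 hi
  rw [show a + n - 1 - ((i : ℕ) : ℤ) = a + ((n - 1 - i : ℕ) : ℤ) by omega]

theorem LagArray.eLpNorm_sum_sum_le [CompleteSpace V] (hD : LagArray ρ D) {r c : ℝ}
    (hV : IsTwoSmooth V r c) (hr : 2 ≤ r) (hc : 0 ≤ c) {α : ℕ → ℝ} (hα : ∀ m, 0 ≤ α m)
    (hb : ∀ i m, eLpNorm (D i m) (ENNReal.ofReal r) (iid ℤ ρ) ≤ ENNReal.ofReal (α m))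
    (I : Finset ℕ) (a : ℤ) (n : ℕ) :
    eLpNorm (fun x => ∑ i ∈ Finset.range n, ∑ m ∈ I, D (a + i) m x) (ENNReal.ofReal r)
      (iid ℤ ρ) ≤ ENNReal.ofReal (√(2 * c * n) * ∑ m ∈ I, α m) := by
  have hr1 : 1 ≤ ENNReal.ofReal r := by
    rw [← ENNReal.ofReal_one]; exact ENNReal.ofReal_le_ofReal (by linarith)
  have h1 : (fun x => ∑ i ∈ Finset.range n, ∑ m ∈ I, D (a + i) m x) =
      ∑ m ∈ I, fun x => ∑ i ∈ Finset.range n, D (a + i) m x := by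
    ext x; rw [Finset.sum_apply, Finset.sum_comm]
  rw [h1, Finset.mul_sum, ENNReal.ofReal_sum_of_nonneg fun m _ => mul_nonneg (by positivity) (hα m)]
  refine (MeasureTheory.eLpNorm_sum_le (fun m _ => ?_) hr1).trans
    (Finset.sum_le_sum fun m _ => hD.eLpNorm_sum_le hV hr hc (hα m) (fun i => hb i m) a n)
  exact Finset.aestronglyMeasurable_fun_sum _ fun i _ => (hD.meas _ m).aestronglyMeasurable

theorem LagArray.measure_max_le [CompleteSpace V] (hD : LagArray ρ D) {q c : ℝ}
    (hV : IsTwoSmooth V q c) (hq : 2 < q) (hc : 0 ≤ c) {α : ℕ → ℝ} (hα : ∀ m, 0 ≤ α m)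
    (hb : ∀ i m, eLpNorm (D i m) (ENNReal.ofReal q) (iid ℤ ρ) ≤ ENNReal.ofReal (α m))
    (I : Finset ℕ) (a : ℤ) (R : ℕ) {y : ℝ} (hy : 0 < y) :
    iid ℤ ρ {x | ∃ k ≤ 2 ^ R, y < ‖∑ i ∈ Finset.range k, ∑ m ∈ I, D (a + i) m x‖} ≤
      ENNReal.ofReal ((chainConst q c * √((2 : ℝ) ^ R) * (∑ m ∈ I, α m) / y) ^ q) := by
  have hα' : 0 ≤ ∑ m ∈ I, α m := Finset.sum_nonneg fun m _ => hα m
  refine (measure_max_partial_sum_le (μ := iid ℤ ρ) (by linarith : 1 ≤ q)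
    (fun i x => ∑ m ∈ I, D (a + i) m x)
    (fun i => Finset.aestronglyMeasurable_fun_sum _ fun m _ => (hD.meas _ m).aestronglyMeasurable) R
    (fun r => √(2 * c * (2 : ℝ) ^ r) * ∑ m ∈ I, α m) (fun r => by positivity) (fun r _ j _ => ?_)
    hy).trans ?_
  · have := hD.eLpNorm_sum_sum_le hV hq.le hc hα hb I (a + (j * 2 ^ r : ℕ)) (2 ^ r)
    push_cast at this ⊢
    simpa only [add_assoc] using this
  · refine ENNReal.ofReal_le_ofReal (Real.rpow_le_rpow ?_ ?_ (by linarith))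
    · have : 0 ≤ ∑ r ∈ Finset.range (R + 1), ((2 : ℝ) ^ (R - r)) ^ (1 / q) *
          (√(2 * c * (2 : ℝ) ^ r) * ∑ m ∈ I, α m) := Finset.sum_nonneg fun r _ => by positivity
      positivity
    · gcongr
      exact sum_dyadic_sqrt_le hq hα' R

/-- At exponent `2` all dyadic levels contribute equally, whence the factor `(R + 1)²` instead of a
geometric sum. -/
theorem LagArray.measure_max_le_two [CompleteSpace V] (hD : LagArray ρ D) {c : ℝ}
    (hV : IsTwoSmooth V 2 c) (hc : 0 ≤ c) {α : ℕ → ℝ} (hα : ∀ m, 0 ≤ α m)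
    (hb : ∀ i m, eLpNorm (D i m) 2 (iid ℤ ρ) ≤ ENNReal.ofReal (α m))
    (I : Finset ℕ) (a : ℤ) (R : ℕ) {y : ℝ} (hy : 0 < y) :
    iid ℤ ρ {x | ∃ k ≤ 2 ^ R, y < ‖∑ i ∈ Finset.range k, ∑ m ∈ I, D (a + i) m x‖} ≤
      ENNReal.ofReal (2 * c * (R + 1) ^ 2 * 2 ^ R * (∑ m ∈ I, α m) ^ 2 / y ^ 2) := by
  have hα' : 0 ≤ ∑ m ∈ I, α m := Finset.sum_nonneg fun m _ => hα m
  have hb' : ∀ i m, eLpNorm (D i m) (ENNReal.ofReal 2) (iid ℤ ρ) ≤ ENNReal.ofReal (α m) := by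
    simpa using hb
  refine (measure_max_partial_sum_le (μ := iid ℤ ρ) (by norm_num : (1 : ℝ) ≤ 2)
    (fun i x => ∑ m ∈ I, D (a + i) m x)
    (fun i => Finset.aestronglyMeasurable_fun_sum _ fun m _ => (hD.meas _ m).aestronglyMeasurable) R
    (fun r => √(2 * c * (2 : ℝ) ^ r) * ∑ m ∈ I, α m) (fun r => by positivity) (fun r _ j _ => ?_)
    hy).trans ?_
  · have := hD.eLpNorm_sum_sum_le hV le_rfl hc hα hb' I (a + (j * 2 ^ r : ℕ)) (2 ^ r)
    push_cast at this ⊢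
    simpa only [add_assoc] using this
  · refine ENNReal.ofReal_le_ofReal (le_of_eq ?_)
    have hterm : ∀ r ∈ Finset.range (R + 1), ((2 : ℝ) ^ (R - r)) ^ (1 / 2 : ℝ) *
        (√(2 * c * (2 : ℝ) ^ r) * ∑ m ∈ I, α m) = √(2 * c * 2 ^ R) * ∑ m ∈ I, α m := fun r hr => by
      have hr' : r ≤ R := by simpa [Nat.lt_succ_iff] using hr
      rw [← Real.sqrt_eq_rpow, ← mul_assoc, ← Real.sqrt_mul (by positivity)]
      congr 2
      rw [show (2 : ℝ) ^ R = 2 ^ (R - r) * 2 ^ r by rw [← pow_add]; congr 1; omega]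
      ring
    rw [Finset.sum_congr rfl hterm, Finset.sum_const, Finset.card_range, nsmul_eq_mul,
      Real.rpow_two, div_pow, mul_pow, mul_pow, Real.sq_sqrt (by positivity)]
    push_cast
    ring

end LagArray

/-! ### A maximal Bernstein inequality -/

section Bernstein

variable {Ω : Type*} {mΩ : MeasurableSpace Ω} {μ : Measure Ω} [IsProbabilityMeasure μ]

/-- Taking means in `e^x ≤ 1 + x + x²`, valid for `|x| ≤ 1`. -/
theorem integral_exp_le {Z : Ω → ℝ} (hZm : AEStronglyMeasurable Z μ) {y v s : ℝ}
    (hy : ∀ ω, |Z ω| ≤ y) (hZ0 : ∫ ω, Z ω ∂μ = 0) (hv : ∫ ω, Z ω ^ 2 ∂μ ≤ v) (hs : 0 ≤ s)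
    (hsy : s * y ≤ 1) : ∫ ω, Real.exp (s * Z ω) ∂μ ≤ Real.exp (s ^ 2 * v) := by
  have hZi : Integrable Z μ := Integrable.of_bound hZm y (ae_of_all _ hy)
  have hZ2 : Integrable (fun ω => Z ω ^ 2) μ :=
    Integrable.of_bound (hZm.pow 2) (y ^ 2) (ae_of_all _ fun ω => by
      rw [Real.norm_eq_abs, abs_pow]; gcongr; exact hy ω)
  have hpt : ∀ ω, Real.exp (s * Z ω) ≤ 1 + s * Z ω + s ^ 2 * Z ω ^ 2 := fun ω => by
    have h1 : |s * Z ω| ≤ 1 := by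
      rw [abs_mul, abs_of_nonneg hs]
      exact (mul_le_mul_of_nonneg_left (hy ω) hs).trans hsy
    have h2 := (abs_le.1 (Real.abs_exp_sub_one_sub_id_le h1)).2
    nlinarith
  have hexp : Integrable (fun ω => Real.exp (s * Z ω)) μ := by
    refine Integrable.of_bound (Real.continuous_exp.comp_aestronglyMeasurable (hZm.const_mul s))
      (Real.exp 1) (ae_of_all _ fun ω => ?_)
    rw [Real.norm_eq_abs, Real.abs_exp]
    refine Real.exp_le_exp.2 ?_
    exact (mul_le_mul_of_nonneg_left ((le_abs_self _).trans (hy ω)) hs).trans hsy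
  have hlin : Integrable (fun ω => 1 + s * Z ω) μ := (integrable_const _).add (hZi.const_mul s)
  calc ∫ ω, Real.exp (s * Z ω) ∂μ ≤ ∫ ω, (1 + s * Z ω + s ^ 2 * Z ω ^ 2) ∂μ :=
        integral_mono hexp (hlin.add (hZ2.const_mul _)) hpt
    _ = 1 + s ^ 2 * ∫ ω, Z ω ^ 2 ∂μ := by
        rw [integral_add hlin (hZ2.const_mul _), integral_add (integrable_const _) (hZi.const_mul s), integral_const_mul,
          integral_const_mul, hZ0]
        simp
    _ ≤ 1 + s ^ 2 * v := by gcongr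
    _ ≤ Real.exp (s ^ 2 * v) := by linarith [Real.add_one_le_exp (s ^ 2 * v)]

/-- Doob's maximal inequality for the exponentials of the partial sums. They form a submartingale
because each factor is independent of the past and has mean at least one, the increments being
centred. -/
theorem measure_max_sum_ge_le_exp (ℱ : Filtration ℕ mΩ) {Z : ℕ → Ω → ℝ} {y v s : ℝ}
    (hZm : ∀ k, StronglyMeasurable[ℱ (k + 1)] (Z k))
    (hind : ∀ k, Indep (MeasurableSpace.comap (Z k) inferInstance) (ℱ k) μ)
    (hy : ∀ k ω, |Z k ω| ≤ y) (hZ0 : ∀ k, ∫ ω, Z k ω ∂μ = 0) (hv : ∀ k, ∫ ω, Z k ω ^ 2 ∂μ ≤ v)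
    (hs : 0 ≤ s) (hsy : s * y ≤ 1) (n : ℕ) (x : ℝ) :
    μ {ω | ∃ k ≤ n, x ≤ ∑ i ∈ Finset.range k, Z i ω} ≤
      ENNReal.ofReal (Real.exp (-(s * x) + s ^ 2 * (n * v))) := by
  have hZm' : ∀ k, StronglyMeasurable (Z k) := fun k => (hZm k).mono (ℱ.le _)
  let f : ℕ → Ω → ℝ := fun k ω => Real.exp (s * ∑ i ∈ Finset.range k, Z i ω)
  have hSm : ∀ k, StronglyMeasurable[ℱ k] fun ω => ∑ i ∈ Finset.range k, Z i ω := fun k =>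
    Finset.stronglyMeasurable_fun_sum _ fun i hi => (hZm i).mono (ℱ.mono (Finset.mem_range.1 hi))
  have hfm : ∀ k, StronglyMeasurable[ℱ k] (f k) := fun k =>
    Real.continuous_exp.comp_stronglyMeasurable ((hSm k).const_mul s)
  have hfi : ∀ k, Integrable (f k) μ := fun k => by
    refine Integrable.of_bound ((hfm k).mono (ℱ.le _)).aestronglyMeasurable
      (Real.exp (s * ∑ i ∈ Finset.range k, y)) (ae_of_all _ fun ω => ?_)
    rw [Real.norm_eq_abs, Real.abs_exp]
    refine Real.exp_le_exp.2 (mul_le_mul_of_nonneg_left ?_ hs)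
    exact Finset.sum_le_sum fun i _ => (le_abs_self _).trans (hy i ω)
  have hgm : ∀ k, StronglyMeasurable[MeasurableSpace.comap (Z k) inferInstance]
      fun ω => Real.exp (s * Z k ω) := fun k => by
    have : Measurable[MeasurableSpace.comap (Z k) inferInstance] (Z k) := comap_measurable _
    exact (Real.measurable_exp.comp (this.const_mul s)).stronglyMeasurable
  have hgi : ∀ k, Integrable (fun ω => Real.exp (s * Z k ω)) μ := fun k => by
    refine Integrable.of_bound (Real.continuous_exp.comp_aestronglyMeasurable
      ((hZm' k).aestronglyMeasurable.const_mul s)) (Real.exp 1) (ae_of_all _ fun ω => ?_)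
    rw [Real.norm_eq_abs, Real.abs_exp]
    refine Real.exp_le_exp.2 ?_
    exact (mul_le_mul_of_nonneg_left ((le_abs_self _).trans (hy k ω)) hs).trans hsy
  have hstep : ∀ k, f (k + 1) = f k * fun ω => Real.exp (s * Z k ω) := fun k => by
    ext ω
    simp only [f, Pi.mul_apply]
    rw [Finset.sum_range_succ, mul_add, Real.exp_add]
  have hcond : ∀ k, μ[f (k + 1) | ℱ k] =ᵐ[μ]
      fun ω => f k ω * ∫ ω', Real.exp (s * Z k ω') ∂μ := fun k => by
    have h1 := condExp_mul_of_stronglyMeasurable_left (μ := μ) (hfm k)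
      (by rw [← hstep]; exact hfi _) (hgi k)
    have h2 := condExp_indep_eq (μ := μ) (hZm' k).measurable.comap_le (ℱ.le k) (hgm k) (hind k)
    rw [hstep]
    filter_upwards [h1, h2] with ω hω1 hω2
    rw [hω1, Pi.mul_apply, hω2]
  have hone : ∀ k, 1 ≤ ∫ ω, Real.exp (s * Z k ω) ∂μ := fun k => by
    have hZi : Integrable (Z k) μ :=
      Integrable.of_bound (hZm' k).aestronglyMeasurable y (ae_of_all _ (hy k))
    calc (1 : ℝ) = ∫ ω, (1 + s * Z k ω) ∂μ := by
          rw [integral_add (integrable_const _) (hZi.const_mul s), integral_const_mul, hZ0]; simp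
      _ ≤ _ := integral_mono ((integrable_const _).add (hZi.const_mul s)) (hgi k) fun ω => by
          have := Real.add_one_le_exp (s * Z k ω)
          simp only; linarith
  have hsub : Submartingale f ℱ μ := by
    refine submartingale_nat hfm hfi fun k => ?_
    filter_upwards [hcond k] with ω hω
    rw [hω]
    exact le_mul_of_one_le_right (Real.exp_pos _).le (hone k)
  have hmean : ∀ k : ℕ, ∫ ω, f k ω ∂μ ≤ Real.exp (s ^ 2 * (k * v)) := fun k => by
    induction k with
    | zero => simp [f]
    | succ k ih =>
      rw [← integral_condExp (ℱ.le k) (μ := μ) (f := f (k + 1)), integral_congr_ae (hcond k),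
        integral_mul_const]
      have h1 := integral_exp_le (hZm' k).aestronglyMeasurable (hy k) (hZ0 k) (hv k) hs hsy
      calc (∫ ω, f k ω ∂μ) * ∫ ω, Real.exp (s * Z k ω) ∂μ
          ≤ Real.exp (s ^ 2 * (k * v)) * Real.exp (s ^ 2 * v) :=
            mul_le_mul ih h1 (by linarith [hone k]) (Real.exp_pos _).le
        _ = _ := by rw [← Real.exp_add]; congr 1; push_cast; ring
  have hmax := maximal_ineq (μ := μ) hsub (fun k ω => (Real.exp_pos _).le)
    (ε := (Real.exp (s * x)).toNNReal) n
  have hset : {ω | ∃ k ≤ n, x ≤ ∑ i ∈ Finset.range k, Z i ω} ⊆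
      {ω | (((Real.exp (s * x)).toNNReal : ℝ≥0) : ℝ) ≤
        (Finset.range (n + 1)).sup' Finset.nonempty_range_add_one fun k => f k ω} := by
    rintro ω ⟨k, hk, hx⟩
    simp only [Set.mem_ofPred_eq, Real.coe_toNNReal _ (Real.exp_pos _).le]
    refine le_trans ?_ (Finset.le_sup' (fun k => f k ω) (b := k) (by simpa [Nat.lt_succ_iff]))
    exact Real.exp_le_exp.2 (mul_le_mul_of_nonneg_left hx hs)
  have hmean' : (∫ ω in {ω | (((Real.exp (s * x)).toNNReal : ℝ≥0) : ℝ) ≤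
      (Finset.range (n + 1)).sup' Finset.nonempty_range_add_one fun k => f k ω}, f n ω ∂μ) ≤
        Real.exp (s ^ 2 * (n * v)) :=
    (setIntegral_le_integral (hfi n) (ae_of_all _ fun ω => (Real.exp_pos _).le)).trans (hmean n)
  have h3 : ENNReal.ofReal (Real.exp (s * x)) *
      μ {ω | ∃ k ≤ n, x ≤ ∑ i ∈ Finset.range k, Z i ω} ≤
        ENNReal.ofReal (Real.exp (s ^ 2 * (n * v))) := by
    refine le_trans ?_ (hmax.trans (ENNReal.ofReal_le_ofReal hmean'))
    exact mul_le_mul_right (measure_mono hset) _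
  rw [Real.exp_add, Real.exp_neg, ENNReal.ofReal_mul (by positivity),
    ENNReal.ofReal_inv_of_pos (Real.exp_pos _)]
  calc _ = (ENNReal.ofReal (Real.exp (s * x)))⁻¹ * (ENNReal.ofReal (Real.exp (s * x)) *
        μ {ω | ∃ k ≤ n, x ≤ ∑ i ∈ Finset.range k, Z i ω}) := by
        rw [← mul_assoc, ENNReal.inv_mul_cancel (by simpa using Real.exp_pos _) (by simp), one_mul]
    _ ≤ _ := by gcongr

/-- The exponential parameter `√(Λ/(nv))` is optimal in the Gaussian range; beyond it `s` is capped
at `1/y`, the largest value admitted by `integral_exp_le`. -/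
theorem measure_max_sum_ge_le (ℱ : Filtration ℕ mΩ) {Z : ℕ → Ω → ℝ} {y v Λ : ℝ}
    (hZm : ∀ k, StronglyMeasurable[ℱ (k + 1)] (Z k))
    (hind : ∀ k, Indep (MeasurableSpace.comap (Z k) inferInstance) (ℱ k) μ)
    (hy0 : 0 < y)
    (hy : ∀ k ω, |Z k ω| ≤ y) (hZ0 : ∀ k, ∫ ω, Z k ω ∂μ = 0) (hv : ∀ k, ∫ ω, Z k ω ^ 2 ∂μ ≤ v)
    (hΛ : 0 ≤ Λ) (n : ℕ) :
    μ {ω | ∃ k ≤ n, 2 * √(n * v * Λ) + 2 * y * Λ ≤ ∑ i ∈ Finset.range k, Z i ω} ≤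
      ENNReal.ofReal (Real.exp (-Λ)) := by
  have hv0 : 0 ≤ v := (integral_nonneg fun ω => sq_nonneg _).trans (hv 0)
  rcases le_or_gt (y ^ 2 * Λ) (n * v) with h | h
  · rcases eq_or_lt_of_le (show 0 ≤ (n : ℝ) * v by positivity) with h0 | h0
    · have : Λ = 0 := by
        rw [← h0] at h
        nlinarith [mul_nonneg (sq_nonneg y) hΛ, pow_pos hy0 2]
      rw [this]
      simp [prob_le_one]
    · have hs : 0 ≤ √(Λ / (n * v)) := Real.sqrt_nonneg _
      refine (measure_max_sum_ge_le_exp ℱ hZm hind hy hZ0 hv hs ?_ n _).trans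
        (ENNReal.ofReal_le_ofReal (Real.exp_le_exp.2 ?_))
      · rw [← abs_of_pos hy0, ← Real.sqrt_sq_eq_abs, ← Real.sqrt_mul (by positivity),
          Real.sqrt_le_left (by norm_num), one_pow, div_mul_eq_mul_div, div_le_one h0]
        linarith
      · have h1 : √(Λ / (n * v)) * √(n * v * Λ) = Λ := by
          rw [← Real.sqrt_mul (by positivity),
            show Λ / (n * v) * (n * v * Λ) = Λ ^ 2 by rw [← mul_assoc, div_mul_cancel₀ _ h0.ne', sq], Real.sqrt_sq hΛ]
        have h2 : √(Λ / (n * v)) ^ 2 * (n * v) = Λ := by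
          rw [Real.sq_sqrt (by positivity), div_mul_cancel₀ _ h0.ne']
        have h3 : 0 ≤ √(Λ / (n * v)) * (2 * y * Λ) := by positivity
        rw [h2]
        nlinarith
  · refine (measure_max_sum_ge_le_exp ℱ hZm hind hy hZ0 hv (s := 1 / y) (by positivity) ?_ n
      _).trans (ENNReal.ofReal_le_ofReal (Real.exp_le_exp.2 ?_))
    · rw [one_div, inv_mul_cancel₀ hy0.ne']
    · have h1 : 1 / y * (2 * y * Λ) = 2 * Λ := by field_simp
      have h2 : (1 / y) ^ 2 * (n * v) ≤ Λ := by
        rw [div_pow, one_pow, one_div, inv_mul_le_iff₀ (by positivity)]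
        exact h.le
      have h3 : 0 ≤ 1 / y * (2 * √(n * v * Λ)) := by positivity
      nlinarith

theorem measure_max_abs_sum_ge_le (ℱ : Filtration ℕ mΩ) {Z : ℕ → Ω → ℝ} {y v Λ : ℝ}
    (hZm : ∀ k, StronglyMeasurable[ℱ (k + 1)] (Z k))
    (hind : ∀ k, Indep (MeasurableSpace.comap (Z k) inferInstance) (ℱ k) μ)
    (hy0 : 0 < y)
    (hy : ∀ k ω, |Z k ω| ≤ y) (hZ0 : ∀ k, ∫ ω, Z k ω ∂μ = 0) (hv : ∀ k, ∫ ω, Z k ω ^ 2 ∂μ ≤ v)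
    (hΛ : 0 ≤ Λ) (n : ℕ) :
    μ {ω | ∃ k ≤ n, 2 * √(n * v * Λ) + 2 * y * Λ ≤ |∑ i ∈ Finset.range k, Z i ω|} ≤
      2 * ENNReal.ofReal (Real.exp (-Λ)) := by
  have h1 := measure_max_sum_ge_le ℱ hZm hind hy0 hy hZ0 hv hΛ n
  have h2 := measure_max_sum_ge_le ℱ (Z := fun k ω => -Z k ω) (fun k => (hZm k).neg)
    (fun k => indep_of_indep_of_le_left (hind k) (by
      rw [← measurable_iff_comap_le]
      exact Measurable.neg (comap_measurable (Z k)))) hy0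
    (fun k ω => by rw [abs_neg]; exact hy k ω) (fun k => by rw [integral_neg, hZ0, neg_zero])
    (fun k => by simpa using hv k) hΛ n
  refine le_trans (measure_mono ?_) ((measure_union_le _ _).trans ((add_le_add h1 h2).trans_eq
    (two_mul _).symm))
  rintro ω ⟨k, hk, h⟩
  rcases le_abs'.1 h with h | h
  · right
    refine ⟨k, hk, ?_⟩
    rw [Finset.sum_neg_distrib]; linarith
  · left; exact ⟨k, hk, h⟩

/-- A Fuk–Nagaev type maximal inequality: truncation at level `y` and Bernstein's inequality. -/
theorem measure_max_abs_sum_gt_le {κ : Type*} [Fintype κ] (ℱ : Filtration ℕ mΩ)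
    {Z : ℕ → κ → Ω → ℝ} {G : ℕ → Ω → ℝ} {q g y v Λ : ℝ} (hq : 1 ≤ q) (hg : 0 ≤ g)
    (hZm : ∀ k j, StronglyMeasurable[ℱ (k + 1)] (Z k j))
    (hind : ∀ k j, Indep (MeasurableSpace.comap (Z k j) inferInstance) (ℱ k) μ)
    (hG : ∀ k j ω, |Z k j ω| ≤ G k ω) (hGm : ∀ k, AEStronglyMeasurable (G k) μ)
    (hGq : ∀ k, eLpNorm (G k) (ENNReal.ofReal q) μ ≤ ENNReal.ofReal g)
    (hZ0 : ∀ k j, ∫ ω, Z k j ω ∂μ = 0) (hvi : ∀ k j, Integrable (fun ω => Z k j ω ^ 2) μ)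
    (hv : ∀ k j, ∫ ω, Z k j ω ^ 2 ∂μ ≤ v) (hy : 0 < y) (hΛ : 0 ≤ Λ) (n : ℕ) :
    μ {ω | ∃ k ≤ n, ∃ j, y + (2 * √(n * v * Λ) + 4 * y * Λ) < |∑ i ∈ Finset.range k, Z i j ω|} ≤
      ENNReal.ofReal (n * (g / y) ^ q + 2 * Fintype.card κ * Real.exp (-Λ)) := by
  have hq0 : 0 < q := by linarith
  have hne : ENNReal.ofReal q ≠ 0 := by simpa using hq0
  have hZm' : ∀ k j, StronglyMeasurable (Z k j) := fun k j => (hZm k j).mono (ℱ.le _)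
  -- If this quantity is at least one, the asserted bound exceeds one. Otherwise the total drift
  -- created by truncation is at most `y`, which is the first summand of the threshold.
  rcases le_or_gt 1 ((n : ℝ) * (g / y) ^ q) with hbig | hsmall
  · refine prob_le_one.trans ?_
    rw [← ENNReal.ofReal_one]
    refine ENNReal.ofReal_le_ofReal ?_
    have : 0 ≤ 2 * (Fintype.card κ : ℝ) * Real.exp (-Λ) := by positivity
    linarith
  have hGmem : ∀ k, MemLp (G k) (ENNReal.ofReal q) μ := fun k =>
    ⟨hGm k, (hGq k).trans_lt ENNReal.ofReal_lt_top⟩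
  have hGint : ∀ k, ∫ ω, |G k ω| ^ q ∂μ ≤ g ^ q := fun k => by
    have h1 : ENNReal.ofReal (∫ ω, |G k ω| ^ q ∂μ) ≤ ENNReal.ofReal (g ^ q) := by
      rw [← ENNReal.ofReal_rpow_of_nonneg hg hq0.le]
      refine le_trans (le_of_eq ?_) (ENNReal.rpow_le_rpow (hGq k) hq0.le)
      rw [eLpNorm_ofReal_rpow hq0, ofReal_integral_eq_lintegral_ofReal]
      · congr 1 with ω
        rw [← ENNReal.ofReal_rpow_of_nonneg (abs_nonneg _) hq0.le, ← Real.norm_eq_abs, ofReal_norm]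
      · have := (hGmem k).integrable_norm_rpow hne ENNReal.ofReal_ne_top
        simpa [ENNReal.toReal_ofReal hq0.le] using this
      · exact ae_of_all _ fun ω => by positivity
    exact (ENNReal.ofReal_le_ofReal_iff (by positivity)).1 h1
  have hGi : ∀ k, Integrable (fun ω => |G k ω| ^ q) μ := fun k => by
    have := (hGmem k).integrable_norm_rpow hne ENNReal.ofReal_ne_top
    simpa [ENNReal.toReal_ofReal hq0.le] using this
  let t : ℝ → ℝ := fun u => if |u| ≤ y then u else 0
  have htm : Measurable t := Measurable.ite (measurableSet_le measurable_id.abs measurable_const)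
    measurable_id measurable_const
  have hty : ∀ u, |t u| ≤ y := fun u => by
    by_cases h : |u| ≤ y
    · simp [t, h]
    · simp [t, h, hy.le]
  have htu : ∀ u, t u ^ 2 ≤ u ^ 2 := fun u => by
    by_cases h : |u| ≤ y
    · simp [t, h]
    · simp [t, h]; positivity
  have hti : ∀ k j, Integrable (fun ω => t (Z k j ω)) μ := fun k j =>
    Integrable.of_bound (htm.comp (hZm' k j).measurable).aestronglyMeasurable y
      (ae_of_all _ fun ω => hty _)
  have ht2i : ∀ k j, Integrable (fun ω => t (Z k j ω) ^ 2) μ := fun k j =>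
    Integrable.of_bound ((htm.comp (hZm' k j).measurable).pow_const 2).aestronglyMeasurable (y ^ 2)
      (ae_of_all _ fun ω => by
        rw [Real.norm_eq_abs, abs_pow]; have := hty (Z k j ω); gcongr)
  have hZi : ∀ k j, Integrable (Z k j) μ := fun k j =>
    ((memLp_two_iff_integrable_sq (hZm' k j).aestronglyMeasurable).2 (hvi k j)).integrable
      (by norm_num)
  let e : ℕ → κ → ℝ := fun k j => ∫ ω, t (Z k j ω) ∂μ
  -- `Z` being centred, the truncated mean is minus the mean of the removed part, and where `|Z| >
  -- y` one has `|Z| ≤ y (|G|/y)^q`.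
  have he : ∀ k j, |e k j| ≤ y * (g / y) ^ q := fun k j => by
    have h1 : e k j = -∫ ω, (Z k j ω - t (Z k j ω)) ∂μ := by
      rw [integral_sub (hZi k j) (hti k j), hZ0]; simp [e]
    have hpt : ∀ ω, |Z k j ω - t (Z k j ω)| ≤ y * y⁻¹ ^ q * |G k ω| ^ q := fun ω => by
      by_cases h : |Z k j ω| ≤ y
      · simp only [t, h, if_true, sub_self, abs_zero]; positivity
      · simp only [t, h, if_false, sub_zero]
        have h2 : |Z k j ω| ≤ |G k ω| := (hG k j ω).trans (le_abs_self _)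
        have h3 : y ≤ |G k ω| := (not_le.1 h).le.trans h2
        refine h2.trans ?_
        rw [mul_assoc, ← Real.mul_rpow (by positivity) (abs_nonneg _)]
        have h4 : 1 ≤ y⁻¹ * |G k ω| := by
          rw [inv_mul_eq_div, le_div_iff₀ hy]; linarith
        calc |G k ω| = y * (y⁻¹ * |G k ω|) ^ (1 : ℝ) := by rw [Real.rpow_one]; field_simp
          _ ≤ _ := by gcongr
    rw [h1, abs_neg]
    calc |∫ ω, (Z k j ω - t (Z k j ω)) ∂μ| ≤ ∫ ω, |Z k j ω - t (Z k j ω)| ∂μ :=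
          abs_integral_le_integral_abs
      _ ≤ ∫ ω, y * y⁻¹ ^ q * |G k ω| ^ q ∂μ :=
          integral_mono ((hZi k j).sub (hti k j)).abs ((hGi k).const_mul _) hpt
      _ ≤ y * y⁻¹ ^ q * g ^ q := by
          rw [integral_const_mul]
          exact mul_le_mul_of_nonneg_left (hGint k) (by positivity)
      _ = y * (g / y) ^ q := by
          rw [mul_assoc, ← Real.mul_rpow (by positivity) hg, div_eq_inv_mul]
  -- After centring, the truncated variables are bounded by `2y`; hence the term `4yΛ` of the
  -- threshold.
  have hB : ∀ j, μ {ω | ∃ k ≤ n, 2 * √(n * v * Λ) + 2 * (2 * y) * Λ ≤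
      |∑ i ∈ Finset.range k, (t (Z i j ω) - e i j)|} ≤ 2 * ENNReal.ofReal (Real.exp (-Λ)) :=
      fun j => by
    refine measure_max_abs_sum_ge_le ℱ (Z := fun i ω => t (Z i j ω) - e i j) (fun k => ?_)
      (fun k => ?_) (by positivity) (fun k ω => ?_) (fun k => ?_) (fun k => ?_) hΛ n
    · exact ((htm.comp (hZm k j).measurable).sub measurable_const).stronglyMeasurable
    · refine indep_of_indep_of_le_left (hind k j) ?_
      rw [← measurable_iff_comap_le]
      exact (htm.comp (comap_measurable (Z k j))).sub_const _
    · have h1 : |e k j| ≤ y := by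
        have := norm_integral_le_of_norm_le_const (μ := μ) (f := fun ω => t (Z k j ω)) (C := y)
          (ae_of_all _ fun ω => hty _)
        simpa [e] using this
      calc |t (Z k j ω) - e k j| ≤ |t (Z k j ω)| + |e k j| := abs_sub _ _
        _ ≤ 2 * y := by linarith [hty (Z k j ω)]
    · rw [integral_sub (hti k j) (integrable_const _)]; simp [e]
    · have h1 : ∀ ω, (t (Z k j ω) - e k j) ^ 2 =
          t (Z k j ω) ^ 2 - 2 * e k j * t (Z k j ω) + e k j ^ 2 := fun ω => by ring
      have h4 : Integrable (fun ω => t (Z k j ω) ^ 2 - 2 * e k j * t (Z k j ω)) μ :=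
        (ht2i k j).sub ((hti k j).const_mul _)
      simp only [h1]
      rw [integral_add h4 (integrable_const _),
        integral_sub (ht2i k j) ((hti k j).const_mul _), integral_const_mul]
      have h2 : ∫ ω, t (Z k j ω) ∂μ = e k j := rfl
      have h3 : ∫ ω, t (Z k j ω) ^ 2 ∂μ ≤ v :=
        (integral_mono (ht2i k j) (hvi k j) fun ω => htu _).trans (hv k j)
      rw [h2]
      simp only [integral_const, probReal_univ, smul_eq_mul, one_mul]
      nlinarith [sq_nonneg (e k j)]
  have hA : ∀ k, μ {ω | y ≤ |G k ω|} ≤ ENNReal.ofReal ((g / y) ^ q) := fun k => by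
    have h1 := meas_ge_le_mul_pow_eLpNorm_enorm μ hne ENNReal.ofReal_ne_top (hGm k)
      (ε := ENNReal.ofReal y) (by simpa using hy) (by simp)
    have h2 : {ω | y ≤ |G k ω|} = {ω | ENNReal.ofReal y ≤ ‖G k ω‖ₑ} := by
      ext ω
      rw [Set.mem_ofPred_eq, Set.mem_ofPred_eq, ← ofReal_norm, Real.norm_eq_abs,
        ENNReal.ofReal_le_ofReal_iff (abs_nonneg _)]
    rw [h2]
    refine h1.trans ?_
    rw [ENNReal.toReal_ofReal hq0.le, ← ENNReal.mul_rpow_of_nonneg _ _ hq0.le,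
      ← ENNReal.ofReal_rpow_of_nonneg (by positivity) hq0.le, div_eq_inv_mul,
      ENNReal.ofReal_mul (by positivity), ENNReal.ofReal_inv_of_pos hy]
    gcongr
    exact hGq k
  have hsub : {ω | ∃ k ≤ n, ∃ j,
      y + (2 * √(n * v * Λ) + 4 * y * Λ) < |∑ i ∈ Finset.range k, Z i j ω|} ⊆
      (⋃ k ∈ Finset.range n, {ω | y ≤ |G k ω|}) ∪
      ⋃ j ∈ (Finset.univ : Finset κ), {ω | ∃ k ≤ n, 2 * √(n * v * Λ) + 2 * (2 * y) * Λ ≤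
        |∑ i ∈ Finset.range k, (t (Z i j ω) - e i j)|} := by
    rintro ω ⟨k, hk, j, hx⟩
    by_cases hω : ∃ i < n, y ≤ |G i ω|
    · obtain ⟨i, hi, hi'⟩ := hω
      left
      simp only [Set.mem_iUnion]
      exact ⟨i, Finset.mem_range.2 hi, hi'⟩
    · right
      push Not at hω
      simp only [Set.mem_iUnion]
      refine ⟨j, Finset.mem_univ j, k, hk, ?_⟩
      have h1 : ∑ i ∈ Finset.range k, Z i j ω =
          ∑ i ∈ Finset.range k, (t (Z i j ω) - e i j) + ∑ i ∈ Finset.range k, e i j := by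
        rw [← Finset.sum_add_distrib]
        refine Finset.sum_congr rfl fun i hi => ?_
        have : |Z i j ω| ≤ y := ((hG i j ω).trans (le_abs_self _)).trans
          (hω i ((Finset.mem_range.1 hi).trans_le hk)).le
        simp [t, this]
      have h2 : |∑ i ∈ Finset.range k, e i j| ≤ y := by
        calc |∑ i ∈ Finset.range k, e i j| ≤ ∑ i ∈ Finset.range k, |e i j| :=
              Finset.abs_sum_le_sum_abs _ _
          _ ≤ ∑ i ∈ Finset.range k, y * (g / y) ^ q := Finset.sum_le_sum fun i _ => he i j
          _ = k * (y * (g / y) ^ q) := by simp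
          _ ≤ n * (y * (g / y) ^ q) := by gcongr
          _ = y * (n * (g / y) ^ q) := by ring
          _ ≤ y * 1 := by gcongr
          _ = y := mul_one y
      have h3 := abs_add_le (∑ i ∈ Finset.range k, (t (Z i j ω) - e i j))
        (∑ i ∈ Finset.range k, e i j)
      rw [← h1] at h3
      linarith
  refine (measure_mono hsub).trans ((measure_union_le _ _).trans ?_)
  rw [ENNReal.ofReal_add (by positivity) (by positivity)]
  refine add_le_add ?_ ?_
  · refine (measure_biUnion_finset_le _ _).trans ((Finset.sum_le_sum fun k _ => hA k).trans ?_)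
    rw [Finset.sum_const, Finset.card_range, nsmul_eq_mul, ENNReal.ofReal_mul (by positivity)]
    simp
  · refine (measure_biUnion_finset_le _ _).trans ((Finset.sum_le_sum fun j _ => hB j).trans ?_)
    rw [Finset.sum_const, Finset.card_univ, nsmul_eq_mul, ENNReal.ofReal_mul (by positivity),
      ENNReal.ofReal_mul (by positivity)]
    simp only [ENNReal.ofReal_ofNat, ENNReal.ofReal_natCast]
    rw [← mul_assoc, mul_comm (Fintype.card κ : ℝ≥0∞) 2]

end Bernstein

/-! ### Deviation of the partial sums of an array of lagged projections -/

section Deviation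

theorem sum_range_mul_eq {V : Type*} [AddCommMonoid V] (f : ℕ → V) (τ B : ℕ) :
    ∑ i ∈ Finset.range (B * τ), f i = ∑ b ∈ Finset.range B, ∑ i ∈ Finset.range τ, f (b * τ + i) := by
  induction B with
  | zero => simp
  | succ B ih => rw [Nat.succ_mul, Finset.sum_range_add, ih, Finset.sum_range_succ]

theorem sum_range_parity {V : Type*} [AddCommMonoid V] (f : ℕ → V) (B : ℕ) :
    ∑ b ∈ Finset.range B, f b = ∑ c ∈ Finset.range ((B + 1) / 2), f (2 * c + 0) +
      ∑ c ∈ Finset.range (B / 2), f (2 * c + 1) := by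
  induction B with
  | zero => simp
  | succ B ih =>
    rw [Finset.sum_range_succ, ih]
    rcases Nat.even_or_odd' B with ⟨d, rfl | rfl⟩
    · rw [show (2 * d + 1 + 1) / 2 = d + 1 by omega, show (2 * d + 1) / 2 = d by omega,
        show 2 * d / 2 = d by omega, Finset.sum_range_succ]
      abel
    · rw [show (2 * d + 1 + 1 + 1) / 2 = d + 1 by omega, show (2 * d + 1 + 1) / 2 = d + 1 by omega,
        show (2 * d + 1) / 2 = d by omega, Finset.sum_range_succ _ d, Finset.sum_range_succ _ d]
      abel

variable {E : Type*} [MeasurableSpace E] {ρ : Measure E} [IsProbabilityMeasure ρ]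

theorem indep_of_dependsOn {ι W : Type*} [MeasurableSpace W] {s t : Set ι} (h : Disjoint s t)
    {f : (ι → E) → W} (hf : Measurable f) (hs : DependsOn f s) :
    Indep (MeasurableSpace.comap f inferInstance) (coordSigma E t) (iid ι ρ) := by
  refine indep_of_indep_of_le_left (indep_coordSigma ρ h) ?_
  exact (measurable_coordSigma_of_dependsOn hs hf).comap_le

theorem LagArray.integral_eq_zero {V : Type*} [NormedAddCommGroup V] [NormedSpace ℝ V]
    {D : ℤ → ℕ → (ℤ → E) → V} (hD : LagArray ρ D) (hi : ∀ i m, Integrable (D i m) (iid ℤ ρ))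
    (i : ℤ) (m : ℕ) : ∫ x, D i m x ∂(iid ℤ ρ) = 0 := by
  rw [← integral_avg ρ (s := Set.Ioi (i - m)) (hi i m), integral_congr_ae (hD.avg_zero i m)]
  simp

variable {p : ℕ} {s : ℝ≥0∞} [Fact (1 ≤ s)]
  {D : ℤ → ℕ → (ℤ → E) → PiLp s fun _ : Fin p => ℝ}

theorem LagArray.coord (hD : LagArray ρ D) (hi : ∀ i m, Integrable (D i m) (iid ℤ ρ)) (k : Fin p) :
    LagArray ρ fun i m x => D i m x k where
  meas i m := (PiLp.continuous_apply s (fun _ : Fin p => ℝ) k).comp_stronglyMeasurable (hD.meas i m)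
  dep i m := fun x y h => by
    have := hD.dep i m h
    simp only [this]
  avg_zero i m := by
    filter_upwards [hD.avg_zero i m, (integrable_mix ρ (s := Set.Ioi (i - m)) (hi i m)).prod_right_ae]
      with x hx hx'
    have h1 := (PiLp.proj (𝕜 := ℝ) s (fun _ : Fin p => ℝ) k).integral_comp_comm hx'
    unfold avg at hx ⊢
    simp only [PiLp.proj_apply] at h1
    rw [h1, hx]
    simp

/-- With lags below `τ = 2^(l+1)`, the sum over a block of `τ` indices depends on `2τ - 1`
consecutive innovations, so the even-numbered blocks are independent, and so are the odd-numbered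
ones. Each family is handled by truncation and Bernstein's inequality, with the `ℓ_s` norm as
envelope and coordinatewise second moments as variances. The incomplete last block is handled by
chaining inside the block. -/
theorem LagArray.level_deviation (hD : LagArray ρ D) {q c : ℝ}
    (hV : IsTwoSmooth (PiLp s fun _ : Fin p => ℝ) q c) (hq : 2 < q) (hc : 0 ≤ c) {α β : ℕ → ℝ}
    (hα : ∀ m, 0 ≤ α m) (hβ : ∀ m, 0 ≤ β m)
    (hb : ∀ i m, eLpNorm (D i m) (ENNReal.ofReal q) (iid ℤ ρ) ≤ ENNReal.ofReal (α m))
    (hb2 : ∀ i m k, eLpNorm (fun x => D i m x k) 2 (iid ℤ ρ) ≤ ENNReal.ofReal (β m))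
    (a : ℤ) {l L : ℕ} (hl : l < L) (I : Finset ℕ) (hI : ∀ m ∈ I, m + 1 < 2 ^ (l + 1)) {y Λ : ℝ}
    (hy : 0 < y) (hΛ : 1 ≤ Λ) :
    iid ℤ ρ {x | ∃ k ≤ 2 ^ L, ∃ j, 11 * y * Λ + 8 * (√((2 : ℝ) ^ L * Λ) * ∑ m ∈ I, β m) <
        |∑ i ∈ Finset.range k, ∑ m ∈ I, D (a + i) m x j|} ≤
      ENNReal.ofReal (4 * p * Real.exp (-Λ) + 3 * ((2 : ℝ) ^ (L - l - 1) *
        (chainConst q c * √((2 : ℝ) ^ (l + 1)) * (∑ m ∈ I, α m) / y) ^ q)) := by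
  have hq1 : 1 ≤ ENNReal.ofReal q := by
    rw [← ENNReal.ofReal_one]; exact ENNReal.ofReal_le_ofReal (by linarith)
  have hint : ∀ i m, Integrable (D i m) (iid ℤ ρ) := fun i m =>
    MemLp.integrable hq1 ⟨(hD.meas i m).aestronglyMeasurable, (hb i m).trans_lt ENNReal.ofReal_lt_top⟩
  set A := ∑ m ∈ I, α m with hA
  set B := ∑ m ∈ I, β m with hB
  have hA0 : 0 ≤ A := Finset.sum_nonneg fun m _ => hα m
  have hB0 : 0 ≤ B := Finset.sum_nonneg fun m _ => hβ m
  set τ : ℕ := 2 ^ (l + 1) with hτ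
  set N : ℕ := 2 ^ (L - l - 1) with hN
  have hNτ : N * τ = 2 ^ L := by rw [hN, hτ, ← pow_add]; congr 1; omega
  have hτ0 : 0 < τ := by positivity
  set g : ℝ := chainConst q c * √(τ : ℝ) * A with hg
  have hCn : 0 ≤ chainConst q c := chainConst_nonneg hq
  have hg0 : 0 ≤ g := by positivity
  let U : ℕ → (ℤ → E) → PiLp s fun _ : Fin p => ℝ := fun i x => ∑ m ∈ I, D (a + i) m x
  let Zb : ℕ → (ℤ → E) → PiLp s fun _ : Fin p => ℝ := fun b x =>
    ∑ i ∈ Finset.range τ, U (b * τ + i) x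
  have hUm : ∀ i, StronglyMeasurable (U i) := fun i =>
    Finset.stronglyMeasurable_fun_sum _ fun m _ => hD.meas _ m
  have hZbm : ∀ b, StronglyMeasurable (Zb b) := fun b =>
    Finset.stronglyMeasurable_fun_sum _ fun i _ => hUm _
  have hZbdep : ∀ b : ℕ, DependsOn (Zb b) (Set.Icc (a + b * τ - τ + 1) (a + b * τ + τ - 1)) :=
      fun b => by
    refine dependsOn_finset_sum _ fun i hi => dependsOn_finset_sum _ fun m hm => ?_
    refine (hD.dep _ m).mono fun u hu => ?_
    have h1 := hI m hm
    have h2 := Finset.mem_range.1 hi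
    have h3 : ((m : ℤ) + 1 < τ) := by exact_mod_cast h1
    have h4 : ((i : ℤ) < τ) := by exact_mod_cast h2
    simp only [Set.mem_Icc] at hu ⊢
    push_cast at hu
    constructor <;> linarith [hu.1, hu.2]
  have hZcoord : ∀ b j x, Zb b x j =
      ∑ i ∈ Finset.range τ, ∑ m ∈ I, D (a + (b * τ : ℕ) + i) m x j := fun b j x => by
    simp only [Zb, U, WithLp.ofLp_sum, Finset.sum_apply, Nat.cast_add, add_assoc]
  have hZjm : ∀ b j, Measurable fun x => Zb b x j := fun b j =>
    ((PiLp.continuous_apply s (fun _ : Fin p => ℝ) j).comp_stronglyMeasurable (hZbm b)).measurable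
  have hZ2norm : ∀ b j, eLpNorm (fun x => Zb b x j) 2 (iid ℤ ρ) ≤
      ENNReal.ofReal (√(2 * τ) * B) := fun b j => by
    have h1 := (hD.coord hint j).eLpNorm_sum_sum_le isTwoSmooth_real_two le_rfl zero_le_one hβ
      (by simpa using fun i m => hb2 i m j) I (a + (b * τ : ℕ)) τ
    simp only [hZcoord]
    simpa using h1
  have hZ2mem : ∀ b j, MemLp (fun x => Zb b x j) 2 (iid ℤ ρ) := fun b j =>
    ⟨(hZjm b j).aestronglyMeasurable, (hZ2norm b j).trans_lt ENNReal.ofReal_lt_top⟩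
  have hZ2 : ∀ b j, ∫ x, Zb b x j ^ 2 ∂(iid ℤ ρ) ≤ 2 * τ * B ^ 2 := fun b j => by
    have h1 := (hZ2mem b j).eLpNorm_eq_integral_rpow_norm (by norm_num) (by norm_num)
    have h2 := hZ2norm b j
    rw [h1, ENNReal.ofReal_le_ofReal_iff (by positivity)] at h2
    simp only [ENNReal.toReal_ofNat, Real.rpow_two, Real.norm_eq_abs, sq_abs] at h2
    rw [← one_div, ← Real.sqrt_eq_rpow, Real.sqrt_le_iff] at h2
    refine h2.2.trans_eq ?_
    rw [mul_pow, Real.sq_sqrt (by positivity)]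
  have hZ0 : ∀ b j, ∫ x, Zb b x j ∂(iid ℤ ρ) = 0 := fun b j => by
    simp only [hZcoord]
    have hci : ∀ i m, Integrable (fun x => D i m x j) (iid ℤ ρ) := fun i m =>
      MemLp.integrable (q := 2) (by norm_num) ⟨((hD.coord hint j).meas i m).aestronglyMeasurable,
        (hb2 i m j).trans_lt ENNReal.ofReal_lt_top⟩
    rw [integral_finsetSum _ fun i _ => integrable_finsetSum _ fun m _ => hci _ m]
    refine Finset.sum_eq_zero fun i _ => ?_
    rw [integral_finsetSum _ fun m _ => hci _ m]
    exact Finset.sum_eq_zero fun m _ => (hD.coord hint j).integral_eq_zero hci _ m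
  have hparity : ∀ e : ℕ, iid ℤ ρ {x | ∃ k ≤ N, ∃ j : Fin p,
      y + (2 * √(N * (2 * τ * B ^ 2) * Λ) + 4 * y * Λ) <
        |∑ d ∈ Finset.range k, Zb (2 * d + e) x j|} ≤
      ENNReal.ofReal (N * (g / y) ^ q + 2 * p * Real.exp (-Λ)) := fun e => by
    -- Stage `d` contains the innovations strictly before the support of block `2d + e`; the support
    -- of the preceding block of the same parity lies in this range.
    let ℱ : Filtration ℕ (MeasurableSpace.pi : MeasurableSpace (ℤ → E)) :=
      { seq := fun d => coordSigma E (Set.Iic (a + (2 * d + e : ℕ) * τ - τ))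
        mono' := fun d d' hd => coordSigma_mono (Set.Iic_subset_Iic.2 (by gcongr))
        le' := fun d => coordSigma_le _ }
    have h1 := measure_max_abs_sum_gt_le (μ := iid ℤ ρ) ℱ
      (Z := fun d j x => Zb (2 * d + e) x j) (G := fun d x => ‖Zb (2 * d + e) x‖) (q := q) (g := g)
      (Λ := Λ) (by linarith) hg0 (fun d j => ?_) (fun d j => ?_) (fun d j x => ?_)
      (fun d => (hZbm _).norm.aestronglyMeasurable) (fun d => ?_) (fun d j => hZ0 _ j)
      (fun d j => (hZ2mem _ j).integrable_sq) (fun d j => hZ2 _ j) hy (by linarith) N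
    · simpa only [Fintype.card_fin] using h1
    · refine (measurable_coordSigma_of_dependsOn (s := Set.Iic (a + (2 * (d + 1) + e : ℕ) * τ - τ))
        ?_ (hZjm _ j)).stronglyMeasurable
      refine DependsOn.mono (fun u hu => ?_) (fun x x' h => by rw [hZbdep (2 * d + e) h])
      simp only [Set.mem_Icc, Set.mem_Iic] at hu ⊢
      push_cast at hu ⊢
      linarith [hu.2]
    · refine indep_of_dependsOn (s := Set.Icc (a + (2 * d + e : ℕ) * τ - τ + 1)
        (a + (2 * d + e : ℕ) * τ + τ - 1)) ?_ (hZjm _ j) fun x x' h => by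
          rw [hZbdep (2 * d + e) h]
      rw [Set.disjoint_left]
      intro u hu hu'
      simp only [Set.mem_Icc, Set.mem_Iic] at hu hu'
      linarith [hu.1]
    · simpa using PiLp.norm_apply_le (Zb (2 * d + e) x) j
    · rw [eLpNorm_norm]
      have h2 := hD.eLpNorm_sum_sum_le hV hq.le hc hα hb I (a + ((2 * d + e) * τ : ℕ)) τ
      have h3 : (fun x => ∑ i ∈ Finset.range τ, ∑ m ∈ I, D (a + ((2 * d + e) * τ : ℕ) + i) m x) =
          Zb (2 * d + e) := by
        ext1 x
        simp only [Zb, U, Nat.cast_add, add_assoc]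
      rw [h3] at h2
      refine h2.trans (ENNReal.ofReal_le_ofReal ?_)
      rw [hg, Real.sqrt_mul (by positivity)]
      gcongr
      unfold chainConst
      have := rpow_half_lt_one hq
      rw [le_div_iff₀ (by linarith)]
      have h4 : (0 : ℝ) ≤ (1 / 2 : ℝ) ^ (1 / 2 - 1 / q) := by positivity
      nlinarith [Real.sqrt_nonneg (2 * c)]
  have hinblock : ∀ b : ℕ, iid ℤ ρ {x | ∃ k ≤ τ, y < ‖∑ i ∈ Finset.range k, U (b * τ + i) x‖} ≤
      ENNReal.ofReal ((g / y) ^ q) := fun b => by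
    have h1 := hD.measure_max_le hV hq hc hα hb I (a + (b * τ : ℕ)) (l + 1) hy
    refine le_trans (le_of_eq ?_) (h1.trans_eq ?_)
    · congr 1
      ext x
      simp only [U, Nat.cast_add, add_assoc]
      rfl
    · rw [hg, hτ]; push_cast; rfl
  have hsub : {x | ∃ k ≤ 2 ^ L, ∃ j, 11 * y * Λ + 8 * (√((2 : ℝ) ^ L * Λ) * B) <
        |∑ i ∈ Finset.range k, ∑ m ∈ I, D (a + i) m x j|} ⊆
      ({x | ∃ k ≤ N, ∃ j : Fin p, y + (2 * √(N * (2 * τ * B ^ 2) * Λ) + 4 * y * Λ) <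
        |∑ d ∈ Finset.range k, Zb (2 * d + 0) x j|} ∪
      {x | ∃ k ≤ N, ∃ j : Fin p, y + (2 * √(N * (2 * τ * B ^ 2) * Λ) + 4 * y * Λ) <
        |∑ d ∈ Finset.range k, Zb (2 * d + 1) x j|}) ∪
      ⋃ b ∈ Finset.range N, {x | ∃ k ≤ τ, y < ‖∑ i ∈ Finset.range k, U (b * τ + i) x‖} := by
    rintro x ⟨k, hk, j, hx⟩
    by_contra hcon
    simp only [Set.mem_union, Set.mem_iUnion, not_or, Set.mem_ofPred_eq] at hcon
    obtain ⟨⟨h0, h1⟩, h2⟩ := hcon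
    push Not at h0 h1 h2
    have hkdiv : k / τ ≤ N := by
      refine Nat.div_le_of_le_mul ?_
      rw [mul_comm, hNτ]; exact hk
    have hkj : ∑ i ∈ Finset.range k, ∑ m ∈ I, D (a + i) m x j =
        (∑ i ∈ Finset.range k, U i x) j := by
      simp only [U, WithLp.ofLp_sum, Finset.sum_apply]
    have hdec : ∑ i ∈ Finset.range k, U i x = (∑ d ∈ Finset.range ((k / τ + 1) / 2),
        Zb (2 * d + 0) x + ∑ d ∈ Finset.range (k / τ / 2), Zb (2 * d + 1) x) +
        ∑ i ∈ Finset.range (k % τ), U (k / τ * τ + i) x := by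
      conv_lhs => rw [← Nat.div_add_mod' k τ]
      rw [Finset.sum_range_add, sum_range_mul_eq, ← sum_range_parity (fun b => Zb b x)]
    have h3 : ‖∑ i ∈ Finset.range (k % τ), U (k / τ * τ + i) x‖ ≤ y := by
      rcases hkdiv.lt_or_eq with h | h
      · exact h2 _ (Finset.mem_range.2 h) _ (Nat.mod_lt _ hτ0).le
      · have : k % τ = 0 := by
          have := Nat.div_add_mod' k τ
          rw [h, hNτ] at this
          omega
        simp [this, hy.le]
    have h4 : |(∑ i ∈ Finset.range (k % τ), U (k / τ * τ + i) x) j| ≤ y :=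
      (by simpa using PiLp.norm_apply_le (∑ i ∈ Finset.range (k % τ), U (k / τ * τ + i) x) j :
        |(∑ i ∈ Finset.range (k % τ), U (k / τ * τ + i) x) j| ≤ _).trans h3
    have hN0 : 0 < N := by positivity
    have hhalf : ∀ M ≤ N, (M + 1) / 2 ≤ N ∧ M / 2 ≤ N := fun M hM => by
      clear_value N
      omega
    have h5 := h0 _ (hhalf _ hkdiv).1 j
    have h6 := h1 _ (hhalf _ hkdiv).2 j
    have h7 : 2 * √(N * (2 * τ * B ^ 2) * Λ) ≤ 4 * (√((2 : ℝ) ^ L * Λ) * B) := by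
      have : (N : ℝ) * (2 * τ * B ^ 2) * Λ = 2 * ((2 : ℝ) ^ L * Λ) * B ^ 2 := by
        have : (N : ℝ) * τ = 2 ^ L := by exact_mod_cast hNτ
        rw [← this]; ring
      rw [this, Real.sqrt_mul (by positivity), Real.sqrt_sq hB0, Real.sqrt_mul (by norm_num)]
      have h8 : √(2 : ℝ) ≤ 2 := by
        rw [Real.sqrt_le_left (by norm_num)]; norm_num
      have h9 : 0 ≤ √((2 : ℝ) ^ L * Λ) * B := by positivity
      nlinarith
    rw [hkj, hdec] at hx
    simp only [PiLp.add_apply] at hx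
    simp only [WithLp.ofLp_sum, Finset.sum_apply] at hx h4
    -- The constant `11` collects `y + 4yΛ` for each parity and `y` for the last block, since `Λ ≥
    -- 1`.
    have h10 := abs_add_three (∑ d ∈ Finset.range ((k / τ + 1) / 2), Zb (2 * d + 0) x j)
      (∑ d ∈ Finset.range (k / τ / 2), Zb (2 * d + 1) x j)
      (∑ i ∈ Finset.range (k % τ), U (k / τ * τ + i) x j)
    nlinarith
  refine (measure_mono hsub).trans ((measure_union_le _ _).trans ((add_le_add
    ((measure_union_le _ _).trans (add_le_add (hparity 0) (hparity 1)))
    ((measure_biUnion_finset_le _ _).trans (Finset.sum_le_sum fun b _ => hinblock b))).trans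
    (le_of_eq ?_)))
  rw [Finset.sum_const, Finset.card_range, nsmul_eq_mul, ← ENNReal.ofReal_natCast N,
    ← ENNReal.ofReal_mul (by positivity), ← ENNReal.ofReal_add (by positivity) (by positivity),
    ← ENNReal.ofReal_add (by positivity) (by positivity)]
  congr 1
  have h1 : (N : ℝ) = 2 ^ (L - l - 1) := by rw [hN]; push_cast; rfl
  have h2 : (τ : ℝ) = 2 ^ (l + 1) := by rw [hτ]; push_cast; rfl
  rw [← h1, ← h2, ← hg]
  ring

end Deviation

/-! ### Allocation of the deviation over dyadic lags -/

section Allocation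

theorem exists_sum_geometric_mul_rpow_le {c : ℝ} (hc : 0 < c) (r : ℝ) :
    ∃ C : ℝ, 0 < C ∧ ∀ n : ℕ, ∑ l ∈ Finset.range n, ((2 : ℝ) ^ l) ^ (-c) * (1 + (l : ℝ)) ^ r ≤ C := by
  obtain ⟨k, hk⟩ := exists_nat_ge r
  set θ : ℝ := (2 : ℝ) ^ (-c) with hθ
  have hθ0 : 0 < θ := by positivity
  have hθ1 : θ < 1 := Real.rpow_lt_one_of_one_lt_of_neg (by norm_num) (by linarith)
  have h1 : Summable fun l : ℕ => (l : ℝ) ^ k * θ ^ l :=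
    summable_pow_mul_geometric_of_norm_lt_one k (by rwa [Real.norm_eq_abs, abs_of_pos hθ0])
  have h2 : Summable fun l : ℕ => (1 + (l : ℝ)) ^ k * θ ^ l := by
    have h3 := ((summable_nat_add_iff 1).2 h1).mul_right θ⁻¹
    refine h3.congr fun l => ?_
    push_cast
    rw [pow_succ]
    field_simp
    ring
  refine ⟨∑' l : ℕ, (1 + (l : ℝ)) ^ k * θ ^ l + 1, ?_, fun n => ?_⟩
  · have : 0 ≤ ∑' l : ℕ, (1 + (l : ℝ)) ^ k * θ ^ l := tsum_nonneg fun l => by positivity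
    linarith
  · refine le_trans (Finset.sum_le_sum fun l _ => ?_) ((h2.sum_le_tsum (Finset.range n) fun l _ => by
      positivity).trans (by linarith))
    rw [← Real.rpow_natCast 2 l, ← Real.rpow_mul (by norm_num), mul_comm (l : ℝ),
      Real.rpow_mul (by norm_num), Real.rpow_natCast, mul_comm]
    have h4 : (1 + (l : ℝ)) ^ r ≤ (1 + (l : ℝ)) ^ k := by
      rw [← Real.rpow_natCast]
      exact Real.rpow_le_rpow_of_exponent_le (by linarith [Nat.cast_nonneg (α := ℝ) l]) hk
    gcongr

theorem sum_inv_sq_le (n : ℕ) : ∑ l ∈ Finset.range n, (1 + (l : ℝ)) ^ (-2 : ℝ) ≤ 2 := by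
  have key : ∀ n : ℕ, ∑ l ∈ Finset.range (n + 1), (1 + (l : ℝ)) ^ (-2 : ℝ) ≤ 2 - 1 / (n + 1) := by
    intro n
    induction n with
    | zero => norm_num
    | succ n ih =>
      rw [Finset.sum_range_succ]
      have h1 : (1 + ((n + 1 : ℕ) : ℝ)) ^ (-2 : ℝ) ≤ 1 / (n + 1) - 1 / (n + 1 + 1) := by
        push_cast
        rw [Real.rpow_neg (by positivity), Real.rpow_two, div_sub_div _ _ (by positivity)
          (by positivity), inv_eq_one_div, div_le_div_iff₀ (by positivity) (by positivity)]
        have : (0 : ℝ) ≤ n := Nat.cast_nonneg n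
        nlinarith
      push_cast at h1 ⊢
      linarith
  have h0 : (0 : ℝ) ≤ (1 + (n : ℝ)) ^ (-2 : ℝ) := by positivity
  have h1 : (0 : ℝ) ≤ 1 / (n + 1) := by positivity
  have h2 := key n
  rw [Finset.sum_range_succ] at h2
  linarith

/-- The weight of the dyadic level `l` among `L` levels. -/
def levelWeight (L l : ℕ) : ℝ := 1 + (min l (L - l) : ℕ)

theorem one_le_levelWeight (L l : ℕ) : 1 ≤ levelWeight L l := by
  unfold levelWeight; linarith [Nat.cast_nonneg (α := ℝ) (min l (L - l))]

theorem levelWeight_le_left (L l : ℕ) : levelWeight L l ≤ 1 + l := by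
  unfold levelWeight; gcongr; exact min_le_left _ _

theorem levelWeight_le_right (L l : ℕ) : levelWeight L l ≤ 1 + (L - l : ℕ) := by
  unfold levelWeight; gcongr; exact min_le_right _ _

theorem sum_reflect_le {f : ℕ → ℝ} (hf : ∀ l, 0 ≤ f l) (L : ℕ) :
    ∑ l ∈ Finset.range L, f (L - l) ≤ ∑ l ∈ Finset.range (L + 1), f l := by
  rw [Finset.sum_range_succ', ← Finset.sum_range_reflect]
  have : ∀ j ∈ Finset.range L, f (L - (L - 1 - j)) = f (j + 1) := fun j hj => by
    congr 1; have := Finset.mem_range.1 hj; omega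
  rw [Finset.sum_congr rfl this]
  linarith [hf 0]

/-- The `w l` are the shares of the total deviation granted to the lag levels. Up to weights, the
cost of level `l` is a power of `2^l` with exponent `η = q(1/2 - 1/q - A)`. If `η > 0` the top
levels dominate and the shares decrease away from the top; if `η < 0` they decrease away from the
bottom. At `η = 0` all levels count alike: uniform shares `1/L` give `L (L²)^q`, which is the origin
of the factor `(log x)^(1+2q)` in `varpi`. The last summand on the left accounts for lags beyond
`2^L`. -/
theorem exists_level_allocation {q A : ℝ} (hq : 2 < q) :
    ∃ C : ℝ, 0 < C ∧ ∀ (L : ℕ) (x : ℝ), 3 ≤ x → (2 : ℝ) ^ L ≤ 16 * x →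
      ∃ w : ℕ → ℝ, (∀ l < L, 0 < w l) ∧ ∑ l ∈ Finset.range L, w l ≤ 2 ∧
        (2 : ℝ) ^ L * ∑ l ∈ Finset.range L, ((2 : ℝ) ^ l) ^ (q / 2 - A * q - 1) *
          (levelWeight L l / w l) ^ q + ((2 : ℝ) ^ L) ^ (q / 2 - A * q) ≤ C * varpi q A x := by
  have hq0 : 0 < q := by linarith
  set η := q / 2 - A * q - 1 with hη
  have hηq : η = q * (1 / 2 - 1 / q - A) := by rw [hη]; field_simp; ring
  rcases lt_trichotomy A (1 / 2 - 1 / q) with hA | hA | hA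
  · have hη0 : 0 < η := by rw [hηq]; exact mul_pos hq0 (by linarith)
    obtain ⟨C, hC0, hC⟩ := exists_sum_geometric_mul_rpow_le hη0 (3 * q)
    refine ⟨(C + 1) * 16 ^ (q / 2 - A * q), by positivity, fun L x hx hLx => ?_⟩
    refine ⟨fun l => (1 + ((L - l : ℕ) : ℝ)) ^ (-2 : ℝ), fun l _ => by positivity, ?_, ?_⟩
    · exact (sum_reflect_le (f := fun l : ℕ => (1 + (l : ℝ)) ^ (-2 : ℝ)) (fun l => by positivity)
        L).trans (sum_inv_sq_le _)
    · have hterm : ∀ l ∈ Finset.range L, ((2 : ℝ) ^ l) ^ η *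
          (levelWeight L l / (1 + ((L - l : ℕ) : ℝ)) ^ (-2 : ℝ)) ^ q ≤ ((2 : ℝ) ^ L) ^ η *
            (((2 : ℝ) ^ (L - l)) ^ (-η) * (1 + ((L - l : ℕ) : ℝ)) ^ (3 * q)) := fun l hl => by
        have hl' := Finset.mem_range.1 hl
        have h1 : ((2 : ℝ) ^ L) ^ η * ((2 : ℝ) ^ (L - l)) ^ (-η) = ((2 : ℝ) ^ l) ^ η := by
          rw [show (2 : ℝ) ^ L = 2 ^ l * 2 ^ (L - l) by rw [← pow_add]; congr 1; omega,
            Real.mul_rpow (by positivity) (by positivity), mul_assoc,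
            ← Real.rpow_add (by positivity), add_neg_cancel, Real.rpow_zero, mul_one]
        rw [← mul_assoc, h1]
        gcongr
        rw [Real.rpow_mul (by positivity)]
        have h0 := one_le_levelWeight L l
        refine Real.rpow_le_rpow (by positivity) ?_ hq0.le
        rw [Real.rpow_neg (by positivity), div_inv_eq_mul, Real.rpow_two]
        calc _ ≤ (1 + ((L - l : ℕ) : ℝ)) * (1 + ((L - l : ℕ) : ℝ)) ^ 2 := by
              gcongr; exact levelWeight_le_right L l
          _ = (1 + ((L - l : ℕ) : ℝ)) ^ (3 : ℝ) := by norm_cast; ring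
      have hsum : ∑ l ∈ Finset.range L, ((2 : ℝ) ^ l) ^ η *
          (levelWeight L l / (1 + ((L - l : ℕ) : ℝ)) ^ (-2 : ℝ)) ^ q ≤ ((2 : ℝ) ^ L) ^ η * C := by
        refine (Finset.sum_le_sum hterm).trans ?_
        rw [← Finset.mul_sum]
        gcongr
        exact (sum_reflect_le (f := fun l : ℕ => ((2 : ℝ) ^ l) ^ (-η) * (1 + (l : ℝ)) ^ (3 * q))
          (fun l => by positivity) L).trans (hC _)
      have hv : varpi q A x = x ^ (q / 2 - A * q) := by
        unfold varpi
        rw [if_neg (not_lt.2 hA.le), if_neg hA.ne]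
      have h2 : (2 : ℝ) ^ L * ((2 : ℝ) ^ L) ^ η = ((2 : ℝ) ^ L) ^ (q / 2 - A * q) := by
        conv_lhs => rw [← Real.rpow_one ((2 : ℝ) ^ L)]
        rw [Real.rpow_one ((2 : ℝ) ^ L)]
        nth_rewrite 1 [← Real.rpow_one ((2 : ℝ) ^ L)]
        rw [← Real.rpow_add (by positivity)]
        congr 1; rw [hη]; ring
      calc _ ≤ (2 : ℝ) ^ L * (((2 : ℝ) ^ L) ^ η * C) + ((2 : ℝ) ^ L) ^ (q / 2 - A * q) := by
            gcongr
        _ = (C + 1) * ((2 : ℝ) ^ L) ^ (q / 2 - A * q) := by rw [← mul_assoc, h2]; ring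
        _ ≤ (C + 1) * (16 * x) ^ (q / 2 - A * q) := by
            gcongr
            linarith
        _ = _ := by rw [hv, Real.mul_rpow (by norm_num) (by linarith)]; ring
  · have hη0 : η = 0 := by rw [hηq, hA]; ring
    have he : q / 2 - A * q = 1 := by linarith
    have hl3 : 1 ≤ Real.log 3 := by
      rw [Real.le_log_iff_exp_le (by norm_num)]
      exact Real.exp_one_lt_three.le
    set c₀ := (1 + Real.log 16) / Real.log 2 with hc₀
    have hlog2 : 0 < Real.log 2 := Real.log_pos (by norm_num)
    have hlog16 : 0 < Real.log 16 := Real.log_pos (by norm_num)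
    have hc₀0 : 0 < c₀ := by positivity
    refine ⟨16 * c₀ ^ (1 + 2 * q) + 16, by positivity, fun L x hx hLx => ?_⟩
    have hlogx : 1 ≤ Real.log x := hl3.trans (Real.log_le_log (by norm_num) hx)
    have hLlog : (L : ℝ) ≤ c₀ * Real.log x := by
      have h1 := Real.log_le_log (by positivity) hLx
      rw [Real.log_pow, Real.log_mul (by norm_num) (by linarith)] at h1
      rw [hc₀, div_mul_eq_mul_div, le_div_iff₀ hlog2]
      nlinarith
    refine ⟨fun _ => (L : ℝ)⁻¹, fun l hl => ?_, ?_, ?_⟩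
    · have : 0 < L := by omega
      positivity
    · rw [Finset.sum_const, Finset.card_range, nsmul_eq_mul]
      exact mul_inv_le_one.trans (by norm_num)
    · have hv : varpi q A x = x * Real.log x ^ (1 + 2 * q) := by
        unfold varpi
        rw [if_neg (by rw [hA]; exact lt_irrefl _), if_pos hA]
      have hlogp : 1 ≤ Real.log x ^ (1 + 2 * q) := Real.one_le_rpow hlogx (by linarith)
      have hsum : ∑ l ∈ Finset.range L, ((2 : ℝ) ^ l) ^ η * (levelWeight L l / (L : ℝ)⁻¹) ^ q ≤
          (L : ℝ) ^ (1 + 2 * q) := by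
        calc _ ≤ ∑ l ∈ Finset.range L, ((L : ℝ) ^ 2) ^ q := by
              refine Finset.sum_le_sum fun l hl => ?_
              have hl' := Finset.mem_range.1 hl
              have h0 := one_le_levelWeight L l
              rw [hη0, Real.rpow_zero, one_mul, div_inv_eq_mul, sq]
              gcongr
              refine (levelWeight_le_left L l).trans ?_
              have : (l : ℝ) + 1 ≤ L := by exact_mod_cast hl'
              linarith
          _ = (L : ℝ) ^ (1 + 2 * q) := by
              rw [Finset.sum_const, Finset.card_range, nsmul_eq_mul, ← Real.rpow_natCast,
                ← Real.rpow_mul (by positivity), add_comm,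
                Real.rpow_add_one' (by positivity) (by linarith)]
              push_cast; ring
      calc _ ≤ (16 * x) * (L : ℝ) ^ (1 + 2 * q) + (16 * x) ^ (1 : ℝ) := by
            rw [he]
            exact add_le_add (mul_le_mul hLx hsum (Finset.sum_nonneg fun l _ => by
              have := one_le_levelWeight L l; positivity) (by positivity))
              (Real.rpow_le_rpow (by positivity) hLx (by norm_num))
        _ ≤ (16 * x) * (c₀ * Real.log x) ^ (1 + 2 * q) + (16 * x) * Real.log x ^ (1 + 2 * q) := by
            rw [Real.rpow_one]
            refine add_le_add ?_ (le_mul_of_one_le_right (by positivity) hlogp)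
            have : 0 ≤ 1 + 2 * q := by linarith
            gcongr
        _ = _ := by rw [hv, Real.mul_rpow hc₀0.le (by linarith)]; ring
  · have hη0 : η < 0 := by rw [hηq]; exact mul_neg_of_pos_of_neg hq0 (by linarith)
    obtain ⟨C, hC0, hC⟩ := exists_sum_geometric_mul_rpow_le (neg_pos.2 hη0) (3 * q)
    refine ⟨16 * (C + 1), by positivity, fun L x hx hLx => ?_⟩
    refine ⟨fun l => (1 + (l : ℝ)) ^ (-2 : ℝ), fun l _ => by positivity, sum_inv_sq_le _, ?_⟩
    have hv : varpi q A x = x := by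
      unfold varpi
      rw [if_pos hA]
    have hsum : ∑ l ∈ Finset.range L, ((2 : ℝ) ^ l) ^ η *
        (levelWeight L l / (1 + (l : ℝ)) ^ (-2 : ℝ)) ^ q ≤ C := by
      refine le_trans (Finset.sum_le_sum fun l _ => ?_) (hC L)
      rw [neg_neg]
      gcongr
      rw [Real.rpow_mul (by positivity)]
      have h0 := one_le_levelWeight L l
      refine Real.rpow_le_rpow (by positivity) ?_ hq0.le
      rw [Real.rpow_neg (by positivity), div_inv_eq_mul, Real.rpow_two]
      calc _ ≤ (1 + (l : ℝ)) * (1 + (l : ℝ)) ^ 2 := by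
            gcongr; exact levelWeight_le_left L l
        _ = (1 + (l : ℝ)) ^ (3 : ℝ) := by norm_cast; ring
    have htop : ((2 : ℝ) ^ L) ^ (q / 2 - A * q) ≤ (2 : ℝ) ^ L := by
      conv_rhs => rw [← Real.rpow_one ((2 : ℝ) ^ L)]
      exact Real.rpow_le_rpow_of_exponent_le (one_le_pow₀ (by norm_num)) (by linarith)
    calc _ ≤ (2 : ℝ) ^ L * C + (2 : ℝ) ^ L := by gcongr
      _ = (C + 1) * 2 ^ L := by ring
      _ ≤ (C + 1) * (16 * x) := by gcongr
      _ = _ := by rw [hv]; ring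

/-- Since the weights grow linearly with the distance to the nearer end of the range of levels, the
union over the levels costs a constant factor instead of `L`. -/
theorem sum_exp_neg_levelWeight_le {Λ : ℝ} (hΛ : 1 ≤ Λ) (L : ℕ) :
    ∑ l ∈ Finset.range L, Real.exp (-(Λ * levelWeight L l)) ≤ 4 * Real.exp (-Λ) := by
  have hgeo : ∀ n : ℕ, ∑ l ∈ Finset.range n, Real.exp (-(l : ℝ)) ≤ 2 := fun n => by
    have h1 : Real.exp (-1) < 1 / 2 := by
      rw [Real.exp_neg, one_div]
      exact inv_strictAnti₀ (by norm_num) (by linarith [Real.exp_one_gt_d9])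
    have h2 : ∀ l : ℕ, Real.exp (-(l : ℝ)) ≤ (1 / 2 : ℝ) ^ l := fun l => by
      rw [show -(l : ℝ) = l * (-1) by ring, Real.exp_nat_mul]
      gcongr
    refine (Finset.sum_le_sum fun l _ => h2 l).trans ?_
    exact (summable_geometric_two.sum_le_tsum _ fun _ _ => by positivity).trans_eq
      tsum_geometric_two
  have hterm : ∀ l ∈ Finset.range L, Real.exp (-(Λ * levelWeight L l)) ≤
      Real.exp (-Λ) * (Real.exp (-(l : ℝ)) + Real.exp (-((L - l : ℕ) : ℝ))) := fun l _ => by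
    have h1 : Real.exp (-(Λ * levelWeight L l)) ≤
        Real.exp (-Λ) * Real.exp (-((min l (L - l) : ℕ) : ℝ)) := by
      rw [← Real.exp_add]
      refine Real.exp_le_exp.2 ?_
      unfold levelWeight
      have : (0 : ℝ) ≤ (min l (L - l) : ℕ) := Nat.cast_nonneg _
      nlinarith
    refine h1.trans (mul_le_mul_of_nonneg_left ?_ (Real.exp_pos _).le)
    rcases min_choice l (L - l) with h | h <;> rw [h]
    · linarith [Real.exp_pos (-((L - l : ℕ) : ℝ))]
    · linarith [Real.exp_pos (-(l : ℝ))]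
  refine (Finset.sum_le_sum hterm).trans ?_
  rw [← Finset.mul_sum, Finset.sum_add_distrib]
  have h3 := sum_reflect_le (f := fun l : ℕ => Real.exp (-(l : ℝ))) (fun l => (Real.exp_pos _).le) L
  have h4 := hgeo L
  have h5 := hgeo (L + 1)
  have h6 := Real.exp_pos (-Λ)
  nlinarith

theorem sum_range_eq_sum_dyadic {V : Type*} [AddCommMonoid V] (f : ℕ → V) (R L : ℕ) :
    ∑ m ∈ Finset.range R, f m =
      ∑ l ∈ Finset.range L, ∑ m ∈ Finset.range R with 2 ^ l ≤ m + 1 ∧ m + 1 < 2 ^ (l + 1), f m +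
        ∑ m ∈ Finset.range R with 2 ^ L ≤ m + 1, f m := by
  induction L with
  | zero => simp
  | succ L ih =>
    rw [ih, Finset.sum_range_succ, add_assoc]
    congr 1
    rw [← Finset.sum_filter_add_sum_filter_not ({m ∈ Finset.range R | 2 ^ L ≤ m + 1})
      (fun m => m + 1 < 2 ^ (L + 1)), Finset.filter_filter, Finset.filter_filter]
    congr 1
    refine Finset.sum_congr ?_ fun _ _ => rfl
    ext m
    simp only [Finset.mem_filter, not_lt, and_congr_right_iff]
    intro _
    have : 2 ^ (L + 1) = 2 * 2 ^ L := by ring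
    omega

end Allocation

/-! ### Deviation inequality for one row, with all lags together -/

section RowDeviation

variable {E : Type*} [MeasurableSpace E] {ρ : Measure E} [IsProbabilityMeasure ρ]

/-- A union bound over the dyadic levels of lags. Lags from `2^L - 1` on, which are too long for
blocking within the window, are treated all at once by chaining. -/
theorem LagArray.dyadic_deviation {p : ℕ} {s : ℝ≥0∞} [Fact (1 ≤ s)]
    {D : ℤ → ℕ → (ℤ → E) → PiLp s fun _ : Fin p => ℝ} (hD : LagArray ρ D) {q c : ℝ}
    (hV : IsTwoSmooth (PiLp s fun _ : Fin p => ℝ) q c) (hq : 2 < q) (hc : 0 ≤ c) {α β : ℕ → ℝ}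
    (hα : ∀ m, 0 ≤ α m) (hβ : ∀ m, 0 ≤ β m)
    (hb : ∀ i m, eLpNorm (D i m) (ENNReal.ofReal q) (iid ℤ ρ) ≤ ENNReal.ofReal (α m))
    (hb2 : ∀ i m k, eLpNorm (fun x => D i m x k) 2 (iid ℤ ρ) ≤ ENNReal.ofReal (β m))
    {A a₁ a₂ : ℝ}
    (hta : ∀ l R : ℕ, ∑ m ∈ Finset.range R with 2 ^ l ≤ m + 1, α m ≤ a₁ * ((2 : ℝ) ^ l) ^ (-A))
    (htb : ∀ l R : ℕ, ∑ m ∈ Finset.range R with 2 ^ l ≤ m + 1, β m ≤ a₂ * ((2 : ℝ) ^ l) ^ (-A))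
    (a : ℤ) (L R : ℕ) {y Λ : ℕ → ℝ} {y' : ℝ} (hy : ∀ l < L, 0 < y l) (hΛ : ∀ l, 1 ≤ Λ l)
    (hy' : 0 < y') :
    iid ℤ ρ {x | ∃ k ≤ 2 ^ L, ∃ j, ∑ l ∈ Finset.range L, (11 * y l * Λ l +
        8 * (√((2 : ℝ) ^ L * Λ l) * (a₂ * ((2 : ℝ) ^ l) ^ (-A)))) + y' <
        |∑ i ∈ Finset.range k, ∑ m ∈ Finset.range R, D (a + i) m x j|} ≤
      ENNReal.ofReal (∑ l ∈ Finset.range L, (4 * p * Real.exp (-Λ l) + 3 * ((2 : ℝ) ^ (L - l - 1) *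
        (chainConst q c * √((2 : ℝ) ^ (l + 1)) * (a₁ * ((2 : ℝ) ^ l) ^ (-A)) / y l) ^ q)) +
        (chainConst q c * √((2 : ℝ) ^ L) * (a₁ * ((2 : ℝ) ^ L) ^ (-A)) / y') ^ q) := by
  have hCn : 0 ≤ chainConst q c := chainConst_nonneg hq
  let I : ℕ → Finset ℕ := fun l => {m ∈ Finset.range R | 2 ^ l ≤ m + 1 ∧ m + 1 < 2 ^ (l + 1)}
  let J : Finset ℕ := {m ∈ Finset.range R | 2 ^ L ≤ m + 1}
  have hIle : ∀ {γ : ℕ → ℝ} (_ : ∀ m, 0 ≤ γ m) (l : ℕ), ∑ m ∈ I l, γ m ≤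
      ∑ m ∈ Finset.range R with 2 ^ l ≤ m + 1, γ m := fun hγ l => by
    refine Finset.sum_le_sum_of_subset_of_nonneg (fun m hm => ?_) fun m _ _ => hγ m
    simp only [I, Finset.mem_filter] at hm ⊢
    exact ⟨hm.1, hm.2.1⟩
  have hlev : ∀ l ∈ Finset.range L, iid ℤ ρ {x | ∃ k ≤ 2 ^ L, ∃ j, 11 * y l * Λ l +
      8 * (√((2 : ℝ) ^ L * Λ l) * (a₂ * ((2 : ℝ) ^ l) ^ (-A))) <
        |∑ i ∈ Finset.range k, ∑ m ∈ I l, D (a + i) m x j|} ≤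
      ENNReal.ofReal (4 * p * Real.exp (-Λ l) + 3 * ((2 : ℝ) ^ (L - l - 1) *
        (chainConst q c * √((2 : ℝ) ^ (l + 1)) * (a₁ * ((2 : ℝ) ^ l) ^ (-A)) / y l) ^ q)) := by
    intro l hl
    have hl' := Finset.mem_range.1 hl
    have hyl := hy l hl'
    refine le_trans (measure_mono ?_) ((hD.level_deviation hV hq hc hα hβ hb hb2 a hl' (I l)
      (fun m hm => (Finset.mem_filter.1 hm).2.2) hyl (hΛ l)).trans (ENNReal.ofReal_le_ofReal ?_))
    · rintro x ⟨k, hk, j, hx⟩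
      refine ⟨k, hk, j, lt_of_le_of_lt ?_ hx⟩
      gcongr
      exact (hIle hβ l).trans (htb l R)
    · have : 0 ≤ ∑ m ∈ I l, α m := Finset.sum_nonneg fun m _ => hα m
      gcongr
      exact (hIle hα l).trans (hta l R)
  have htop : iid ℤ ρ {x | ∃ k ≤ 2 ^ L, ∃ j : Fin p, y' <
      |∑ i ∈ Finset.range k, ∑ m ∈ J, D (a + i) m x j|} ≤
      ENNReal.ofReal ((chainConst q c * √((2 : ℝ) ^ L) * (a₁ * ((2 : ℝ) ^ L) ^ (-A)) / y') ^ q) := by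
    refine le_trans (measure_mono ?_) ((hD.measure_max_le hV hq hc hα hb J a L hy').trans
      (ENNReal.ofReal_le_ofReal ?_))
    · rintro x ⟨k, hk, j, hx⟩
      refine ⟨k, hk, hx.trans_le ?_⟩
      have := PiLp.norm_apply_le (∑ i ∈ Finset.range k, ∑ m ∈ J, D (a + i) m x) j
      simpa only [WithLp.ofLp_sum, Finset.sum_apply, Real.norm_eq_abs] using this
    · have : 0 ≤ ∑ m ∈ J, α m := Finset.sum_nonneg fun m _ => hα m
      gcongr
      exact hta L R
  have hsub : {x | ∃ k ≤ 2 ^ L, ∃ j, ∑ l ∈ Finset.range L, (11 * y l * Λ l +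
        8 * (√((2 : ℝ) ^ L * Λ l) * (a₂ * ((2 : ℝ) ^ l) ^ (-A)))) + y' <
        |∑ i ∈ Finset.range k, ∑ m ∈ Finset.range R, D (a + i) m x j|} ⊆
      (⋃ l ∈ Finset.range L, {x | ∃ k ≤ 2 ^ L, ∃ j, 11 * y l * Λ l +
      8 * (√((2 : ℝ) ^ L * Λ l) * (a₂ * ((2 : ℝ) ^ l) ^ (-A))) <
        |∑ i ∈ Finset.range k, ∑ m ∈ I l, D (a + i) m x j|}) ∪
      {x | ∃ k ≤ 2 ^ L, ∃ j : Fin p, y' <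
      |∑ i ∈ Finset.range k, ∑ m ∈ J, D (a + i) m x j|} := by
    rintro x ⟨k, hk, j, hx⟩
    by_contra hcon
    simp only [Set.mem_union, Set.mem_iUnion, not_or, Set.mem_ofPred_eq] at hcon
    obtain ⟨h0, h1⟩ := hcon
    push Not at h0 h1
    have hdec : ∑ i ∈ Finset.range k, ∑ m ∈ Finset.range R, D (a + i) m x j =
        ∑ l ∈ Finset.range L, ∑ i ∈ Finset.range k, ∑ m ∈ I l, D (a + i) m x j +
        ∑ i ∈ Finset.range k, ∑ m ∈ J, D (a + i) m x j := by
      rw [Finset.sum_comm (s := Finset.range L), ← Finset.sum_add_distrib]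
      exact Finset.sum_congr rfl fun i _ => sum_range_eq_sum_dyadic _ R L
    have h2 : |∑ l ∈ Finset.range L, ∑ i ∈ Finset.range k, ∑ m ∈ I l, D (a + i) m x j| ≤
        ∑ l ∈ Finset.range L, (11 * y l * Λ l +
          8 * (√((2 : ℝ) ^ L * Λ l) * (a₂ * ((2 : ℝ) ^ l) ^ (-A)))) :=
      (Finset.abs_sum_le_sum_abs _ _).trans (Finset.sum_le_sum fun l hl => h0 l hl k hk j)
    rw [hdec] at hx
    have h3 := abs_add_le (∑ l ∈ Finset.range L, ∑ i ∈ Finset.range k, ∑ m ∈ I l, D (a + i) m x j)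
      (∑ i ∈ Finset.range k, ∑ m ∈ J, D (a + i) m x j)
    linarith [h1 k hk j]
  have ha₁ : 0 ≤ a₁ := by
    have h1 := hta 0 0
    simpa using h1
  have hnn : ∀ l ∈ Finset.range L, 0 ≤ 4 * p * Real.exp (-Λ l) + 3 * ((2 : ℝ) ^ (L - l - 1) *
        (chainConst q c * √((2 : ℝ) ^ (l + 1)) * (a₁ * ((2 : ℝ) ^ l) ^ (-A)) / y l) ^ q) :=
      fun l hl => by
    have := hy l (Finset.mem_range.1 hl)
    positivity
  refine (measure_mono hsub).trans ((measure_union_le _ _).trans ((add_le_add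
    ((measure_biUnion_finset_le _ _).trans (Finset.sum_le_sum hlev)) htop).trans (le_of_eq ?_)))
  rw [ENNReal.ofReal_add (Finset.sum_nonneg hnn) (by positivity),
    ENNReal.ofReal_sum_of_nonneg hnn]

/-- Deviation of the partial sums over a window of length `2 ^ L`, for an array of vectors. -/
theorem exists_row_deviation {q A c : ℝ} (hq : 2 < q) (hA : 0 < A) (hc : 0 ≤ c) :
    ∃ C : ℝ, 0 < C ∧ ∀ {E : Type*} [MeasurableSpace E] {ρ : Measure E} [IsProbabilityMeasure ρ]
      {p : ℕ} {s : ℝ≥0∞} [Fact (1 ≤ s)] {D : ℤ → ℕ → (ℤ → E) → PiLp s fun _ : Fin p => ℝ},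
      LagArray ρ D → IsTwoSmooth (PiLp s fun _ : Fin p => ℝ) q c →
      ∀ {α β : ℕ → ℝ}, (∀ m, 0 ≤ α m) → (∀ m, 0 ≤ β m) →
      (∀ i m, eLpNorm (D i m) (ENNReal.ofReal q) (iid ℤ ρ) ≤ ENNReal.ofReal (α m)) →
      (∀ i m k, eLpNorm (fun x => D i m x k) 2 (iid ℤ ρ) ≤ ENNReal.ofReal (β m)) →
      ∀ {a₁ a₂ : ℝ},
      (∀ l R : ℕ, ∑ m ∈ Finset.range R with 2 ^ l ≤ m + 1, α m ≤ a₁ * ((2 : ℝ) ^ l) ^ (-A)) →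
      (∀ l R : ℕ, ∑ m ∈ Finset.range R with 2 ^ l ≤ m + 1, β m ≤ a₂ * ((2 : ℝ) ^ l) ^ (-A)) →
      ∀ (a : ℤ) (L R : ℕ) (u : ℝ), 3 ≤ u → (2 : ℝ) ^ L ≤ 16 * u → ∀ {h Λ : ℝ}, 0 < h → 1 ≤ Λ →
      iid ℤ ρ {x | ∃ k ≤ 2 ^ L, ∃ j, C * (h + a₂ * √(u * Λ)) <
        |∑ i ∈ Finset.range k, ∑ m ∈ Finset.range R, D (a + i) m x j|} ≤
      ENNReal.ofReal (C * (p * Real.exp (-Λ) + (a₁ * Λ / h) ^ q * varpi q A u)) := by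
  obtain ⟨C₁, hC₁0, hC₁⟩ := exists_level_allocation (A := A) hq
  obtain ⟨C₂, hC₂0, hC₂⟩ := exists_sum_geometric_mul_rpow_le hA 1
  set Cc := chainConst q c with hCc
  have hCn : 0 ≤ Cc := chainConst_nonneg hq
  have hq0 : 0 < q := by linarith
  set C₃ : ℝ := 3 * (Cc * √2) ^ q + Cc ^ q + 1 with hC₃
  have hC₃0 : 0 < C₃ := by positivity
  refine ⟨23 + 32 * C₂ + 16 + C₃ * C₁, by positivity, ?_⟩
  intro E _ ρ _ p s _ D hD hV α β hα hβ hb hb2 a₁ a₂ hta htb a L R u hu hLu h Λ hh hΛ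
  obtain ⟨w, hw0, hw1, hw2⟩ := hC₁ L u hu hLu
  have ha₁ : 0 ≤ a₁ := by simpa using hta 0 0
  have ha₂ : 0 ≤ a₂ := by simpa using htb 0 0
  have he : ∀ l, 1 ≤ levelWeight L l := one_le_levelWeight L
  -- The truncation level is chosen so that `y l * Λ l = h * w l`: level `l` spends exactly its
  -- share of `h`.
  have hdev := hD.dyadic_deviation hV hq hc hα hβ hb hb2 hta htb a L R
    (y := fun l => h * w l / (Λ * levelWeight L l)) (Λ := fun l => Λ * levelWeight L l) (y' := h)
    (fun l hl => by have := hw0 l hl; have := he l; positivity)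
    (fun l => one_le_mul_of_one_le_of_one_le hΛ (he l)) hh
  refine le_trans (measure_mono ?_) (hdev.trans (ENNReal.ofReal_le_ofReal ?_))
  · rintro x ⟨k, hk, j, hx⟩
    refine ⟨k, hk, j, lt_of_le_of_lt ?_ hx⟩
    -- The extra factor `1 + l` in the Gaussian part is harmless, since its sum against `(2^l)^(-A)`
    -- converges for `A > 0`.
    have h1 : ∀ l ∈ Finset.range L, 11 * (h * w l / (Λ * levelWeight L l)) *
        (Λ * levelWeight L l) + 8 * (√((2 : ℝ) ^ L * (Λ * levelWeight L l)) *
          (a₂ * ((2 : ℝ) ^ l) ^ (-A))) ≤ 11 * h * w l +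
          32 * (a₂ * √(u * Λ)) * (((2 : ℝ) ^ l) ^ (-A) * (1 + (l : ℝ)) ^ (1 : ℝ)) := fun l _ => by
      have hel := he l
      have h2 : 11 * (h * w l / (Λ * levelWeight L l)) * (Λ * levelWeight L l) = 11 * h * w l := by
        field_simp
      have h3 : √((2 : ℝ) ^ L * (Λ * levelWeight L l)) ≤ 4 * √(u * Λ) * (1 + l) := by
        have h4 : (2 : ℝ) ^ L * (Λ * levelWeight L l) ≤ (4 * (1 + l)) ^ 2 * (u * Λ) := by
          have h5 := levelWeight_le_left L l
          have h6 : (1 : ℝ) + l ≤ (1 + l) ^ 2 := by nlinarith [Nat.cast_nonneg (α := ℝ) l]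
          calc (2 : ℝ) ^ L * (Λ * levelWeight L l) ≤ (16 * u) * (Λ * (1 + l) ^ 2) := by
                gcongr; exact h5.trans h6
            _ = _ := by ring
        refine (Real.sqrt_le_sqrt h4).trans (le_of_eq ?_)
        rw [Real.sqrt_mul (by positivity), Real.sqrt_sq (by positivity)]; ring
      rw [h2, Real.rpow_one]
      have h7 : √((2 : ℝ) ^ L * (Λ * levelWeight L l)) * (a₂ * ((2 : ℝ) ^ l) ^ (-A)) ≤
          4 * √(u * Λ) * (1 + l) * (a₂ * ((2 : ℝ) ^ l) ^ (-A)) := by gcongr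
      nlinarith
    calc _ ≤ ∑ l ∈ Finset.range L, (11 * h * w l +
          32 * (a₂ * √(u * Λ)) * (((2 : ℝ) ^ l) ^ (-A) * (1 + (l : ℝ)) ^ (1 : ℝ))) + h := by
          linarith [Finset.sum_le_sum h1]
      _ = 11 * h * ∑ l ∈ Finset.range L, w l + 32 * (a₂ * √(u * Λ)) *
          ∑ l ∈ Finset.range L, ((2 : ℝ) ^ l) ^ (-A) * (1 + (l : ℝ)) ^ (1 : ℝ) + h := by
          rw [Finset.sum_add_distrib, Finset.mul_sum, Finset.mul_sum]
      _ ≤ 11 * h * 2 + 32 * (a₂ * √(u * Λ)) * C₂ + h := by gcongr; exact hC₂ L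
      _ = 23 * h + 32 * C₂ * (a₂ * √(u * Λ)) := by ring
      _ ≤ _ := by
          have h8 : 0 ≤ a₂ * √(u * Λ) := by positivity
          have h9 : 0 < C₃ * C₁ := by positivity
          nlinarith [mul_pos hC₂0 hh, mul_pos h9 hh, mul_nonneg h9.le h8]
  · have hbase : ∀ (n : ℕ), √((2 : ℝ) ^ n) ^ q * ((((2 : ℝ) ^ n) ^ (-A)) ^ q) =
        ((2 : ℝ) ^ n) ^ (q / 2 - A * q) := fun n => by
      rw [Real.sqrt_eq_rpow, ← Real.rpow_mul (by positivity), ← Real.rpow_mul (by positivity),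
        ← Real.rpow_add (by positivity)]
      congr 1; ring
    have hpoly : ∀ l ∈ Finset.range L, (2 : ℝ) ^ (L - l - 1) * (Cc * √((2 : ℝ) ^ (l + 1)) *
        (a₁ * ((2 : ℝ) ^ l) ^ (-A)) / (h * w l / (Λ * levelWeight L l))) ^ q ≤
        (Cc * √2) ^ q * (a₁ * Λ / h) ^ q * ((2 : ℝ) ^ L * (((2 : ℝ) ^ l) ^ (q / 2 - A * q - 1) *
          (levelWeight L l / w l) ^ q)) := fun l hl => by
      have hl' := Finset.mem_range.1 hl
      have hwl := hw0 l hl'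
      have hel := he l
      have h1 : Cc * √((2 : ℝ) ^ (l + 1)) * (a₁ * ((2 : ℝ) ^ l) ^ (-A)) /
          (h * w l / (Λ * levelWeight L l)) = (Cc * √2) * (a₁ * Λ / h) *
            ((√((2 : ℝ) ^ l) * ((2 : ℝ) ^ l) ^ (-A)) * (levelWeight L l / w l)) := by
        rw [pow_succ, Real.sqrt_mul (by positivity)]
        field_simp
      rw [h1, Real.mul_rpow (x := Cc * √2 * (a₁ * Λ / h)) (by positivity) (by positivity),
        Real.mul_rpow (x := Cc * √2) (by positivity) (by positivity),
        Real.mul_rpow (x := √((2 : ℝ) ^ l) * ((2 : ℝ) ^ l) ^ (-A)) (by positivity) (by positivity),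
        Real.mul_rpow (x := √((2 : ℝ) ^ l)) (by positivity) (by positivity), hbase]
      have h2 : (2 : ℝ) ^ (L - l - 1) * ((2 : ℝ) ^ l) ^ (q / 2 - A * q) ≤
          2 ^ L * ((2 : ℝ) ^ l) ^ (q / 2 - A * q - 1) := by
        rw [Real.rpow_sub_one (by positivity),
          show (2 : ℝ) ^ L = 2 ^ (L - l - 1) * (2 ^ l * 2) by
            rw [← pow_succ, ← pow_add]; congr 1; omega]
        have h3 : 0 ≤ (2 : ℝ) ^ (L - l - 1) * ((2 : ℝ) ^ l) ^ (q / 2 - A * q) := by positivity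
        calc _ ≤ 2 * ((2 : ℝ) ^ (L - l - 1) * ((2 : ℝ) ^ l) ^ (q / 2 - A * q)) := by linarith
          _ = _ := by field_simp
      have h4 : 0 ≤ (Cc * √2) ^ q * (a₁ * Λ / h) ^ q := by positivity
      have h5 : 0 ≤ (levelWeight L l / w l) ^ q := by positivity
      calc _ = (Cc * √2) ^ q * (a₁ * Λ / h) ^ q * (((2 : ℝ) ^ (L - l - 1) *
            ((2 : ℝ) ^ l) ^ (q / 2 - A * q)) * (levelWeight L l / w l) ^ q) := by ring
        _ ≤ (Cc * √2) ^ q * (a₁ * Λ / h) ^ q * ((2 ^ L * ((2 : ℝ) ^ l) ^ (q / 2 - A * q - 1)) *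
            (levelWeight L l / w l) ^ q) := by gcongr
        _ = _ := by ring
    have htop : (Cc * √((2 : ℝ) ^ L) * (a₁ * ((2 : ℝ) ^ L) ^ (-A)) / h) ^ q ≤
        Cc ^ q * (a₁ * Λ / h) ^ q * ((2 : ℝ) ^ L) ^ (q / 2 - A * q) := by
      have h1 : Cc * √((2 : ℝ) ^ L) * (a₁ * ((2 : ℝ) ^ L) ^ (-A)) / h =
          Cc * (a₁ / h) * (√((2 : ℝ) ^ L) * ((2 : ℝ) ^ L) ^ (-A)) := by ring
      rw [h1, Real.mul_rpow (by positivity) (by positivity),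
        Real.mul_rpow (by positivity) (by positivity), Real.mul_rpow (by positivity) (by positivity),
        hbase]
      gcongr
      exact le_mul_of_one_le_right ha₁ hΛ
    set W := ∑ l ∈ Finset.range L, ((2 : ℝ) ^ l) ^ (q / 2 - A * q - 1) *
      (levelWeight L l / w l) ^ q with hW
    have hW0 : 0 ≤ W := Finset.sum_nonneg fun l hl => by
      have := hw0 l (Finset.mem_range.1 hl); have := he l; positivity
    have hexp := sum_exp_neg_levelWeight_le hΛ L
    have hP : 0 ≤ (a₁ * Λ / h) ^ q := by positivity
    have hsum : ∑ l ∈ Finset.range L, (4 * (p : ℝ) * Real.exp (-(Λ * levelWeight L l)) +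
        3 * ((2 : ℝ) ^ (L - l - 1) * (Cc * √((2 : ℝ) ^ (l + 1)) * (a₁ * ((2 : ℝ) ^ l) ^ (-A)) /
          (h * w l / (Λ * levelWeight L l))) ^ q)) ≤ 16 * (p * Real.exp (-Λ)) +
          3 * ((Cc * √2) ^ q * (a₁ * Λ / h) ^ q * ((2 : ℝ) ^ L * W)) := by
      rw [Finset.sum_add_distrib, ← Finset.mul_sum, ← Finset.mul_sum]
      have h1 := Finset.sum_le_sum hpoly
      rw [← Finset.mul_sum, ← Finset.mul_sum] at h1
      have h2 : (0 : ℝ) ≤ 4 * p := by positivity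
      nlinarith
    have hfin : 3 * ((Cc * √2) ^ q * (a₁ * Λ / h) ^ q * ((2 : ℝ) ^ L * W)) +
        Cc ^ q * (a₁ * Λ / h) ^ q * ((2 : ℝ) ^ L) ^ (q / 2 - A * q) ≤
        C₃ * C₁ * ((a₁ * Λ / h) ^ q * varpi q A u) := by
      have h1 : 0 ≤ (2 : ℝ) ^ L * W := by positivity
      have h2 : 0 ≤ ((2 : ℝ) ^ L) ^ (q / 2 - A * q) := by positivity
      have h3 : 3 * (Cc * √2) ^ q ≤ C₃ := by rw [hC₃]; linarith [show 0 ≤ Cc ^ q by positivity]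
      have h4 : Cc ^ q ≤ C₃ := by rw [hC₃]; linarith [show 0 ≤ (Cc * √2) ^ q by positivity]
      calc _ = (a₁ * Λ / h) ^ q * (3 * (Cc * √2) ^ q * ((2 : ℝ) ^ L * W) +
            Cc ^ q * ((2 : ℝ) ^ L) ^ (q / 2 - A * q)) := by ring
        _ ≤ (a₁ * Λ / h) ^ q * (C₃ * ((2 : ℝ) ^ L * W) + C₃ * ((2 : ℝ) ^ L) ^ (q / 2 - A * q)) := by
            gcongr
        _ = (a₁ * Λ / h) ^ q * (C₃ * ((2 : ℝ) ^ L * W + ((2 : ℝ) ^ L) ^ (q / 2 - A * q))) := by ring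
        _ ≤ (a₁ * Λ / h) ^ q * (C₃ * (C₁ * varpi q A u)) := by gcongr
        _ = _ := by ring
    have hpe : 0 ≤ (p : ℝ) * Real.exp (-Λ) := by positivity
    have hvp : 0 ≤ varpi q A u := by
      have h1 : 0 ≤ C₁ * varpi q A u := le_trans (by positivity) hw2
      exact nonneg_of_mul_nonneg_right h1 hC₁0
    have hPv : 0 ≤ (a₁ * Λ / h) ^ q * varpi q A u := by positivity
    have hCC : 0 ≤ C₃ * C₁ := by positivity
    nlinarith [mul_nonneg hC₂0.le hpe, mul_nonneg hCC hpe, mul_nonneg hC₂0.le hPv]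

end RowDeviation

/-! ### Lag increments of the products of a causal process -/

section CausalArray

variable {E : Type*} [MeasurableSpace E] {ρ : Measure E} [IsProbabilityMeasure ρ] {p : ℕ}

/-- A causal process `g i j`, with index `i` and coordinate `j`, with uniformly bounded
`L^{2q}` norms. -/
structure CausalArray (ρ : Measure E) [IsProbabilityMeasure ρ] (q v : ℝ)
    (g : ℤ → Fin p → (ℤ → E) → ℝ) : Prop where
  meas : ∀ i j, Measurable (g i j)
  dep : ∀ i j, DependsOn (g i j) (Set.Iic i)
  moment : ∀ i j, eLpNorm (g i j) (ENNReal.ofReal (2 * q)) (iid ℤ ρ) ≤ ENNReal.ofReal v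

/-- The kernel which is integrated to give the lag increments. -/
def lagKernel (s : ℝ≥0∞) (g : ℤ → Fin p → (ℤ → E) → ℝ) (j : Fin p) (i : ℤ) (m : ℕ)
    (z : (ℤ → E) × (ℤ → E)) : PiLp s fun _ : Fin p => ℝ :=
  (g i j (mix (Set.Ici (i - m)) z.1 z.2) - g i j (mix (Set.Ioi (i - m)) z.1 z.2)) •
    WithLp.toLp s fun k => (1 / 2 : ℝ) *
      (g i k (mix (Set.Ici (i - m)) z.1 z.2) + g i k (mix (Set.Ioi (i - m)) z.1 z.2))

/-- The share of row `j` in the projection at lag `m` of the products `g i j * g i k`. -/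
def lagIncrement (s : ℝ≥0∞) [Fact (1 ≤ s)] (ρ : Measure E) [IsProbabilityMeasure ρ]
    (g : ℤ → Fin p → (ℤ → E) → ℝ) (j : Fin p) (i : ℤ) (m : ℕ) (x : ℤ → E) :
    PiLp s fun _ : Fin p => ℝ :=
  ∫ y, lagKernel s g j i m (x, y) ∂(iid ℤ ρ)

/-- The distance of coordinate `j` at index `i` to its version with an independent copy
of the innovation at lag `m`. -/
def coupledDist (ρ : Measure E) [IsProbabilityMeasure ρ] (g : ℤ → Fin p → (ℤ → E) → ℝ) (a : ℝ)
    (i : ℤ) (m : ℕ) (j : Fin p) : ℝ≥0∞ :=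
  eLpNorm (fun z : (ℤ → E) × (ℤ → E) => g i j z.1 -
    g i j (Function.update z.1 (i - m) (z.2 (i - m)))) (ENNReal.ofReal a) ((iid ℤ ρ).prod (iid ℤ ρ))

theorem norm_toLp_le_sum_rpow {s : ℝ≥0∞} [Fact (1 ≤ s)] {r : ℝ} (hr : 0 < r)
    (hrs : r ≤ s.toReal) (f : Fin p → ℝ) :
    ‖(WithLp.toLp s f : PiLp s fun _ : Fin p => ℝ)‖ ^ r ≤ ∑ k, |f k| ^ r := by
  have hs0 : 0 < s.toReal := by linarith
  rw [PiLp.norm_eq_sum hs0]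
  set T := ∑ k, |f k| ^ r with hT
  have hT0 : 0 ≤ T := Finset.sum_nonneg fun k _ => by positivity
  have h1 : ∀ k, |f k| ≤ T ^ (1 / r) := fun k => by
    rw [one_div, Real.le_rpow_inv_iff_of_pos (abs_nonneg _) hT0 hr]
    exact Finset.single_le_sum (f := fun k => |f k| ^ r) (fun k _ => by positivity)
      (Finset.mem_univ k)
  have h2 : ∑ k, ‖f k‖ ^ s.toReal ≤ T ^ (s.toReal / r) := by
    have h3 : ∀ k ∈ Finset.univ, ‖f k‖ ^ s.toReal ≤ |f k| ^ r * T ^ ((s.toReal - r) / r) :=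
      fun k _ => by
      rw [Real.norm_eq_abs]
      calc |f k| ^ s.toReal = |f k| ^ r * |f k| ^ (s.toReal - r) := by
            rw [← Real.rpow_add_of_nonneg (abs_nonneg _) hr.le (by linarith)]
            congr 1; ring
        _ ≤ |f k| ^ r * (T ^ (1 / r)) ^ (s.toReal - r) := by
            gcongr
            exact h1 k
        _ = _ := by rw [← Real.rpow_mul hT0]; congr 2; ring
    refine (Finset.sum_le_sum h3).trans_eq ?_
    rw [← Finset.sum_mul, ← hT]
    nth_rewrite 1 [← Real.rpow_one T]
    rw [← Real.rpow_add_of_nonneg hT0 zero_le_one (div_nonneg (by linarith) hr.le)]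
    congr 1; field_simp; ring
  rw [← Real.rpow_mul (Finset.sum_nonneg fun k _ => by positivity)]
  have h4 : 1 / s.toReal * r = (s.toReal / r)⁻¹ := by field_simp
  rw [h4]
  refine (Real.rpow_le_rpow (Finset.sum_nonneg fun k _ => by positivity) h2 (by positivity)).trans_eq ?_
  rw [← Real.rpow_mul hT0, mul_inv_cancel₀ (by positivity), Real.rpow_one]

/-- For `r ≤ s` the `ℓ_s` norm is at most the `ℓ_r` norm, so the price for a whole vector is
`p^(1/r)`. At `r = 2q` this is only half of the power of `p` contained in `J`. -/
theorem eLpNorm_toLp_le {X : Type*} [MeasurableSpace X] {μ : Measure X} {s : ℝ≥0∞} [Fact (1 ≤ s)]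
    {r : ℝ} (hr : 0 < r) (hrs : r ≤ s.toReal) {f : X → Fin p → ℝ} {v : ℝ} (hv : 0 ≤ v)
    (hf : ∀ k, AEMeasurable (fun x => f x k) μ)
    (hb : ∀ k, eLpNorm (fun x => f x k) (ENNReal.ofReal r) μ ≤ ENNReal.ofReal v) :
    eLpNorm (fun x => (WithLp.toLp s (f x) : PiLp s fun _ : Fin p => ℝ)) (ENNReal.ofReal r) μ ≤
      ENNReal.ofReal ((p : ℝ) ^ (1 / r) * v) := by
  have hb' : ∀ k, ∫⁻ x, ‖f x k‖ₑ ^ r ∂μ ≤ ENNReal.ofReal (v ^ r) := fun k => by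
    have := ENNReal.rpow_le_rpow (hb k) hr.le
    rwa [eLpNorm_ofReal_rpow hr, ENNReal.ofReal_rpow_of_nonneg hv hr.le] at this
  rw [← ENNReal.rpow_le_rpow_iff hr, eLpNorm_ofReal_rpow hr,
    ENNReal.ofReal_rpow_of_nonneg (by positivity) hr.le,
    Real.mul_rpow (by positivity) hv, ← Real.rpow_mul (by positivity), one_div,
    inv_mul_cancel₀ hr.ne', Real.rpow_one]
  calc _ ≤ ∫⁻ x, ∑ k, ‖f x k‖ₑ ^ r ∂μ := by
        refine lintegral_mono fun x => ?_
        have h1 := norm_toLp_le_sum_rpow hr hrs (f x)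
        have h2 := ENNReal.ofReal_le_ofReal h1
        rw [ENNReal.ofReal_sum_of_nonneg (fun k _ => by positivity),
          ← ENNReal.ofReal_rpow_of_nonneg (norm_nonneg _) hr.le, ofReal_norm] at h2
        refine h2.trans_eq (Finset.sum_congr rfl fun k _ => ?_)
        rw [← ENNReal.ofReal_rpow_of_nonneg (abs_nonneg _) hr.le, ← Real.norm_eq_abs, ofReal_norm]
    _ = ∑ k, ∫⁻ x, ‖f x k‖ₑ ^ r ∂μ := by
        rw [lintegral_finsetSum' _ fun k _ => ((hf k).enorm.pow_const r)]
    _ ≤ ∑ k : Fin p, ENNReal.ofReal (v ^ r) := Finset.sum_le_sum fun k _ => hb' k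
    _ = _ := by
        rw [Finset.sum_const, Finset.card_univ, Fintype.card_fin, nsmul_eq_mul,
          ENNReal.ofReal_mul (by positivity), ENNReal.ofReal_natCast]

/-- The pair of interpolations between two independent copies at lag `m` has the law of
a point and its version with one resampled coordinate. -/
theorem update_mix_swap (u : ℤ) (x y : ℤ → E) :
    Function.update (mix (Set.Ici u) x y) u (mix (Set.Ici u) y x u) = mix (Set.Ioi u) x y := by
  ext i
  rcases lt_trichotomy i u with h | rfl | h
  · rw [Function.update_of_ne h.ne, mix_of_notMem _ _ (by simpa using h),
      mix_of_notMem _ _ (by simpa using h.le)]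
  · rw [Function.update_self, mix_of_mem _ _ (by simp), mix_of_notMem _ _ (by simp)]
  · rw [Function.update_of_ne h.ne', mix_of_mem _ _ (by simpa using h.le),
      mix_of_mem _ _ (by simpa using h)]

theorem eLpNorm_mix_sub_le {f : (ℤ → E) → ℝ} (hf : Measurable f) (u : ℤ) (a : ℝ) :
    eLpNorm (fun z : (ℤ → E) × (ℤ → E) => f (mix (Set.Ici u) z.1 z.2) -
      f (mix (Set.Ioi u) z.1 z.2)) (ENNReal.ofReal a) ((iid ℤ ρ).prod (iid ℤ ρ)) =
    eLpNorm (fun z : (ℤ → E) × (ℤ → E) => f z.1 - f (Function.update z.1 u (z.2 u)))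
      (ENNReal.ofReal a) ((iid ℤ ρ).prod (iid ℤ ρ)) := by
  have hm : Measurable fun z : (ℤ → E) × (ℤ → E) => Function.update z.1 u (z.2 u) := by
    refine measurable_pi_lambda _ fun i => ?_
    by_cases hi : i = u
    · subst hi; simp only [Function.update_self]; fun_prop
    · simp only [Function.update_of_ne hi]; fun_prop
  have hd : Measurable fun z : (ℤ → E) × (ℤ → E) => f z.1 - f (Function.update z.1 u (z.2 u)) :=
    (hf.comp measurable_fst).sub (hf.comp hm)
  rw [← eLpNorm_comp_measurePreserving hd.aestronglyMeasurable
    (measurePreserving_mix_swap ρ (Set.Ici u))]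
  congr 1 with z
  simp only [Function.comp_apply, update_mix_swap]

variable {q v : ℝ} {g : ℤ → Fin p → (ℤ → E) → ℝ} {s : ℝ≥0∞} [Fact (1 ≤ s)]

theorem CausalArray.stronglyMeasurable_lagKernel (hg : CausalArray ρ q v g) (j : Fin p) (i : ℤ)
    (m : ℕ) : StronglyMeasurable (lagKernel s g j i m) := by
  have h := hg.meas i
  unfold lagKernel
  have hφ : Measurable fun z : (ℤ → E) × (ℤ → E) => g i j (mix (Set.Ici (i - m)) z.1 z.2) -
      g i j (mix (Set.Ioi (i - m)) z.1 z.2) := by fun_prop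
  refine hφ.stronglyMeasurable.smul ?_
  refine (PiLp.continuous_toLp s _).comp_stronglyMeasurable (Measurable.stronglyMeasurable ?_)
  fun_prop

theorem CausalArray.eLpNorm_mix_le (hg : CausalArray ρ q v g) (hv : 0 ≤ v) (t t' : Set ℤ) (i : ℤ)
    (k : Fin p) (hq : 1 ≤ 2 * q) :
    eLpNorm (fun z : (ℤ → E) × (ℤ → E) => (1 / 2 : ℝ) * (g i k (mix t z.1 z.2) +
      g i k (mix t' z.1 z.2))) (ENNReal.ofReal (2 * q)) ((iid ℤ ρ).prod (iid ℤ ρ)) ≤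
      ENNReal.ofReal v := by
  have h := hg.meas i k
  have h1 : ∀ t : Set ℤ, eLpNorm (fun z : (ℤ → E) × (ℤ → E) => g i k (mix t z.1 z.2))
      (ENNReal.ofReal (2 * q)) ((iid ℤ ρ).prod (iid ℤ ρ)) ≤ ENNReal.ofReal v := fun t =>
    (eLpNorm_comp_measurePreserving h.aestronglyMeasurable (measurePreserving_mix ρ t)).trans_le
      (hg.moment i k)
  have h2 := eLpNorm_const_smul (1 / 2 : ℝ) (fun z : (ℤ → E) × (ℤ → E) => g i k (mix t z.1 z.2) +
      g i k (mix t' z.1 z.2)) (ENNReal.ofReal (2 * q)) ((iid ℤ ρ).prod (iid ℤ ρ))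
  refine h2.trans_le ?_
  have h3 := eLpNorm_add_le (μ := (iid ℤ ρ).prod (iid ℤ ρ)) (p := ENNReal.ofReal (2 * q))
    (f := fun z : (ℤ → E) × (ℤ → E) => g i k (mix t z.1 z.2))
    (g := fun z : (ℤ → E) × (ℤ → E) => g i k (mix t' z.1 z.2))
    (Measurable.aestronglyMeasurable (by fun_prop)) (Measurable.aestronglyMeasurable (by fun_prop))
    (ENNReal.one_le_ofReal.2 hq)
  refine (mul_le_mul_right (h3.trans (add_le_add (h1 t) (h1 t'))) _).trans_eq ?_
  rw [← ENNReal.ofReal_add hv hv, Real.enorm_eq_ofReal (by norm_num), ← ENNReal.ofReal_mul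
    (by norm_num)]
  congr 1; ring

/-- Hölder's inequality with exponents `2q` and `2q`: the scalar difference gives the dependence of
coordinate `j`, and the vector of means gives moments of all coordinates. -/
theorem CausalArray.eLpNorm_lagKernel_le (hg : CausalArray ρ q v g) (hq : 2 < q) (hv : 0 ≤ v)
    (hqs : 2 * q ≤ s.toReal) (j : Fin p) (i : ℤ) (m : ℕ) {θ : ℝ} (hθ0 : 0 ≤ θ)
    (hθ : coupledDist ρ g (2 * q) i m j ≤ ENNReal.ofReal θ) :
    eLpNorm (lagKernel s g j i m) (ENNReal.ofReal q) ((iid ℤ ρ).prod (iid ℤ ρ)) ≤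
      ENNReal.ofReal (θ * ((p : ℝ) ^ (1 / (2 * q)) * v)) := by
  have h := hg.meas i
  have : ENNReal.HolderTriple (ENNReal.ofReal (2 * q)) (ENNReal.ofReal (2 * q))
      (ENNReal.ofReal q) := by
    constructor
    rw [← ENNReal.ofReal_inv_of_pos (by linarith), ← ENNReal.ofReal_inv_of_pos (by linarith),
      ← ENNReal.ofReal_add (by positivity) (by positivity)]
    congr 1; field_simp; ring
  refine (eLpNorm_smul_le_mul_eLpNorm (p := ENNReal.ofReal (2 * q)) (q := ENNReal.ofReal (2 * q))
    (f := fun z : (ℤ → E) × (ℤ → E) => (WithLp.toLp s fun k => (1 / 2 : ℝ) *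
      (g i k (mix (Set.Ici (i - m)) z.1 z.2) + g i k (mix (Set.Ioi (i - m)) z.1 z.2)) :
        PiLp s fun _ : Fin p => ℝ))
    (φ := fun z : (ℤ → E) × (ℤ → E) => g i j (mix (Set.Ici (i - m)) z.1 z.2) -
      g i j (mix (Set.Ioi (i - m)) z.1 z.2))
    ((PiLp.continuous_toLp s _).comp_stronglyMeasurable (Measurable.stronglyMeasurable
      (by fun_prop))).aestronglyMeasurable
    (Measurable.aestronglyMeasurable (by fun_prop))).trans ?_
  rw [eLpNorm_mix_sub_le (h j), ENNReal.ofReal_mul hθ0]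
  refine mul_le_mul' hθ ?_
  exact eLpNorm_toLp_le (by linarith) hqs hv (fun k => Measurable.aemeasurable (by fun_prop))
    fun k => hg.eLpNorm_mix_le hv _ _ i k (by linarith)

/-- Second moments of single entries follow from Hölder's inequality with exponents `4` and `4`,
without any power of `p`. This is why the Gaussian part of the rate contains only `N_{X,4}`. -/
theorem CausalArray.eLpNorm_lagKernel_apply_le (hg : CausalArray ρ q v g) (hq : 2 < q) (hv : 0 ≤ v)
    (j k : Fin p) (i : ℤ) (m : ℕ) {θ : ℝ} (hθ0 : 0 ≤ θ)
    (hθ : coupledDist ρ g 4 i m j ≤ ENNReal.ofReal θ) :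
    eLpNorm (fun z => lagKernel s g j i m z k) 2 ((iid ℤ ρ).prod (iid ℤ ρ)) ≤
      ENNReal.ofReal (θ * v) := by
  have h := hg.meas i
  have : ENNReal.HolderTriple (ENNReal.ofReal 4) (ENNReal.ofReal 4) 2 := by
    constructor
    rw [← ENNReal.ofReal_inv_of_pos (by norm_num), ← ENNReal.ofReal_add (by positivity)
      (by positivity), show (2 : ℝ≥0∞) = ENNReal.ofReal 2 by simp, ← ENNReal.ofReal_inv_of_pos
        (by norm_num)]
    congr 1; norm_num
  refine (eLpNorm_smul_le_mul_eLpNorm (p := ENNReal.ofReal 4) (q := ENNReal.ofReal 4)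
    (f := fun z : (ℤ → E) × (ℤ → E) => (1 / 2 : ℝ) * (g i k (mix (Set.Ici (i - m)) z.1 z.2) +
      g i k (mix (Set.Ioi (i - m)) z.1 z.2)))
    (φ := fun z : (ℤ → E) × (ℤ → E) => g i j (mix (Set.Ici (i - m)) z.1 z.2) -
      g i j (mix (Set.Ioi (i - m)) z.1 z.2)) (Measurable.aestronglyMeasurable (by fun_prop))
    (Measurable.aestronglyMeasurable (by fun_prop))).trans ?_
  rw [eLpNorm_mix_sub_le (h j), ENNReal.ofReal_mul hθ0]
  refine mul_le_mul' hθ (le_trans ?_ (hg.eLpNorm_mix_le hv (Set.Ici (i - m)) (Set.Ioi (i - m)) i k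
    (by linarith)))
  exact eLpNorm_le_eLpNorm_of_exponent_le (ENNReal.ofReal_le_ofReal (by linarith))
    (Measurable.aestronglyMeasurable (by fun_prop))

theorem CausalArray.coupledDist_le (hg : CausalArray ρ q v g) (hq : 2 < q) (hv : 0 ≤ v) (i : ℤ)
    (m : ℕ) (j : Fin p) : coupledDist ρ g (2 * q) i m j ≤ ENNReal.ofReal (2 * v) := by
  have h := hg.meas i j
  unfold coupledDist
  rw [← eLpNorm_mix_sub_le h]
  refine (eLpNorm_sub_le (Measurable.aestronglyMeasurable (by fun_prop))
    (Measurable.aestronglyMeasurable (by fun_prop))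
    (ENNReal.one_le_ofReal.2 (by linarith))).trans ?_
  have h1 : ∀ t : Set ℤ, eLpNorm (fun z : (ℤ → E) × (ℤ → E) => g i j (mix t z.1 z.2))
      (ENNReal.ofReal (2 * q)) ((iid ℤ ρ).prod (iid ℤ ρ)) ≤ ENNReal.ofReal v := fun t =>
    (eLpNorm_comp_measurePreserving h.aestronglyMeasurable (measurePreserving_mix ρ t)).trans_le
      (hg.moment i j)
  refine (add_le_add (h1 _) (h1 _)).trans_eq ?_
  rw [← ENNReal.ofReal_add hv hv, two_mul]

theorem CausalArray.integrable_lagKernel (hg : CausalArray ρ q v g) (hq : 2 < q) (hv : 0 ≤ v)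
    (hqs : 2 * q ≤ s.toReal) (j : Fin p) (i : ℤ) (m : ℕ) :
    Integrable (lagKernel s g j i m) ((iid ℤ ρ).prod (iid ℤ ρ)) := by
  have h1 := hg.eLpNorm_lagKernel_le hq hv hqs j i m (by positivity)
    (hg.coupledDist_le hq hv i m j)
  have h2 : MemLp (lagKernel s g j i m) (ENNReal.ofReal q) ((iid ℤ ρ).prod (iid ℤ ρ)) :=
    ⟨(hg.stronglyMeasurable_lagKernel j i m).aestronglyMeasurable, h1.trans_lt ENNReal.ofReal_lt_top⟩
  exact h2.integrable (by simpa using (by linarith : 1 ≤ q))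

/-- The average vanishes by antisymmetry: exchanging the coordinate `i - m` between the two copies
swaps the two interpolations in `lagKernel`, which reverses the sign of the difference and fixes the
sum. -/
theorem CausalArray.lagArray (hg : CausalArray ρ q v g) (hq : 2 < q) (hv : 0 ≤ v)
    (hqs : 2 * q ≤ s.toReal) (j : Fin p) :
    LagArray ρ (lagIncrement s ρ g j) where
  meas i m := (hg.stronglyMeasurable_lagKernel j i m).integral_prod_right'
  dep i m := by
    intro x y hxy
    have key : ∀ (t : Set ℤ), t ⊆ Set.Ici (i - m) → ∀ (k : Fin p) (z : ℤ → E),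
        g i k (mix t x z) = g i k (mix t y z) := fun t ht k z => by
      refine hg.dep i k fun l hl => ?_
      by_cases hlt : l ∈ t
      · rw [mix_of_mem _ _ hlt, mix_of_mem _ _ hlt]
        exact hxy l ⟨ht hlt, hl⟩
      · rw [mix_of_notMem _ _ hlt, mix_of_notMem _ _ hlt]
    unfold lagIncrement lagKernel
    simp only [key _ le_rfl, key _ Set.Ioi_subset_Ici_self]
  avg_zero i m := by
    set u : ℤ := i - m with hu
    have hint := hg.integrable_lagKernel hq hv hqs j i m
    have hΓ := hg.stronglyMeasurable_lagKernel (s := s) j i m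
    have hmp : MeasurePreserving (fun w : (ℤ → E) × ((ℤ → E) × (ℤ → E)) =>
        (mix (Set.Ioi u) w.1 w.2.1, w.2.2)) ((iid ℤ ρ).prod ((iid ℤ ρ).prod (iid ℤ ρ)))
        ((iid ℤ ρ).prod (iid ℤ ρ)) := by
      have h1 := (measurePreserving_mix ρ (Set.Ioi u)).prod (MeasurePreserving.id (iid ℤ ρ))
      have h2 := h1.comp (measurePreserving_prodAssoc (iid ℤ ρ) (iid ℤ ρ) (iid ℤ ρ)).symm
      exact h2
    have hI := (hmp.integrable_comp_of_integrable hint).prod_right_ae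
    filter_upwards [hI] with x hx
    have hx' : Integrable (fun z : (ℤ → E) × (ℤ → E) =>
      lagKernel s g j i m (mix (Set.Ioi u) x z.1, z.2)) ((iid ℤ ρ).prod (iid ℤ ρ)) := hx
    have h1 : avg ρ (Set.Ioi u) (lagIncrement s ρ g j i m) x = ∫ z : (ℤ → E) × (ℤ → E),
        lagKernel s g j i m (mix (Set.Ioi u) x z.1, z.2) ∂((iid ℤ ρ).prod (iid ℤ ρ)) := by
      rw [integral_prod _ hx']
      rfl
    have hanti : ∀ z : (ℤ → E) × (ℤ → E), lagKernel s g j i m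
        (mix (Set.Ioi u) x (mix {u}ᶜ z.1 z.2), mix {u}ᶜ z.2 z.1) =
        -lagKernel s g j i m (mix (Set.Ioi u) x z.1, z.2) := fun z => by
      have e1 : mix (Set.Ici u) (mix (Set.Ioi u) x (mix {u}ᶜ z.1 z.2)) (mix {u}ᶜ z.2 z.1) =
          mix (Set.Ioi u) (mix (Set.Ioi u) x z.1) z.2 := by
        ext l
        rcases lt_trichotomy l u with h | rfl | h
        · simp [mix, h.not_ge, h.le, h.ne]
        · simp [mix]
        · simp [mix, h, h.le]
      have e2 : mix (Set.Ioi u) (mix (Set.Ioi u) x (mix {u}ᶜ z.1 z.2)) (mix {u}ᶜ z.2 z.1) =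
          mix (Set.Ici u) (mix (Set.Ioi u) x z.1) z.2 := by
        ext l
        rcases lt_trichotomy l u with h | rfl | h
        · simp [mix, h.not_ge, h.le, h.ne]
        · simp [mix]
        · simp [mix, h, h.le]
      unfold lagKernel
      simp only [← hu, e1, e2]
      rw [← neg_smul, neg_sub]
      simp only [add_comm]
    have h2 : ∫ z : (ℤ → E) × (ℤ → E), lagKernel s g j i m (mix (Set.Ioi u) x z.1, z.2)
        ∂((iid ℤ ρ).prod (iid ℤ ρ)) = -∫ z : (ℤ → E) × (ℤ → E),
          lagKernel s g j i m (mix (Set.Ioi u) x z.1, z.2) ∂((iid ℤ ρ).prod (iid ℤ ρ)) := by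
      have hsw := measurePreserving_mix_swap ρ ({u}ᶜ : Set ℤ)
      rw [← integral_neg]
      simp only [← hanti]
      conv_lhs => rw [← hsw.map_eq]
      rw [integral_map hsw.measurable.aemeasurable]
      rw [hsw.map_eq]
      exact hx'.aestronglyMeasurable
    rw [h1]
    rw [eq_neg_iff_add_eq_zero, ← two_smul ℝ] at h2
    simpa using h2

end CausalArray

/-! ### Partial sums of the products of a causal process -/

section Products

/-- Fatou's lemma for sets. Continuity from below holds for increasing unions of arbitrary sets, so
no measurability is involved. -/
theorem measure_le_of_eventually {X : Type*} [MeasurableSpace X] {μ : Measure X} {A : Set X}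
    {B : ℕ → Set X} {c : ℝ≥0∞} (h : ∀ᵐ x ∂μ, x ∈ A → ∀ᶠ R in atTop, x ∈ B R) (hB : ∀ R, μ (B R) ≤ c) :
    μ A ≤ c := by
  have hmono : Monotone fun R₀ : ℕ => ⋂ R ≥ R₀, B R := fun a b hab =>
    Set.biInter_mono (fun R hR => le_trans hab hR) fun _ _ => le_rfl
  have h1 : μ A ≤ μ (⋃ R₀ : ℕ, ⋂ R ≥ R₀, B R) := by
    refine measure_mono_ae ?_
    filter_upwards [h] with x hx hxA
    obtain ⟨R₀, hR₀⟩ := eventually_atTop.1 (hx hxA)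
    exact Set.mem_iUnion.2 ⟨R₀, Set.mem_iInter₂.2 hR₀⟩
  refine h1.trans ?_
  rw [hmono.measure_iUnion]
  exact iSup_le fun R₀ => (measure_mono (Set.biInter_subset_of_mem (le_refl R₀))).trans (hB R₀)

variable {E : Type*} [MeasurableSpace E] {ρ : Measure E} [IsProbabilityMeasure ρ] {p : ℕ}
  {q v : ℝ} {g : ℤ → Fin p → (ℤ → E) → ℝ}

theorem CausalArray.memLp_two (hg : CausalArray ρ q v g) (hq : 2 < q) (i : ℤ) (j : Fin p) :
    MemLp (g i j) 2 (iid ℤ ρ) := by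
  have h : MemLp (g i j) (ENNReal.ofReal (2 * q)) (iid ℤ ρ) :=
    ⟨(hg.meas i j).aestronglyMeasurable, (hg.moment i j).trans_lt ENNReal.ofReal_lt_top⟩
  refine h.mono_exponent ?_
  rw [show (2 : ℝ≥0∞) = ENNReal.ofReal 2 by simp]
  exact ENNReal.ofReal_le_ofReal (by linarith)

theorem CausalArray.integrable_mul (hg : CausalArray ρ q v g) (hq : 2 < q) (i : ℤ) (j k : Fin p) :
    Integrable (fun x => g i j x * g i k x) (iid ℤ ρ) :=
  (hg.memLp_two hq i j).integrable_mul (hg.memLp_two hq i k)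

/-- Polarisation: `ab - a'b'` is the sum of `(a - a')(b + b')/2` and `(b - b')(a + a')/2`. Entry
`(j, k)` is thereby shared between row `j` and row `k`, and each row involves differences of its own
coordinate only. -/
theorem CausalArray.lagIncrement_add (hg : CausalArray ρ q v g) (hq : 2 < q) (hv : 0 ≤ v)
    {s : ℝ≥0∞} [Fact (1 ≤ s)] (hqs : 2 * q ≤ s.toReal) (i : ℤ) (m : ℕ) (j k : Fin p) :
    ∀ᵐ x ∂(iid ℤ ρ), lagIncrement s ρ g j i m x k + lagIncrement s ρ g k i m x j =
      avg ρ (Set.Ici (i - m)) (fun y => g i j y * g i k y) x -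
        avg ρ (Set.Ioi (i - m)) (fun y => g i j y * g i k y) x := by
  have hF := hg.integrable_mul hq i j k
  filter_upwards [(hg.integrable_lagKernel hq hv hqs j i m).prod_right_ae,
    (hg.integrable_lagKernel hq hv hqs k i m).prod_right_ae,
    (integrable_mix ρ (s := Set.Ici (i - m)) hF).prod_right_ae,
    (integrable_mix ρ (s := Set.Ioi (i - m)) hF).prod_right_ae] with x h1 h2 h3 h4
  have hproj : ∀ (j k : Fin p), Integrable (fun y => lagKernel s g j i m (x, y)) (iid ℤ ρ) →
      Integrable (fun y => lagKernel s g j i m (x, y) k) (iid ℤ ρ) ∧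
      lagIncrement s ρ g j i m x k = ∫ y, lagKernel s g j i m (x, y) k ∂(iid ℤ ρ) := fun j k h =>
    ⟨(PiLp.proj (𝕜 := ℝ) s (fun _ : Fin p => ℝ) k).integrable_comp h,
      ((PiLp.proj (𝕜 := ℝ) s (fun _ : Fin p => ℝ) k).integral_comp_comm h).symm⟩
  obtain ⟨i1, e1⟩ := hproj j k h1
  obtain ⟨i2, e2⟩ := hproj k j h2
  rw [e1, e2, ← integral_add i1 i2]
  unfold avg
  rw [← integral_sub h3 h4]
  congr 1 with y
  simp only [lagKernel, PiLp.smul_apply, smul_eq_mul]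
  ring

/-- The centred products. -/
def prodDev (ρ : Measure E) [IsProbabilityMeasure ρ] (g : ℤ → Fin p → (ℤ → E) → ℝ) (j k : Fin p)
    (i : ℤ) (x : ℤ → E) : ℝ :=
  g i j x * g i k x - ∫ y, g i j y * g i k y ∂(iid ℤ ρ)

/-- The sum over lags telescopes. Its upper end is the mean, because by causality the average over
all coordinates up to `i` is the full integral; its lower end converges by `tendsto_avg_Ici`. -/
theorem CausalArray.tendsto_sum_lagIncrement (hg : CausalArray ρ q v g) (hq : 2 < q) (hv : 0 ≤ v)
    {s : ℝ≥0∞} [Fact (1 ≤ s)] (hqs : 2 * q ≤ s.toReal) (i : ℤ) (j k : Fin p) :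
    ∀ᵐ x ∂(iid ℤ ρ), Tendsto (fun R => ∑ m ∈ Finset.range R, (lagIncrement s ρ g j i m x k +
      lagIncrement s ρ g k i m x j)) atTop (𝓝 (prodDev ρ g j k i x)) := by
  have hm : StronglyMeasurable fun y => g i j y * g i k y :=
    ((hg.meas i j).mul (hg.meas i k)).stronglyMeasurable
  filter_upwards [tendsto_avg_Ici ρ hm (hg.integrable_mul hq i j k) (i + 1),
    ae_all_iff.2 fun m => hg.lagIncrement_add hq hv hqs i m j k] with x h1 h2
  have h3 : ∀ R : ℕ, ∑ m ∈ Finset.range R, (lagIncrement s ρ g j i m x k +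
      lagIncrement s ρ g k i m x j) =
      avg ρ (Set.Ici (i + 1 - R)) (fun y => g i j y * g i k y) x -
        ∫ y, g i j y * g i k y ∂(iid ℤ ρ) := fun R => by
    have h0 : avg ρ (Set.Ici (i + 1)) (fun y => g i j y * g i k y) x =
        ∫ y, g i j y * g i k y ∂(iid ℤ ρ) := by
      unfold avg
      congr 1 with y
      have h : ∀ j, g i j (mix (Set.Ici (i + 1)) x y) = g i j y := fun j => by
        refine hg.dep i j fun l hl => mix_of_notMem _ _ ?_
        simp only [Set.mem_Ici, Set.mem_Iic] at hl ⊢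
        omega
      simp only [h]
    induction R with
    | zero => simp [h0]
    | succ R ih =>
      rw [Finset.sum_range_succ, ih, h2 R]
      have e1 : Set.Ioi (i - (R : ℤ)) = Set.Ici (i + 1 - R) := by ext l; simp; omega
      have e2 : i + 1 - ((R + 1 : ℕ) : ℤ) = i - R := by push_cast; ring
      rw [e1, e2]
      ring
  simp only [h3, prodDev]
  exact h1.sub_const _

/-- Bounds for partial sums of truncated lag increments carry over to centred products. -/
theorem CausalArray.measure_prodDev_le (hg : CausalArray ρ q v g) (hq : 2 < q) (hv : 0 ≤ v)
    {s : ℝ≥0∞} [Fact (1 ≤ s)] (hqs : 2 * q ≤ s.toReal) (𝒲 : Set (ℤ × ℕ)) {y : ℝ} {c : ℝ≥0∞}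
    (h : ∀ R, iid ℤ ρ {x | ∃ w ∈ 𝒲, ∃ j k, y < |∑ i ∈ Finset.range w.2, ∑ m ∈ Finset.range R,
      (lagIncrement s ρ g j (w.1 + i) m x k + lagIncrement s ρ g k (w.1 + i) m x j)|} ≤ c) :
    iid ℤ ρ {x | ∃ w ∈ 𝒲, ∃ j k, y < |∑ i ∈ Finset.range w.2, prodDev ρ g j k (w.1 + i) x|} ≤ c := by
  refine measure_le_of_eventually (B := fun R => {x | ∃ w ∈ 𝒲, ∃ j k, y <
    |∑ i ∈ Finset.range w.2, ∑ m ∈ Finset.range R, (lagIncrement s ρ g j (w.1 + i) m x k +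
      lagIncrement s ρ g k (w.1 + i) m x j)|}) ?_ h
  have hall : ∀ᵐ x ∂(iid ℤ ρ), ∀ (i : ℤ) (j k : Fin p), Tendsto (fun R => ∑ m ∈ Finset.range R,
      (lagIncrement s ρ g j i m x k + lagIncrement s ρ g k i m x j)) atTop
        (𝓝 (prodDev ρ g j k i x)) :=
    ae_all_iff.2 fun i => ae_all_iff.2 fun j => ae_all_iff.2 fun k =>
      hg.tendsto_sum_lagIncrement hq hv hqs i j k
  refine hall.mono fun x hx hxm => ?_
  obtain ⟨w, hw, j, k, hy⟩ := hxm
  have h1 := (tendsto_finsetSum (Finset.range w.2) fun i _ => hx (w.1 + i) j k).abs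
  -- The strict inequality is an open condition, so it already holds for all large truncations `R`.
  exact (h1.eventually_const_lt hy).mono fun R hR => ⟨w, hw, j, k, hR⟩

/-- The even exponent depends on `q` alone, which keeps the smoothness constant free of `p`. -/
theorem exists_piLp_exponent (q : ℝ) : ∃ k : ℕ, 1 ≤ k ∧ 2 * q ≤ (((2 * k : ℕ) : ℝ≥0∞)).toReal := by
  obtain ⟨k, hk⟩ := exists_nat_ge q
  refine ⟨k + 1, by omega, ?_⟩
  rw [ENNReal.toReal_natCast]
  push_cast
  linarith

theorem CausalArray.eLpNorm_lagIncrement_le (hg : CausalArray ρ q v g) (hq : 2 < q) (hv : 0 ≤ v)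
    {s : ℝ≥0∞} [Fact (1 ≤ s)] (hqs : 2 * q ≤ s.toReal) (j : Fin p) (i : ℤ) (m : ℕ) {θ : ℝ}
    (hθ0 : 0 ≤ θ) (hθ : coupledDist ρ g (2 * q) i m j ≤ ENNReal.ofReal θ) :
    eLpNorm (lagIncrement s ρ g j i m) (ENNReal.ofReal q) (iid ℤ ρ) ≤
      ENNReal.ofReal (θ * ((p : ℝ) ^ (1 / (2 * q)) * v)) :=
  (eLpNorm_integral_right_le (hg.stronglyMeasurable_lagKernel j i m) (by linarith)).trans
    (hg.eLpNorm_lagKernel_le hq hv hqs j i m hθ0 hθ)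

theorem CausalArray.eLpNorm_lagIncrement_apply_le (hg : CausalArray ρ q v g) (hq : 2 < q)
    (hv : 0 ≤ v) {s : ℝ≥0∞} [Fact (1 ≤ s)] (hqs : 2 * q ≤ s.toReal) (j k : Fin p) (i : ℤ) (m : ℕ)
    {θ : ℝ} (hθ0 : 0 ≤ θ) (hθ : coupledDist ρ g 4 i m j ≤ ENNReal.ofReal θ) :
    eLpNorm (fun x => lagIncrement s ρ g j i m x k) 2 (iid ℤ ρ) ≤ ENNReal.ofReal (θ * v) := by
  have h1 : (fun x => lagIncrement s ρ g j i m x k) =ᵐ[iid ℤ ρ]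
      fun x => ∫ y, lagKernel s g j i m (x, y) k ∂(iid ℤ ρ) := by
    filter_upwards [(hg.integrable_lagKernel hq hv hqs j i m).prod_right_ae] with x hx
    exact ((PiLp.proj (𝕜 := ℝ) s (fun _ : Fin p => ℝ) k).integral_comp_comm hx).symm
  rw [eLpNorm_congr_ae h1]
  have h2 := eLpNorm_integral_right_le (μ := iid ℤ ρ) (ν := iid ℤ ρ)
    ((PiLp.continuous_apply s (fun _ : Fin p => ℝ) k).comp_stronglyMeasurable
      (hg.stronglyMeasurable_lagKernel (s := s) j i m)) (r := 2) (by norm_num)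
  simp only [ENNReal.ofReal_ofNat] at h2
  exact h2.trans (hg.eLpNorm_lagKernel_apply_le hq hv j k i m hθ0 hθ)

/-- Deviation inequality for the partial sums of the centred products. -/
theorem exists_products_deviation {q A v : ℝ} (hq : 2 < q) (hA : 0 < A) (hv : 0 ≤ v) :
    ∃ C : ℝ, 0 < C ∧ ∀ {E : Type*} [MeasurableSpace E] {ρ : Measure E} [IsProbabilityMeasure ρ]
      {p : ℕ} {g : ℤ → Fin p → (ℤ → E) → ℝ}, CausalArray ρ q v g →
      ∀ {θ₁ θ₂ : Fin p → ℕ → ℝ}, (∀ j m, 0 ≤ θ₁ j m) → (∀ j m, 0 ≤ θ₂ j m) →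
      (∀ i m j, coupledDist ρ g (2 * q) i m j ≤ ENNReal.ofReal (θ₁ j m)) →
      (∀ i m j, coupledDist ρ g 4 i m j ≤ ENNReal.ofReal (θ₂ j m)) →
      ∀ {d₁ : Fin p → ℝ} {N : ℝ},
      (∀ j l R, ∑ m ∈ Finset.range R with 2 ^ l ≤ m + 1, θ₁ j m ≤ d₁ j * ((2 : ℝ) ^ l) ^ (-A)) →
      (∀ j l R, ∑ m ∈ Finset.range R with 2 ^ l ≤ m + 1, θ₂ j m ≤ N * ((2 : ℝ) ^ l) ^ (-A)) →
      ∀ (a : ℤ) (L : ℕ) (u : ℝ), 3 ≤ u → (2 : ℝ) ^ L ≤ 16 * u → ∀ {h Λ : ℝ}, 0 < h → 1 ≤ Λ →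
      iid ℤ ρ {x | ∃ k ≤ 2 ^ L, ∃ j l, C * (h + N * √(u * Λ)) <
        |∑ i ∈ Finset.range k, prodDev ρ g j l (a + i) x|} ≤
      ENNReal.ofReal (C * (p ^ 2 * Real.exp (-Λ) +
        (Λ / h) ^ q * varpi q A u * (√p * ∑ j, d₁ j ^ q))) := by
  obtain ⟨e, he1, he2⟩ := exists_piLp_exponent q
  have hfact : Fact (1 ≤ ((2 * e : ℕ) : ℝ≥0∞)) := ⟨by exact_mod_cast (by omega : 1 ≤ 2 * e)⟩
  have hc0 : 0 ≤ smoothConst e := by linarith [one_le_smoothConst e]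
  obtain ⟨C, hC0, hC⟩ := exists_row_deviation (q := q) (A := A) (c := smoothConst e) hq hA hc0
  refine ⟨2 * C * (1 + v) + C * (1 + v ^ q), by positivity, ?_⟩
  intro E _ ρ _ p g hg θ₁ θ₂ hθ₁ hθ₂ hc₁ hc₂ d₁ N hd₁ hN a L u hu hLu h Λ hh hΛ
  have hq0 : 0 < q := by linarith
  set s : ℝ≥0∞ := ((2 * e : ℕ) : ℝ≥0∞) with hs
  have hsm : IsTwoSmooth (PiLp s fun _ : Fin p => ℝ) q (smoothConst e) := by
    refine (isTwoSmooth_piLp (ι := Fin p) e).mono hc0 hq0 ?_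
    rw [hs, ENNReal.toReal_natCast] at he2
    linarith
  have hN0 : ∀ j : Fin p, 0 ≤ N := fun j => by simpa using hN j 0 0
  have hrow : ∀ (R : ℕ) (j : Fin p), iid ℤ ρ {x | ∃ k ≤ 2 ^ L, ∃ l, C * (h + N * v * √(u * Λ)) <
      |∑ i ∈ Finset.range k, ∑ m ∈ Finset.range R, lagIncrement s ρ g j (a + i) m x l|} ≤
      ENNReal.ofReal (C * (p * Real.exp (-Λ) +
        (d₁ j * ((p : ℝ) ^ (1 / (2 * q)) * v) * Λ / h) ^ q * varpi q A u)) := fun R j => by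
    have h1 := hg.lagArray hq hv he2 j
    refine hC h1 hsm (α := fun m => θ₁ j m * ((p : ℝ) ^ (1 / (2 * q)) * v))
      (β := fun m => θ₂ j m * v) (fun m => mul_nonneg (hθ₁ j m) (by positivity))
      (fun m => mul_nonneg (hθ₂ j m) hv)
      (fun i m => hg.eLpNorm_lagIncrement_le hq hv he2 j i m (hθ₁ j m) (hc₁ i m j))
      (fun i m k => hg.eLpNorm_lagIncrement_apply_le hq hv he2 j k i m (hθ₂ j m) (hc₂ i m j))
      (fun l R => ?_) (fun l R => ?_) a L R u hu hLu hh hΛ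
    · rw [← Finset.sum_mul]
      calc _ ≤ d₁ j * ((2 : ℝ) ^ l) ^ (-A) * ((p : ℝ) ^ (1 / (2 * q)) * v) := by
            gcongr; exact hd₁ j l R
        _ = _ := by ring
    · rw [← Finset.sum_mul]
      calc _ ≤ N * ((2 : ℝ) ^ l) ^ (-A) * v := by
            gcongr; exact hN j l R
        _ = _ := by ring
  have hw : {x | ∃ k ≤ 2 ^ L, ∃ j l, (2 * C * (1 + v) + C * (1 + v ^ q)) * (h + N * √(u * Λ)) <
        |∑ i ∈ Finset.range k, prodDev ρ g j l (a + i) x|} =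
      {x | ∃ w ∈ {w : ℤ × ℕ | w.1 = a ∧ w.2 ≤ 2 ^ L}, ∃ j l,
        (2 * C * (1 + v) + C * (1 + v ^ q)) * (h + N * √(u * Λ)) <
        |∑ i ∈ Finset.range w.2, prodDev ρ g j l (w.1 + i) x|} := by
    ext x
    constructor
    · rintro ⟨k, hk, j, l, hx⟩
      exact ⟨(a, k), ⟨rfl, hk⟩, j, l, hx⟩
    · rintro ⟨⟨_, k⟩, ⟨rfl, hk⟩, j, l, hx⟩
      exact ⟨k, hk, j, l, hx⟩
  rw [hw]
  refine hg.measure_prodDev_le hq hv he2 _ fun R => ?_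
  have hvp : 0 ≤ varpi q A u := by
    unfold varpi
    have : 0 ≤ Real.log u := Real.log_nonneg (by linarith)
    split_ifs <;> positivity
  have hd0 : ∀ j, 0 ≤ d₁ j := fun j => by simpa using hd₁ j 0 0
  calc _ ≤ iid ℤ ρ (⋃ j ∈ (Finset.univ : Finset (Fin p)), {x | ∃ k ≤ 2 ^ L, ∃ l,
      C * (h + N * v * √(u * Λ)) <
      |∑ i ∈ Finset.range k, ∑ m ∈ Finset.range R, lagIncrement s ρ g j (a + i) m x l|}) := by
        refine measure_mono ?_
        rintro x ⟨⟨_, k⟩, ⟨rfl, hk⟩, j, l, hx⟩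
        simp only [Finset.sum_add_distrib] at hx
        have h1 := hx.trans_le (abs_add_le _ _)
        have hN0 := hN0 j
        have hthr : 2 * (C * (h + N * v * √(u * Λ))) ≤
            (2 * C * (1 + v) + C * (1 + v ^ q)) * (h + N * √(u * Λ)) := by
          have h2 : 0 ≤ N * √(u * Λ) := by positivity
          have h3 : 0 ≤ C * (1 + v ^ q) * (h + N * √(u * Λ)) := by positivity
          have h4 : 0 ≤ C * (v * h + N * √(u * Λ)) := by positivity
          nlinarith
        simp only [Set.mem_iUnion, Finset.mem_univ, exists_const, Set.mem_ofPred_eq]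
        by_contra hcon
        push Not at hcon
        have h5 := hcon j k hk l
        have h6 := hcon l k hk j
        linarith
    _ ≤ ∑ j : Fin p, ENNReal.ofReal (C * (p * Real.exp (-Λ) +
        (d₁ j * ((p : ℝ) ^ (1 / (2 * q)) * v) * Λ / h) ^ q * varpi q A u)) :=
        (measure_biUnion_finset_le _ _).trans (Finset.sum_le_sum fun j _ => hrow R j)
    _ = ENNReal.ofReal (∑ j : Fin p, C * (p * Real.exp (-Λ) +
        (d₁ j * ((p : ℝ) ^ (1 / (2 * q)) * v) * Λ / h) ^ q * varpi q A u)) := by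
        rw [ENNReal.ofReal_sum_of_nonneg fun j _ => ?_]
        have := hd0 j
        positivity
    _ ≤ _ := by
        refine ENNReal.ofReal_le_ofReal ?_
        -- The `q`-th power of the price `p^(1/(2q))` of a row is `√p`.
        have hj : ∀ j : Fin p, (d₁ j * ((p : ℝ) ^ (1 / (2 * q)) * v) * Λ / h) ^ q =
            d₁ j ^ q * (v ^ q * ((Λ / h) ^ q * √p)) := fun j => by
          rw [show d₁ j * ((p : ℝ) ^ (1 / (2 * q)) * v) * Λ / h =
            d₁ j * (v * ((Λ / h) * (p : ℝ) ^ (1 / (2 * q)))) by ring,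
            Real.mul_rpow (hd0 j) (by positivity), Real.mul_rpow hv (by positivity),
            Real.mul_rpow (x := Λ / h) (by positivity) (by positivity), ← Real.rpow_mul (by positivity),
            show 1 / (2 * q) * q = 1 / 2 by field_simp, Real.sqrt_eq_rpow]
        simp only [hj]
        rw [← Finset.mul_sum, Finset.sum_add_distrib, Finset.sum_const, Finset.card_univ,
          Fintype.card_fin, nsmul_eq_mul, ← Finset.sum_mul, ← Finset.sum_mul]
        have hX : 0 ≤ (p : ℝ) ^ 2 * Real.exp (-Λ) := by positivity
        have hY : 0 ≤ (Λ / h) ^ q * varpi q A u * (√p * ∑ j, d₁ j ^ q) := by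
          have : 0 ≤ ∑ j, d₁ j ^ q := Finset.sum_nonneg fun j _ => by have := hd0 j; positivity
          positivity
        have e1 : C * (p * (p * Real.exp (-Λ)) + (∑ j, d₁ j ^ q) * (v ^ q * ((Λ / h) ^ q * √p)) *
            varpi q A u) = C * (p ^ 2 * Real.exp (-Λ)) +
              C * v ^ q * ((Λ / h) ^ q * varpi q A u * (√p * ∑ j, d₁ j ^ q)) := by ring
        rw [e1, mul_add]
        have hvq : 0 ≤ v ^ q := by positivity
        gcongr ?_ * _ + ?_ * _
        · nlinarith [mul_nonneg hC0.le hv, mul_nonneg hC0.le hvq]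
        · nlinarith [mul_nonneg hC0.le hv, mul_nonneg hC0.le hvq]

/-- Deviation inequality with separate treatment of short and long lags. The starting points of
the short windows are in `𝒜`, and they are contained in one long window. -/
theorem exists_products_deviation_split {q A v : ℝ} (hq : 2 < q) (hv : 0 ≤ v) :
    ∃ C : ℝ, 0 < C ∧ ∀ {E : Type*} [MeasurableSpace E] {ρ : Measure E} [IsProbabilityMeasure ρ]
      {p : ℕ} {g : ℤ → Fin p → (ℤ → E) → ℝ}, CausalArray ρ q v g →
      ∀ {θ₂ : Fin p → ℕ → ℝ}, (∀ j m, 0 ≤ θ₂ j m) →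
      (∀ i m j, coupledDist ρ g 4 i m j ≤ ENNReal.ofReal (θ₂ j m)) →
      ∀ {N : ℝ},
      (∀ j l R, ∑ m ∈ Finset.range R with 2 ^ l ≤ m + 1, θ₂ j m ≤ N * ((2 : ℝ) ^ l) ^ (-A)) →
      ∀ (a : ℤ) (𝒜 : Finset ℕ) (W W' l : ℕ), (∀ d ∈ 𝒜, d + 2 ^ W ≤ 2 ^ W') → ∀ {y : ℝ}, 0 < y →
      iid ℤ ρ {x | ∃ d ∈ 𝒜, ∃ k ≤ 2 ^ W, ∃ j j', y <
        |∑ i ∈ Finset.range k, prodDev ρ g j j' (a + d + i) x|} ≤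
      ENNReal.ofReal (C * (𝒜.card * (p : ℝ) ^ 2 * (√((2 : ℝ) ^ W) * 2 ^ l / y) ^ q +
        (p : ℝ) ^ 2 * ((W' + 1) ^ 2 * 2 ^ W' * (N * ((2 : ℝ) ^ l) ^ (-A)) ^ 2 / y ^ 2))) := by
  obtain ⟨e, he1, he2⟩ := exists_piLp_exponent q
  have hfact : Fact (1 ≤ ((2 * e : ℕ) : ℝ≥0∞)) := ⟨by exact_mod_cast (by omega : 1 ≤ 2 * e)⟩
  have hc0 : 0 ≤ smoothConst e := by linarith [one_le_smoothConst e]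
  have hq0 : 0 < q := by linarith
  set Cc := chainConst q (smoothConst e)
  have hCc : 0 ≤ Cc := chainConst_nonneg hq
  refine ⟨(8 * Cc * v ^ 2) ^ q + 128 * v ^ 2 + 1, by positivity, ?_⟩
  intro E _ ρ _ p g hg θ₂ hθ₂ hc₂ N hN a 𝒜 W W' l hW y hy
  set s : ℝ≥0∞ := ((2 * e : ℕ) : ℝ≥0∞) with hs
  have hsm : IsTwoSmooth (PiLp s fun _ : Fin p => ℝ) q (smoothConst e) := by
    refine (isTwoSmooth_piLp (ι := Fin p) e).mono hc0 hq0 ?_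
    rw [hs, ENNReal.toReal_natCast] at he2
    linarith
  have hlag := fun j => hg.lagArray hq hv he2 j
  have hw : {x | ∃ d ∈ 𝒜, ∃ k ≤ 2 ^ W, ∃ j j', y <
        |∑ i ∈ Finset.range k, prodDev ρ g j j' (a + d + i) x|} =
      {x | ∃ w ∈ {w : ℤ × ℕ | ∃ d ∈ 𝒜, w.1 = a + d ∧ w.2 ≤ 2 ^ W}, ∃ j l,
        y < |∑ i ∈ Finset.range w.2, prodDev ρ g j l (w.1 + i) x|} := by
    ext x
    constructor
    · rintro ⟨d, hd, k, hk, j, l, hx⟩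
      exact ⟨(a + d, k), ⟨d, hd, rfl, hk⟩, j, l, hx⟩
    · rintro ⟨⟨_, k⟩, ⟨d, hd, rfl, hk⟩, j, l, hx⟩
      exact ⟨d, hd, k, hk, j, l, hx⟩
  rw [hw]
  refine hg.measure_prodDev_le hq hv he2 _ fun R => ?_
  let I : Finset ℕ := {m ∈ Finset.range R | ¬ 2 ^ l ≤ m + 1}
  let J : Finset ℕ := {m ∈ Finset.range R | 2 ^ l ≤ m + 1}
  have hp0 : (0 : ℝ) ≤ (p : ℝ) ^ (1 / (2 * q)) := by positivity
  -- There are fewer than `2^l` short lags, and each dependence coefficient is bounded by `2v`; no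
  -- decay in the lag is used.
  have hsmall : ∀ (d : ℕ) (j : Fin p), iid ℤ ρ {x | ∃ k ≤ 2 ^ W, y / 4 <
      ‖∑ i ∈ Finset.range k, ∑ m ∈ I, lagIncrement s ρ g j (a + d + i) m x‖} ≤
      ENNReal.ofReal ((8 * Cc * v ^ 2) ^ q * (p * (√((2 : ℝ) ^ W) * 2 ^ l / y) ^ q)) := fun d j => by
    refine ((hlag j).measure_max_le hsm hq hc0
      (α := fun _ => 2 * v * ((p : ℝ) ^ (1 / (2 * q)) * v)) (fun _ => by positivity)
      (fun i m => hg.eLpNorm_lagIncrement_le hq hv he2 j i m (by positivity)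
        (hg.coupledDist_le hq hv i m j)) I (a + d) W (by positivity : 0 < y / 4)).trans
        (ENNReal.ofReal_le_ofReal ?_)
    have hI : (I.card : ℝ) ≤ 2 ^ l := by
      have : I ⊆ Finset.range (2 ^ l) := fun m hm => by
        have := (Finset.mem_filter.1 hm).2
        exact Finset.mem_range.2 (by omega)
      exact_mod_cast (Finset.card_le_card this).trans_eq (Finset.card_range _)
    rw [Finset.sum_const, nsmul_eq_mul]
    calc _ ≤ (Cc * √((2 : ℝ) ^ W) * (2 ^ l * (2 * v * ((p : ℝ) ^ (1 / (2 * q)) * v))) / (y / 4)) ^ q := by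
          gcongr
      _ = ((8 * Cc * v ^ 2) * ((p : ℝ) ^ (1 / (2 * q)) * (√((2 : ℝ) ^ W) * 2 ^ l / y))) ^ q := by
          congr 1; field_simp; ring
      _ = (8 * Cc * v ^ 2) ^ q * (√p * (√((2 : ℝ) ^ W) * 2 ^ l / y) ^ q) := by
          rw [Real.mul_rpow (x := 8 * Cc * v ^ 2) (by positivity) (by positivity),
            Real.mul_rpow (x := (p : ℝ) ^ (1 / (2 * q))) (by positivity) (by positivity),
            ← Real.rpow_mul (by positivity), show 1 / (2 * q) * q = 1 / 2 by field_simp,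
            Real.sqrt_eq_rpow (p : ℝ)]
      _ ≤ _ := by
          have : √(p : ℝ) ≤ p := by
            rcases Nat.eq_zero_or_pos p with rfl | hp
            · simp
            · rw [Real.sqrt_le_left (by positivity)]
              have : (1 : ℝ) ≤ p := by exact_mod_cast hp
              nlinarith
          gcongr
  -- Long lags are controlled through second moments on the long window only. A sum over a short
  -- window is a difference of two partial sums there, so `y/2 = y/4 + 2 (y/8)` is available for
  -- each of the two rows.
  have hlarge : ∀ (j j' : Fin p), iid ℤ ρ {x | ∃ k ≤ 2 ^ W', y / 8 <
      ‖∑ i ∈ Finset.range k, ∑ m ∈ J, lagIncrement s ρ g j (a + i) m x j'‖} ≤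
      ENNReal.ofReal (128 * v ^ 2 * ((W' + 1) ^ 2 * 2 ^ W' * (N * ((2 : ℝ) ^ l) ^ (-A)) ^ 2 /
        y ^ 2)) := fun j j' => by
    have hint : ∀ i m, Integrable (lagIncrement s ρ g j i m) (iid ℤ ρ) := fun i m =>
      (hg.integrable_lagKernel hq hv he2 j i m).integral_prod_left
    refine (((hlag j).coord hint j').measure_max_le_two isTwoSmooth_real_two zero_le_one
      (α := fun m => θ₂ j m * v) (fun m => mul_nonneg (hθ₂ j m) hv)
      (fun i m => hg.eLpNorm_lagIncrement_apply_le hq hv he2 j j' i m (hθ₂ j m) (hc₂ i m j)) J a W'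
        (by positivity : 0 < y / 8)).trans (ENNReal.ofReal_le_ofReal ?_)
    rw [← Finset.sum_mul]
    have h0 : 0 ≤ ∑ m ∈ J, θ₂ j m := Finset.sum_nonneg fun m _ => hθ₂ j m
    calc _ ≤ 2 * 1 * ((W' : ℝ) + 1) ^ 2 * 2 ^ W' * (N * ((2 : ℝ) ^ l) ^ (-A) * v) ^ 2 /
          (y / 8) ^ 2 := by
          gcongr; exact hN j l R
      _ = _ := by field_simp; ring
  calc _ ≤ iid ℤ ρ ((⋃ z ∈ 𝒜 ×ˢ (Finset.univ : Finset (Fin p)), {x | ∃ k ≤ 2 ^ W, y / 4 <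
      ‖∑ i ∈ Finset.range k, ∑ m ∈ I, lagIncrement s ρ g z.2 (a + z.1 + i) m x‖}) ∪
      ⋃ z ∈ (Finset.univ : Finset (Fin p × Fin p)), {x | ∃ k ≤ 2 ^ W', y / 8 <
      ‖∑ i ∈ Finset.range k, ∑ m ∈ J, lagIncrement s ρ g z.1 (a + i) m x z.2‖}) := by
        refine measure_mono ?_
        rintro x ⟨⟨_, k⟩, ⟨d, hd, rfl, hk⟩, j, j', hx⟩
        by_contra hcon
        simp only [Set.mem_union, Set.mem_iUnion, not_or, Set.mem_ofPred_eq] at hcon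
        obtain ⟨h0, h1⟩ := hcon
        push Not at h0 h1
        have key : ∀ j j', |∑ i ∈ Finset.range k, ∑ m ∈ Finset.range R,
            lagIncrement s ρ g j (a + d + i) m x j'| ≤ y / 2 := fun j j' => by
          have e1 : ∑ i ∈ Finset.range k, ∑ m ∈ Finset.range R,
              lagIncrement s ρ g j (a + d + i) m x j' =
              ∑ i ∈ Finset.range k, ∑ m ∈ I, lagIncrement s ρ g j (a + d + i) m x j' +
              (∑ i ∈ Finset.range (d + k), ∑ m ∈ J, lagIncrement s ρ g j (a + i) m x j' -
                ∑ i ∈ Finset.range d, ∑ m ∈ J, lagIncrement s ρ g j (a + i) m x j') := by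
            rw [Finset.sum_range_add, add_sub_cancel_left, ← Finset.sum_add_distrib]
            refine Finset.sum_congr rfl fun i _ => ?_
            rw [← Finset.sum_filter_add_sum_filter_not (Finset.range R) (fun m => 2 ^ l ≤ m + 1),
              add_comm]
            push_cast
            simp only [add_assoc, I, J]
          have h2 := h0 (d, j) (Finset.mem_product.2 ⟨hd, Finset.mem_univ _⟩) k hk
          have h3 := PiLp.norm_apply_le (∑ i ∈ Finset.range k, ∑ m ∈ I,
            lagIncrement s ρ g j (a + d + i) m x) j'
          simp only [WithLp.ofLp_sum, Finset.sum_apply, Real.norm_eq_abs] at h3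
          have h4 := h1 (j, j') (Finset.mem_univ _) (d + k) ((Nat.add_le_add_left hk d).trans (hW d hd))
          have h5 := h1 (j, j') (Finset.mem_univ _) d ((Nat.le_add_right _ _).trans (hW d hd))
          rw [Real.norm_eq_abs] at h4 h5
          rw [e1, abs_le]
          have h6 := abs_le.1 (h3.trans h2)
          have h7 := abs_le.1 h4
          have h8 := abs_le.1 h5
          constructor <;> linarith [h6.1, h6.2, h7.1, h7.2, h8.1, h8.2]
        simp only [Finset.sum_add_distrib] at hx
        have h9 := hx.trans_le (abs_add_le _ _)
        linarith [key j j', key j' j]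
    _ ≤ ∑ z ∈ 𝒜 ×ˢ (Finset.univ : Finset (Fin p)),
          ENNReal.ofReal ((8 * Cc * v ^ 2) ^ q * (p * (√((2 : ℝ) ^ W) * 2 ^ l / y) ^ q)) +
        ∑ z ∈ (Finset.univ : Finset (Fin p × Fin p)), ENNReal.ofReal (128 * v ^ 2 *
          ((W' + 1) ^ 2 * 2 ^ W' * (N * ((2 : ℝ) ^ l) ^ (-A)) ^ 2 / y ^ 2)) :=
        (measure_union_le _ _).trans (add_le_add
          ((measure_biUnion_finset_le _ _).trans (Finset.sum_le_sum fun z _ => hsmall z.1 z.2))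
          ((measure_biUnion_finset_le _ _).trans (Finset.sum_le_sum fun z _ => hlarge z.1 z.2)))
    _ = ENNReal.ofReal ((𝒜.card * p) * ((8 * Cc * v ^ 2) ^ q *
          (p * (√((2 : ℝ) ^ W) * 2 ^ l / y) ^ q)) + (p * p) * (128 * v ^ 2 *
          ((W' + 1) ^ 2 * 2 ^ W' * (N * ((2 : ℝ) ^ l) ^ (-A)) ^ 2 / y ^ 2))) := by
        rw [Finset.sum_const, Finset.sum_const, nsmul_eq_mul, nsmul_eq_mul, Finset.card_product,
          Finset.card_univ, Finset.card_univ, Fintype.card_prod, Fintype.card_fin,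
          ENNReal.ofReal_add (by positivity) (by positivity),
          ENNReal.ofReal_mul (p := (𝒜.card : ℝ) * p) (by positivity),
          ENNReal.ofReal_mul (p := (p : ℝ) * p) (by positivity),
          ENNReal.ofReal_mul (p := (𝒜.card : ℝ)) (by positivity),
          ENNReal.ofReal_mul (p := (p : ℝ)) (q := (p : ℝ)) (by positivity),
          ENNReal.ofReal_natCast, ENNReal.ofReal_natCast]
        push_cast
        rfl
    _ ≤ _ := by
        refine ENNReal.ofReal_le_ofReal ?_
        set P₁ := (√((2 : ℝ) ^ W) * 2 ^ l / y) ^ q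
        set P₂ := ((W' : ℝ) + 1) ^ 2 * 2 ^ W' * (N * ((2 : ℝ) ^ l) ^ (-A)) ^ 2 / y ^ 2
        have h1 : 0 ≤ 𝒜.card * (p : ℝ) ^ 2 * P₁ := by positivity
        have h2 : 0 ≤ (p : ℝ) ^ 2 * P₂ := by positivity
        have h3 : 0 ≤ (8 * Cc * v ^ 2) ^ q := by positivity
        have h4 : 0 ≤ 128 * v ^ 2 := by positivity
        nlinarith [mul_nonneg h3 h2, mul_nonneg h4 h1]

end Products

/-! ### The observations as functions of an i.i.d. sequence -/

namespace Model

variable {p : ℕ} {S : Type*} [MeasurableSpace S] (X : Model p S)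

/-- The law of an innovation. -/
def law : Measure (Fin p → ℝ) := X.μ.map (X.ε 0)

instance : IsProbabilityMeasure X.μ := X.isProb

instance : IsProbabilityMeasure X.law :=
  Measure.isProbabilityMeasure_map (X.ε_meas 0).aemeasurable

theorem measurePreserving_innovations :
    MeasurePreserving (fun ω i => X.ε i ω) X.μ (iid ℤ X.law) := by
  refine ⟨measurable_pi_lambda _ X.ε_meas, ?_⟩
  rw [X.ε_indep.map_fun_eq_infinitePi_map X.ε_meas]
  congr 1
  ext1 i
  exact (X.ε_ident i).map_eq

/-- `H_j(F; t)` for the past at time `0` of a sequence of innovations. -/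
def base (t : ℝ) (j : Fin p) (x : ℤ → Fin p → ℝ) : ℝ := X.H (fun k : ℕ => x (-k)) t j

theorem measurable_base {t : ℝ} (ht : t ∈ Set.Icc (0 : ℝ) 1) (j : Fin p) :
    Measurable (X.base t j) := by
  have h1 : Measurable fun x : ℤ → Fin p → ℝ =>
      ((fun k : ℕ => x (-k), (⟨t, ht⟩ : Set.Icc (0 : ℝ) 1)) :
        (ℕ → Fin p → ℝ) × Set.Icc (0 : ℝ) 1) := by fun_prop
  exact (measurable_pi_apply j).comp (X.H_meas.comp h1)

theorem dependsOn_base (t : ℝ) (j : Fin p) : DependsOn (X.base t j) (Set.Iic 0) := by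
  intro x y hxy
  unfold base
  congr 2
  ext1 k
  exact hxy _ (by simp)

theorem proc_zero_eq (t : ℝ) (j : Fin p) (ω : S) :
    X.proc 0 t ω j = X.base t j fun i => X.ε i ω := by
  change X.H (fun k : ℕ => X.ε (0 - k) ω) t j = _
  simp [base]

theorem proc_eq (i : ℤ) (t : ℝ) (j : Fin p) (ω : S) :
    X.proc i t ω j = X.base t j fun l => X.ε (l + i) ω := by
  change X.H (fun k : ℕ => X.ε (i - k) ω) t j = X.H (fun k : ℕ => X.ε (-k + i) ω) t j
  simp only [neg_add_eq_sub]

theorem coupled_zero_eq (m : ℕ) (t : ℝ) (j : Fin p) (z : S × S) :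
    X.coupled m 0 t z j = X.base t j
      (Function.update (fun i => X.ε i z.1) (-m : ℤ) (X.ε (-m : ℤ) z.2)) := by
  change X.H (Function.update (fun k : ℕ => X.ε (0 - k) z.1) m (X.ε (0 - m) z.2)) t j = _
  unfold base
  congr 2
  ext1 k
  by_cases hk : k = m
  · subst hk; simp
  · rw [Function.update_of_ne hk, Function.update_of_ne (by simpa using hk)]; simp

/-- The observations as functions of the innovations; zero outside of the sample. -/
def canon (n : ℕ) (i : ℤ) (j : Fin p) (x : ℤ → Fin p → ℝ) : ℝ :=
  if 1 ≤ i ∧ i ≤ n then X.base ((i : ℝ) / n) j fun l => x (l + i) else 0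

theorem div_mem_Icc {i : ℤ} {n : ℕ} (h : 1 ≤ i ∧ i ≤ n) : (i : ℝ) / n ∈ Set.Icc (0 : ℝ) 1 := by
  have h1 : (1 : ℝ) ≤ i := by exact_mod_cast h.1
  have h2 : (i : ℝ) ≤ n := by exact_mod_cast h.2
  have h3 : (0 : ℝ) < n := by linarith
  exact ⟨by positivity, (div_le_one h3).2 h2⟩

theorem eLpNorm_base_comp {t : ℝ} (ht : t ∈ Set.Icc (0 : ℝ) 1) (j : Fin p) (a : ℝ≥0∞) :
    eLpNorm (X.base t j) a (iid ℤ X.law) = eLpNorm (fun ω => X.proc 0 t ω j) a X.μ := by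
  rw [← eLpNorm_comp_measurePreserving (X.measurable_base ht j).aestronglyMeasurable
    X.measurePreserving_innovations]
  congr 1 with ω
  rw [proc_zero_eq]; rfl

/-- The bound for the `L^{2q}` norms which follows from the moment condition. -/
def _root_.TVClime.momentBound (q ν : ℝ) : ℝ := (max ν 0) ^ (1 / (2 * q))

theorem _root_.TVClime.momentBound_nonneg (q ν : ℝ) : 0 ≤ momentBound q ν :=
  Real.rpow_nonneg (le_max_right _ _) _

theorem eLpNorm_proc_le {q A ν : ℝ} (hq : 0 < q) (hX : X.Dependence q A ν) {t : ℝ}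
    (ht : t ∈ Set.Icc (0 : ℝ) 1) (j : Fin p) :
    eLpNorm (fun ω => X.proc 0 t ω j) (ENNReal.ofReal (2 * q)) X.μ ≤
      ENNReal.ofReal (momentBound q ν) := by
  have h1 : ∫⁻ ω, ‖X.proc 0 t ω j‖ₑ ^ (2 * q) ∂X.μ ≤ ENNReal.ofReal (max ν 0) :=
    (le_iSup₂_of_le t ht (le_iSup (fun j => ∫⁻ ω, ‖X.proc 0 t ω j‖ₑ ^ (2 * q) ∂X.μ) j)).trans
      (hX.moment_le.trans (ENNReal.ofReal_le_ofReal (le_max_left _ _)))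
  rw [← ENNReal.rpow_le_rpow_iff (show 0 < 2 * q by linarith), eLpNorm_ofReal_rpow (by linarith)]
  refine h1.trans_eq ?_
  rw [ENNReal.ofReal_rpow_of_nonneg (momentBound_nonneg _ _) (by linarith)]
  unfold momentBound
  rw [← Real.rpow_mul (le_max_right _ _), one_div, inv_mul_cancel₀ (by linarith), Real.rpow_one]

theorem causalArray {q A ν : ℝ} (hq : 0 < q) (hX : X.Dependence q A ν) (n : ℕ) :
    CausalArray X.law q (momentBound q ν) (X.canon n) where
  meas i j := by
    unfold canon
    split_ifs with h
    · exact (X.measurable_base (div_mem_Icc h) j).comp (by fun_prop)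
    · exact measurable_const
  dep i j := by
    intro x y hxy
    unfold canon
    split_ifs with h
    · exact X.dependsOn_base _ j fun l hl => hxy _ (by simp only [Set.mem_Iic] at hl ⊢; omega)
    · rfl
  moment i j := by
    unfold canon
    split_ifs with h
    · have h1 := eLpNorm_comp_measurePreserving (p := ENNReal.ofReal (2 * q))
        (X.measurable_base (div_mem_Icc h) j).aestronglyMeasurable (measurePreserving_shift X.law i)
      refine h1.trans_le ?_
      rw [X.eLpNorm_base_comp (div_mem_Icc h)]
      exact X.eLpNorm_proc_le hq hX (div_mem_Icc h) j
    · simp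

theorem measurable_update_base {t : ℝ} (ht : t ∈ Set.Icc (0 : ℝ) 1) (j : Fin p) (u : ℤ) :
    Measurable fun z : (ℤ → Fin p → ℝ) × (ℤ → Fin p → ℝ) =>
      X.base t j z.1 - X.base t j (Function.update z.1 u (z.2 u)) := by
  have hm : Measurable fun z : (ℤ → Fin p → ℝ) × (ℤ → Fin p → ℝ) =>
      Function.update z.1 u (z.2 u) := by
    refine measurable_pi_lambda _ fun i => ?_
    by_cases hi : i = u
    · subst hi; simp only [Function.update_self]; fun_prop
    · simp only [Function.update_of_ne hi]; fun_prop
  exact ((X.measurable_base ht j).comp measurable_fst).sub ((X.measurable_base ht j).comp hm)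

theorem eLpNorm_base_sub_update_le {t : ℝ} (ht : t ∈ Set.Icc (0 : ℝ) 1) (a : ℝ) (m : ℕ)
    (j : Fin p) :
    eLpNorm (fun z : (ℤ → Fin p → ℝ) × (ℤ → Fin p → ℝ) => X.base t j z.1 -
      X.base t j (Function.update z.1 (-m : ℤ) (z.2 (-m : ℤ)))) (ENNReal.ofReal a)
      ((iid ℤ X.law).prod (iid ℤ X.law)) ≤ X.theta a m j := by
  rw [← eLpNorm_comp_measurePreserving (X.measurable_update_base ht j _).aestronglyMeasurable
    (X.measurePreserving_innovations.prod X.measurePreserving_innovations)]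
  refine le_trans (le_of_eq ?_) (le_iSup₂_of_le t ht le_rfl)
  congr 1 with z
  rw [proc_zero_eq, coupled_zero_eq]; rfl

theorem coupledDist_canon_le (n : ℕ) (a : ℝ) (i : ℤ) (m : ℕ) (j : Fin p) :
    coupledDist X.law (X.canon n) a i m j ≤ X.theta a m j := by
  unfold coupledDist canon
  split_ifs with h
  · refine le_trans (le_of_eq ?_) (X.eLpNorm_base_sub_update_le (div_mem_Icc h) a m j)
    rw [← eLpNorm_comp_measurePreserving
      (X.measurable_update_base (div_mem_Icc h) j _).aestronglyMeasurable
      ((measurePreserving_shift X.law i).prod (measurePreserving_shift X.law i))]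
    congr 1 with z
    simp only [Function.comp_apply, Prod.map]
    congr 2
    ext1 l
    by_cases hl : l = -(m : ℤ)
    · subst hl
      rw [show -(m : ℤ) + i = i - m by ring, Function.update_self, Function.update_self]
    · rw [Function.update_of_ne hl, Function.update_of_ne (by omega)]
  · simp

theorem tsum_theta_le_dan {a A : ℝ} (j : Fin p) (m : ℕ) :
    ENNReal.ofReal (((m : ℝ) + 1) ^ A) * ∑' i : ℕ, X.theta a (m + i) j ≤ X.dan a A j :=
  le_iSup (fun m : ℕ => ENNReal.ofReal (((m : ℝ) + 1) ^ A) * ∑' i : ℕ, X.theta a (m + i) j) m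

theorem theta_lt_top {a A : ℝ} {j : Fin p} (h : X.dan a A j < ∞) (m : ℕ) : X.theta a m j < ∞ := by
  refine lt_of_le_of_lt ?_ h
  refine le_trans ?_ (X.tsum_theta_le_dan j 0)
  simp only [CharP.cast_eq_zero, zero_add, Real.one_rpow, ENNReal.ofReal_one, one_mul]
  exact ENNReal.le_tsum m

theorem sum_theta_le {a A : ℝ} {j : Fin p} (h : X.dan a A j < ∞) (l R : ℕ) :
    ∑ m ∈ Finset.range R with 2 ^ l ≤ m + 1, (X.theta a m j).toReal ≤
      (X.dan a A j).toReal * ((2 : ℝ) ^ l) ^ (-A) := by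
  -- The lags with `m + 1 ≥ 2^l` start at `2^l - 1`, where the weight in `dan` equals `(2^l)^A`.
  have h1 := X.tsum_theta_le_dan (a := a) (A := A) j (2 ^ l - 1)
  have h2 : (((2 ^ l - 1 : ℕ) : ℝ) + 1) = 2 ^ l := by
    rw [Nat.cast_sub Nat.one_le_two_pow]; push_cast; ring
  rw [h2] at h1
  have h3 : ∑ m ∈ Finset.range R with 2 ^ l ≤ m + 1, X.theta a m j ≤
      ∑' i : ℕ, X.theta a (2 ^ l - 1 + i) j := by
    have h4 : ∑ m ∈ Finset.range R with 2 ^ l ≤ m + 1, X.theta a m j ≤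
        ∑ i ∈ Finset.range R, X.theta a (2 ^ l - 1 + i) j := by
      have h5 : ({m ∈ Finset.range R | 2 ^ l ≤ m + 1} : Finset ℕ) ⊆
          (Finset.range R).image (fun i => 2 ^ l - 1 + i) := by
        intro m hm
        simp only [Finset.mem_filter, Finset.mem_range] at hm
        exact Finset.mem_image.2 ⟨m - (2 ^ l - 1), Finset.mem_range.2 (by omega), by omega⟩
      refine (Finset.sum_le_sum_of_subset h5).trans ?_
      rw [Finset.sum_image fun a _ b _ hab => by simpa using hab]
    exact h4.trans (ENNReal.sum_le_tsum _)
  have h6 : ENNReal.ofReal (((2 : ℝ) ^ l) ^ A) *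
      ∑ m ∈ Finset.range R with 2 ^ l ≤ m + 1, X.theta a m j ≤ X.dan a A j :=
    (mul_le_mul_right h3 _).trans h1
  have h7 := ENNReal.toReal_mono h.ne h6
  rw [ENNReal.toReal_mul, ENNReal.toReal_ofReal (by positivity), ENNReal.toReal_sum
    fun m _ => (X.theta_lt_top h m).ne] at h7
  rw [Real.rpow_neg (by positivity), ← div_eq_mul_inv, le_div_iff₀ (by positivity), mul_comm]
  exact h7

theorem theta_mono {a a' : ℝ} (ha : a ≤ a') (m : ℕ) (j : Fin p) :
    X.theta a m j ≤ X.theta a' m j := by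
  refine iSup₂_mono fun t ht => eLpNorm_le_eLpNorm_of_exponent_le (ENNReal.ofReal_le_ofReal ha) ?_
  have h := (X.measurable_update_base ht j (-m : ℤ)).comp
    (X.measurePreserving_innovations.prod X.measurePreserving_innovations).measurable
  refine Measurable.aestronglyMeasurable ?_
  convert h using 1
  ext1 z
  rw [proc_zero_eq, coupled_zero_eq]; rfl

theorem dan_mono {a a' A : ℝ} (ha : a ≤ a') (j : Fin p) : X.dan a A j ≤ X.dan a' A j := by
  refine iSup_mono fun m => ?_
  gcongr with i
  exact X.theta_mono ha _ j

theorem dan_four_lt_top {q A ν : ℝ} (hq : 2 < q) (hX : X.Dependence q A ν) (j : Fin p) :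
    X.dan (2 * 2) A j < ∞ :=
  (X.dan_mono (by linarith) j).trans_lt (hX.dan_lt_top j)

theorem dan_le_N (q A : ℝ) (j : Fin p) : (X.dan (2 * q) A j).toReal ≤ X.N q A :=
  le_ciSup (f := fun j => (X.dan (2 * q) A j).toReal) (Set.finite_range _).bddAbove j

theorem M_rpow {q A : ℝ} (hq : 0 < q) : X.M q A ^ q = ∑ j, (X.dan (2 * q) A j).toReal ^ q := by
  unfold M
  rw [← Real.rpow_mul (Finset.sum_nonneg fun j _ => by positivity), one_div,
    inv_mul_cancel₀ hq.ne', Real.rpow_one]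

/-- The centred products of the observations; zero outside of the sample. -/
def centered (n : ℕ) (j k : Fin p) (i : ℕ) (ω : S) : ℝ :=
  if 1 ≤ i ∧ i ≤ n then X.obs n i ω j * X.obs n i ω k - X.cov ((i : ℝ) / n) j k else 0

theorem prodDev_canon (n : ℕ) (j k : Fin p) (i : ℕ) (ω : S) :
    prodDev X.law (X.canon n) j k i (fun l => X.ε l ω) = X.centered n j k i ω := by
  unfold prodDev centered canon
  by_cases h : 1 ≤ i ∧ i ≤ n
  · have h' : 1 ≤ (i : ℤ) ∧ (i : ℤ) ≤ n := by omega
    have ht := div_mem_Icc h'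
    simp only [if_pos h, if_pos h']
    congr 1
    · unfold obs
      rw [proc_eq, proc_eq]
      push_cast
      rfl
    · have hm := ((X.measurable_base ht j).mul (X.measurable_base ht k)).aestronglyMeasurable
        (μ := iid ℤ X.law)
      have h1 := measurePreserving_shift X.law (i : ℤ)
      have h2 := X.measurePreserving_innovations
      have h3 : ∫ y, X.base ((i : ℝ) / n) j (fun l => y (l + i)) *
          X.base ((i : ℝ) / n) k (fun l => y (l + i)) ∂(iid ℤ X.law) =
          ∫ y, X.base ((i : ℝ) / n) j y * X.base ((i : ℝ) / n) k y ∂(iid ℤ X.law) := by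
        conv_rhs => rw [← h1.map_eq]
        rw [integral_map h1.aemeasurable (by rw [h1.map_eq]; exact hm)]
      have h4 : ∫ ω, X.proc 0 ((i : ℝ) / n) ω j * X.proc 0 ((i : ℝ) / n) ω k ∂X.μ =
          ∫ y, X.base ((i : ℝ) / n) j y * X.base ((i : ℝ) / n) k y ∂(iid ℤ X.law) := by
        rw [← h2.map_eq, integral_map h2.aemeasurable (by rw [h2.map_eq]; exact hm)]
        simp only [proc_zero_eq]
      simp only [cov, Matrix.of_apply, h4, Int.cast_natCast]
      exact h3
  · have h' : ¬ (1 ≤ (i : ℤ) ∧ (i : ℤ) ≤ n) := by omega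
    simp [h]

theorem coupledDist_canon_le_four (n : ℕ) (i : ℤ) (m : ℕ) (j : Fin p) :
    coupledDist X.law (X.canon n) 4 i m j ≤ X.theta (2 * 2) m j := by
  have := X.coupledDist_canon_le n (2 * 2) i m j
  rwa [show (2 * 2 : ℝ) = 4 by norm_num] at this ⊢

/-- Deviation inequality for partial sums of the centred products over a window. -/
theorem exists_centered_deviation {q A : ℝ} (ν : ℝ) (hq : 2 < q) (hA : 0 < A) :
    ∃ C : ℝ, 0 < C ∧ ∀ {p : ℕ} {S : Type*} [MeasurableSpace S] (X : Model p S),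
      X.Dependence q A ν → ∀ (n a L : ℕ) (u : ℝ), 3 ≤ u → (2 : ℝ) ^ L ≤ 16 * u →
      ∀ {h Λ : ℝ}, 0 < h → 1 ≤ Λ →
      X.μ {ω | ∃ k ≤ 2 ^ L, ∃ j l, C * (h + X.N 2 A * √(u * Λ)) <
        |∑ i ∈ Finset.range k, X.centered n j l (a + i) ω|} ≤
      ENNReal.ofReal (C * (p ^ 2 * Real.exp (-Λ) +
        (Λ / h) ^ q * varpi q A u * (√p * X.M q A ^ q))) := by
  obtain ⟨C, hC0, hC⟩ := exists_products_deviation hq hA (momentBound_nonneg q ν)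
  refine ⟨C, hC0, ?_⟩
  intro p S _ X hX n a L u hu hLu h Λ hh hΛ
  have h1 := hC (X.causalArray (by linarith) hX n)
    (θ₁ := fun j m => (X.theta (2 * q) m j).toReal) (θ₂ := fun j m => (X.theta (2 * 2) m j).toReal)
    (fun j m => by positivity) (fun j m => by positivity)
    (fun i m j => (X.coupledDist_canon_le n _ i m j).trans_eq
      (ENNReal.ofReal_toReal (X.theta_lt_top (hX.dan_lt_top j) m).ne).symm)
    (fun i m j => (X.coupledDist_canon_le_four n i m j).trans_eq
      (ENNReal.ofReal_toReal (X.theta_lt_top (X.dan_four_lt_top hq hX j) m).ne).symm)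
    (d₁ := fun j => (X.dan (2 * q) A j).toReal) (N := X.N 2 A)
    (fun j l R => X.sum_theta_le (hX.dan_lt_top j) l R)
    (fun j l R => (X.sum_theta_le (X.dan_four_lt_top hq hX j) l R).trans
      (mul_le_mul_of_nonneg_right (X.dan_le_N 2 A j) (by positivity)))
    a L u hu hLu hh hΛ
  rw [← X.M_rpow (by linarith), ← X.measurePreserving_innovations.map_eq] at h1
  refine le_trans (le_trans (measure_mono ?_)
    (Measure.le_map_apply X.measurePreserving_innovations.aemeasurable _)) h1
  rintro ω ⟨k, hk, j, l, hx⟩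
  refine ⟨k, hk, j, l, hx.trans_eq ?_⟩
  congr 1
  refine Finset.sum_congr rfl fun i _ => ?_
  have := X.prodDev_canon n j l (a + i) ω
  push_cast at this
  exact this.symm

/-- Deviation inequality with separate treatment of short and long lags. -/
theorem exists_centered_deviation_split {q A : ℝ} (ν : ℝ) (hq : 2 < q) :
    ∃ C : ℝ, 0 < C ∧ ∀ {p : ℕ} {S : Type*} [MeasurableSpace S] (X : Model p S),
      X.Dependence q A ν → ∀ (n a : ℕ) (𝒜 : Finset ℕ) (W W' l : ℕ),
      (∀ d ∈ 𝒜, d + 2 ^ W ≤ 2 ^ W') → ∀ {y : ℝ}, 0 < y →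
      X.μ {ω | ∃ d ∈ 𝒜, ∃ k ≤ 2 ^ W, ∃ j j', y <
        |∑ i ∈ Finset.range k, X.centered n j j' (a + d + i) ω|} ≤
      ENNReal.ofReal (C * (𝒜.card * (p : ℝ) ^ 2 * (√((2 : ℝ) ^ W) * 2 ^ l / y) ^ q +
        (p : ℝ) ^ 2 * ((W' + 1) ^ 2 * 2 ^ W' * (X.N 2 A * ((2 : ℝ) ^ l) ^ (-A)) ^ 2 / y ^ 2))) := by
  obtain ⟨C, hC0, hC⟩ := exists_products_deviation_split (A := A) hq (momentBound_nonneg q ν)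
  refine ⟨C, hC0, ?_⟩
  intro p S _ X hX n a 𝒜 W W' l hW y hy
  have h1 := hC (X.causalArray (by linarith) hX n)
    (θ₂ := fun j m => (X.theta (2 * 2) m j).toReal) (fun j m => by positivity)
    (fun i m j => (X.coupledDist_canon_le_four n i m j).trans_eq
      (ENNReal.ofReal_toReal (X.theta_lt_top (X.dan_four_lt_top hq hX j) m).ne).symm)
    (N := X.N 2 A)
    (fun j l R => (X.sum_theta_le (X.dan_four_lt_top hq hX j) l R).trans
      (mul_le_mul_of_nonneg_right (X.dan_le_N 2 A j) (by positivity)))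
    a 𝒜 W W' l hW hy
  rw [← X.measurePreserving_innovations.map_eq] at h1
  refine le_trans (le_trans (measure_mono ?_)
    (Measure.le_map_apply X.measurePreserving_innovations.aemeasurable _)) h1
  rintro ω ⟨d, hd, k, hk, j, l, hx⟩
  refine ⟨d, hd, k, hk, j, l, hx.trans_eq ?_⟩
  congr 1
  refine Finset.sum_congr rfl fun i _ => ?_
  have := X.prodDev_canon n j l (a + d + i) ω
  push_cast at this
  exact this.symm

/-! ### Second moments -/

theorem memLp_proc {q A ν : ℝ} (hq : 2 < q) (hX : X.Dependence q A ν) {t : ℝ}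
    (ht : t ∈ Set.Icc (0 : ℝ) 1) (j : Fin p) : MemLp (fun ω => X.proc 0 t ω j) 2 X.μ := by
  have hm : AEStronglyMeasurable (fun ω => X.proc 0 t ω j) X.μ := by
    have := ((X.measurable_base ht j).comp X.measurePreserving_innovations.measurable)
    refine Measurable.aestronglyMeasurable ?_
    convert this using 1
    ext1 ω
    rw [proc_zero_eq]; rfl
  have h : MemLp (fun ω => X.proc 0 t ω j) (ENNReal.ofReal (2 * q)) X.μ :=
    ⟨hm, (X.eLpNorm_proc_le (by linarith) hX ht j).trans_lt ENNReal.ofReal_lt_top⟩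
  refine h.mono_exponent ?_
  rw [show (2 : ℝ≥0∞) = ENNReal.ofReal 2 by simp]
  exact ENNReal.ofReal_le_ofReal (by linarith)

/-- A centred variable is the limit of sums of its projections on single innovations, and the
projection at lag `m` is bounded by `θ_m`; Fatou's lemma passes to the limit. The point is to bound
covariances by `N` itself, so that the bias terms of order `1/(nb)` can be absorbed into a rate
proportional to `N`. -/
theorem eLpNorm_two_proc_le_dan {q A ν : ℝ} (hq : 2 < q) (hX : X.Dependence q A ν) {t : ℝ}
    (ht : t ∈ Set.Icc (0 : ℝ) 1) (j : Fin p) (h0 : ∫ ω, X.proc 0 t ω j ∂X.μ = 0) :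
    eLpNorm (fun ω => X.proc 0 t ω j) 2 X.μ ≤ X.dan (2 * 2) A j := by
  set f := X.base t j with hf
  have hfm := X.measurable_base ht j
  have hfs : StronglyMeasurable f := hfm.stronglyMeasurable
  have hΦ := X.measurePreserving_innovations
  have hf2 : MemLp f 2 (iid ℤ X.law) := by
    refine ⟨hfs.aestronglyMeasurable, ?_⟩
    rw [hf, X.eLpNorm_base_comp ht]
    exact (X.memLp_proc hq hX ht j).2
  have hfi : Integrable f (iid ℤ X.law) := hf2.integrable (by norm_num)
  have hf0 : ∫ x, f x ∂(iid ℤ X.law) = 0 := by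
    rw [← hΦ.map_eq, integral_map hΦ.aemeasurable (by rw [hΦ.map_eq]; exact hfs.aestronglyMeasurable)]
    simpa only [proc_zero_eq] using h0
  have hstep : ∀ R : ℕ, eLpNorm (avg X.law (Set.Ici (1 - (R : ℤ))) f) 2 (iid ℤ X.law) ≤
      ∑ m ∈ Finset.range R, X.theta (2 * 2) m j := fun R => by
    induction R with
    | zero =>
      have h1 : avg X.law (Set.Ici (1 - ((0 : ℕ) : ℤ))) f = fun _ => 0 := by
        ext1 x
        rw [← hf0]
        unfold avg
        congr 1 with y
        exact X.dependsOn_base t j fun l hl => mix_of_notMem _ _ (by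
          simp only [Set.mem_Iic, Set.mem_Ici] at hl ⊢; push_cast; omega)
      rw [h1]; simp
    | succ R ih =>
      rw [Finset.sum_range_succ]
      have e1 : (1 : ℤ) - ((R + 1 : ℕ) : ℤ) = -(R : ℤ) := by push_cast; ring
      have e2 : Set.Ici (1 - (R : ℤ)) = Set.Ioi (-(R : ℤ)) := by ext l; simp; omega
      rw [e1]
      have h2 : eLpNorm (fun x => avg X.law (Set.Ici (-(R : ℤ))) f x -
          avg X.law (Set.Ioi (-(R : ℤ))) f x) 2 (iid ℤ X.law) ≤ X.theta (2 * 2) R j := by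
        have h3 : (fun x => avg X.law (Set.Ici (-(R : ℤ))) f x -
            avg X.law (Set.Ioi (-(R : ℤ))) f x) =ᵐ[iid ℤ X.law]
            fun x => ∫ y, (f (mix (Set.Ici (-(R : ℤ))) x y) - f (mix (Set.Ioi (-(R : ℤ))) x y))
              ∂(iid ℤ X.law) := by
          filter_upwards [(integrable_mix X.law (s := Set.Ici (-(R : ℤ))) hfi).prod_right_ae,
            (integrable_mix X.law (s := Set.Ioi (-(R : ℤ))) hfi).prod_right_ae] with x h4 h5
          exact (integral_sub h4 h5).symm
        rw [eLpNorm_congr_ae h3]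
        have hΓ : StronglyMeasurable fun z : (ℤ → Fin p → ℝ) × (ℤ → Fin p → ℝ) =>
            f (mix (Set.Ici (-(R : ℤ))) z.1 z.2) - f (mix (Set.Ioi (-(R : ℤ))) z.1 z.2) :=
          Measurable.stronglyMeasurable (by fun_prop)
        have h6 := eLpNorm_integral_right_le (μ := iid ℤ X.law) (ν := iid ℤ X.law) hΓ (r := 2)
          (by norm_num)
        rw [eLpNorm_mix_sub_le hfm, ENNReal.ofReal_ofNat] at h6
        refine h6.trans ((eLpNorm_le_eLpNorm_of_exponent_le ?_ ?_).trans
          (X.eLpNorm_base_sub_update_le ht (2 * 2) R j))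
        · rw [show (2 : ℝ≥0∞) = ENNReal.ofReal 2 by simp]
          exact ENNReal.ofReal_le_ofReal (by norm_num)
        · exact (X.measurable_update_base ht j _).aestronglyMeasurable
      rw [e2] at ih
      have h7 := eLpNorm_add_le (μ := iid ℤ X.law) (p := 2)
        (stronglyMeasurable_avg X.law (s := Set.Ioi (-(R : ℤ))) hfs).aestronglyMeasurable
        ((stronglyMeasurable_avg X.law (s := Set.Ici (-(R : ℤ))) hfs).sub
          (stronglyMeasurable_avg X.law (s := Set.Ioi (-(R : ℤ))) hfs)).aestronglyMeasurable
        (by norm_num)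
      rw [add_sub_cancel] at h7
      exact h7.trans (add_le_add ih h2)
  have hbound : ∀ R : ℕ, eLpNorm (avg X.law (Set.Ici (1 - (R : ℤ))) f) 2 (iid ℤ X.law) ≤
      X.dan (2 * 2) A j := fun R => by
    refine (hstep R).trans ((ENNReal.sum_le_tsum _).trans ?_)
    simpa using X.tsum_theta_le_dan (a := 2 * 2) (A := A) j 0
  rw [← X.eLpNorm_base_comp ht]
  refine (Lp.eLpNorm_lim_le_liminf_eLpNorm (fun R =>
    (stronglyMeasurable_avg X.law hfs).aestronglyMeasurable) f
    (tendsto_avg_Ici X.law hfs hfi 1)).trans ?_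
  exact liminf_le_of_frequently_le' (Frequently.of_forall hbound)

theorem abs_integral_mul_le {f g : S → ℝ} (hf : MemLp f 2 X.μ) (hg : MemLp g 2 X.μ) {a b : ℝ}
    (ha : eLpNorm f 2 X.μ ≤ ENNReal.ofReal a) (hb : eLpNorm g 2 X.μ ≤ ENNReal.ofReal b)
    (ha0 : 0 ≤ a) (hb0 : 0 ≤ b) : |∫ ω, f ω * g ω ∂X.μ| ≤ a * b := by
  have h1 : ‖∫ ω, f ω * g ω ∂X.μ‖ₑ ≤ ENNReal.ofReal (a * b) := by
    refine (enorm_integral_le_lintegral_enorm _).trans ?_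
    rw [← eLpNorm_one_eq_lintegral_enorm, ENNReal.ofReal_mul ha0]
    have h2 := eLpNorm_smul_le_mul_eLpNorm (p := 2) (q := 2) (r := 1) hg.1 hf.1
    exact h2.trans (mul_le_mul' ha hb)
  rw [Real.enorm_eq_ofReal_abs] at h1
  exact (ENNReal.ofReal_le_ofReal_iff (by positivity)).1 h1

variable {q A ν L D : ℝ}

theorem eLpNorm_two_proc_le_N (hq : 2 < q) (hX : X.Dependence q A ν) (hs : X.Smooth L D) {t : ℝ}
    (ht : t ∈ Set.Icc (0 : ℝ) 1) (j : Fin p) :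
    eLpNorm (fun ω => X.proc 0 t ω j) 2 X.μ ≤ ENNReal.ofReal (X.N 2 A) := by
  refine (X.eLpNorm_two_proc_le_dan hq hX ht j (hs.mean_zero t ht j)).trans ?_
  rw [← ENNReal.ofReal_toReal (X.dan_four_lt_top hq hX j).ne]
  exact ENNReal.ofReal_le_ofReal (X.dan_le_N 2 A j)

theorem eLpNorm_two_proc_le (hq : 2 < q) (hX : X.Dependence q A ν) {t : ℝ}
    (ht : t ∈ Set.Icc (0 : ℝ) 1) (j : Fin p) :
    eLpNorm (fun ω => X.proc 0 t ω j) 2 X.μ ≤ ENNReal.ofReal (momentBound q ν) := by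
  refine (eLpNorm_le_eLpNorm_of_exponent_le ?_ (X.memLp_proc hq hX ht j).1).trans
    (X.eLpNorm_proc_le (by linarith) hX ht j)
  rw [show (2 : ℝ≥0∞) = ENNReal.ofReal 2 by simp]
  exact ENNReal.ofReal_le_ofReal (by linarith)

theorem N_nonneg (q A : ℝ) : 0 ≤ X.N q A := Real.iSup_nonneg fun _ => by positivity

theorem abs_cov_le_sq (hq : 2 < q) (hX : X.Dependence q A ν) (hs : X.Smooth L D) {t : ℝ}
    (ht : t ∈ Set.Icc (0 : ℝ) 1) (j k : Fin p) : |X.cov t j k| ≤ X.N 2 A * X.N 2 A :=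
  X.abs_integral_mul_le (X.memLp_proc hq hX ht j) (X.memLp_proc hq hX ht k)
    (X.eLpNorm_two_proc_le_N hq hX hs ht j) (X.eLpNorm_two_proc_le_N hq hX hs ht k)
    (X.N_nonneg _ _) (X.N_nonneg _ _)

/-- One factor is bounded by `N` and the other by the moments: the bias requires a bound linear in
`N`. The quadratic form `abs_cov_le_sq` serves to bound `N` from below in terms of `κ`. -/
theorem abs_cov_le (hq : 2 < q) (hX : X.Dependence q A ν) (hs : X.Smooth L D) {t : ℝ}
    (ht : t ∈ Set.Icc (0 : ℝ) 1) (j k : Fin p) : |X.cov t j k| ≤ X.N 2 A * momentBound q ν :=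
  X.abs_integral_mul_le (X.memLp_proc hq hX ht j) (X.memLp_proc hq hX ht k)
    (X.eLpNorm_two_proc_le_N hq hX hs ht j) (X.eLpNorm_two_proc_le hq hX ht k)
    (X.N_nonneg _ _) (momentBound_nonneg _ _)

theorem abs_cov_sub_le (hq : 2 < q) (hL : 0 < L) (hX : X.Dependence q A ν) (hs : X.Smooth L D)
    {t t' : ℝ} (ht : t ∈ Set.Ico (0 : ℝ) 1) (ht' : t' ∈ Set.Ico (0 : ℝ) 1) (j k : Fin p) :
    |X.cov t j k - X.cov t' j k| ≤ 2 * X.N 2 A * L * |t - t'| := by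
  have h1 := Set.Ico_subset_Icc_self ht
  have h2 := Set.Ico_subset_Icc_self ht'
  have m1 := X.memLp_proc hq hX h1
  have m2 := X.memLp_proc hq hX h2
  have hN := X.N_nonneg 2 A
  have hLt : 0 ≤ L * |t - t'| := by positivity
  have e : X.cov t j k - X.cov t' j k =
      ∫ ω, X.proc 0 t ω j * (X.proc 0 t ω k - X.proc 0 t' ω k) ∂X.μ +
      ∫ ω, (X.proc 0 t ω j - X.proc 0 t' ω j) * X.proc 0 t' ω k ∂X.μ := by
    have i1 : Integrable (fun ω => X.proc 0 t ω j * (X.proc 0 t ω k - X.proc 0 t' ω k)) X.μ :=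
      (m1 j).integrable_mul ((m1 k).sub (m2 k))
    have i2 : Integrable (fun ω => (X.proc 0 t ω j - X.proc 0 t' ω j) * X.proc 0 t' ω k) X.μ :=
      ((m1 j).sub (m2 j)).integrable_mul (m2 k)
    have i3 : Integrable (fun ω => X.proc 0 t ω j * X.proc 0 t ω k) X.μ :=
      (m1 j).integrable_mul (m1 k)
    have i4 : Integrable (fun ω => X.proc 0 t' ω j * X.proc 0 t' ω k) X.μ :=
      (m2 j).integrable_mul (m2 k)
    change ∫ ω, X.proc 0 t ω j * X.proc 0 t ω k ∂X.μ -
      ∫ ω, X.proc 0 t' ω j * X.proc 0 t' ω k ∂X.μ = _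
    rw [← integral_add i1 i2, ← integral_sub i3 i4]
    congr 1 with ω
    ring
  rw [e]
  refine (abs_add_le _ _).trans ?_
  have a1 := X.abs_integral_mul_le (m1 j) ((m1 k).sub (m2 k))
    (X.eLpNorm_two_proc_le_N hq hX hs h1 j) (hs.lipschitz t ht t' ht' k) hN hLt
  have a2 := X.abs_integral_mul_le ((m1 j).sub (m2 j)) (m2 k)
    (hs.lipschitz t ht t' ht' j) (X.eLpNorm_two_proc_le_N hq hX hs h2 k) hLt hN
  simp only [Pi.sub_apply] at a1 a2
  linarith

end Model

/-! ### Kernel weights -/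

section Kernel

/-- A function whose increments are dominated by those of a monotone function with range in
an interval of length `V`. -/
def HasVariationBound (f : ℝ → ℝ) (V : ℝ) : Prop :=
  ∃ Φ : ℝ → ℝ, Monotone Φ ∧ (∀ u v, Φ v - Φ u ≤ V) ∧ ∀ u v, u ≤ v → |f v - f u| ≤ Φ v - Φ u

/-- The dominating function increases at rate `c` on `[-1,1]` and jumps by `M` at each endpoint,
where `f` may be discontinuous. -/
theorem hasVariationBound_of_lipschitzOn {f : ℝ → ℝ} {c M : ℝ} (hM : ∀ u, |f u| ≤ M)
    (hc : 0 ≤ c) (hsupp : ∀ u, u ∉ Set.Icc (-1 : ℝ) 1 → f u = 0)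
    (hlip : ∀ u ∈ Set.Icc (-1 : ℝ) 1, ∀ v ∈ Set.Icc (-1 : ℝ) 1, |f v - f u| ≤ c * |v - u|) :
    HasVariationBound f (2 * c + 2 * M) := by
  have hM0 : 0 ≤ M := (abs_nonneg _).trans (hM 0)
  refine ⟨fun u => c * max (-1) (min u 1) + (if -1 ≤ u then M else 0) + (if 1 < u then M else 0),
    ?_, ?_, ?_⟩
  · intro u v huv
    have h1 : max (-1) (min u 1) ≤ max (-1) (min v 1) := max_le_max le_rfl (min_le_min huv le_rfl)
    have h2 := mul_le_mul_of_nonneg_left h1 hc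
    dsimp only
    split_ifs <;> linarith
  · intro u v
    have h1 : max (-1) (min v 1) ≤ 1 := max_le (by norm_num) (min_le_right _ _)
    have h2 : -1 ≤ max (-1) (min u 1) := le_max_left _ _
    have h3 := mul_le_mul_of_nonneg_left h1 hc
    have h4 := mul_le_mul_of_nonneg_left h2 hc
    dsimp only
    split_ifs <;> linarith
  · intro u v huv
    have h1 : max (-1) (min u 1) ≤ max (-1) (min v 1) := max_le_max le_rfl (min_le_min huv le_rfl)
    have h2 := mul_le_mul_of_nonneg_left h1 hc
    dsimp only
    by_cases hu : u ∈ Set.Icc (-1 : ℝ) 1 <;> by_cases hv : v ∈ Set.Icc (-1 : ℝ) 1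
    · rw [min_eq_left hu.2, min_eq_left hv.2, max_eq_right hu.1, max_eq_right hv.1, if_pos hu.1,
        if_pos hv.1, if_neg (not_lt.2 hu.2), if_neg (not_lt.2 hv.2)]
      refine (hlip u hu v hv).trans ?_
      rw [abs_of_nonneg (by linarith)]
      linarith
    · have hv1 : 1 < v := by
        by_contra h
        exact hv ⟨hu.1.trans huv, not_lt.1 h⟩
      rw [hsupp v hv, zero_sub, abs_neg, if_pos hu.1, if_pos (hu.1.trans huv), if_pos hv1,
        if_neg (not_lt.2 hu.2)]
      linarith [hM u]
    · have hu1 : ¬ -1 ≤ u := fun h => hu ⟨h, huv.trans hv.2⟩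
      rw [hsupp u hu, sub_zero, if_neg hu1, if_pos hv.1, if_neg (not_lt.2 hv.2),
        if_neg (not_lt.2 (huv.trans hv.2))]
      linarith [hM v]
    · rw [hsupp u hu, hsupp v hv, sub_zero, abs_zero]
      split_ifs <;> linarith

theorem HasVariationBound.sum_le {f : ℝ → ℝ} {V : ℝ} (h : HasVariationBound f V) {s : ℕ → ℝ}
    (hs : Monotone s) (m : ℕ) : ∑ k ∈ Finset.range m, |f (s (k + 1)) - f (s k)| ≤ V := by
  obtain ⟨Φ, -, h2, h3⟩ := h
  refine (Finset.sum_le_sum fun k _ => h3 _ _ (hs k.le_succ)).trans ?_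
  rw [Finset.sum_range_sub fun k => Φ (s k)]
  exact h2 _ _

/-- The intervals `[s k, r (k+1)]` lie in the consecutive intervals `[r k, r (k+1)]`, over which the
dominating function telescopes. This compares the sums of `f` over a grid and over a translate of
it. -/
theorem HasVariationBound.sum_shift_le {f : ℝ → ℝ} {V : ℝ} (h : HasVariationBound f V) {s r : ℕ → ℝ}
    (h1 : ∀ k, s k ≤ r (k + 1)) (h2 : ∀ k, r k ≤ s k) (m : ℕ) :
    ∑ k ∈ Finset.range m, |f (r (k + 1)) - f (s k)| ≤ V := by
  obtain ⟨Φ, hΦ, h3, h4⟩ := h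
  refine (Finset.sum_le_sum fun k _ => (h4 _ _ (h1 k)).trans
    (sub_le_sub_left (hΦ (h2 k)) (Φ (r (k + 1))))).trans ?_
  rw [Finset.sum_range_sub fun k => Φ (r k)]
  exact h3 _ _

/-- Summation by parts. -/
theorem abs_sum_mul_le_of_partial_sums {c y : ℕ → ℝ} {m : ℕ} {G : ℝ}
    (h : ∀ k ≤ m, |∑ i ∈ Finset.range k, y i| ≤ G) :
    |∑ k ∈ Finset.range m, c k * y k| ≤
      (|c m| + ∑ k ∈ Finset.range m, |c (k + 1) - c k|) * G := by
  have key : ∀ m, ∑ k ∈ Finset.range m, c k * y k = c m * ∑ i ∈ Finset.range m, y i -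
      ∑ k ∈ Finset.range m, (c (k + 1) - c k) * ∑ i ∈ Finset.range (k + 1), y i := fun m => by
    induction m with
    | zero => simp
    | succ m ih =>
      rw [Finset.sum_range_succ, ih, Finset.sum_range_succ (fun k => (c (k + 1) - c k) * _),
        Finset.sum_range_succ y]
      ring
  rw [key, add_mul, Finset.sum_mul]
  refine (abs_sub _ _).trans (add_le_add ?_ ((Finset.abs_sum_le_sum_abs _ _).trans
    (Finset.sum_le_sum fun k hk => ?_)))
  · rw [abs_mul]
    exact mul_le_mul_of_nonneg_left (h m le_rfl) (abs_nonneg _)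
  · rw [abs_mul]
    exact mul_le_mul_of_nonneg_left (h _ (Finset.mem_range.1 hk)) (abs_nonneg _)

variable {K : ℝ → ℝ}

theorem IsRegularKernel.exists_bound (hK : IsRegularKernel K) : ∃ M : ℝ, 0 < M ∧ ∀ u, K u ≤ M := by
  obtain ⟨c, hc⟩ := hK.lipschitz
  refine ⟨K 0 + c + 1, by have := hK.nonneg 0; positivity, fun u => ?_⟩
  by_cases hu : u ∈ Set.Icc (-1 : ℝ) 1
  · have h1 := hc.dist_le_mul u hu 0 (by norm_num)
    rw [Real.dist_eq, Real.dist_eq, sub_zero] at h1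
    have h2 : |u| ≤ 1 := abs_le.2 hu
    have h3 := (abs_le.1 h1).2
    nlinarith [c.2]
  · rw [hK.support u hu]
    have := hK.nonneg 0
    positivity

theorem IsRegularKernel.exists_variationBound (hK : IsRegularKernel K) :
    ∃ V : ℝ, 0 < V ∧ HasVariationBound K V ∧ HasVariationBound (fun u => u * K u) V := by
  obtain ⟨c, hc⟩ := hK.lipschitz
  obtain ⟨M, hM0, hM⟩ := hK.exists_bound
  have habs : ∀ u, |K u| ≤ M := fun u => by rw [abs_of_nonneg (hK.nonneg u)]; exact hM u
  have hlip : ∀ u ∈ Set.Icc (-1 : ℝ) 1, ∀ v ∈ Set.Icc (-1 : ℝ) 1, |K v - K u| ≤ c * |v - u| :=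
    fun u hu v hv => by simpa [Real.dist_eq] using hc.dist_le_mul v hv u hu
  have h1 := hasVariationBound_of_lipschitzOn (c := c + M) habs (by positivity) hK.support
    fun u hu v hv => (hlip u hu v hv).trans (by
      have : 0 ≤ M * |v - u| := by positivity
      nlinarith)
  have h2 := hasVariationBound_of_lipschitzOn (f := fun u => u * K u) (c := c + M) (M := M)
    (fun u => by
      by_cases hu : u ∈ Set.Icc (-1 : ℝ) 1
      · rw [abs_mul]
        exact (mul_le_mul (abs_le.2 hu) (habs u) (abs_nonneg _) zero_le_one).trans (by linarith)
      · rw [hK.support u hu]; simpa using hM0.le)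
    (by positivity) (fun u hu => by rw [hK.support u hu, mul_zero])
    fun u hu v hv => by
      have e : v * K v - u * K u = v * (K v - K u) + (v - u) * K u := by ring
      rw [e]
      refine (abs_add_le _ _).trans ?_
      rw [abs_mul, abs_mul]
      have h3 : |v| * |K v - K u| ≤ 1 * (c * |v - u|) :=
        mul_le_mul (abs_le.2 hv) (hlip u hu v hv) (abs_nonneg _) zero_le_one
      have h4 : |v - u| * |K u| ≤ |v - u| * M := mul_le_mul_of_nonneg_left (habs u) (abs_nonneg _)
      linarith
  exact ⟨_, by positivity, h1, h2⟩

/-- The mean of `K` over `[-1,1]` is `1/2`, so some value is at least `1/4`; the Lipschitz condition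
keeps `K` above `1/8` at distance `δ`. The interval extends from that point towards the origin in
order to stay inside `[-1,1]`. -/
theorem IsRegularKernel.exists_interval (hK : IsRegularKernel K) :
    ∃ δ u₁ : ℝ, 0 < δ ∧ -1 ≤ u₁ ∧ u₁ + δ ≤ 1 ∧ ∀ u ∈ Set.Icc u₁ (u₁ + δ), 1 / 8 ≤ K u := by
  obtain ⟨c, hc⟩ := hK.lipschitz
  have h0 : ∃ u₀ ∈ Set.Icc (-1 : ℝ) 1, 1 / 4 ≤ K u₀ := by
    by_contra hcon
    push Not at hcon
    have h1 : ∫ u in (-1 : ℝ)..1, K u ≤ ∫ _ in (-1 : ℝ)..1, (1 / 4 : ℝ) := by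
      refine intervalIntegral.integral_mono_on (by norm_num) ?_ (by simp) fun u hu => (hcon u hu).le
      refine ContinuousOn.intervalIntegrable ?_
      rw [Set.uIcc_of_le (by norm_num)]
      exact hc.continuousOn
    rw [hK.integral_eq_one] at h1
    norm_num at h1
  obtain ⟨u₀, hu₀, hKu⟩ := h0
  set δ : ℝ := 1 / (8 * (c + 1)) with hδ
  have hc0 : (0 : ℝ) ≤ c := c.2
  have hδ0 : 0 < δ := by positivity
  have hδ1 : δ ≤ 1 := by
    rw [hδ, div_le_one (by positivity)]; linarith
  have hcδ : c * δ ≤ 1 / 8 := by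
    rw [hδ, mul_one_div, div_le_div_iff₀ (by positivity) (by norm_num)]; linarith
  have key : ∀ u ∈ Set.Icc (-1 : ℝ) 1, |u - u₀| ≤ δ → 1 / 8 ≤ K u := fun u hu h => by
    have h1 := hc.dist_le_mul u hu u₀ hu₀
    rw [Real.dist_eq, Real.dist_eq] at h1
    have h2 := (abs_le.1 h1).1
    have h3 := mul_le_mul_of_nonneg_left h hc0
    linarith
  rcases le_total u₀ 0 with h | h
  · refine ⟨δ, u₀, hδ0, hu₀.1, by linarith, fun u hu => key u ⟨hu₀.1.trans hu.1, by linarith [hu.2]⟩ ?_⟩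
    rw [abs_of_nonneg (by linarith [hu.1])]; linarith [hu.2]
  · refine ⟨δ, u₀ - δ, hδ0, by linarith, by linarith [hu₀.2], fun u hu => key u
      ⟨by linarith [hu.1], by linarith [hu.2, hu₀.2]⟩ ?_⟩
    rw [abs_le]; constructor <;> linarith [hu.1, hu.2]

/-- The sum of the kernel over the sample, in the time scale of the observations. -/
def kernelSum (K : ℝ → ℝ) (n : ℕ) (B x : ℝ) : ℝ := ∑ l ∈ Finset.Icc 1 n, K ((l - x) / B)

theorem IsRegularKernel.weight_eq (hK : IsRegularKernel K) {b : ℝ} {n : ℕ} (hb : 0 < b) (hn : 0 < n)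
    (t : ℝ) (i : ℕ) :
    weight K b n t i = K ((i - n * t) / (n * b)) / kernelSum K n (n * b) (n * t) := by
  have hn' : (0 : ℝ) < n := by exact_mod_cast hn
  have h1 : ∀ i : ℕ, scaledKernel K b ((i : ℝ) / n) t = K ((i - n * t) / (n * b)) / b := fun i => by
    unfold scaledKernel
    congr 1
    have h2 : |(i : ℝ) / n - t| / b = |(i - n * t) / (n * b)| := by
      rw [abs_div, abs_of_pos (show 0 < n * b by positivity),
        show (i : ℝ) / n - t = (i - n * t) / n by field_simp, abs_div, abs_of_pos hn', div_div]
    rw [h2]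
    rcases abs_choice (((i : ℝ) - n * t) / (n * b)) with h | h <;> rw [h]
    exact hK.symm _
  unfold weight kernelSum
  simp only [h1]
  rw [← Finset.sum_div, div_div_div_cancel_right₀ hb.ne']

/-- At least `Bδ - 1 ≥ Bδ/2` sample points fall where the kernel is at least `1/8`. -/
theorem IsRegularKernel.exists_kernelSum_ge (hK : IsRegularKernel K) :
    ∃ c B₀ : ℝ, 0 < c ∧ 1 ≤ B₀ ∧ ∀ (n : ℕ) (B x : ℝ), B₀ ≤ B → B ≤ x → x ≤ n - B →
      c * B ≤ kernelSum K n B x := by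
  obtain ⟨δ, u₁, hδ, hu1, hu2, hKu⟩ := hK.exists_interval
  refine ⟨δ / 16, max 1 (2 / δ), by positivity, le_max_left _ _, fun n B x hB hBx hxn => ?_⟩
  have hB1 : 1 ≤ B := (le_max_left _ _).trans hB
  have hB0 : 0 < B := by linarith
  have hBδ : 2 ≤ B * δ := by
    have := (le_max_right _ _).trans hB
    rwa [div_le_iff₀ hδ] at this
  set α := x + B * u₁ with hα
  have hα0 : 0 ≤ α := by nlinarith
  have hαn : α + B * δ ≤ n := by nlinarith
  set m := ⌊B * δ⌋₊ with hm
  have hm1 : (m : ℝ) ≤ B * δ := Nat.floor_le (by positivity)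
  have hm2 : B * δ - 1 < m := Nat.sub_one_lt_floor _
  have hfl1 : (⌊α⌋₊ : ℝ) ≤ α := Nat.floor_le hα0
  have hfl2 : α < ⌊α⌋₊ + 1 := Nat.lt_floor_add_one _
  have hsub : (Finset.range m).image (fun i => ⌊α⌋₊ + 1 + i) ⊆ Finset.Icc 1 n := by
    intro l hl
    obtain ⟨i, hi, rfl⟩ := Finset.mem_image.1 hl
    have hi' : (i : ℝ) + 1 ≤ m := by exact_mod_cast Finset.mem_range.1 hi
    refine Finset.mem_Icc.2 ⟨by omega, ?_⟩
    have : ((⌊α⌋₊ + 1 + i : ℕ) : ℝ) ≤ n := by push_cast; linarith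
    exact_mod_cast this
  unfold kernelSum
  calc δ / 16 * B ≤ m * (1 / 8) := by linarith
    _ = ∑ i ∈ Finset.range m, (1 / 8 : ℝ) := by simp
    _ ≤ ∑ i ∈ Finset.range m, K (((⌊α⌋₊ + 1 + i : ℕ) - x) / B) := by
        refine Finset.sum_le_sum fun i hi => hKu _ ?_
        have hi' : (i : ℝ) + 1 ≤ m := by exact_mod_cast Finset.mem_range.1 hi
        have hi0 : (0 : ℝ) ≤ i := Nat.cast_nonneg i
        push_cast
        constructor
        · rw [le_div_iff₀ hB0]; linarith
        · rw [div_le_iff₀ hB0]; linarith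
    _ = ∑ l ∈ (Finset.range m).image (fun i => ⌊α⌋₊ + 1 + i), K ((l - x) / B) := by
        rw [Finset.sum_image fun a _ b _ hab => by simpa using hab]
    _ ≤ _ := Finset.sum_le_sum_of_subset_of_nonneg hsub fun l _ _ => hK.nonneg _

theorem IsRegularKernel.eq_zero (hK : IsRegularKernel K) {B y : ℝ} (hB : 0 < B) (h : B < |y|) :
    K (y / B) = 0 := by
  refine hK.support _ fun hmem => ?_
  have h1 := abs_le.2 hmem
  rw [abs_div, abs_of_pos hB, div_le_one hB] at h1
  linarith

/-- A weighted sum is bounded in terms of the partial sums over a window which contains the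
support of the weights. -/
theorem IsRegularKernel.exists_abs_weighted_sum_le (hK : IsRegularKernel K) :
    ∃ C B₀ : ℝ, 0 < C ∧ 1 ≤ B₀ ∧ ∀ (n : ℕ) (b t : ℝ), 0 < b → B₀ ≤ n * b →
      t ∈ Set.Icc b (1 - b) → ∀ (Y : ℕ → ℝ), (∀ i, ¬ (1 ≤ i ∧ i ≤ n) → Y i = 0) →
      ∀ (a m : ℕ), (∀ i ∈ Finset.Icc 1 n, |(i : ℝ) - n * t| ≤ n * b → a ≤ i ∧ i < a + m) →
      ∀ G : ℝ, (∀ k ≤ m, |∑ i ∈ Finset.range k, Y (a + i)| ≤ G) →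
      |∑ i ∈ Finset.Icc 1 n, weight K b n t i * Y i| ≤ C / (n * b) * G := by
  obtain ⟨c, B₀, hc, hB₀, hZ⟩ := hK.exists_kernelSum_ge
  obtain ⟨V, hV0, hV, -⟩ := hK.exists_variationBound
  obtain ⟨M, hM0, hM⟩ := hK.exists_bound
  refine ⟨(M + V) / c, B₀, by positivity, hB₀, fun n b t hb hB ht Y hY a m hsupp G hG => ?_⟩
  have hB0 : 0 < n * b := by linarith
  have hn : 0 < n := by
    rcases Nat.eq_zero_or_pos n with rfl | h
    · simp at hB0
    · exact h
  have hn' : (0 : ℝ) < n := by exact_mod_cast hn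
  have hx1 : n * b ≤ n * t := mul_le_mul_of_nonneg_left ht.1 hn'.le
  have hx2 : n * t ≤ n - n * b := by nlinarith [mul_le_mul_of_nonneg_left ht.2 hn'.le]
  have hZc := hZ n (n * b) (n * t) hB hx1 hx2
  set Z := kernelSum K n (n * b) (n * t)
  have hZ0 : 0 < Z := lt_of_lt_of_le (by positivity) hZc
  have hG0 : 0 ≤ G := (abs_nonneg _).trans (hG 0 (Nat.zero_le _))
  have e1 : ∑ i ∈ Finset.Icc 1 n, weight K b n t i * Y i =
      (∑ k ∈ Finset.range m, K (((a + k : ℕ) - n * t) / (n * b)) * Y (a + k)) / Z := by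
    simp only [hK.weight_eq hb hn]
    rw [Finset.sum_div]
    have h1 : ∑ k ∈ Finset.range m, K (((a + k : ℕ) - n * t) / (n * b)) * Y (a + k) / Z =
        ∑ i ∈ (Finset.range m).image (fun k => a + k), K ((i - n * t) / (n * b)) / Z * Y i := by
      rw [Finset.sum_image fun a _ b _ hab => by simpa using hab]
      exact Finset.sum_congr rfl fun k _ => by ring
    rw [h1]
    refine Finset.sum_congr_of_eq_on_inter ?_ ?_ fun _ _ _ => rfl
    · intro i hi hni
      by_cases hd : |(i : ℝ) - n * t| ≤ n * b
      · obtain ⟨h2, h3⟩ := hsupp i hi hd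
        exact absurd (Finset.mem_image.2 ⟨i - a, Finset.mem_range.2 (by omega), by omega⟩) hni
      · rw [hK.eq_zero hB0 (not_le.1 hd), zero_div, zero_mul]
    · intro i _ hni
      rw [hY i (by simpa using hni), mul_zero]
  rw [e1, abs_div, abs_of_pos hZ0, div_le_iff₀ hZ0]
  have h2 := abs_sum_mul_le_of_partial_sums (c := fun k => K (((a + k : ℕ) - n * t) / (n * b)))
    (y := fun k => Y (a + k)) hG
  refine h2.trans ?_
  have hmono : Monotone fun k : ℕ => (((a + k : ℕ) : ℝ) - n * t) / (n * b) := by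
    intro k k' hk
    dsimp only
    gcongr
  have h3 := hV.sum_le hmono m
  have h4 : |K (((a + m : ℕ) - n * t) / (n * b))| ≤ M := by
    rw [abs_of_nonneg (hK.nonneg _)]; exact hM _
  calc _ ≤ (M + V) * G := by
        refine mul_le_mul_of_nonneg_right (add_le_add h4 h3) hG0
    _ = (M + V) / c / (n * b) * G * (c * (n * b)) := by
        field_simp
    _ ≤ _ := by gcongr

theorem weight_nonneg (hK : IsRegularKernel K) {b : ℝ} (hb : 0 < b) (n : ℕ) (t : ℝ) (i : ℕ) :
    0 ≤ weight K b n t i :=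
  div_nonneg (div_nonneg (hK.nonneg _) hb.le)
    (Finset.sum_nonneg fun _ _ => div_nonneg (hK.nonneg _) hb.le)

/-- For the first moment: `u ↦ u K(u)` is odd, so its sum over a grid centred at the integer `⌊nt⌋`
vanishes, and moving the centre to `nt` costs at most the variation of this function. The sum thus
stays bounded where the trivial estimate would be of order `nb`. -/
theorem IsRegularKernel.exists_weight_facts (hK : IsRegularKernel K) :
    ∃ C B₀ : ℝ, 0 < C ∧ 1 ≤ B₀ ∧ ∀ (n : ℕ) (b t : ℝ), 0 < b → B₀ ≤ n * b →
      t ∈ Set.Icc b (1 - b) → ∑ i ∈ Finset.Icc 1 n, weight K b n t i = 1 ∧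
      (∀ i, weight K b n t i ≤ C / (n * b)) ∧
      |∑ i ∈ Finset.Icc 1 n, weight K b n t i * ((i : ℝ) / n - t)| ≤ C / (n * b) := by
  obtain ⟨c, B₀, hc, hB₀, hZ⟩ := hK.exists_kernelSum_ge
  obtain ⟨V, hV0, -, hV⟩ := hK.exists_variationBound
  obtain ⟨M, hM0, hM⟩ := hK.exists_bound
  refine ⟨(M + V) / c, B₀, by positivity, hB₀, fun n b t hb hB ht => ?_⟩
  have hB0 : 0 < n * b := by linarith
  have hn : 0 < n := by
    rcases Nat.eq_zero_or_pos n with rfl | h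
    · simp at hB0
    · exact h
  have hn' : (0 : ℝ) < n := by exact_mod_cast hn
  have hx1 : n * b ≤ n * t := mul_le_mul_of_nonneg_left ht.1 hn'.le
  have hx2 : n * t ≤ n - n * b := by nlinarith [mul_le_mul_of_nonneg_left ht.2 hn'.le]
  have hZc := hZ n (n * b) (n * t) hB hx1 hx2
  have hb1 : b ≤ 1 := by linarith [ht.1, ht.2]
  set B := n * b with hBdef
  set x := n * t with hx
  have hZ0 : 0 < kernelSum K n B x := lt_of_lt_of_le (by positivity) hZc
  refine ⟨?_, fun i => ?_, ?_⟩
  · simp only [hK.weight_eq hb hn]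
    rw [← Finset.sum_div]
    exact div_self hZ0.ne'
  · rw [hK.weight_eq hb hn, div_le_div_iff₀ hZ0 hB0]
    calc _ ≤ M * B := by gcongr; exact hM _
      _ ≤ (M + V) / c * (c * B) := by
          rw [show (M + V) / c * (c * B) = (M + V) * B by field_simp]
          exact mul_le_mul_of_nonneg_right (by linarith) hB0.le
      _ ≤ _ := by gcongr
  · set f : ℝ → ℝ := fun u => u * K u with hf
    have hf0 : ∀ y : ℝ, B < |y| → f (y / B) = 0 := fun y hy => by
      simp only [hf, hK.eq_zero hB0 hy, mul_zero]
    have e1 : ∑ i ∈ Finset.Icc 1 n, weight K b n t i * ((i : ℝ) / n - t) =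
        b * (∑ i ∈ Finset.Icc 1 n, f ((i - x) / B)) / kernelSum K n B x := by
      simp only [hK.weight_eq hb hn]
      rw [Finset.mul_sum, Finset.sum_div]
      refine Finset.sum_congr rfl fun i _ => ?_
      have : (i : ℝ) / n - t = b * ((i - x) / B) := by
        rw [hx, hBdef]; field_simp
      rw [this, hf]; ring
    have hx0 : 0 ≤ x := by linarith
    set x₀ := ⌊x⌋₊ with hx₀
    have hfl1 : (x₀ : ℝ) ≤ x := Nat.floor_le hx0
    have hfl2 : x < x₀ + 1 := Nat.lt_floor_add_one _
    -- Here `k - 1` runs from `-1` to `2x₀ + 1`, symmetrically about `x₀`.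
    set S := ∑ k ∈ Finset.range (2 * x₀ + 3), f (((k : ℝ) - 1 - x) / B) with hS
    have hsym : ∑ k ∈ Finset.range (2 * x₀ + 3), f (((k : ℝ) - 1 - x₀) / B) = 0 := by
      have h1 := Finset.sum_range_reflect (fun k : ℕ => f (((k : ℝ) - 1 - x₀) / B)) (2 * x₀ + 3)
      have h2 : ∀ k ∈ Finset.range (2 * x₀ + 3),
          f ((((2 * x₀ + 3 - 1 - k : ℕ) : ℝ) - 1 - x₀) / B) = -f (((k : ℝ) - 1 - x₀) / B) :=
        fun k hk => by
        have hk' := Finset.mem_range.1 hk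
        have h3 : (((2 * x₀ + 3 - 1 - k : ℕ) : ℝ) - 1 - x₀) / B = -(((k : ℝ) - 1 - x₀) / B) := by
          rw [Nat.cast_sub (by omega)]; push_cast; ring
        rw [h3]
        simp only [hf, hK.symm]; ring
      rw [Finset.sum_congr rfl h2, Finset.sum_neg_distrib] at h1
      linarith
    have hSV : |S| ≤ V := by
      have h1 : S = -∑ k ∈ Finset.range (2 * x₀ + 3),
          (f (((k : ℝ) - 1 - x₀) / B) - f (((k : ℝ) - 1 - x) / B)) := by
        rw [Finset.sum_sub_distrib, hsym]; ring
      rw [h1, abs_neg]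
      refine (Finset.abs_sum_le_sum_abs _ _).trans ?_
      have h2 := hV.sum_shift_le (s := fun k : ℕ => ((k : ℝ) - 1 - x) / B)
        (r := fun k : ℕ => ((k : ℝ) - 2 - x₀) / B) (fun k => by
          push_cast; gcongr ?_ / B; linarith) (fun k => by
          gcongr ?_ / B; linarith) (2 * x₀ + 3)
      refine le_trans (le_of_eq (Finset.sum_congr rfl fun k _ => ?_)) h2
      push_cast
      rw [show (k : ℝ) - 1 - x₀ = k + 1 - 2 - x₀ by ring]
    -- The point `-1` is outside the support of the kernel. The point `0` is not in the sample but
    -- may lie on the boundary of the support, when `x = B`, so its term is kept and bounded by `M`.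
    have hsplit : ∑ i ∈ Finset.Icc 1 n, f ((i - x) / B) = S - f ((0 - x) / B) := by
      rw [hS, Finset.sum_range_succ', Finset.sum_range_succ']
      have h1 : f ((((0 : ℕ) : ℝ) - 1 - x) / B) = 0 := hf0 _ (by
        rw [abs_of_neg (by push_cast; linarith)]; push_cast; linarith)
      have h2 : ((((0 + 1 : ℕ) : ℝ) - 1 - x) / B) = (0 - x) / B := by push_cast; ring
      rw [h1, h2, add_zero, add_sub_cancel_right]
      have h3 : ∑ k ∈ Finset.range (2 * x₀ + 1), f ((((k + 1 + 1 : ℕ) : ℝ) - 1 - x) / B) =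
          ∑ i ∈ (Finset.range (2 * x₀ + 1)).image (fun k => (k + 1 : ℕ)), f ((((i : ℕ) : ℝ) - x) / B) := by
        rw [Finset.sum_image fun a _ b _ hab => Nat.add_right_cancel hab]
        refine Finset.sum_congr rfl fun k _ => ?_
        congr 2
        push_cast
        ring
      rw [h3]
      refine Finset.sum_congr_of_eq_on_inter ?_ ?_ fun _ _ _ => rfl
      · intro i hi hni
        refine hf0 _ ?_
        have hi1 := (Finset.mem_Icc.1 hi).1
        have h4 : 2 * x₀ + 2 ≤ i := by
          by_contra h5
          exact hni (Finset.mem_image.2 ⟨i - 1, Finset.mem_range.2 (by omega), by omega⟩)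
        have h6 : 2 * (x₀ : ℝ) + 2 ≤ i := by exact_mod_cast h4
        exact lt_of_lt_of_le (by linarith) (le_abs_self _)
      · intro i hi hni
        refine hf0 _ ?_
        obtain ⟨k, -, rfl⟩ := Finset.mem_image.1 hi
        have h4 : n < k + 1 := by
          by_contra h5
          exact hni (Finset.mem_Icc.2 ⟨by omega, by omega⟩)
        have h6 : (n : ℝ) < (k + 1 : ℕ) := by exact_mod_cast h4
        exact lt_of_lt_of_le (by linarith) (le_abs_self _)
    have hf1 : |f ((0 - x) / B)| ≤ M := by
      by_cases hy : B < |0 - x|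
      · rw [hf0 _ hy]; simpa using hM0.le
      · simp only [hf, abs_mul, abs_div, abs_of_pos hB0]
        have h1 : |0 - x| / B ≤ 1 := by rw [div_le_one hB0]; exact not_lt.1 hy
        have h2 : |K ((0 - x) / B)| ≤ M := by rw [abs_of_nonneg (hK.nonneg _)]; exact hM _
        exact (mul_le_mul h1 h2 (abs_nonneg _) zero_le_one).trans_eq (one_mul _)
    rw [e1, hsplit, abs_div, abs_of_pos hZ0, div_le_div_iff₀ hZ0 hB0, abs_mul, abs_of_pos hb]
    have h7 : |S - f ((0 - x) / B)| ≤ M + V := (abs_sub _ _).trans (by linarith)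
    calc _ ≤ 1 * (M + V) * B := by gcongr
      _ = (M + V) / c * (c * B) := by field_simp
      _ ≤ _ := by gcongr

end Kernel

/-! ### The constrained minimization -/

section Clime

variable {p : ℕ} {A W V S T : Matrix (Fin p) (Fin p) ℝ} {c δ lam κ : ℝ}

theorem maxNorm_le (hc : 0 ≤ c) (h : ∀ j k, |A j k| ≤ c) : maxNorm A ≤ c :=
  Real.iSup_le (fun j => Real.iSup_le (fun k => h j k) hc) hc

theorem abs_le_maxNorm (A : Matrix (Fin p) (Fin p) ℝ) (j k : Fin p) : |A j k| ≤ maxNorm A :=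
  (le_ciSup (f := fun k => |A j k|) (Set.finite_range _).bddAbove k).trans
    (le_ciSup (f := fun j => ⨆ k, |A j k|) (Set.finite_range _).bddAbove j)

theorem maxNorm_nonneg (A : Matrix (Fin p) (Fin p) ℝ) : 0 ≤ maxNorm A :=
  Real.iSup_nonneg fun _ => Real.iSup_nonneg fun _ => abs_nonneg _

theorem sum_abs_le_colNorm (A : Matrix (Fin p) (Fin p) ℝ) (k : Fin p) :
    ∑ j, |A j k| ≤ colNorm A :=
  le_ciSup (f := fun k => ∑ j, |A j k|) (Set.finite_range _).bddAbove k

theorem abs_le_colNorm (A : Matrix (Fin p) (Fin p) ℝ) (j k : Fin p) : |A j k| ≤ colNorm A :=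
  (Finset.single_le_sum (f := fun j => |A j k|) (fun _ _ => abs_nonneg _)
    (Finset.mem_univ j)).trans (sum_abs_le_colNorm A k)

theorem colNorm_nonneg (A : Matrix (Fin p) (Fin p) ℝ) : 0 ≤ colNorm A :=
  Real.iSup_nonneg fun _ => Finset.sum_nonneg fun _ _ => abs_nonneg _

theorem abs_mul_le (hδ : ∀ j k, |A j k| ≤ δ) (W : Matrix (Fin p) (Fin p) ℝ) (j k : Fin p) :
    |(A * W) j k| ≤ δ * ∑ l, |W l k| := by
  rw [Matrix.mul_apply, Finset.mul_sum]
  refine (Finset.abs_sum_le_sum_abs _ _).trans (Finset.sum_le_sum fun l _ => ?_)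
  rw [abs_mul]
  exact mul_le_mul_of_nonneg_right (hδ j l) (abs_nonneg _)

/-- The columns of a solution have minimal `ℓ¹` norm. -/
theorem IsClime.sum_abs_le (h : IsClime S lam W) (hV : V ∈ feasible S lam) (k : Fin p) :
    ∑ j, |W j k| ≤ ∑ j, |V j k| := by
  obtain ⟨hW, hmin⟩ := h ⟨V, hV⟩
  -- Constraint and objective both decouple over columns: `W` with its column `k` taken from `V` is
  -- still feasible.
  set U := W.updateCol k (fun j => V j k) with hU
  have hcol : ∀ j l, (S * U - 1) j l = if l = k then (S * V - 1) j l else (S * W - 1) j l := by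
    intro j l
    simp only [Matrix.sub_apply, Matrix.mul_apply, hU, Matrix.updateCol_apply]
    split_ifs with hl
    · subst hl; rfl
    · rfl
  have hlam : 0 ≤ lam := (maxNorm_nonneg _).trans hW
  have hUf : U ∈ feasible S lam := by
    refine maxNorm_le hlam fun j l => ?_
    rw [hcol]
    split_ifs
    · exact (abs_le_maxNorm _ j l).trans hV
    · exact (abs_le_maxNorm _ j l).trans hW
  have h1 := hmin U hUf
  unfold entryNorm at h1
  rw [Finset.sum_comm, Finset.sum_comm (f := fun j k => |U j k|),
    ← Finset.add_sum_erase _ _ (Finset.mem_univ k),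
    ← Finset.add_sum_erase _ (fun l => ∑ j, |U j l|) (Finset.mem_univ k)] at h1
  have h2 : ∑ l ∈ Finset.univ.erase k, ∑ j, |U j l| = ∑ l ∈ Finset.univ.erase k, ∑ j, |W j l| := by
    refine Finset.sum_congr rfl fun l hl => Finset.sum_congr rfl fun j _ => ?_
    rw [hU, Matrix.updateCol_ne (Finset.ne_of_mem_erase hl)]
  have h3 : ∑ j, |U j k| = ∑ j, |V j k| := by
    refine Finset.sum_congr rfl fun j _ => ?_
    rw [hU, Matrix.updateCol_self]
  rw [h2, h3] at h1
  linarith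

/-- The identity `W - T⁻¹ = T⁻¹((SW - 1) - (S - T)W)` reduces the error to the constraint and the
columns of `W`, which by minimality are no longer than those of the competitor `V`. Symmetry of
`T⁻¹` turns the column norm into the row norm that is needed. -/
theorem maxNorm_sub_inv_le_of_feasible (hT : IsUnit T) (hTs : T.IsSymm) (hκ : colNorm T⁻¹ ≤ κ)
    (h : IsClime S lam W) (hV : V ∈ feasible S lam)
    (hVc : ∀ k, ∑ j, |V j k| ≤ c) (hδ : ∀ j k, |S j k - T j k| ≤ δ) (hδ0 : 0 ≤ δ)
    (hc0 : 0 ≤ c) : maxNorm (W - T⁻¹) ≤ κ * (lam + δ * c) := by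
  obtain ⟨hW, -⟩ := h ⟨V, hV⟩
  have hlam : 0 ≤ lam := (maxNorm_nonneg _).trans hW
  have hκ0 : 0 ≤ κ := (colNorm_nonneg _).trans hκ
  have hdet : IsUnit T.det := (Matrix.isUnit_iff_isUnit_det T).1 hT
  have h1 : W - T⁻¹ = T⁻¹ * ((S * W - 1) - (S - T) * W) := by
    have : (S * W - 1) - (S - T) * W = T * W - 1 := by rw [Matrix.sub_mul]; abel
    rw [this, Matrix.mul_sub, ← Matrix.mul_assoc, Matrix.nonsing_inv_mul _ hdet, Matrix.one_mul,
      Matrix.mul_one]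
  have hent : ∀ j k, |((S * W - 1) - (S - T) * W) j k| ≤ lam + δ * c := fun j k => by
    rw [Matrix.sub_apply]
    refine (abs_sub _ _).trans (add_le_add ((abs_le_maxNorm _ j k).trans hW) ?_)
    exact (abs_mul_le (A := S - T) hδ W j k).trans
      (mul_le_mul_of_nonneg_left ((h.sum_abs_le hV k).trans (hVc k)) hδ0)
  have hb0 : 0 ≤ lam + δ * c := by positivity
  refine maxNorm_le (mul_nonneg hκ0 hb0) fun j k => ?_
  rw [h1, Matrix.mul_apply]
  refine (Finset.abs_sum_le_sum_abs _ _).trans ?_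
  have hsymm : (T⁻¹).IsSymm := hTs.inv
  calc _ ≤ ∑ l, |T⁻¹ l j| * (lam + δ * c) := by
        refine Finset.sum_le_sum fun l _ => ?_
        rw [abs_mul, hsymm.apply l j]
        exact mul_le_mul_of_nonneg_left (hent l k) (abs_nonneg _)
    _ ≤ _ := by
        rw [← Finset.sum_mul]
        exact mul_le_mul_of_nonneg_right ((sum_abs_le_colNorm _ j).trans hκ) hb0

/-- The error of a solution when the inverse of the target is feasible. -/
theorem maxNorm_clime_sub_inv_le (hT : IsUnit T) (hTs : T.IsSymm) (hκ : colNorm T⁻¹ ≤ κ)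
    (h : IsClime S lam W) (hδ : ∀ j k, |S j k - T j k| ≤ δ)
    (hδ0 : 0 ≤ δ) (hδlam : δ * κ ≤ lam) : maxNorm (W - T⁻¹) ≤ 2 * (κ * lam) := by
  have hdet : IsUnit T.det := (Matrix.isUnit_iff_isUnit_det T).1 hT
  have hκ0 : 0 ≤ κ := (colNorm_nonneg _).trans hκ
  have hc : ∀ k, ∑ j, |T⁻¹ j k| ≤ κ := fun k => (sum_abs_le_colNorm _ k).trans hκ
  have hf : T⁻¹ ∈ feasible S lam := by
    refine maxNorm_le ((mul_nonneg hδ0 hκ0).trans hδlam) fun j k => ?_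
    have h1 : S * T⁻¹ - 1 = (S - T) * T⁻¹ := by
      rw [Matrix.sub_mul, Matrix.mul_nonsing_inv _ hdet]
    rw [h1]
    exact (abs_mul_le (A := S - T) hδ _ j k).trans
      ((mul_le_mul_of_nonneg_left (hc k) hδ0).trans hδlam)
  refine (maxNorm_sub_inv_le_of_feasible hT hTs hκ h hf hc hδ hδ0 hκ0).trans ?_
  nlinarith

/-- The error of a solution when the perturbation is small relative to the dimension. -/
theorem maxNorm_clime_sub_inv_le_of_small (hT : IsUnit T) (hTs : T.IsSymm) (hκ : colNorm T⁻¹ ≤ κ)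
    (h : IsClime S lam W) (hlam : 0 ≤ lam)
    (hδ0 : 0 ≤ δ) (hδ : ∀ j k, |S j k - T j k| ≤ δ) {η : ℝ} (hη : ∀ j k, |S j k - T j k| ≤ η)
    (hsmall : κ * (p * η) ≤ 1 / 2) : maxNorm (W - T⁻¹) ≤ κ * (lam + δ * (2 * κ)) := by
  have hdet : IsUnit T.det := (Matrix.isUnit_iff_isUnit_det T).1 hT
  have hκ0 : 0 ≤ κ := (colNorm_nonneg _).trans hκ
  -- Writing `v = T⁻¹(Sv - (S - T)v)`, the perturbation contributes at most half of the `ℓ¹` norm of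
  -- `v`. Hence `S` is injective, and the columns of `S⁻¹` have `ℓ¹` norm at most `2κ`.
  have hvec : ∀ v w : Fin p → ℝ, S.mulVec v = w → ∑ j, |v j| ≤ 2 * κ * ∑ j, |w j| := by
    intro v w hvw
    have hv : v = T⁻¹.mulVec (w - (S - T).mulVec v) := by
      rw [Matrix.sub_mulVec, hvw, sub_sub_cancel, Matrix.mulVec_mulVec, Matrix.nonsing_inv_mul _ hdet,
        Matrix.one_mulVec]
    have hT1 : ∀ y : Fin p → ℝ, ∑ j, |T⁻¹.mulVec y j| ≤ κ * ∑ k, |y k| := fun y => by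
      calc _ ≤ ∑ j, ∑ k, |T⁻¹ j k| * |y k| := by
            refine Finset.sum_le_sum fun j _ => ?_
            simp only [Matrix.mulVec, dotProduct]
            refine (Finset.abs_sum_le_sum_abs _ _).trans_eq ?_
            simp only [abs_mul]
        _ = ∑ k, (∑ j, |T⁻¹ j k|) * |y k| := by
            rw [Finset.sum_comm]; simp only [Finset.sum_mul]
        _ ≤ ∑ k, κ * |y k| := Finset.sum_le_sum fun k _ =>
            mul_le_mul_of_nonneg_right ((sum_abs_le_colNorm _ k).trans hκ) (abs_nonneg _)
        _ = _ := by rw [Finset.mul_sum]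
    have hD : ∑ j, |(S - T).mulVec v j| ≤ p * η * ∑ k, |v k| := by
      calc _ ≤ ∑ j : Fin p, η * ∑ k, |v k| := by
            refine Finset.sum_le_sum fun j _ => ?_
            simp only [Matrix.mulVec, dotProduct]
            rw [Finset.mul_sum]
            refine (Finset.abs_sum_le_sum_abs _ _).trans (Finset.sum_le_sum fun k _ => ?_)
            rw [abs_mul]
            exact mul_le_mul_of_nonneg_right (hη j k) (abs_nonneg _)
        _ = _ := by
            rw [Finset.sum_const, Finset.card_univ, Fintype.card_fin, nsmul_eq_mul]; ring
    have hsum : ∑ j, |v j| ≤ κ * (∑ j, |w j| + p * η * ∑ k, |v k|) := by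
      calc ∑ j, |v j| = ∑ j, |T⁻¹.mulVec (w - (S - T).mulVec v) j| := by rw [← hv]
        _ ≤ κ * ∑ k, |(w - (S - T).mulVec v) k| := hT1 _
        _ ≤ κ * (∑ j, |w j| + ∑ j, |(S - T).mulVec v j|) := by
            rw [← Finset.sum_add_distrib]
            exact mul_le_mul_of_nonneg_left (Finset.sum_le_sum fun k _ => abs_sub _ _) hκ0
        _ ≤ _ := by gcongr
    have hv0 : 0 ≤ ∑ k, |v k| := Finset.sum_nonneg fun _ _ => abs_nonneg _
    nlinarith
  have hSdet : IsUnit S.det := by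
    rw [isUnit_iff_ne_zero]
    intro h0
    obtain ⟨v, hv0, hv⟩ := Matrix.exists_mulVec_eq_zero_iff.2 h0
    have h1 := hvec v 0 hv
    simp only [Pi.zero_apply, abs_zero, Finset.sum_const_zero, mul_zero] at h1
    refine hv0 (funext fun j => ?_)
    have h2 := (Finset.single_le_sum (f := fun j => |v j|) (fun _ _ => abs_nonneg _)
      (Finset.mem_univ j)).trans h1
    exact abs_nonpos_iff.1 h2
  have hSf : S⁻¹ ∈ feasible S lam := by
    refine maxNorm_le hlam fun j k => ?_
    rw [Matrix.mul_nonsing_inv _ hSdet]; simpa using hlam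
  refine maxNorm_sub_inv_le_of_feasible hT hTs hκ h hSf (fun k => ?_) hδ hδ0 (by positivity)
  have h1 := hvec (fun j => S⁻¹ j k) (fun j => (1 : Matrix (Fin p) (Fin p) ℝ) j k) (by
    ext j
    rw [← Matrix.mul_nonsing_inv _ hSdet]; rfl)
  refine h1.trans_eq ?_
  rw [Finset.sum_eq_single k (fun j _ hj => by simp [hj]) (by simp)]
  simp

/-- The zero matrix is feasible, so the solution is zero and the error is `T⁻¹` itself. -/
theorem maxNorm_clime_sub_inv_le_of_one_le (hκ : colNorm T⁻¹ ≤ κ)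
    (h : IsClime S lam W) (hlam : 1 ≤ lam) :
    maxNorm (W - T⁻¹) ≤ 2 * (κ * lam) := by
  have hκ0 : 0 ≤ κ := (colNorm_nonneg _).trans hκ
  have hf : (0 : Matrix (Fin p) (Fin p) ℝ) ∈ feasible S lam := by
    refine maxNorm_le (by linarith) fun j k => ?_
    rw [Matrix.mul_zero, zero_sub, Matrix.neg_apply, abs_neg, Matrix.one_apply]
    split_ifs
    · simpa using hlam
    · simp; linarith
  refine maxNorm_le (by positivity) fun j k => ?_
  have h1 := h.sum_abs_le hf k
  simp only [Matrix.zero_apply, abs_zero, Finset.sum_const_zero] at h1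
  have h2 := (Finset.single_le_sum (f := fun j => |W j k|) (fun _ _ => abs_nonneg _)
    (Finset.mem_univ j)).trans h1
  have h3 := (abs_le_colNorm T⁻¹ j k).trans hκ
  rw [Matrix.sub_apply]
  refine (abs_sub _ _).trans ?_
  nlinarith

end Clime

/-! ### Bias -/

section Bias

/-- The slope is the derivative at the interior point `t`. It is bounded through the Lipschitz
constant `ℓ`, which in the application is proportional to `N`, and not through `D`. -/
theorem exists_taylor {σ : ℝ → ℝ} {D ℓ t : ℝ} (hσ : ContDiffOn ℝ 2 σ (Set.Ico 0 1))
    (hD : ∀ t ∈ Set.Ico (0 : ℝ) 1, |iteratedDerivWithin 2 σ (Set.Ico 0 1) t| ≤ D)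
    (hℓ : ∀ s ∈ Set.Ico (0 : ℝ) 1, ∀ t ∈ Set.Ico (0 : ℝ) 1, |σ s - σ t| ≤ ℓ * |s - t|)
    (hℓ0 : 0 ≤ ℓ) (ht : t ∈ Set.Ioo (0 : ℝ) 1) :
    ∃ g : ℝ, |g| ≤ ℓ ∧ ∀ s ∈ Set.Ico (0 : ℝ) 1, |σ s - σ t - g * (s - t)| ≤ D * (s - t) ^ 2 := by
  set I := Set.Ico (0 : ℝ) 1 with hI
  have hu : UniqueDiffOn ℝ I := uniqueDiffOn_Ico 0 1
  have htI : t ∈ I := ⟨ht.1.le, ht.2⟩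
  have hdσ : DifferentiableOn ℝ σ I := hσ.differentiableOn (by norm_num)
  have hdg : DifferentiableOn ℝ (derivWithin σ I) I := by
    have := hσ.derivWithin hu (m := 1) (by norm_num)
    exact this.differentiableOn (by norm_num)
  have h2 : ∀ s ∈ I, ‖derivWithin (derivWithin σ I) I s‖ ≤ D := fun s hs => by
    have := hD s hs
    rwa [iteratedDerivWithin_succ, iteratedDerivWithin_one] at this
  have hconv : Convex ℝ I := convex_Ico 0 1
  have hg : ∀ s ∈ I, |derivWithin σ I s - derivWithin σ I t| ≤ D * |s - t| := fun s hs =>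
    hconv.norm_image_sub_le_of_norm_derivWithin_le hdg h2 htI hs
  refine ⟨derivWithin σ I t, ?_, fun s hs => ?_⟩
  · have hnhds : I ∈ 𝓝 t := Ico_mem_nhds ht.1 ht.2
    have h3 : HasDerivAt σ (derivWithin σ I t) t :=
      (hdσ t htI).hasDerivWithinAt.hasDerivAt hnhds
    exact h3.le_of_lip' hℓ0 (by filter_upwards [hnhds] with s hs using hℓ s hs t htI)
  · set h : ℝ → ℝ := fun r => σ r - derivWithin σ I t * r with hh
    have hsub : Set.uIcc t s ⊆ I := hconv.ordConnected.uIcc_subset htI hs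
    have hder : ∀ r ∈ Set.uIcc t s, HasDerivWithinAt h (derivWithin σ I r - derivWithin σ I t)
        (Set.uIcc t s) r := fun r hr => by
      have h4 := ((hdσ r (hsub hr)).hasDerivWithinAt.mono hsub)
      have h5 := ((hasDerivWithinAt_id r (Set.uIcc t s)).const_mul (derivWithin σ I t))
      rw [mul_one] at h5
      exact h4.sub h5
    have hbound : ∀ r ∈ Set.uIcc t s, ‖derivWithin σ I r - derivWithin σ I t‖ ≤ D * |s - t| :=
      fun r hr => by
      refine (hg r (hsub hr)).trans ?_
      have hD0 : 0 ≤ D := (abs_nonneg _).trans (hD t htI)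
      exact mul_le_mul_of_nonneg_left (Set.abs_sub_left_of_mem_uIcc hr) hD0
    have h6 := (convex_uIcc t s).norm_image_sub_le_of_norm_hasDerivWithin_le hder hbound
      Set.left_mem_uIcc Set.right_mem_uIcc
    rw [Real.norm_eq_abs, Real.norm_eq_abs] at h6
    have e : h s - h t = σ s - σ t - derivWithin σ I t * (s - t) := by simp only [hh]; ring
    rw [e] at h6
    refine h6.trans_eq ?_
    rw [mul_assoc, ← sq, sq_abs]

/-- Taylor's formula at `t`: the remainder is at most `D b²` on the kernel window, and the linear
term is small by the first moment of the weights. Smoothness is available on `[0,1)` only, so the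
observation `i = n` is treated apart: its weight is of order `1/(nb)` and its Taylor remainder of
order `N`. -/
theorem Model.exists_bias_le {q L : ℝ} (A ν D : ℝ) (hq : 2 < q) (hL : 0 < L) {K : ℝ → ℝ}
    (hK : IsRegularKernel K) :
    ∃ C B₀ : ℝ, 0 < C ∧ 1 ≤ B₀ ∧ ∀ {p : ℕ} {S : Type*} [MeasurableSpace S] (X : Model p S),
      X.Dependence q A ν → X.Smooth L D → ∀ (n : ℕ) (b t : ℝ), 0 < b → B₀ ≤ n * b →
      t ∈ Set.Icc b (1 - b) → ∀ j k,
      |∑ i ∈ Finset.Icc 1 n, weight K b n t i * X.cov ((i : ℝ) / n) j k - X.cov t j k| ≤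
        C * (b ^ 2 + X.N 2 A / (n * b)) := by
  obtain ⟨C₁, B₀, hC₁, hB₀, hw⟩ := hK.exists_weight_facts
  set v := momentBound q ν with hv
  have hv0 : 0 ≤ v := momentBound_nonneg q ν
  refine ⟨|D| + C₁ * (2 * v + 4 * L) + 1, B₀, by positivity, hB₀, ?_⟩
  intro p S _ X hX hs n b t hb hB ht j k
  obtain ⟨hw1, hw2, hw3⟩ := hw n b t hb hB ht
  have hB0 : 0 < n * b := by linarith
  have hn' : (0 : ℝ) < n := by
    by_contra h
    nlinarith
  have hN := X.N_nonneg 2 A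
  have ht0 : t ∈ Set.Ioo (0 : ℝ) 1 := ⟨by linarith [ht.1], by linarith [ht.2]⟩
  have htI : t ∈ Set.Ico (0 : ℝ) 1 := ⟨ht0.1.le, ht0.2⟩
  obtain ⟨g, hg, htay⟩ := exists_taylor (hs.contDiff j k) (hs.deriv_le j k)
    (fun s hs' t ht' => X.abs_cov_sub_le hq hL hX hs hs' ht' j k) (by positivity) ht0
  have hw0 : ∀ i, 0 ≤ weight K b n t i := weight_nonneg hK hb n t
  have hD0 : 0 ≤ D := (abs_nonneg _).trans (hs.deriv_le j k t htI)
  set r : ℕ → ℝ := fun i => X.cov ((i : ℝ) / n) j k - X.cov t j k - g * ((i : ℝ) / n - t) with hr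
  have e : ∑ i ∈ Finset.Icc 1 n, weight K b n t i * X.cov ((i : ℝ) / n) j k - X.cov t j k =
      ∑ i ∈ Finset.Icc 1 n, weight K b n t i * r i +
        g * ∑ i ∈ Finset.Icc 1 n, weight K b n t i * ((i : ℝ) / n - t) := by
    have h1 : X.cov t j k = ∑ i ∈ Finset.Icc 1 n, weight K b n t i * X.cov t j k := by
      rw [← Finset.sum_mul, hw1, one_mul]
    conv_lhs => rw [h1]
    rw [Finset.mul_sum, ← Finset.sum_add_distrib, ← Finset.sum_sub_distrib]
    refine Finset.sum_congr rfl fun i _ => ?_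
    simp only [hr]; ring
  have hri : ∀ i ∈ Finset.Icc 1 n, |weight K b n t i * r i| ≤ weight K b n t i * (D * b ^ 2) +
      (if i = n then C₁ / (n * b) * (2 * X.N 2 A * v + 2 * X.N 2 A * L) else 0) := by
    intro i hi
    rw [abs_mul, abs_of_nonneg (hw0 i)]
    obtain ⟨hi1, hi2⟩ := Finset.mem_Icc.1 hi
    by_cases hin : i = n
    · rw [if_pos hin]
      have h1 : (i : ℝ) / n = 1 := by rw [hin]; exact div_self hn'.ne'
      have h2 : |r i| ≤ 2 * X.N 2 A * v + 2 * X.N 2 A * L := by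
        simp only [hr, h1]
        have a1 := X.abs_cov_le hq hX hs (t := 1) (by simp) j k
        have a2 := X.abs_cov_le hq hX hs (Set.Ico_subset_Icc_self htI) j k
        have a3 : |g * (1 - t)| ≤ 2 * X.N 2 A * L := by
          rw [abs_mul, abs_of_pos (show 0 < 1 - t by linarith [ht0.2])]
          have := abs_nonneg g
          nlinarith [ht0.1, ht0.2]
        have a4 := abs_sub (X.cov 1 j k - X.cov t j k) (g * (1 - t))
        have a5 := abs_sub (X.cov 1 j k) (X.cov t j k)
        linarith
      have h3 := mul_le_mul (hw2 i) h2 (abs_nonneg _) (by positivity)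
      have h4 : 0 ≤ weight K b n t i * (D * b ^ 2) := mul_nonneg (hw0 i) (by positivity)
      linarith
    · rw [if_neg hin, add_zero]
      have hiI : (i : ℝ) / n ∈ Set.Ico (0 : ℝ) 1 := by
        refine ⟨by positivity, (div_lt_one hn').2 ?_⟩
        exact_mod_cast lt_of_le_of_ne hi2 hin
      by_cases hd : n * b < |(i : ℝ) - n * t|
      · have : weight K b n t i = 0 := by
          rw [hK.weight_eq hb (by exact_mod_cast hn'), hK.eq_zero hB0 hd, zero_div]
        rw [this]; simp
      · refine mul_le_mul_of_nonneg_left ((htay _ hiI).trans ?_) (hw0 i)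
        refine mul_le_mul_of_nonneg_left ?_ hD0
        have h1 : |(i : ℝ) / n - t| ≤ b := by
          rw [show (i : ℝ) / n - t = (i - n * t) / n by field_simp, abs_div, abs_of_pos hn',
            div_le_iff₀ hn']
          linarith
        exact sq_le_sq' (abs_le.1 h1).1 (abs_le.1 h1).2
  have hS1 : |∑ i ∈ Finset.Icc 1 n, weight K b n t i * r i| ≤ D * b ^ 2 +
      C₁ / (n * b) * (2 * X.N 2 A * v + 2 * X.N 2 A * L) := by
    refine (Finset.abs_sum_le_sum_abs _ _).trans ((Finset.sum_le_sum hri).trans ?_)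
    rw [Finset.sum_add_distrib, ← Finset.sum_mul, hw1, one_mul, Finset.sum_ite_eq']
    split_ifs
    · rfl
    · have : 0 ≤ C₁ / (n * b) * (2 * X.N 2 A * v + 2 * X.N 2 A * L) := by positivity
      linarith
  have hS2 : |g * ∑ i ∈ Finset.Icc 1 n, weight K b n t i * ((i : ℝ) / n - t)| ≤
      2 * X.N 2 A * L * (C₁ / (n * b)) := by
    rw [abs_mul]
    exact mul_le_mul hg hw3 (abs_nonneg _) (by positivity)
  rw [e]
  refine (abs_add_le _ _).trans ((add_le_add hS1 hS2).trans ?_)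
  rw [abs_of_nonneg hD0]
  have h1 : D * b ^ 2 + C₁ / (n * b) * (2 * X.N 2 A * v + 2 * X.N 2 A * L) +
      2 * X.N 2 A * L * (C₁ / (n * b)) =
      D * b ^ 2 + (C₁ * (2 * v + 4 * L)) * (X.N 2 A / (n * b)) := by ring
  rw [h1]
  have h2 : 0 ≤ X.N 2 A / (n * b) := by positivity
  have h3 : 0 ≤ b ^ 2 := by positivity
  have h4 : 0 ≤ C₁ * (2 * v + 4 * L) := by positivity
  nlinarith [mul_nonneg hD0 h2, mul_nonneg h4 h3]

end Bias

/-! ### Deviation of the smoothed covariance matrix -/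

/-- The times in `𝒯` have kernel windows which fit into one window of length of the order `u`, and
also into short windows of length of the order `n b`, at most of the order `u / (n b)` in number. -/
structure HasWindows (n : ℕ) (b u : ℝ) (𝒯 : Set ℝ) : Prop where
  subset : 𝒯 ⊆ Set.Icc b (1 - b)
  le : n * b ≤ u
  long : ∃ a L : ℕ, (2 : ℝ) ^ L ≤ 16 * u ∧ ∀ t ∈ 𝒯, ∀ i ∈ Finset.Icc 1 n,
    |(i : ℝ) - n * t| ≤ n * b → a ≤ i ∧ i < a + 2 ^ L
  short : ∃ (a : ℕ) (𝒜 : Finset ℕ) (W W' : ℕ), (∀ d ∈ 𝒜, d + 2 ^ W ≤ 2 ^ W') ∧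
    (2 : ℝ) ^ W ≤ 16 * (n * b) ∧ (2 : ℝ) ^ W' ≤ 16 * u ∧ (𝒜.card : ℝ) ≤ 2 * u / (n * b) ∧
    ∀ t ∈ 𝒯, ∃ d ∈ 𝒜, ∀ i ∈ Finset.Icc 1 n,
      |(i : ℝ) - n * t| ≤ n * b → a + d ≤ i ∧ i < a + d + 2 ^ W

theorem varpi_pos {q A u : ℝ} (hu : 3 ≤ u) : 0 < varpi q A u := by
  have h1 : 0 < Real.log u := Real.log_pos (by linarith)
  have h2 : 0 < u := by linarith
  unfold varpi
  split_ifs <;> positivity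

namespace Model

theorem covHat_sub_cov {p : ℕ} {S : Type*} [MeasurableSpace S] (X : Model p S) (K : ℝ → ℝ) (b : ℝ)
    (n : ℕ) (ω : S) (t : ℝ) (j k : Fin p) :
    X.covHat K b n ω t j k - X.cov t j k =
      ∑ i ∈ Finset.Icc 1 n, weight K b n t i * X.centered n j k i ω +
      (∑ i ∈ Finset.Icc 1 n, weight K b n t i * X.cov ((i : ℝ) / n) j k - X.cov t j k) := by
  have h1 : X.covHat K b n ω t j k =
      ∑ i ∈ Finset.Icc 1 n, weight K b n t i * (X.obs n i ω j * X.obs n i ω k) := by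
    simp [covHat, Matrix.sum_apply, Matrix.vecMulVec_apply]
  rw [h1, ← add_sub_assoc, ← Finset.sum_add_distrib]
  congr 1
  refine Finset.sum_congr rfl fun i hi => ?_
  rw [centered, if_pos (Finset.mem_Icc.1 hi)]
  ring

theorem centered_of_notMem {p : ℕ} {S : Type*} [MeasurableSpace S] (X : Model p S) {n : ℕ}
    (j k : Fin p) {i : ℕ} (ω : S) (hi : ¬ (1 ≤ i ∧ i ≤ n)) : X.centered n j k i ω = 0 :=
  if_neg hi

variable {q A ν L D : ℝ} {K : ℝ → ℝ}

theorem exists_covHat_deviation (ν D : ℝ) (hq : 2 < q) (hA : 0 < A) (hL : 0 < L)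
    (hK : IsRegularKernel K) :
    ∃ C B₀ : ℝ, 0 < C ∧ 3 ≤ B₀ ∧ ∀ {p : ℕ} {S : Type*} [MeasurableSpace S] (X : Model p S),
      X.Dependence q A ν → X.Smooth L D → 0 < p → 0 < X.M q A →
      ∀ {n : ℕ} {b u : ℝ} {𝒯 : Set ℝ}, 0 < b → B₀ ≤ n * b → HasWindows n b u 𝒯 →
      ∀ {Λ : ℝ}, 1 ≤ Λ →
      X.μ {ω | ∃ t ∈ 𝒯, ∃ j k, C * (b ^ 2 + (Λ ^ 2 * (p : ℝ) ^ (-(1 / (2 * q))) * X.J q A u +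
        X.N 2 A * √(u * Λ)) / (n * b)) < |X.covHat K b n ω t j k - X.cov t j k|} ≤
      ENNReal.ofReal (C * (p ^ 2 * Real.exp (-Λ) + Λ ^ (-q))) := by
  obtain ⟨C₁, hC₁, hdev⟩ := exists_centered_deviation (A := A) ν hq hA
  obtain ⟨C₂, B₂, hC₂, hB₂, hw⟩ := hK.exists_abs_weighted_sum_le
  obtain ⟨C₃, B₃, hC₃, hB₃, hbias⟩ := exists_bias_le A ν D hq hL hK
  refine ⟨C₁ + C₁ * C₂ + C₃, max 3 (max B₂ B₃), by positivity, le_max_left _ _, ?_⟩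
  intro p S _ X hX hs hp hM n b u 𝒯 hb hB hwin Λ hΛ
  have hB3 : 3 ≤ n * b := (le_max_left _ _).trans hB
  have hBB₂ : B₂ ≤ n * b := (le_max_left _ _).trans ((le_max_right _ _).trans hB)
  have hBB₃ : B₃ ≤ n * b := (le_max_right _ _).trans ((le_max_right _ _).trans hB)
  have hu : 3 ≤ u := hB3.trans hwin.le
  have hB0 : 0 < n * b := by linarith
  have hN := X.N_nonneg 2 A
  obtain ⟨a, ℓ, hℓ, hcov⟩ := hwin.long
  have hϖ : 0 < varpi q A u := varpi_pos hu
  have hp0 : (0 : ℝ) < p := by exact_mod_cast hp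
  have hq0 : 0 < q := by linarith
  -- The rows involve `√p M^q ϖ`, while `J^q = M^q p ϖ`. This `h` uses the surplus `√p` and turns
  -- the polynomial part of the probability into exactly `Λ^(-q)`.
  set h := Λ ^ 2 * (p : ℝ) ^ (-(1 / (2 * q))) * X.J q A u with hh
  have hJ0 : 0 < X.J q A u := by unfold J; positivity
  have hh0 : 0 < h := by positivity
  have hΛ0 : 0 < Λ := by linarith
  have hprob := hdev X hX n a ℓ u hu hℓ hh0 hΛ
  have hhq : (Λ / h) ^ q * varpi q A u * (√p * X.M q A ^ q) = Λ ^ (-q) := by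
    have e1 : h ^ q = (Λ ^ q * Λ ^ q) * ((√p)⁻¹ * (X.M q A ^ q * (p * varpi q A u))) := by
      rw [hh, J, Real.mul_rpow (by positivity) (by positivity), Real.mul_rpow (by positivity)
        (by positivity), Real.mul_rpow (by positivity) (by positivity), ← Real.rpow_mul (by positivity),
        ← Real.rpow_mul (by positivity), one_div_mul_cancel hq0.ne', Real.rpow_one,
        ← Real.mul_rpow hΛ0.le hΛ0.le, ← sq, Real.sqrt_eq_rpow, ← Real.rpow_neg hp0.le,
        show -(1 / (2 * q)) * q = -(1 / 2) by field_simp]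
      ring
    have hsq : √(p : ℝ) * √p = p := Real.mul_self_sqrt hp0.le
    have hsp : 0 < √(p : ℝ) := Real.sqrt_pos.2 hp0
    rw [Real.div_rpow hΛ0.le hh0.le, e1, Real.rpow_neg hΛ0.le]
    nth_rewrite 2 [← hsq]
    have h1 : 0 < Λ ^ q := by positivity
    have h2 : 0 < X.M q A ^ q := by positivity
    field_simp
  rw [hhq] at hprob
  refine le_trans (measure_mono ?_) (hprob.trans (ENNReal.ofReal_le_ofReal ?_))
  · rintro ω ⟨t, ht, j, k, hx⟩
    by_contra hcon
    simp only [Set.mem_ofPred_eq] at hcon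
    push Not at hcon
    have hG := hw n b t hb hBB₂ (hwin.subset ht) (fun i => X.centered n j k i ω)
      (fun i hi => X.centered_of_notMem j k ω hi) a (2 ^ ℓ) (hcov t ht) _
      (fun k' hk' => hcon k' hk' j k)
    have hbi := hbias X hX hs n b t hb hBB₃ (hwin.subset ht) j k
    rw [X.covHat_sub_cov] at hx
    have h1 := hx.trans_le ((abs_add_le _ _).trans (add_le_add hG hbi))
    -- The bias term `N/(nb)` is absorbed by the Gaussian part of the threshold.
    have h2 : X.N 2 A ≤ X.N 2 A * √(u * Λ) := by
      refine le_mul_of_one_le_right hN ?_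
      rw [Real.one_le_sqrt]; nlinarith
    have h3 : X.N 2 A / (n * b) ≤ (h + X.N 2 A * √(u * Λ)) / (n * b) := by
      gcongr; linarith
    have h4 : C₂ / (n * b) * (C₁ * (h + X.N 2 A * √(u * Λ))) =
        C₁ * C₂ * ((h + X.N 2 A * √(u * Λ)) / (n * b)) := by ring
    rw [h4] at h1
    have h5 : 0 ≤ (h + X.N 2 A * √(u * Λ)) / (n * b) := by positivity
    have h6 : 0 ≤ b ^ 2 := by positivity
    have h7 := mul_le_mul_of_nonneg_left h3 hC₃.le
    nlinarith [mul_pos hC₁ hC₂, mul_nonneg hC₁.le h5, mul_nonneg hC₁.le h6,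
      mul_nonneg (mul_pos hC₁ hC₂).le h6]
  · have : 0 ≤ (p : ℝ) ^ 2 * Real.exp (-Λ) + Λ ^ (-q) := by positivity
    have h1 : 0 ≤ C₁ * C₂ := by positivity
    gcongr
    linarith

/-- The squared logarithm is that of the maximal inequality at exponent `2`, over a window of length
of order `B²`; any negative power of `B` beats it. -/
theorem tendsto_rate_zero {γ α c₄ : ℝ} (hγ : 0 < γ) (hα : 0 < α) (hc₄ : 0 < c₄) (c₁ c₂ : ℝ) :
    Tendsto (fun B : ℝ => c₁ * B ^ (-α) + c₂ * ((Real.log (c₄ * B ^ 2) / Real.log 2 + 1) ^ 2 *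
      B ^ (-γ))) atTop (𝓝 0) := by
  have h1 : Tendsto (fun B : ℝ => B ^ (-α)) atTop (𝓝 0) := tendsto_rpow_neg_atTop hα
  have h2 : Tendsto (fun B : ℝ => (Real.log (c₄ * B ^ 2) / Real.log 2 + 1) * B ^ (-(γ / 2))) atTop
      (𝓝 0) := by
    have h3 : Tendsto (fun B : ℝ => B ^ (-(γ / 2))) atTop (𝓝 0) :=
      tendsto_rpow_neg_atTop (by positivity)
    have h4 : Tendsto (fun B : ℝ => Real.log B * B ^ (-(γ / 2))) atTop (𝓝 0) := by
      have := (isLittleO_log_rpow_atTop (show 0 < γ / 2 by positivity)).tendsto_div_nhds_zero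
      refine this.congr' ?_
      filter_upwards [eventually_gt_atTop 0] with B hB
      rw [Real.rpow_neg hB.le, div_eq_mul_inv]
    have h5 := (h3.const_mul (Real.log c₄ / Real.log 2 + 1)).add (h4.const_mul (2 / Real.log 2))
    simp only [mul_zero, add_zero] at h5
    refine h5.congr' ?_
    filter_upwards [eventually_gt_atTop 0] with B hB
    rw [Real.log_mul hc₄.ne' (by positivity), Real.log_pow]
    push_cast
    ring
  have h6 := (h1.const_mul c₁).add ((h2.pow 2).const_mul c₂)
  simp only [mul_zero, ne_eq, OfNat.ofNat_ne_zero, not_false_eq_true, zero_pow, add_zero] at h6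
  refine h6.congr' ?_
  filter_upwards [eventually_gt_atTop 0] with B hB
  congr 2
  rw [mul_pow, ← Real.rpow_natCast (B ^ (-(γ / 2))) 2, ← Real.rpow_mul hB.le]
  congr 2
  push_cast; ring

/-- Consistency in bounded dimension. -/
theorem exists_covHat_consistency (ν D : ℝ) (hq : 2 < q) (hA : 0 < A) (hL : 0 < L)
    (hK : IsRegularKernel K) {η c n₀ ε : ℝ} (hη : 0 < η) (hc : 0 < c) (hn₀ : 0 < n₀) (hε : 0 < ε)
    (P : ℕ) :
    ∃ b₁ B₁ : ℝ, 0 < b₁ ∧ 0 < B₁ ∧ ∀ {p : ℕ} {S : Type*} [MeasurableSpace S] (X : Model p S),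
      X.Dependence q A ν → X.Smooth L D → p ≤ P → n₀ ≤ X.N 2 A →
      ∀ {n : ℕ} {b u : ℝ} {𝒯 : Set ℝ}, 0 < b → b ≤ b₁ → B₁ ≤ n * b → HasWindows n b u 𝒯 →
      X.N 2 A * √u / (n * b) ≤ c →
      X.μ {ω | ∃ t ∈ 𝒯, ∃ j k, η < |X.covHat K b n ω t j k - X.cov t j k|} ≤ ENNReal.ofReal ε := by
  obtain ⟨C₁, hC₁, hdev⟩ := exists_centered_deviation_split (A := A) ν hq
  obtain ⟨C₂, B₂, hC₂, hB₂, hw⟩ := hK.exists_abs_weighted_sum_le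
  obtain ⟨C₃, B₃, hC₃, hB₃, hbias⟩ := exists_bias_le A ν D hq hL hK
  have hq0 : 0 < q := by linarith
  set c₃ := η / (2 * C₂) with hc₃
  have hc₃0 : 0 < c₃ := by positivity
  -- Short and long lags are separated near `B^γ`. With order `B` short windows, the short lags
  -- contribute `B * B^((γ - 1/2) q) = B^(-α)`, where `α > 0` because `q > 2`; the long lags
  -- contribute `B^(-2Aγ)` up to logarithms.
  set γ := (q / 2 - 1) / (2 * q) with hγ
  have hγ0 : 0 < γ := div_pos (by linarith) (by linarith)
  set α := (q / 2 - 1) / 2 with hα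
  have hα0 : 0 < α := by rw [hα]; linarith
  set c₄ := 16 * (c / n₀) ^ 2 with hc₄
  have hc₄0 : 0 < c₄ := by positivity
  set k₁ := C₁ * (2 * (c / n₀) ^ 2 * (P : ℝ) ^ 2 * (4 / c₃) ^ q) with hk₁
  set k₂ := C₁ * ((P : ℝ) ^ 2 * (16 * c ^ 2 * 2 ^ (2 * A) / c₃ ^ 2)) with hk₂
  have hlim := tendsto_rate_zero (γ := 2 * A * γ) (by positivity) hα0 hc₄0 k₁ k₂
  obtain ⟨B₄, hB₄⟩ := eventually_atTop.1 (hlim.eventually_le_const hε)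
  have hlim2 : Tendsto (fun B : ℝ => C₃ * (c / √B)) atTop (𝓝 0) := by
    have := (tendsto_const_nhds (x := c)).div_atTop Real.tendsto_sqrt_atTop
    simpa using this.const_mul C₃
  obtain ⟨B₅, hB₅⟩ := eventually_atTop.1
    (hlim2.eventually_le_const (show (0 : ℝ) < η / 4 by positivity))
  refine ⟨√(η / (4 * C₃)), max (max 1 B₂) (max B₃ (max B₄ B₅)), by positivity,
    lt_of_lt_of_le one_pos ((le_max_left _ _).trans (le_max_left _ _)), ?_⟩
  intro p S _ X hX hs hp hn n b u 𝒯 hb hb₁ hB hwin hNu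
  have hB1 : 1 ≤ n * b := ((le_max_left _ _).trans (le_max_left _ _)).trans hB
  have hBB₂ : B₂ ≤ n * b := ((le_max_right _ _).trans (le_max_left _ _)).trans hB
  have hBB₃ : B₃ ≤ n * b := ((le_max_left _ _).trans (le_max_right _ _)).trans hB
  have hBB₄ : B₄ ≤ n * b :=
    ((le_max_left _ _).trans ((le_max_right _ _).trans (le_max_right _ _))).trans hB
  have hBB₅ : B₅ ≤ n * b :=
    ((le_max_right _ _).trans ((le_max_right _ _).trans (le_max_right _ _))).trans hB
  have hB0 : 0 < n * b := by linarith
  have hu1 : 1 ≤ u := hB1.trans hwin.le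
  have hu0 : 0 < u := by linarith
  have hN : 0 < X.N 2 A := hn₀.trans_le hn
  set B := n * b with hBdef
  have hNu' : X.N 2 A * √u ≤ c * B := by rwa [div_le_iff₀ hB0] at hNu
  -- The lower bound on `N` converts the bound on `N √u / B` into `u = O(B²)`, so that the number of
  -- short windows is of order `B`.
  have huB : u ≤ (c / n₀) ^ 2 * B ^ 2 := by
    have h1 : n₀ * √u ≤ c * B := (mul_le_mul_of_nonneg_right hn (Real.sqrt_nonneg _)).trans hNu'
    have h2 : √u ≤ c / n₀ * B := by
      rw [div_mul_eq_mul_div, le_div_iff₀ hn₀, mul_comm]; exact h1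
    calc u = √u ^ 2 := (Real.sq_sqrt hu0.le).symm
      _ ≤ (c / n₀ * B) ^ 2 := by gcongr
      _ = _ := by ring
  obtain ⟨a, 𝒜, W, W', hW1, hW2, hW3, hcard, hcov⟩ := hwin.short
  set y := c₃ * B with hy
  have hy0 : 0 < y := by positivity
  set l := ⌊γ * Real.logb 2 B⌋₊ with hl
  have hlogb : 0 ≤ γ * Real.logb 2 B := mul_nonneg hγ0.le (Real.logb_nonneg (by norm_num) hB1)
  have hBγ : (2 : ℝ) ^ (γ * Real.logb 2 B) = B ^ γ := by
    rw [mul_comm, Real.rpow_mul (by norm_num), Real.rpow_logb (by norm_num) (by norm_num) hB0]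
  have hl1 : (2 : ℝ) ^ l ≤ B ^ γ := by
    rw [← hBγ, ← Real.rpow_natCast]
    exact Real.rpow_le_rpow_of_exponent_le (by norm_num) (Nat.floor_le hlogb)
  have hl2 : B ^ γ / 2 ≤ (2 : ℝ) ^ l := by
    rw [← hBγ, div_le_iff₀ (by norm_num), ← pow_succ, ← Real.rpow_natCast]
    refine Real.rpow_le_rpow_of_exponent_le (by norm_num) ?_
    push_cast
    exact (Nat.lt_floor_add_one _).le
  have hprob := hdev X hX n a 𝒜 W W' l hW1 hy0
  have hBγ0 : 0 < B ^ γ := by positivity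
  refine le_trans (measure_mono ?_) (hprob.trans (ENNReal.ofReal_le_ofReal (le_trans ?_ (hB₄ B hBB₄))))
  · rintro ω ⟨t, ht, j, k, hx⟩
    by_contra hcon
    simp only [Set.mem_ofPred_eq] at hcon
    push Not at hcon
    obtain ⟨d, hd, hdi⟩ := hcov t ht
    have hG := hw n b t hb hBB₂ (hwin.subset ht) (fun i => X.centered n j k i ω)
      (fun i hi => X.centered_of_notMem j k ω hi) (a + d) (2 ^ W) hdi _
      (fun k' hk' => hcon d hd k' hk' j k)
    have hbi := hbias X hX hs n b t hb hBB₃ (hwin.subset ht) j k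
    rw [X.covHat_sub_cov] at hx
    have h1 := hx.trans_le ((abs_add_le _ _).trans (add_le_add hG hbi))
    have h2 : C₂ / (n * b) * y = η / 2 := by
      rw [hy, hc₃, ← hBdef]
      field_simp
    have h3 : C₃ * b ^ 2 ≤ η / 4 := by
      have : b ^ 2 ≤ η / (4 * C₃) := by
        have h4 := pow_le_pow_left₀ hb.le hb₁ 2
        rwa [Real.sq_sqrt (by positivity)] at h4
      calc C₃ * b ^ 2 ≤ C₃ * (η / (4 * C₃)) := by gcongr
        _ = η / 4 := by field_simp
    have h4 : X.N 2 A / B ≤ c / √B := by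
      rw [div_le_div_iff₀ hB0 (Real.sqrt_pos.2 hB0)]
      refine le_trans ?_ hNu'
      gcongr
      exact hwin.le
    have h5 := hB₅ B hBB₅
    have h6 := mul_le_mul_of_nonneg_left h4 hC₃.le
    rw [h2, mul_add] at h1
    linarith
  · have hfirst : C₁ * (𝒜.card * (p : ℝ) ^ 2 * (√((2 : ℝ) ^ W) * 2 ^ l / y) ^ q) ≤ k₁ * B ^ (-α) := by
      have h1 : √((2 : ℝ) ^ W) * 2 ^ l / y ≤ 4 / c₃ * B ^ (γ - 1 / 2) := by
        have h2 : √((2 : ℝ) ^ W) ≤ 4 * √B := by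
          refine (Real.sqrt_le_sqrt hW2).trans_eq ?_
          rw [Real.sqrt_mul (by norm_num), show (16 : ℝ) = 4 ^ 2 by norm_num,
            Real.sqrt_sq (by norm_num)]
        calc _ ≤ 4 * √B * B ^ γ / y := by gcongr
          _ = 4 / c₃ * (B ^ γ * (√B / B)) := by rw [hy]; field_simp
          _ = _ := by
              rw [Real.sqrt_div_self', one_div, Real.sqrt_eq_rpow, ← Real.rpow_neg hB0.le,
                ← Real.rpow_add hB0, sub_eq_add_neg]
      have h3 : (√((2 : ℝ) ^ W) * 2 ^ l / y) ^ q ≤ (4 / c₃) ^ q * B ^ ((γ - 1 / 2) * q) := by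
        refine (Real.rpow_le_rpow (by positivity) h1 hq0.le).trans_eq ?_
        rw [Real.mul_rpow (by positivity) (by positivity), ← Real.rpow_mul hB0.le]
      have h4 : (𝒜.card : ℝ) ≤ 2 * (c / n₀) ^ 2 * B := by
        refine hcard.trans ?_
        rw [div_le_iff₀ hB0]
        linarith
      have hpP : (p : ℝ) ^ 2 ≤ (P : ℝ) ^ 2 := by gcongr
      calc _ ≤ C₁ * ((2 * (c / n₀) ^ 2 * B) * (P : ℝ) ^ 2 *
            ((4 / c₃) ^ q * B ^ ((γ - 1 / 2) * q))) := by gcongr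
        _ = k₁ * (B ^ (1 : ℝ) * B ^ ((γ - 1 / 2) * q)) := by rw [hk₁, Real.rpow_one]; ring
        _ = _ := by
            rw [← Real.rpow_add hB0]
            congr 2
            rw [hγ, hα]; field_simp; ring
    have hsecond : C₁ * ((p : ℝ) ^ 2 * (((W' : ℝ) + 1) ^ 2 * 2 ^ W' *
        (X.N 2 A * ((2 : ℝ) ^ l) ^ (-A)) ^ 2 / y ^ 2)) ≤
        k₂ * ((Real.log (c₄ * B ^ 2) / Real.log 2 + 1) ^ 2 * B ^ (-(2 * A * γ))) := by
      have hW' : (W' : ℝ) ≤ Real.log (c₄ * B ^ 2) / Real.log 2 := by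
        rw [le_div_iff₀ (Real.log_pos (by norm_num)), ← Real.log_pow]
        refine Real.log_le_log (by positivity) (hW3.trans ?_)
        rw [hc₄]; linarith
      have h1 : ((2 : ℝ) ^ l) ^ (-A) ≤ 2 ^ A * B ^ (-(A * γ)) := by
        calc ((2 : ℝ) ^ l) ^ (-A) ≤ (B ^ γ / 2) ^ (-A) :=
              Real.rpow_le_rpow_of_nonpos (by positivity) hl2 (by linarith)
          _ = _ := by
              rw [Real.div_rpow hBγ0.le (by norm_num), ← Real.rpow_mul hB0.le,
                Real.rpow_neg (by norm_num : (0 : ℝ) ≤ 2), div_inv_eq_mul, mul_comm]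
              congr 2; ring
      have h2 : (2 : ℝ) ^ W' * (X.N 2 A * ((2 : ℝ) ^ l) ^ (-A)) ^ 2 / y ^ 2 ≤
          16 * c ^ 2 * 2 ^ (2 * A) / c₃ ^ 2 * B ^ (-(2 * A * γ)) := by
        have e1 : (2 ^ A * B ^ (-(A * γ))) ^ 2 = (2 : ℝ) ^ (2 * A) * B ^ (-(2 * A * γ)) := by
          rw [mul_pow, ← Real.rpow_natCast, ← Real.rpow_mul (by norm_num), ← Real.rpow_natCast,
            ← Real.rpow_mul hB0.le]
          congr 2 <;> push_cast <;> ring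
        have e2 : u * X.N 2 A ^ 2 ≤ c ^ 2 * B ^ 2 := by
          calc u * X.N 2 A ^ 2 = (X.N 2 A * √u) ^ 2 := by
                rw [mul_pow, Real.sq_sqrt hu0.le]; ring
            _ ≤ (c * B) ^ 2 := by gcongr
            _ = _ := by ring
        calc _ ≤ (16 * u) * (X.N 2 A * (2 ^ A * B ^ (-(A * γ)))) ^ 2 / y ^ 2 := by gcongr
          _ = 16 * (u * X.N 2 A ^ 2) * ((2 : ℝ) ^ (2 * A) * B ^ (-(2 * A * γ))) / y ^ 2 := by
              rw [mul_pow, e1]; ring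
          _ ≤ 16 * (c ^ 2 * B ^ 2) * ((2 : ℝ) ^ (2 * A) * B ^ (-(2 * A * γ))) / y ^ 2 := by gcongr
          _ = _ := by rw [hy]; field_simp
      have hpP : (p : ℝ) ^ 2 ≤ (P : ℝ) ^ 2 := by gcongr
      calc _ = C₁ * ((p : ℝ) ^ 2 * (((W' : ℝ) + 1) ^ 2 * ((2 : ℝ) ^ W' *
            (X.N 2 A * ((2 : ℝ) ^ l) ^ (-A)) ^ 2 / y ^ 2))) := by ring
        _ ≤ C₁ * ((P : ℝ) ^ 2 * ((Real.log (c₄ * B ^ 2) / Real.log 2 + 1) ^ 2 *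
            (16 * c ^ 2 * 2 ^ (2 * A) / c₃ ^ 2 * B ^ (-(2 * A * γ))))) := by gcongr
        _ = _ := by rw [hk₂]; ring
    rw [mul_add]
    exact add_le_add hfirst hsecond

end Model

/-! ### Finite sample error bound for CLIME -/

/-- A diagonal entry of `T T⁻¹` equals one. Applied to the covariance matrix, this keeps both `N`
and `κ` away from zero. -/
theorem one_le_mul_of_colNorm_inv_le {p : ℕ} {T : Matrix (Fin p) (Fin p) ℝ} {m κ : ℝ} (hp : 0 < p)
    (hT : IsUnit T) (hm : ∀ j k, |T j k| ≤ m) (hκ : colNorm T⁻¹ ≤ κ) : 1 ≤ m * κ := by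
  have hdet : IsUnit T.det := (Matrix.isUnit_iff_isUnit_det T).1 hT
  have hm0 : 0 ≤ m := (abs_nonneg _).trans (hm ⟨0, hp⟩ ⟨0, hp⟩)
  have h := abs_mul_le hm T⁻¹ ⟨0, hp⟩ ⟨0, hp⟩
  rw [Matrix.mul_nonsing_inv _ hdet, Matrix.one_apply_eq, abs_one] at h
  exact h.trans (mul_le_mul_of_nonneg_left ((sum_abs_le_colNorm _ _).trans hκ) hm0)

namespace Model

variable {p : ℕ} {S : Type*} [MeasurableSpace S] (X : Model p S)

/-- The rate of the smoothed covariance matrix on times whose windows cover the order of `u`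
observations. -/
def rate (q A : ℝ) (n : ℕ) (b u : ℝ) : ℝ :=
  b ^ 2 + (X.J q A u + X.N 2 A * √(u * Real.log p)) / (n * b)

theorem isSymm_cov (t : ℝ) : (X.cov t).IsSymm :=
  Matrix.IsSymm.ext fun j k => by simp only [cov, Matrix.of_apply, mul_comm]

variable {X} {q A ν L D κ : ℝ}

theorem Sparse.one_le_sq_mul (hκ : X.Sparse κ) (hq : 2 < q) (hX : X.Dependence q A ν)
    (hs : X.Smooth L D) (hp : 0 < p) : 1 ≤ X.N 2 A * X.N 2 A * κ :=
  have h0 : (0 : ℝ) ∈ Set.Icc (0 : ℝ) 1 := by simp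
  one_le_mul_of_colNorm_inv_le hp (hκ.isUnit 0 h0) (X.abs_cov_le_sq hq hX hs h0)
    (hκ.colNorm_le 0 h0)

theorem Sparse.one_le_momentBound_mul (hκ : X.Sparse κ) (hq : 2 < q) (hX : X.Dependence q A ν)
    (hp : 0 < p) : 1 ≤ momentBound q ν * momentBound q ν * κ :=
  have h0 : (0 : ℝ) ∈ Set.Icc (0 : ℝ) 1 := by simp
  one_le_mul_of_colNorm_inv_le hp (hκ.isUnit 0 h0)
    (fun j k => X.abs_integral_mul_le (X.memLp_proc hq hX h0 j) (X.memLp_proc hq hX h0 k)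
      (X.eLpNorm_two_proc_le hq hX h0 j) (X.eLpNorm_two_proc_le hq hX h0 k)
      (momentBound_nonneg _ _) (momentBound_nonneg _ _))
    (hκ.colNorm_le 0 h0)

theorem Dependence.M_pos (hX : X.Dependence q A ν) (hq : 2 < q) (hp : 0 < p) (hN : 0 < X.N 2 A) :
    0 < X.M q A := by
  have : Nonempty (Fin p) := ⟨⟨0, hp⟩⟩
  obtain ⟨j, hj⟩ := exists_lt_of_lt_ciSup hN
  have h1 : 0 < (X.dan (2 * q) A j).toReal := hj.trans_le
    (ENNReal.toReal_mono (hX.dan_lt_top j).ne (X.dan_mono (by linarith) j))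
  refine Real.rpow_pos_of_pos ?_ _
  exact Finset.sum_pos' (fun i _ => by positivity) ⟨j, Finset.mem_univ _, by positivity⟩

/-- The threshold is rewritten as a multiple `R` of the rate, in which `log p` replaces `Λ`: `R` has
to dominate `Λ² p^(-1/(2q))` in the polynomial part and `√(Λ / log p)` in the Gaussian part. -/
theorem exists_covHat_deviation_rate (ν D : ℝ) {K : ℝ → ℝ} (hq : 2 < q) (hA : 0 < A) (hL : 0 < L)
    (hK : IsRegularKernel K) :
    ∃ C B₀ : ℝ, 0 < C ∧ 3 ≤ B₀ ∧ ∀ {p : ℕ} {S : Type*} [MeasurableSpace S] (X : Model p S),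
      X.Dependence q A ν → X.Smooth L D → 2 ≤ p → 0 < X.N 2 A →
      ∀ {n : ℕ} {b u : ℝ} {𝒯 : Set ℝ}, 0 < b → B₀ ≤ n * b → HasWindows n b u 𝒯 →
      ∀ {Λ R : ℝ}, 1 ≤ Λ → 1 ≤ R → Λ ^ 2 * (p : ℝ) ^ (-(1 / (2 * q))) ≤ R →
      Λ ≤ R ^ 2 * Real.log p →
      X.μ {ω | ∃ t ∈ 𝒯, ∃ j k,
        C * R * X.rate q A n b u < |X.covHat K b n ω t j k - X.cov t j k|} ≤
      ENNReal.ofReal (C * (p ^ 2 * Real.exp (-Λ) + Λ ^ (-q))) := by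
  obtain ⟨C, B₀, hC, hB₀, h⟩ := exists_covHat_deviation (A := A) ν D hq hA hL hK
  refine ⟨C, B₀, hC, hB₀, ?_⟩
  intro p S _ X hX hs hp hN n b u 𝒯 hb hB hwin Λ R hΛ hR hR₁ hR₂
  refine le_trans (measure_mono ?_) (h X hX hs (by omega) (hX.M_pos hq (by omega) hN) hb hB hwin hΛ)
  rintro ω ⟨t, ht, j, k, hx⟩
  refine ⟨t, ht, j, k, lt_of_le_of_lt ?_ hx⟩
  have hB0 : 0 < n * b := by linarith
  have hu : 3 ≤ u := hB₀.trans (hB.trans hwin.le)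
  have hϖ : 0 < varpi q A u := varpi_pos hu
  have hM := hX.M_pos hq (by omega) hN
  have hp0 : (0 : ℝ) < p := by exact_mod_cast (show 0 < p by omega)
  have hJ0 : 0 < X.J q A u := by unfold J; positivity
  have h1 : √(u * Λ) ≤ R * √(u * Real.log p) := by
    calc √(u * Λ) ≤ √(R ^ 2 * (u * Real.log p)) := Real.sqrt_le_sqrt (by nlinarith)
      _ = _ := by rw [Real.sqrt_mul (by positivity), Real.sqrt_sq (by linarith)]
  have h2 : Λ ^ 2 * (p : ℝ) ^ (-(1 / (2 * q))) * X.J q A u ≤ R * X.J q A u := by gcongr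
  have h3 : X.N 2 A * √(u * Λ) ≤ X.N 2 A * (R * √(u * Real.log p)) := by gcongr
  have h4 : b ^ 2 ≤ R * b ^ 2 := le_mul_of_one_le_left (sq_nonneg b) hR
  calc C * (b ^ 2 + (Λ ^ 2 * (p : ℝ) ^ (-(1 / (2 * q))) * X.J q A u + X.N 2 A * √(u * Λ)) / (n * b))
      ≤ C * (R * b ^ 2 + (R * X.J q A u + X.N 2 A * (R * √(u * Real.log p))) / (n * b)) := by
        gcongr
    _ = C * R * X.rate q A n b u := by unfold rate; ring

/-- With `s = 1/(2q)`, this lets the surplus power of `p` absorb `Λ²` when `Λ = 3 log p`. -/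
theorem sq_log_mul_rpow_le {s x : ℝ} (hs : 0 < s) (hx : 1 ≤ x) :
    Real.log x ^ 2 * x ^ (-s) ≤ (2 / s) ^ 2 := by
  have h0 : 0 < x := by linarith
  have h1 := Real.log_le_rpow_div h0.le (half_pos hs)
  have h2 : Real.log x ^ 2 ≤ (x ^ (s / 2) / (s / 2)) ^ 2 :=
    pow_le_pow_left₀ (Real.log_nonneg hx) h1 2
  have h3 : (x ^ (s / 2)) ^ 2 = x ^ s := by
    rw [← Real.rpow_natCast, ← Real.rpow_mul h0.le]; congr 1; push_cast; ring
  calc Real.log x ^ 2 * x ^ (-s) ≤ (x ^ (s / 2) / (s / 2)) ^ 2 * x ^ (-s) := by gcongr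
    _ = (2 / s) ^ 2 * (x ^ s * x ^ (-s)) := by rw [div_pow, h3]; field_simp
    _ = _ := by rw [← Real.rpow_add h0, add_neg_cancel, Real.rpow_zero, mul_one]

-- The constant `C` precedes `ε`, so `Ω` is feasible with probability near one only in large
-- dimension `p ≥ P(ε)`, where `Λ = 3 log p` is used. In the finitely many dimensions below `P`, the
-- case `λ ≥ 1` is trivial. If `λ < 1`, two events are combined: consistency, which makes `Σ̂`
-- invertible with `Σ̂⁻¹` as the feasible competitor, and a deviation by a multiple `R'` of the
-- rate, where `R'` depends on `ε` and enters only `C'`.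
set_option maxHeartbeats 1000000 in
theorem exists_clime_error_le (ν D : ℝ) {K : ℝ → ℝ} (hq : 2 < q) (hA : 0 < A) (hL : 0 < L)
    (hK : IsRegularKernel K) :
    ∃ C : ℝ, 0 < C ∧ ∀ ε : ℝ, 0 < ε → ∀ κ : ℕ → ℝ, ∃ C' b₁ B₁ : ℝ, 0 < C' ∧ 0 < b₁ ∧ 0 < B₁ ∧
      ∀ {p : ℕ} {S : Type*} [MeasurableSpace S] (X : Model p S),
      2 ≤ p → X.Dependence q A ν → X.Smooth L D → X.Sparse (κ p) →
      ∀ {n : ℕ} {b u : ℝ} {𝒯 : Set ℝ}, 0 < b → b ≤ b₁ → B₁ ≤ n * b → HasWindows n b u 𝒯 →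
      ∀ {lam : ℝ}, C * κ p * X.rate q A n b u ≤ lam →
      ∀ What : S → ℝ → Matrix (Fin p) (Fin p) ℝ,
      (∀ ω, ∀ t ∈ 𝒯, IsClime (X.covHat K b n ω t) lam (What ω t)) →
      X.μ {ω | ∃ t ∈ 𝒯, C' * (κ p * lam) < maxNorm (What ω t - X.prec t)} ≤ ENNReal.ofReal ε := by
  obtain ⟨C, B₀, hC, hB₀, hdev⟩ := exists_covHat_deviation_rate (A := A) ν D hq hA hL hK
  -- The bound of `sq_log_mul_rpow_le` at `s = 1/(2q)`, times `9` from the square of `Λ = 3 log p`.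
  set R := 9 * (4 * q) ^ 2 with hR
  have hR2 : 2 ≤ R := by nlinarith
  refine ⟨C * R, by positivity, fun ε hε κ => ?_⟩
  have hlogtop : Tendsto (fun p : ℕ => 3 * Real.log p) atTop atTop :=
    (Real.tendsto_log_atTop.comp tendsto_natCast_atTop_atTop).const_mul_atTop (by norm_num)
  have hneg : Tendsto (fun x : ℝ => x ^ (-q)) atTop (𝓝 0) := tendsto_rpow_neg_atTop (by linarith)
  have hlim : Tendsto (fun p : ℕ => C * ((p : ℝ)⁻¹ + (3 * Real.log p) ^ (-q))) atTop (𝓝 0) := by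
    simpa using ((tendsto_inv_atTop_nhds_zero_nat (𝕜 := ℝ)).add (hneg.comp hlogtop)).const_mul C
  -- From `P` on, the failure probability for `Λ = 3 log p` is at most `ε`, since `p² e^(-Λ) = 1/p`.
  obtain ⟨P, hP⟩ := eventually_atTop.1 (hlim.eventually_le_const hε)
  have hlim2 : Tendsto (fun Λ : ℝ => C * ((P : ℝ) ^ 2 * Real.exp (-Λ) + Λ ^ (-q))) atTop (𝓝 0) := by
    simpa using ((Real.tendsto_exp_neg_atTop_nhds_zero.const_mul ((P : ℝ) ^ 2)).add
      hneg).const_mul C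
  -- Below `P`, a fixed `Λ` depending on `ε` serves all dimensions.
  obtain ⟨Λ, hΛ, hΛ1⟩ := ((hlim2.eventually_le_const (half_pos hε)).and
    (eventually_ge_atTop 1)).exists
  set κ' := ∑ r ∈ Finset.range P, |κ r| + 1 with hκ'
  have hκ'1 : 1 ≤ κ' := by
    have : 0 ≤ ∑ r ∈ Finset.range P, |κ r| := by positivity
    linarith
  have hκκ' : ∀ r < P, κ r ≤ κ' := fun r hr => by
    have := Finset.single_le_sum (f := fun r => |κ r|) (fun i _ => abs_nonneg _)
      (Finset.mem_range.2 hr)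
    have h1 := le_abs_self (κ r)
    linarith
  set m := momentBound q ν * momentBound q ν with hm
  have hm0 : 0 ≤ m := mul_self_nonneg _
  have hlog2 : 0 < Real.log 2 := Real.log_pos (by norm_num)
  have hl2 : 1 / 2 < Real.log 2 := by have := Real.log_two_gt_d9; linarith
  -- The value of `η` gives `κ p η ≤ 1/2` for every `p < P`, as required for inverting `Σ̂`; `c` is
  -- the bound that `λ < 1` imposes on `N √u / (nb)`; and `n₀` is a lower bound for `N` that follows
  -- from `1 ≤ N² κ`.
  obtain ⟨b₁, B₁, hb₁, hB₁, hcons⟩ := exists_covHat_consistency (A := A) ν D hq hA hL hK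
    (η := 1 / (2 * κ' * (P + 1))) (c := (m + 1) / (C * R * √(Real.log 2))) (n₀ := 1 / κ')
    (ε := ε / 2) (by positivity) (by positivity) (by positivity) (by positivity) P
  set R' := 2 * Λ ^ 2 with hR'
  refine ⟨2 + 2 * R', b₁, max B₀ B₁, by positivity, hb₁, lt_max_of_lt_right hB₁, ?_⟩
  intro p S _ X hp hX hs hκ n b u 𝒯 hb hbb₁ hB hwin lam hlam What hW
  have hp0 : 0 < p := by omega
  have hBB₀ := (le_max_left _ _).trans hB
  have hBB₁ := (le_max_right _ _).trans hB
  have hB0 : 0 < n * b := by linarith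
  have hu : 3 ≤ u := hB₀.trans (hBB₀.trans hwin.le)
  have hN1 := hκ.one_le_sq_mul hq hX hs hp0
  have hm1 := hκ.one_le_momentBound_mul hq hX hp0
  have hκ0 : 0 < κ p := by
    by_contra hcon
    have := mul_nonpos_of_nonneg_of_nonpos hm0 (not_lt.1 hcon)
    linarith
  have hN : 0 < X.N 2 A := by
    refine (X.N_nonneg 2 A).lt_of_ne fun h => ?_
    rw [← h] at hN1
    norm_num at hN1
  have hM := hX.M_pos hq hp0 hN
  have hpR : (2 : ℝ) ≤ p := by exact_mod_cast hp
  have hϖ : 0 < varpi q A u := varpi_pos hu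
  have hJ0 : 0 < X.J q A u := by unfold J; positivity
  have hlogp : Real.log 2 ≤ Real.log p := Real.log_le_log (by norm_num) hpR
  have hr0 : 0 ≤ X.rate q A n b u := by unfold rate; positivity
  have hlam0 : 0 ≤ lam := le_trans (by positivity) hlam
  have hκlam : 0 ≤ κ p * lam := by positivity
  have hR'1 : 2 ≤ R' := by rw [hR']; nlinarith
  have hC2 : 2 * (κ p * lam) ≤ (2 + 2 * R') * (κ p * lam) := by gcongr; linarith
  have hI : ∀ t ∈ 𝒯, t ∈ Set.Icc (0 : ℝ) 1 := fun t ht =>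
    ⟨hb.le.trans (hwin.subset ht).1, (hwin.subset ht).2.trans (by linarith)⟩
  by_cases hpP : P ≤ p
  · have h1 : Real.exp (-(3 * Real.log p)) = ((p : ℝ) ^ 3)⁻¹ := by
      rw [Real.exp_neg, mul_comm, Real.exp_mul, Real.exp_log (by linarith)]
      norm_cast
    have hsl := sq_log_mul_rpow_le (s := 1 / (2 * q)) (by positivity) (show (1 : ℝ) ≤ p by linarith)
    have hb := hdev X hX hs hp hN hb hBB₀ hwin (Λ := 3 * Real.log p) (R := R) (by linarith)
      (by linarith) (by
        rw [mul_pow, mul_assoc, hR]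
        refine (mul_le_mul_of_nonneg_left hsl (by norm_num)).trans_eq ?_
        field_simp; norm_num) (mul_le_mul_of_nonneg_right (by nlinarith) (by linarith))
    refine le_trans (measure_mono ?_) (hb.trans (ENNReal.ofReal_le_ofReal (le_trans (le_of_eq ?_)
      (hP p hpP))))
    · rintro ω ⟨t, ht, hx⟩
      by_contra hcon
      simp only [Set.mem_ofPred_eq] at hcon
      push Not at hcon
      have := maxNorm_clime_sub_inv_le (hκ.isUnit t (hI t ht)) (X.isSymm_cov t)
        (hκ.colNorm_le t (hI t ht)) (hW ω t ht) (hcon t ht) (by positivity)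
        (le_trans (le_of_eq (by ring)) hlam)
      exact absurd (hx.trans_le this) (not_lt.2 hC2)
    · rw [h1]
      field_simp
  push Not at hpP
  have hκp := hκκ' p hpP
  by_cases hl1 : 1 ≤ lam
  · refine le_trans (le_of_eq ?_) zero_le
    convert measure_empty (μ := X.μ)
    refine Set.eq_empty_of_forall_notMem ?_
    rintro ω ⟨t, ht, hx⟩
    have := maxNorm_clime_sub_inv_le_of_one_le (hκ.colNorm_le t (hI t ht)) (hW ω t ht) hl1
    exact absurd (hx.trans_le this) (not_lt.2 hC2)
  push Not at hl1
  have hb2 := hdev X hX hs hp hN hb hBB₀ hwin (Λ := Λ) (R := R') hΛ1 (by linarith) (by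
    have : (p : ℝ) ^ (-(1 / (2 * q))) ≤ 1 :=
      Real.rpow_le_one_of_one_le_of_nonpos (by linarith) (by simp; linarith)
    nlinarith) (by nlinarith)
  have hn₀ : 1 / κ' ≤ X.N 2 A := by
    rw [div_le_iff₀ (by linarith)]
    by_contra hcon
    push Not at hcon
    have h1 : X.N 2 A * X.N 2 A * κ p ≤ X.N 2 A * X.N 2 A * κ' := by gcongr
    have h2 : X.N 2 A ≤ X.N 2 A * κ' := le_mul_of_one_le_right hN.le hκ'1
    nlinarith
  -- Since `λ < 1`, the rate is at most `1/(C R κ)`; the inequality `1 ≤ m κ` then removes `κ`.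
  have hc : X.N 2 A * √u / (n * b) ≤ (m + 1) / (C * R * √(Real.log 2)) := by
    have h1 : X.N 2 A * (√u * √(Real.log 2)) / (n * b) ≤ X.rate q A n b u := by
      have h2 : √u * √(Real.log 2) ≤ √(u * Real.log p) := by
        rw [← Real.sqrt_mul (by linarith)]
        refine Real.sqrt_le_sqrt ?_
        gcongr
      unfold rate
      calc _ ≤ X.N 2 A * √(u * Real.log p) / (n * b) := by gcongr
        _ ≤ (X.J q A u + X.N 2 A * √(u * Real.log p)) / (n * b) := by gcongr; linarith
        _ ≤ _ := by nlinarith [sq_nonneg b]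
    have h3 : C * R * κ p * (X.N 2 A * (√u * √(Real.log 2)) / (n * b)) ≤ 1 :=
      (mul_le_mul_of_nonneg_left h1 (by positivity)).trans (hlam.trans hl1.le)
    rw [le_div_iff₀ (by positivity)]
    set y := X.N 2 A * √u / (n * b) * (C * R * √(Real.log 2)) with hy
    have hy0 : 0 ≤ y := by positivity
    have h4 : κ p * y ≤ 1 := by
      refine le_trans (le_of_eq ?_) h3
      rw [hy]; ring
    calc y ≤ (m * κ p) * y := le_mul_of_one_le_left hy0 hm1
      _ = m * (κ p * y) := by ring
      _ ≤ m * 1 := by gcongr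
      _ ≤ m + 1 := by linarith
  have hb3 := hcons X hX hs hpP.le hn₀ hb hbb₁ hBB₁ hwin hc
  refine le_trans (measure_mono ?_) ((measure_union_le _ _).trans ((add_le_add hb2 hb3).trans ?_))
  · rintro ω ⟨t, ht, hx⟩
    by_contra hcon
    simp only [Set.mem_union, Set.mem_ofPred_eq] at hcon
    push Not at hcon
    obtain ⟨hc1, hc2⟩ := hcon
    have hpP' : (p : ℝ) ≤ P := by exact_mod_cast hpP.le
    have := maxNorm_clime_sub_inv_le_of_small (hκ.isUnit t (hI t ht)) (X.isSymm_cov t)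
      (hκ.colNorm_le t (hI t ht)) (hW ω t ht) hlam0 (by positivity) (hc1 t ht) (hc2 t ht) (by
        calc κ p * (p * (1 / (2 * κ' * (P + 1)))) ≤ κ' * ((P + 1) * (1 / (2 * κ' * (P + 1)))) := by
              gcongr; linarith
          _ = 1 / 2 := by field_simp)
    -- The factor `R ≥ 2` in the lower bound for `λ` pays for the `2` in `2κ`.
    have h1 : C * R' * X.rate q A n b u * (2 * κ p) ≤ R' * lam := by
      have h2 : 2 * (C * κ p * X.rate q A n b u) ≤ C * R * κ p * X.rate q A n b u := by
        have : 0 ≤ C * κ p * X.rate q A n b u := by positivity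
        nlinarith
      nlinarith
    have h3 : κ p * (lam + C * R' * X.rate q A n b u * (2 * κ p)) ≤ κ p * (lam + R' * lam) := by
      gcongr
    have h4 : κ p * (lam + R' * lam) = (1 + R') * (κ p * lam) := by ring
    have h5 : (1 + R') * (κ p * lam) ≤ (2 + 2 * R') * (κ p * lam) := by gcongr <;> linarith
    exact absurd (hx.trans_le (this.trans h3)) (not_lt.2 (h4.trans_le h5))
  · rw [← ENNReal.ofReal_add (by positivity) (by positivity)]
    refine ENNReal.ofReal_le_ofReal ?_
    have : C * ((p : ℝ) ^ 2 * Real.exp (-Λ) + Λ ^ (-q)) ≤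
        C * ((P : ℝ) ^ 2 * Real.exp (-Λ) + Λ ^ (-q)) := by gcongr
    linarith

end Model

/-! ### Windows of kernel estimators -/

theorem exists_lt_two_pow_le {x : ℝ} (hx : 1 ≤ x) : ∃ l : ℕ, x < 2 ^ l ∧ (2 : ℝ) ^ l ≤ 2 * x := by
  obtain ⟨l, h1, h2⟩ := exists_nat_pow_near hx (one_lt_two)
  exact ⟨l + 1, h2, by rw [pow_succ]; linarith⟩

theorem mem_window_of_abs_sub_le {n i : ℕ} {b t : ℝ} {l : ℕ} (hl : 2 * (n * b) < 2 ^ l)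
    (hi : |(i : ℝ) - n * t| ≤ n * b) :
    ⌈(n : ℝ) * t - n * b⌉₊ ≤ i ∧ i < ⌈(n : ℝ) * t - n * b⌉₊ + 2 ^ l := by
  rw [abs_le] at hi
  refine ⟨Nat.ceil_le.2 (by linarith), ?_⟩
  have := Nat.le_ceil ((n : ℝ) * t - n * b)
  have h : (i : ℝ) < ⌈(n : ℝ) * t - n * b⌉₊ + 2 ^ l := by linarith
  exact_mod_cast h

theorem hasWindows_singleton {n : ℕ} {b t : ℝ} (hB : 1 ≤ n * b) (ht : t ∈ Set.Icc b (1 - b)) :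
    HasWindows n b (n * b) {t} := by
  obtain ⟨l, hl1, hl2⟩ := exists_lt_two_pow_le (x := 2 * (n * b)) (by linarith)
  refine ⟨by simpa using ht, le_rfl, ⟨⌈(n : ℝ) * t - n * b⌉₊, l, by linarith, ?_⟩,
    ⟨⌈(n : ℝ) * t - n * b⌉₊, {0}, l, l, by simp, by linarith, by linarith, ?_, ?_⟩⟩
  · rintro _ rfl i - hi
    exact mem_window_of_abs_sub_le hl1 hi
  · rw [Finset.card_singleton, le_div_iff₀ (by linarith)]
    push_cast
    linarith
  · rintro _ rfl
    exact ⟨0, by simp, fun i _ hi => mem_window_of_abs_sub_le hl1 hi⟩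

/-- Short windows start at multiples of `2^w`, where `2^w` exceeds the width `2nb` of a kernel
window, and have length `2^(w+1)`, so every kernel window fits into one of them. Starting points are
at most `n` and lengths at most `8nb ≤ 4n`; hence the long window of length above `5n`. -/
theorem hasWindows_Icc {n : ℕ} {b : ℝ} (hB : 1 ≤ n * b) (hb : b ≤ 1 / 2) :
    HasWindows n b n (Set.Icc b (1 - b)) := by
  have hn0 : (0 : ℝ) ≤ n := n.cast_nonneg
  have hBn : 2 * (n * b) ≤ n := by nlinarith
  obtain ⟨l, hl1, hl2⟩ := exists_lt_two_pow_le (x := n) (by linarith)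
  obtain ⟨w, hw1, hw2⟩ := exists_lt_two_pow_le (x := 2 * (n * b)) (by linarith)
  obtain ⟨l', hl1', hl2'⟩ := exists_lt_two_pow_le (x := 5 * n) (by linarith)
  refine ⟨subset_rfl, by linarith, ⟨0, l, by linarith, fun t _ i hi _ => ⟨zero_le, ?_⟩⟩,
    ⟨0, (Finset.range (n / 2 ^ w + 1)).image (· * 2 ^ w), w + 1, l', ?_, ?_, by linarith, ?_, ?_⟩⟩
  · have h1 : (i : ℝ) ≤ n := by exact_mod_cast (Finset.mem_Icc.1 hi).2
    have h2 : (i : ℝ) < 2 ^ l := by linarith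
    rw [zero_add]
    exact_mod_cast h2
  · intro d hd
    obtain ⟨r, hr, rfl⟩ := Finset.mem_image.1 hd
    have h1 : r * 2 ^ w ≤ n :=
      (Nat.mul_le_mul_right _ (Nat.lt_succ_iff.1 (Finset.mem_range.1 hr))).trans
        (Nat.div_mul_le_self _ _)
    have h2 : ((r * 2 ^ w : ℕ) : ℝ) ≤ n := by exact_mod_cast h1
    have h3 : ((r * 2 ^ w : ℕ) : ℝ) + 2 ^ (w + 1) ≤ 2 ^ l' := by rw [pow_succ]; linarith
    exact_mod_cast h3
  · rw [pow_succ]; linarith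
  · have h1 : (((Finset.range (n / 2 ^ w + 1)).image (· * 2 ^ w)).card : ℝ) ≤ (n / 2 ^ w : ℕ) + 1 := by
      exact_mod_cast Finset.card_image_le.trans_eq (Finset.card_range _)
    have h2 : ((n / 2 ^ w : ℕ) : ℝ) ≤ n / (2 * (n * b)) := by
      refine Nat.cast_div_le.trans ?_
      push_cast
      gcongr
    have h3 : 1 ≤ n / (n * b) := by rw [le_div_iff₀ (by linarith)]; linarith
    have h4 : n / (2 * (n * b)) = n / (n * b) / 2 := by rw [div_div, mul_comm 2]
    rw [mul_div_assoc]
    linarith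
  · intro t ht
    set i₀ := ⌈(n : ℝ) * t - n * b⌉₊ with hi₀
    have hi₀n : i₀ ≤ n := by
      refine Nat.ceil_le.2 ?_
      nlinarith [ht.2]
    refine ⟨i₀ / 2 ^ w * 2 ^ w, Finset.mem_image.2 ⟨_, Finset.mem_range.2
      (Nat.lt_succ_of_le (Nat.div_le_div_right hi₀n)), rfl⟩, fun i _ hi => ?_⟩
    obtain ⟨h1, h2⟩ := mem_window_of_abs_sub_le hw1 hi
    have h3 := Nat.div_add_mod' i₀ (2 ^ w)
    have h4 := Nat.mod_lt i₀ (show 0 < 2 ^ w by positivity)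
    rw [pow_succ, zero_add]
    omega

namespace Model

variable {p : ℕ} {S : Type*} [MeasurableSpace S] (X : Model p S)

theorem rate_eq_pointwiseRate (q A : ℝ) {n : ℕ} {b : ℝ} (hB : 0 < n * b) :
    X.rate q A n b (n * b) = X.pointwiseRate q A n b := by
  have h : √(n * b * Real.log p) / (n * b) = √(Real.log p / (n * b)) := by
    have : Real.log p / (n * b) = (n * b * Real.log p) / (n * b) ^ 2 := by
      rw [sq, mul_div_mul_left _ _ hB.ne']
    rw [this, Real.sqrt_div' _ (sq_nonneg _), Real.sqrt_sq hB.le]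
  rw [rate, pointwiseRate, ← h]
  ring

theorem rate_eq_uniformRate (q A : ℝ) (n : ℕ) (b : ℝ) :
    X.rate q A n b n = X.uniformRate q A n b := by
  rw [rate, uniformRate]
  ring

end Model

theorem ArrayAssumptions.eventually_bandwidth {q A ν L D : ℝ} {κ : ℕ → ℝ} {p : ℕ → ℕ} {b : ℕ → ℝ}
    {S : ℕ → Type*} [∀ n, MeasurableSpace (S n)] {X : ∀ n, Model (p n) (S n)}
    (h : ArrayAssumptions q A ν L D κ p b X) {b₁ : ℝ} (B₁ : ℝ) (hb₁ : 0 < b₁) :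
    ∀ᶠ n in atTop, 0 < b n ∧ b n ≤ b₁ ∧ B₁ ≤ n * b n := by
  filter_upwards [h.bandwidth_zero.eventually_le_const hb₁,
    h.bandwidth_top.eventually_ge_atTop (max 1 B₁)] with n h1 h2
  have h3 : 1 ≤ n * b n := (le_max_left _ _).trans h2
  exact ⟨pos_of_mul_pos_right (by linarith : 0 < n * b n) n.cast_nonneg, h1,
    (le_max_right _ _).trans h2⟩

end TVClime

end

/-- Both parts are instances of one bound for a set of times whose kernel windows jointly cover
order `u` observations: a single time has `u = nb`, the whole interval has `u = n`. The failure
probability is taken as `ε/2` to obtain a strict inequality. -/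
theorem proposition1 (q A ν L D : ℝ) (hq : 2 < q) (hA : 0 < A) (hL : 0 < L)
    (K : ℝ → ℝ) (hK : TVClime.IsRegularKernel K) :
    -- (i) pointwise
    (∃ C : ℝ, 0 < C ∧
      ∀ (κ : ℕ → ℝ) (p : ℕ → ℕ) (b : ℕ → ℝ) (S : ℕ → Type*) [∀ n, MeasurableSpace (S n)]
        (X : ∀ n, TVClime.Model (p n) (S n)),
        TVClime.ArrayAssumptions q A ν L D κ p b X →
        ∀ lam : ℕ → ℝ,
          (∀ᶠ n in atTop, C * κ (p n) * (X n).pointwiseRate q A n (b n) ≤ lam n) →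
        ∀ What : ∀ n, S n → ℝ → Matrix (Fin (p n)) (Fin (p n)) ℝ,
          (∀ n ω, ∀ t ∈ Set.Icc (b n) (1 - b n),
            TVClime.IsClime ((X n).covHat K (b n) n ω t) (lam n) (What n ω t)) →
        ∀ t : ℕ → ℝ, (∀ᶠ n in atTop, t n ∈ Set.Icc (b n) (1 - b n)) →
          TVClime.IsBigOP (fun n => (X n).μ)
            (fun n ω => ENNReal.ofReal (TVClime.maxNorm (What n ω (t n) - (X n).prec (t n))))
            (fun n => κ (p n) * lam n)) ∧
    -- (ii) uniform
    (∃ C : ℝ, 0 < C ∧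
      ∀ (κ : ℕ → ℝ) (p : ℕ → ℕ) (b : ℕ → ℝ) (S : ℕ → Type*) [∀ n, MeasurableSpace (S n)]
        (X : ∀ n, TVClime.Model (p n) (S n)),
        TVClime.ArrayAssumptions q A ν L D κ p b X →
        ∀ lam : ℕ → ℝ,
          (∀ᶠ n in atTop, C * κ (p n) * (X n).uniformRate q A n (b n) ≤ lam n) →
        ∀ What : ∀ n, S n → ℝ → Matrix (Fin (p n)) (Fin (p n)) ℝ,
          (∀ n ω, ∀ t ∈ Set.Icc (b n) (1 - b n),
            TVClime.IsClime ((X n).covHat K (b n) n ω t) (lam n) (What n ω t)) →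
          TVClime.IsBigOP (fun n => (X n).μ)
            (fun n ω => ⨆ t ∈ Set.Icc (b n) (1 - b n),
              ENNReal.ofReal (TVClime.maxNorm (What n ω t - (X n).prec t)))
            (fun n => κ (p n) * lam n)) := by
  obtain ⟨C, hC, hmain⟩ := TVClime.Model.exists_clime_error_le (A := A) ν D hq hA hL hK
  refine ⟨⟨C, hC, ?_⟩, ?_⟩
  · intro κ p b S _ X hX lam hlam What hW t ht ε hε
    obtain ⟨C', b₁, B₁, hC', hb₁, hB₁, hbound⟩ := hmain (ε / 2) (half_pos hε) κ
    refine ⟨C', hC', ?_⟩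
    filter_upwards [hX.eventually_bandwidth (max 1 B₁) hb₁, hlam, ht] with n ⟨hb, hbb, hB⟩ hl htn
    have hB1 := (le_max_left _ _).trans hB
    rw [← (X n).rate_eq_pointwiseRate q A (by linarith)] at hl
    have h := hbound (X n) (hX.two_le n) (hX.dependence n) (hX.smooth n) (hX.sparse n) hb hbb
      ((le_max_right _ _).trans hB) (TVClime.hasWindows_singleton hB1 htn) hl (What n) (by
        rintro ω _ rfl
        exact hW n ω _ htn)
    refine lt_of_le_of_lt ((measure_mono fun ω hω => ?_).trans h)
      ((ENNReal.ofReal_lt_ofReal_iff hε).2 (half_lt_self hε))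
    exact ⟨t n, rfl, not_le.1 fun hle => absurd hω (not_lt.2 (ENNReal.ofReal_le_ofReal hle))⟩
  -- The sample spaces of the two parts range over separate universes, so the bound is taken again
  -- for the second one.
  obtain ⟨C, hC, hmain⟩ := TVClime.Model.exists_clime_error_le (A := A) ν D hq hA hL hK
  refine ⟨C, hC, ?_⟩
  intro κ p b S _ X hX lam hlam What hW ε hε
  obtain ⟨C', b₁, B₁, hC', hb₁, hB₁, hbound⟩ := hmain (ε / 2) (half_pos hε) κ
  refine ⟨C', hC', ?_⟩
  filter_upwards [hX.eventually_bandwidth (max 1 B₁) (lt_min hb₁ one_half_pos), hlam] with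
    n ⟨hb, hbb, hB⟩ hl
  rw [← (X n).rate_eq_uniformRate q A] at hl
  have h := hbound (X n) (hX.two_le n) (hX.dependence n) (hX.smooth n) (hX.sparse n) hb
    (hbb.trans (min_le_left _ _)) ((le_max_right _ _).trans hB)
    (TVClime.hasWindows_Icc ((le_max_left _ _).trans hB) (hbb.trans (min_le_right _ _))) hl
    (What n) (hW n)
  refine lt_of_le_of_lt ((measure_mono fun ω hω => ?_).trans h)
    ((ENNReal.ofReal_lt_ofReal_iff hε).2 (half_lt_self hε))
  rw [Set.mem_ofPred_eq, lt_iSup_iff] at hω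
  obtain ⟨t, hω⟩ := hω
  obtain ⟨ht, hω⟩ := lt_iSup_iff.1 hω
  exact ⟨t, ht, not_le.1 fun hle => absurd hω (not_lt.2 (ENNReal.ofReal_le_ofReal hle))⟩
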